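/- Let $I=[-a,b]$ with $a,b>0$, and let $h:I\to(0,\infty)$ be continuous with: (i) $x=0$ is the only point of global maximum of $h$ on $I$; (ii) $h$ is $C^1$ on $I\setminus\{0\}$ and, for some real $M,c_+,c_->0$ and $m\ge 1$, $h(x)=M-c_+x^m+O(x^{m+1})$ as $x\to0^+$ and $h(x)=M-c_-|x|^m+O(|x|^{m+1})$ as $x\to0^-$. For $\epsilon>0$ let $\Omega_\epsilon=\{(x,y):x\in I,\ 0<y<\epsilon h(x)\}$, and let $\Delta_{\epsilon,D}$, respectively $\Delta_{\epsilon,DN}$, be the positive Laplacian $-\partial_x^2-\partial_y^2$ in $L^2(\Omega_\epsilon)$ with the Dirichlet condition on the whole of $\partial\Omega_\epsilon$, respectively with the Dirichlet condition at $y=0$ and $y=\epsilon h(x)$ and the Neumann condition on the vertical sides $x=-a$ and $x=b$. Let $\mathbf H=-\frac{d^2}{dx^2}+q(x)$ on $L^2(\mathbb R)$, where $q(x)=2\pi^2M^{-3}c_+x^m$ for $x>0$ and $q(x)=2\pi^2M^{-3}c_-|x|^m$ for $x\le0$. Put $\alpha=2/(m+2)$. The spectrum of $\mathbf H$ is discrete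 and consists of simple eigenvalues $\mu_0<\mu_1<\cdots\to\infty$; let $X_j$ be the corresponding eigenfunctions with $\|X_j\|_{L^2(\mathbb R)}=1$ and $X_j(x)>0$ for large $x>0$. For every $\epsilon>0$ the spectra of $\Delta_{\epsilon,D}$ and $\Delta_{\epsilon,DN}$ are discrete; let $\lambda_0(\epsilon)\le\lambda_1(\epsilon)\le\cdots\to\infty$ be the eigenvalues of either operator, repeated according to multiplicity, and $\Psi_j(\epsilon;x,y)$ corresponding real eigenfunctions forming an orthonormal basis of $L^2(\Omega_\epsilon)$. Then for either operator and every $j$: 1) $\displaystyle\lim_{\epsilon\to0^+}\epsilon^{2\alpha}\Bigl(\lambda_j(\epsilon)-\frac{\pi^2}{M^2\epsilon^2}\Bigr)=\mu_j$; 2) with an appropriate choice of the sign of $\Psi_j(\epsilon;\cdot)$ for each $\epsilon$, $$\lim_{\epsilon\to0^+}\int_{\Omega_\epsilon}\Bigl(\Psi_j(\epsilon;x,y)-\frac{\sqrt2}{\sqrt{\epsilon^{1+\alpha}h(x)}}\,X_j(x\epsilon^{-\alpha})\,\sin\frac{\pi y}{\epsilon h(x)}\Bigr)^2dx\,dy=0.$$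 -/

import Mathlib

open Filter Topology MeasureTheory Asymptotics
open scoped ContDiff

namespace NarrowStrip

/-- The standing assumptions on the profile `h` on the segment `[-a, b]`: continuity, positivity,
(i) `0` is the only point of global maximum, (ii) `h` is `C¹` off `0` (one-sidedly at the end points)
and `h(x) = M - c₊ x ^ m + O(x ^ (m+1))` as `x → 0+`, `h(x) = M - c₋ |x| ^ m + O(|x| ^ (m+1))`
as `x → 0-`. -/
structure Profile (a b : ℝ) (h : ℝ → ℝ) (M cp cm m : ℝ) : Prop where
  a_pos : 0 < a
  b_pos : 0 < b
  continuousOn : ContinuousOn h (Set.Icc (-a) b)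
  pos : ∀ x ∈ Set.Icc (-a) b, 0 < h x
  isMax : ∀ x ∈ Set.Icc (-a) b, x ≠ 0 → h x < h 0
  contDiffOn : ContDiffOn ℝ 1 h (Set.Icc (-a) b \ {0})
  M_pos : 0 < M
  cp_pos : 0 < cp
  cm_pos : 0 < cm
  one_le_m : 1 ≤ m
  expansion_right : (fun x : ℝ => h x - (M - cp * x ^ m)) =O[𝓝[>] 0] (fun x : ℝ => x ^ (m + 1))
  expansion_left : (fun x : ℝ => h x - (M - cm * |x| ^ m)) =O[𝓝[<] 0] (fun x : ℝ => |x| ^ (m + 1))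

/-- The narrow strip `{(x, y) : -a < x < b, 0 < y < ε h(x)}`. -/
def strip (a b : ℝ) (h : ℝ → ℝ) (ε : ℝ) : Set (ℝ × ℝ) :=
  {p | -a < p.1 ∧ p.1 < b ∧ 0 < p.2 ∧ p.2 < ε * h p.1}

/-- The condition imposed on the vertical sides `x = -a` and `x = b`. -/
inductive EndCondition
  | dirichlet
  | neumann

/-- The part of the boundary of the strip on which the Dirichlet condition is imposed: all of it, or
only the two curves `y = 0` and `y = ε h(x)` (with their end points). -/
def dirichletPart (a b : ℝ) (h : ℝ → ℝ) (ε : ℝ) : EndCondition → Set (ℝ × ℝ)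
  | .dirichlet => frontier (strip a b h ε)
  | .neumann => {p | p.1 ∈ Set.Icc (-a) b ∧ (p.2 = 0 ∨ p.2 = ε * h p.1)}

/-- `ψ` belongs to the space of `H¹(Ω)`-functions vanishing on the boundary part `Γ`, and `(g₁, g₂)`
is its gradient: `(ψ, g₁, g₂)` is the limit in `L²(Ω)` of `(φ, ∂φ/∂x, ∂φ/∂y)` for smooth compactly
supported `φ` on the plane whose supports do not meet `Γ`. For `Γ = ∂Ω` this is `H¹₀(Ω)`. -/
structure HasGradVanishingOn (Ω Γ : Set (ℝ × ℝ)) (ψ g₁ g₂ : ℝ × ℝ → ℝ) : Prop where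
  memLp : MemLp ψ 2 (volume.restrict Ω)
  memLp_fst : MemLp g₁ 2 (volume.restrict Ω)
  memLp_snd : MemLp g₂ 2 (volume.restrict Ω)
  approx : ∃ φ : ℕ → ℝ × ℝ → ℝ,
    (∀ n, ContDiff ℝ ∞ (φ n) ∧ HasCompactSupport (φ n) ∧ Disjoint (tsupport (φ n)) Γ) ∧
    Tendsto (fun n => ∫ p in Ω, (φ n p - ψ p) ^ 2) atTop (𝓝 0) ∧
    Tendsto (fun n => ∫ p in Ω, (fderiv ℝ (φ n) p (1, 0) - g₁ p) ^ 2) atTop (𝓝 0) ∧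
    Tendsto (fun n => ∫ p in Ω, (fderiv ℝ (φ n) p (0, 1) - g₂ p) ^ 2) atTop (𝓝 0)

/-- `ψ` lies in the domain of the (positive) Laplacian of `Ω` with the Dirichlet condition on `Γ` and
the Neumann condition on the rest of the boundary, i.e. of the self-adjoint operator on `L²(Ω)`
associated with the form `∫ ∇ψ · ∇φ`, and `Δψ = l ψ`. -/
def IsLaplaceEigenfunction (Ω Γ : Set (ℝ × ℝ)) (l : ℝ) (ψ : ℝ × ℝ → ℝ) : Prop :=
  ∃ g₁ g₂ : ℝ × ℝ → ℝ, HasGradVanishingOn Ω Γ ψ g₁ g₂ ∧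
    ∀ φ k₁ k₂ : ℝ × ℝ → ℝ, HasGradVanishingOn Ω Γ φ k₁ k₂ →
      ∫ p in Ω, (g₁ p * k₁ p + g₂ p * k₂ p) = l * ∫ p in Ω, ψ p * φ p

/-- `lam 0 ≤ lam 1 ≤ ⋯ → ∞` is the list of all the eigenvalues of the Laplacian, repeated according
to multiplicity, and `Ψ j` are corresponding eigenfunctions, forming an orthonormal basis of
`L²(Ω)`. -/
structure IsLaplaceEigensystem (Ω Γ : Set (ℝ × ℝ)) (lam : ℕ → ℝ) (Ψ : ℕ → ℝ × ℝ → ℝ) :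
    Prop where
  mono : Monotone lam
  tendsto : Tendsto lam atTop atTop
  eigen : ∀ j, IsLaplaceEigenfunction Ω Γ (lam j) (Ψ j)
  orthonormal : ∀ i j, ∫ p in Ω, Ψ i p * Ψ j p = if i = j then 1 else 0
  complete : ∀ f : ℝ × ℝ → ℝ, MemLp f 2 (volume.restrict Ω) →
    (∀ j, ∫ p in Ω, f p * Ψ j p = 0) → f =ᵐ[volume.restrict Ω] 0

/-- The potential `q` of the limit operator `H = -d²/dx² + q`. -/
noncomputable def potential (M cp cm m : ℝ) (x : ℝ) : ℝ :=
  if 0 < x then 2 * Real.pi ^ 2 / M ^ 3 * cp * x ^ m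
  else 2 * Real.pi ^ 2 / M ^ 3 * cm * |x| ^ m

/-- `μ 0 < μ 1 < ⋯ → ∞` is the list of all the eigenvalues of `-d²/dx² + q` on `L²(ℝ)`, they are
simple, and `X j` are the normalized eigenfunctions that are positive for large `x > 0`; they form an
orthonormal basis of `L²(ℝ)`. The potentials of interest are continuous and non-negative, so that the
operator is self-adjoint on its maximal domain, and its eigenfunctions are the `C²` solutions of
`-X'' + q X = μ X` that lie in `L²(ℝ)`. -/
structure IsSchrodingerEigensystem (q : ℝ → ℝ) (μ : ℕ → ℝ) (X : ℕ → ℝ → ℝ) : Prop where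
  strictMono : StrictMono μ
  tendsto : Tendsto μ atTop atTop
  contDiff : ∀ j, ContDiff ℝ 2 (X j)
  memLp : ∀ j, MemLp (X j) 2 volume
  eigen : ∀ j x, -deriv (deriv (X j)) x + q x * X j x = μ j * X j x
  orthonormal : ∀ i j, ∫ x, X i x * X j x = if i = j then 1 else 0
  complete : ∀ f : ℝ → ℝ, MemLp f 2 volume → (∀ j, ∫ x, f x * X j x = 0) → f =ᵐ[volume] 0
  pos : ∀ j, ∀ᶠ x in atTop, 0 < X j x

end NarrowStrip

/-!
The proof compares the quadratic form of the strip, above the threshold `κ = π² / (M² ε²)`, with the form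
of the limit operator `H` in the scale `s = ε ^ α`. On the slice of width `ε h(x)` the lowest Dirichlet
energy is `π² / (ε² h(x)²)`, which exceeds `κ` by about `2 π² M⁻³ (M - h(x)) / ε²`, that is by
`ε⁻² q(x)` near the maximum. As `q` is homogeneous of degree `m` and `s ^ (m + 2) = ε ^ 2`, the
dilation by `s` turns `-d²/dx² + ε⁻² q` into `s⁻² H`, whence the limits `μ j` of the rescaled eigenvalues
`s² (λ j - κ)`.

Lower bound (`eventually_strip_form_lower_bound`). Let `u(x)` be the component of a test function along
the sine of the widest slice `(0, ε M)`. The spectral gap of the slice (`dirichlet_gap`) makes the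
component orthogonal to the sine cost an energy of order `ε⁻²`, and so does whatever lives away from `x = 0`,
where `M - h` is bounded below (`Profile.exists_gap`). What remains is `u` cut off near `0`, and its energy
is at least that of `H` in the scale `s`. On the test functions orthogonal to `j` suitable functions this
gives `μ j ≤ (1 + o(1)) s² (λ j - κ)`.

Upper bound (`eventually_exists_test_function`). The quasimodes
`s^(-1/2) X_j(x / s) √(2 / (ε h(x))) sin(π y / (ε h(x)))` need not lie in the form domain when `h` is only
continuous at `0`, so they are replaced by test functions in which `X_j` is smooth with compact support, `h`
is replaced by a slightly smaller smooth function, and the sine is truncated near the walls. Their energy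
above `κ` is at most `μ j + o(1)` in the scale `s`, and they are close to the quasimodes.

Conclusion (`tendsto_eigenvalue_and_eigenfunction`). The test function of index `j` is expanded in the
eigenfunctions of the strip. By induction its components of index below `j` tend to zero, and so
`limsup s² (λ j - κ) ≤ μ j`. Since `liminf s² (λ (j + 1) - κ) ≥ μ (j + 1) > μ j`, an energy close to `μ j`
leaves no room for the components of index above `j`, and the test function, hence the quasimode, is close
to `± Ψ_j`.

The eigenvalues of the limit operator and of the strip exist because their form domains embed
compactly in `L²` (`exists_eigensystem_of_compact`, from Poincaré inequalities on small cells). Those of the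
limit operator are simple because two square integrable solutions of `-X'' + q X = μ X` are proportional:
a combination vanishing at a point beyond which `q ≥ μ` is zero (`solution_eq_zero_of_zero`).
-/

namespace NarrowStrip

/-! ### Eigenvalues of a compactly embedded form -/

section Abstract

open scoped InnerProductSpace

variable {V H : Type*} [NormedAddCommGroup V] [InnerProductSpace ℝ V] [CompleteSpace V]
  [NormedAddCommGroup H] [InnerProductSpace ℝ H] [CompleteSpace H]

/-- If `‖ι v‖` is controlled by finitely many functionals of `ι v`, up to an arbitrarily small multiple
of `‖v‖`, then `ι` is compact: it is small on the common kernel of these functionals, hence a limit of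
operators of finite rank. -/
theorem isCompactOperator_of_norm_sq_le (ι : V →L[ℝ] H)
    (hC : ∀ δ : ℝ, 0 < δ → ∃ (κ : Type) (_ : Fintype κ) (g : κ → H),
      ∀ v, ‖ι v‖ ^ 2 ≤ δ * ‖v‖ ^ 2 + ∑ k, ⟪g k, ι v⟫_ℝ ^ 2) :
    IsCompactOperator ι := by
  have hcl : ι ∈ closure {T : V →L[ℝ] H | IsCompactOperator T} := by
    rw [Metric.mem_closure_iff]
    intro δ hδ
    obtain ⟨κ, _, g, hg⟩ := hC ((δ / 2) ^ 2) (by positivity)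
    let U : Submodule ℝ V := Submodule.span ℝ (Set.range fun k => ι.adjoint (g k))
    have : FiniteDimensional ℝ U := FiniteDimensional.span_of_finite ℝ (Set.finite_range _)
    have : ProperSpace U := FiniteDimensional.proper ℝ U
    have hK : IsCompactOperator U.orthogonalProjectionOnto :=
      isCompactOperator_of_locallyCompactSpace_dom U.orthogonalProjectionOnto
    refine ⟨ι ∘L (U.subtypeL ∘L U.orthogonalProjectionOnto),
      (hK.clm_comp U.subtypeL).clm_comp ι, ?_⟩
    rw [dist_eq_norm]
    refine lt_of_le_of_lt (ContinuousLinearMap.opNorm_le_bound _ (by positivity : 0 ≤ δ / 2) ?_)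
      (half_lt_self hδ)
    intro v
    set w := v - U.orthogonalProjectionOnto v with hw
    have hwU : w ∈ Uᗮ := U.sub_starProjection_mem_orthogonal v
    have h1 : (ι - ι ∘L (U.subtypeL ∘L U.orthogonalProjectionOnto)) v = ι w := by
      simp [hw]
    have h2 : ∀ k, ⟪g k, ι w⟫_ℝ = 0 := by
      intro k
      rw [← ContinuousLinearMap.adjoint_inner_left]
      exact (Submodule.mem_orthogonal _ _).1 hwU _ (Submodule.subset_span ⟨k, rfl⟩)
    have h3 : ‖w‖ ≤ ‖v‖ := by
      have : w = Uᗮ.starProjection v := by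
        simp [hw, Submodule.starProjection_orthogonal_val]
      rw [this]
      exact Submodule.norm_starProjection_apply_le _ _
    have h4 := hg w
    simp only [h2] at h4
    rw [h1]
    refine le_of_sq_le_sq ?_ (by positivity)
    calc ‖ι w‖ ^ 2 ≤ (δ / 2) ^ 2 * ‖w‖ ^ 2 := by simpa using h4
      _ ≤ (δ / 2) ^ 2 * ‖v‖ ^ 2 := by gcongr
      _ = (δ / 2 * ‖v‖) ^ 2 := by ring
  rwa [(isClosed_setOfPred_isCompactOperator).closure_eq] at hcl

/-- The norm of a nonzero positive compact operator is an eigenvalue. -/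
theorem exists_eigenvector_norm {T : V →L[ℝ] V} (hT : IsCompactOperator T) (hs : T.IsSymmetric)
    (hpos : ∀ v, 0 ≤ ⟪T v, v⟫_ℝ) (h0 : T ≠ 0) : ∃ e, ‖e‖ = 1 ∧ T e = ‖T‖ • e := by
  have hn : ‖T‖ ≠ 0 := norm_ne_zero_iff.2 h0
  have : Nontrivial V := by
    by_contra hV
    rw [not_nontrivial_iff_subsingleton] at hV
    exact h0 (Subsingleton.elim _ _)
  have hspec : ‖T‖ ∈ spectrum ℝ T := by
    by_contra hr
    obtain ⟨ε, hε, hle⟩ := T.rayleighQuotient_le_of_norm_mem_resolventSet (𝕜 := ℝ) (by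
      simpa [spectrum, resolventSet] using hr)
    have h1 := T.norm_eq_iSup_rayleighQuotient hs
    have h2 : ⨆ x, |T.rayleighQuotient x| ≤ ‖T‖ - ε := by
      refine ciSup_le fun x => ?_
      rw [abs_of_nonneg]
      · exact hle x
      · exact div_nonneg (by simpa [ContinuousLinearMap.reApplyInnerSelf] using hpos x) (by positivity)
    linarith
  have hev := (hT.hasEigenvalue_iff_mem_spectrum hn).2 hspec
  obtain ⟨v, hv⟩ := hev.exists_hasEigenvector
  have hv0 : ‖v‖ ≠ 0 := norm_ne_zero_iff.2 hv.2
  refine ⟨‖v‖⁻¹ • v, by simp [norm_smul, hv0], ?_⟩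
  have := hv.apply_eq_smul
  simp only [map_smul]
  rw [smul_comm]
  congr 1

/-- One step of the construction of the eigenvectors of `ι† ι`: a maximizer of `‖ι w‖ / ‖w‖` on the
orthogonal complement of finitely many eigenvectors. -/
theorem exists_eigenvector_orthogonal (ι : V →L[ℝ] H) (hι : IsCompactOperator ι)
    (hd : ∀ f : H, (∀ v, ⟪f, ι v⟫_ℝ = 0) → f = 0) (hinf : ¬ FiniteDimensional ℝ H)
    (s : Finset V) (hs : ∀ x ∈ s, ∃ σ : ℝ, ι.adjoint (ι x) = σ • x) :
    ∃ e, ‖e‖ = 1 ∧ (∃ σ : ℝ, 0 < σ ∧ ι.adjoint (ι e) = σ • e ∧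
      ∀ w, (∀ x ∈ s, ⟪x, w⟫_ℝ = 0) → ‖ι w‖ ^ 2 ≤ σ * ‖w‖ ^ 2) ∧ ∀ x ∈ s, ⟪x, e⟫_ℝ = 0 := by
  let U : Submodule ℝ V := Submodule.span ℝ (s : Set V)
  have : FiniteDimensional ℝ U := FiniteDimensional.span_finset ℝ s
  have memU : ∀ w, w ∈ Uᗮ ↔ ∀ x ∈ s, ⟪x, w⟫_ℝ = 0 := by
    intro w
    rw [Submodule.mem_orthogonal]
    refine ⟨fun h x hx => h x (Submodule.subset_span hx), fun h u hu => ?_⟩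
    induction hu using Submodule.span_induction with
    | mem x hx => exact h x hx
    | zero => simp
    | add x y _ _ hx hy => rw [inner_add_left, hx, hy, add_zero]
    | smul c x _ hx => rw [inner_smul_left, hx, mul_zero]
  let P := Uᗮ.starProjection
  let S := ι.adjoint ∘L ι
  let T := P ∘L (S ∘L P)
  have hS : ∀ v w, ⟪S v, w⟫_ℝ = ⟪ι v, ι w⟫_ℝ := fun v w => by
    simp [S, ContinuousLinearMap.adjoint_inner_left]
  have hP : ∀ v w, ⟪P v, w⟫_ℝ = ⟪v, P w⟫_ℝ := fun v w =>
    Submodule.inner_starProjection_left_eq_right _ _ _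
  have hT : ∀ v w, ⟪T v, w⟫_ℝ = ⟪ι (P v), ι (P w)⟫_ℝ := fun v w => by
    change ⟪P (S (P v)), w⟫_ℝ = _
    rw [hP, hS]
  have hTc : IsCompactOperator T := ((hι.comp_clm P).clm_comp ι.adjoint).clm_comp P
  have hTs : T.IsSymmetric := fun v w => by
    change ⟪T v, w⟫_ℝ = ⟪v, T w⟫_ℝ
    rw [hT, ← real_inner_comm, ← hT, real_inner_comm]
  have hTp : ∀ v, 0 ≤ ⟪T v, v⟫_ℝ := fun v => by
    rw [hT]; exact real_inner_self_nonneg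
  -- otherwise the range of `ι`, which is dense, would be finite-dimensional
  have hT0 : T ≠ 0 := by
    intro h0
    have h1 : ∀ v, ι (P v) = 0 := fun v => by
      have := hT v v
      rw [h0, real_inner_self_eq_norm_sq] at this
      simpa using this.symm
    have h2 : ∀ v, ι v ∈ U.map (ι : V →ₗ[ℝ] H) := by
      intro v
      refine ⟨U.starProjection v, Submodule.starProjection_apply_mem _ _, ?_⟩
      have h3 := U.starProjection_add_starProjection_orthogonal v
      have h4 := congrArg ι h3
      rw [map_add] at h4
      have h5 := h1 v
      simp only [P] at h5
      rw [h5, add_zero] at h4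
      exact h4
    have h3 : (U.map (ι : V →ₗ[ℝ] H))ᗮ = ⊥ := by
      rw [Submodule.eq_bot_iff]
      intro f hf
      refine hd f fun v => ?_
      rw [real_inner_comm]
      exact (Submodule.mem_orthogonal _ _).1 hf _ (h2 v)
    rw [Submodule.orthogonal_eq_bot_iff] at h3
    refine hinf ?_
    have : FiniteDimensional ℝ (⊤ : Submodule ℝ H) := h3 ▸ inferInstance
    exact Module.finite_def.2 ((Submodule.fg_iff_finiteDimensional _).2 this)
  obtain ⟨e, he1, he⟩ := exists_eigenvector_norm hTc hTs hTp hT0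
  have hn : 0 < ‖T‖ := norm_pos_iff.2 hT0
  have heU : e ∈ Uᗮ := by
    have : e = ‖T‖⁻¹ • T e := by rw [he, smul_smul, inv_mul_cancel₀ hn.ne', one_smul]
    rw [this]
    exact Submodule.smul_mem _ _ (Submodule.starProjection_apply_mem _ _)
  have hPe : ∀ w ∈ Uᗮ, P w = w := fun w hw => Submodule.starProjection_eq_self_iff.2 hw
  have hes := (memU e).1 heU
  refine ⟨e, he1, ⟨‖T‖, hn, ?_, ?_⟩, hes⟩
  · have h1 : S e ∈ Uᗮ := by
      rw [memU]
      intro x hx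
      obtain ⟨σ, hσ⟩ := hs x hx
      rw [real_inner_comm, hS, real_inner_comm, ← hS]
      change ⟪ι.adjoint (ι x), e⟫_ℝ = 0
      rw [hσ, inner_smul_left, hes x hx, mul_zero]
    change S e = _
    rw [← hPe _ h1, ← he]
    change P (S e) = P (S (P e))
    rw [hPe _ heU]
  · intro w hw
    have h1 := hPe w ((memU w).2 hw)
    have h2 := hT w w
    rw [h1, real_inner_self_eq_norm_sq] at h2
    rw [← h2]
    calc ⟪T w, w⟫_ℝ ≤ ‖T w‖ * ‖w‖ := real_inner_le_norm _ _
      _ ≤ (‖T‖ * ‖w‖) * ‖w‖ := by gcongr; exact T.le_opNorm w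
      _ = _ := by ring

/-- The eigenvalue problem `⟪e, v⟫ = ν ⟪ι e, ι v⟫` of a compact map `ι` with dense range: for the
inclusion `ι` of a form domain, with its form as inner product, this is the weak eigenvalue equation. -/
theorem exists_eigensequence (ι : V →L[ℝ] H)
    (hC : ∀ δ : ℝ, 0 < δ → ∃ (κ : Type) (_ : Fintype κ) (g : κ → H),
      ∀ v, ‖ι v‖ ^ 2 ≤ δ * ‖v‖ ^ 2 + ∑ k, ⟪g k, ι v⟫_ℝ ^ 2)
    (hd : ∀ f : H, (∀ v, ⟪f, ι v⟫_ℝ = 0) → f = 0) (hinf : ¬ FiniteDimensional ℝ H) :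
    ∃ (ν : ℕ → ℝ) (e : ℕ → V), Monotone ν ∧ Tendsto ν atTop atTop ∧
      (∀ j v, ⟪e j, v⟫_ℝ = ν j * ⟪ι (e j), ι v⟫_ℝ) ∧
      (∀ i j, ⟪ι (e i), ι (e j)⟫_ℝ = if i = j then 1 else 0) ∧
      (∀ f, (∀ j, ⟪f, ι (e j)⟫_ℝ = 0) → f = 0) := by
  classical
  have hι := isCompactOperator_of_norm_sq_le ι hC
  have step : ∀ s : Finset V, ∃ e, (∀ x ∈ s, ∃ σ : ℝ, ι.adjoint (ι x) = σ • x) → ‖e‖ = 1 ∧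
      (∃ σ : ℝ, 0 < σ ∧ ι.adjoint (ι e) = σ • e ∧
      ∀ w, (∀ x ∈ s, ⟪x, w⟫_ℝ = 0) → ‖ι w‖ ^ 2 ≤ σ * ‖w‖ ^ 2) ∧ ∀ x ∈ s, ⟪x, e⟫_ℝ = 0 := by
    intro s
    by_cases hs : ∀ x ∈ s, ∃ σ : ℝ, ι.adjoint (ι x) = σ • x
    · obtain ⟨e, he⟩ := exists_eigenvector_orthogonal ι hι hd hinf s hs
      exact ⟨e, fun _ => he⟩
    · exact ⟨0, fun h => absurd h hs⟩
  choose F hF using step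
  let s : ℕ → Finset V := fun n => Nat.rec ∅ (fun _ t => insert (F t) t) n
  have s_succ : ∀ n, s (n + 1) = insert (F (s n)) (s n) := fun n => rfl
  have hs : ∀ n, ∀ x ∈ s n, ∃ σ : ℝ, ι.adjoint (ι x) = σ • x := by
    intro n
    induction n with
    | zero => intro x hx; simp [s] at hx
    | succ n ih =>
      intro x hx
      rw [s_succ, Finset.mem_insert] at hx
      rcases hx with rfl | hx
      · obtain ⟨-, ⟨σ, -, h, -⟩, -⟩ := hF _ ih
        exact ⟨σ, h⟩
      · exact ih x hx
  have s_mono : Monotone s := monotone_nat_of_le_succ fun n => by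
    rw [s_succ]; exact Finset.subset_insert _ _
  have mem_s : ∀ {m n}, m < n → F (s m) ∈ s n := fun {m n} hmn =>
    s_mono (Nat.succ_le_of_lt hmn) (by rw [s_succ]; exact Finset.mem_insert_self _ _)
  have s_mem : ∀ n, ∀ x ∈ s n, ∃ m < n, x = F (s m) := by
    intro n
    induction n with
    | zero => intro x hx; simp [s] at hx
    | succ n ih =>
      intro x hx
      rw [s_succ, Finset.mem_insert] at hx
      rcases hx with rfl | hx
      · exact ⟨n, Nat.lt_succ_self n, rfl⟩
      · obtain ⟨m, hm, h⟩ := ih x hx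
        exact ⟨m, by omega, h⟩
  choose h1 h2 h3 using fun n => hF _ (hs n)
  choose σ hσ0 hσ hmax using h2
  obtain ⟨u, hu⟩ : ∃ u : ℕ → V, ∀ n, F (s n) = u n := ⟨_, fun _ => rfl⟩
  simp only [hu] at h1 h3 hσ mem_s s_mem
  have hlt : ∀ {m n}, m < n → ⟪u m, u n⟫_ℝ = 0 := fun {m n} hmn => h3 n _ (mem_s hmn)
  have horth : ∀ m n, ⟪u m, u n⟫_ℝ = if m = n then 1 else 0 := by
    intro m n
    rcases lt_trichotomy m n with h | h | h
    · rw [hlt h, if_neg h.ne]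
    · subst h; rw [real_inner_self_eq_norm_sq, h1 m]; simp
    · rw [real_inner_comm, hlt h, if_neg h.ne']
  have hform : ∀ n v, ⟪ι (u n), ι v⟫_ℝ = σ n * ⟪u n, v⟫_ℝ := fun n v => by
    rw [← ContinuousLinearMap.adjoint_inner_left, hσ n, real_inner_smul_left]
  have hnorm : ∀ n, ‖ι (u n)‖ ^ 2 = σ n := fun n => by
    rw [← real_inner_self_eq_norm_sq, hform, horth]; simp
  have hanti : Antitone σ := antitone_nat_of_succ_le fun n => by
    have := hmax n (u (n + 1)) (fun x hx => by
      obtain ⟨m, hm, rfl⟩ := s_mem n x hx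
      exact hlt (hm.trans (Nat.lt_succ_self n)))
    rw [hnorm, h1 (n + 1)] at this
    simpa using this
  have hON : Orthonormal ℝ u := by
    rw [orthonormal_iff_ite]; exact horth
  have hsmall : ∀ δ : ℝ, 0 < δ → ∃ n, σ n ≤ δ := by
    intro δ hδ
    obtain ⟨κ, _, g, hg⟩ := hC (δ / 2) (by positivity)
    have h0 : Tendsto (fun n => ∑ k, ⟪g k, ι (u n)⟫_ℝ ^ 2) atTop (𝓝 0) := by
      have : Tendsto (fun n => ∑ k, ⟪g k, ι (u n)⟫_ℝ ^ 2) atTop (𝓝 (∑ k : κ, 0)) := by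
        refine tendsto_finsetSum _ fun k _ => ?_
        have hb := hON.inner_products_summable (ι.adjoint (g k))
        have := hb.tendsto_atTop_zero
        refine this.congr fun n => ?_
        rw [Real.norm_eq_abs, sq_abs, ContinuousLinearMap.adjoint_inner_right, real_inner_comm]
      simpa using this
    obtain ⟨n, hn⟩ := (h0.eventually (ge_mem_nhds (half_pos hδ))).exists
    refine ⟨n, ?_⟩
    have := hg (u n)
    rw [hnorm, h1 n] at this
    linarith
  have hkey : ∀ n, 0 < √(σ n) := fun n => Real.sqrt_pos.2 (hσ0 n)
  refine ⟨fun n => (σ n)⁻¹, fun n => (√(σ n))⁻¹ • u n, ?_, ?_, ?_, ?_, ?_⟩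
  · intro m n hmn
    exact inv_anti₀ (hσ0 n) (hanti hmn)
  · refine tendsto_atTop_atTop.2 fun b => ?_
    obtain ⟨n, hn⟩ := hsmall (max b 1)⁻¹ (by positivity)
    refine ⟨n, fun m hm => ?_⟩
    calc b ≤ max b 1 := le_max_left _ _
      _ = ((max b 1)⁻¹)⁻¹ := (inv_inv _).symm
      _ ≤ _ := inv_anti₀ (hσ0 m) ((hanti hm).trans hn)
  · intro j v
    simp only [map_smul, real_inner_smul_left, hform]
    have := (hσ0 j).ne'
    field_simp
  · intro i j
    simp only [map_smul, real_inner_smul_left, real_inner_smul_right, hform, horth]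
    split_ifs with hij
    · subst hij
      have h4 := Real.mul_self_sqrt (hσ0 i).le
      have := (hkey i).ne'
      field_simp
      nlinarith
    · simp
  · intro f hf
    have h4 : ∀ j, ⟪u j, ι.adjoint f⟫_ℝ = 0 := by
      intro j
      have := hf j
      rw [map_smul, real_inner_smul_right, mul_eq_zero] at this
      rcases this with h | h
      · exact absurd h (inv_ne_zero (hkey j).ne')
      · rw [real_inner_comm, ContinuousLinearMap.adjoint_inner_left]; exact h
    have h5 : ι (ι.adjoint f) = 0 := by
      have h6 : ∀ n, ‖ι (ι.adjoint f)‖ ^ 2 ≤ σ n * ‖ι.adjoint f‖ ^ 2 := fun n =>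
        hmax n _ fun x hx => by
          obtain ⟨m, hm, rfl⟩ := s_mem n x hx
          exact h4 m
      have h7 : ‖ι (ι.adjoint f)‖ ^ 2 ≤ 0 := by
        refine le_of_forall_pos_le_add fun δ hδ => ?_
        obtain ⟨n, hn⟩ := hsmall (δ / (‖ι.adjoint f‖ ^ 2 + 1)) (by positivity)
        calc _ ≤ σ n * ‖ι.adjoint f‖ ^ 2 := h6 n
          _ ≤ δ / (‖ι.adjoint f‖ ^ 2 + 1) * (‖ι.adjoint f‖ ^ 2 + 1) := by
            gcongr; linarith
          _ = 0 + δ := by field_simp; ring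
      have h8 : ‖ι (ι.adjoint f)‖ = 0 := by
        have := sq_nonneg ‖ι (ι.adjoint f)‖
        exact pow_eq_zero_iff (two_ne_zero) |>.1 (le_antisymm h7 this)
      exact norm_eq_zero.1 h8
    have h6 : ι.adjoint f = 0 := by
      have : ⟪ι.adjoint f, ι.adjoint f⟫_ℝ = 0 := by
        rw [ContinuousLinearMap.adjoint_inner_left, h5, inner_zero_right]
      exact inner_self_eq_zero.1 this
    refine hd f fun v => ?_
    rw [← ContinuousLinearMap.adjoint_inner_left, h6, inner_zero_left]

end Abstract

/-! ### Quadratic forms on `L²` -/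

section SquareIntegrable

open scoped InnerProductSpace

variable {α : Type*} [MeasurableSpace α] {μ : Measure α}

theorem inner_toLp {f g : α → ℝ} (hf : MemLp f 2 μ) (hg : MemLp g 2 μ) :
    ⟪hf.toLp f, hg.toLp g⟫_ℝ = ∫ x, f x * g x ∂μ := by
  rw [L2.inner_def]
  refine integral_congr_ae ?_
  filter_upwards [hf.coeFn_toLp, hg.coeFn_toLp] with x h1 h2
  rw [h1, h2]
  simp [mul_comm]

theorem norm_sq_toLp {f : α → ℝ} (hf : MemLp f 2 μ) : ‖hf.toLp f‖ ^ 2 = ∫ x, f x ^ 2 ∂μ := by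
  rw [← real_inner_self_eq_norm_sq, inner_toLp]
  simp only [sq]

theorem inner_lp (F G : Lp ℝ 2 μ) : ⟪F, G⟫_ℝ = ∫ x, F x * G x ∂μ := by
  rw [L2.inner_def]
  simp [mul_comm]

theorem inner_lp_toLp (F : Lp ℝ 2 μ) {g : α → ℝ} (hg : MemLp g 2 μ) :
    ⟪F, hg.toLp g⟫_ℝ = ∫ x, F x * g x ∂μ := by
  rw [← inner_toLp (Lp.memLp F) hg, Lp.toLp_coeFn]

theorem integrable_mul {f g : α → ℝ} (hf : MemLp f 2 μ) (hg : MemLp g 2 μ) :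
    Integrable (fun x => f x * g x) μ := hf.integrable_mul hg

theorem integrable_sq {f : α → ℝ} (hf : MemLp f 2 μ) : Integrable (fun x => f x ^ 2) μ :=
  hf.integrable_sq

/-- The Cauchy-Schwarz inequality. -/
theorem sq_integral_mul_le {f g : α → ℝ} (hf : MemLp f 2 μ) (hg : MemLp g 2 μ) :
    (∫ x, f x * g x ∂μ) ^ 2 ≤ (∫ x, f x ^ 2 ∂μ) * ∫ x, g x ^ 2 ∂μ := by
  rw [← inner_toLp hf hg, ← norm_sq_toLp hf, ← norm_sq_toLp hg, ← mul_pow, ← sq_abs]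
  exact pow_le_pow_left₀ (abs_nonneg _) (abs_real_inner_le_norm _ _) 2

theorem tendsto_toLp {f : ℕ → α → ℝ} {g : α → ℝ} (hf : ∀ n, MemLp (f n) 2 μ) (hg : MemLp g 2 μ)
    (h : Tendsto (fun n => ∫ x, (f n x - g x) ^ 2 ∂μ) atTop (𝓝 0)) :
    Tendsto (fun n => (hf n).toLp (f n)) atTop (𝓝 (hg.toLp g)) := by
  rw [tendsto_iff_norm_sub_tendsto_zero]
  have h1 : ∀ n, ‖(hf n).toLp (f n) - hg.toLp g‖ ^ 2 = ∫ x, (f n x - g x) ^ 2 ∂μ := fun n => by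
    rw [← MemLp.toLp_sub, norm_sq_toLp]
    rfl
  have h2 := h.sqrt
  rw [Real.sqrt_zero] at h2
  refine h2.congr fun n => ?_
  rw [← h1, Real.sqrt_sq (norm_nonneg _)]

theorem tendsto_integral_mul {f f' : ℕ → α → ℝ} {g g' : α → ℝ} (hf : ∀ n, MemLp (f n) 2 μ)
    (hg : MemLp g 2 μ) (h : Tendsto (fun n => ∫ x, (f n x - g x) ^ 2 ∂μ) atTop (𝓝 0))
    (hf' : ∀ n, MemLp (f' n) 2 μ)
    (hg' : MemLp g' 2 μ) (h' : Tendsto (fun n => ∫ x, (f' n x - g' x) ^ 2 ∂μ) atTop (𝓝 0)) :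
    Tendsto (fun n => ∫ x, f n x * f' n x ∂μ) atTop (𝓝 (∫ x, g x * g' x ∂μ)) := by
  have := (tendsto_toLp hf hg h).inner (tendsto_toLp hf' hg' h') (𝕜 := ℝ)
  simpa only [inner_toLp] using this

theorem tendsto_integral_mul_left {f' : ℕ → α → ℝ} {g g' : α → ℝ}
    (hg : MemLp g 2 μ) (hf' : ∀ n, MemLp (f' n) 2 μ)
    (hg' : MemLp g' 2 μ) (h' : Tendsto (fun n => ∫ x, (f' n x - g' x) ^ 2 ∂μ) atTop (𝓝 0)) :
    Tendsto (fun n => ∫ x, g x * f' n x ∂μ) atTop (𝓝 (∫ x, g x * g' x ∂μ)) :=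
  tendsto_integral_mul (f := fun _ => g) (fun _ => hg) hg (by simp) hf' hg' h'

theorem tendsto_integral_sq {f : ℕ → α → ℝ} {g : α → ℝ} (hf : ∀ n, MemLp (f n) 2 μ)
    (hg : MemLp g 2 μ) (h : Tendsto (fun n => ∫ x, (f n x - g x) ^ 2 ∂μ) atTop (𝓝 0)) :
    Tendsto (fun n => ∫ x, f n x ^ 2 ∂μ) atTop (𝓝 (∫ x, g x ^ 2 ∂μ)) := by
  simpa only [sq] using tendsto_integral_mul hf hg h hf hg h

/-- Disjoint sets of positive measure make `L²` infinite-dimensional. -/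
theorem not_finiteDimensional_lp (s : ℕ → Set α) (hm : ∀ n, MeasurableSet (s n))
    (hpos : ∀ n, μ (s n) ≠ 0) (hfin : ∀ n, μ (s n) ≠ ⊤)
    (hdisj : Pairwise (Function.onFun Disjoint s)) : ¬ FiniteDimensional ℝ (Lp ℝ 2 μ) := by
  intro hfd
  have hmem : ∀ n, MemLp ((s n).indicator fun _ => (1 : ℝ)) 2 μ := fun n =>
    memLp_indicator_const 2 (hm n) 1 (Or.inr (hfin n))
  have hli : LinearIndependent ℝ fun n => (hmem n).toLp _ := by
    refine linearIndependent_of_ne_zero_of_inner_eq_zero (𝕜 := ℝ) (fun n h0 => ?_)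
      fun m n hmn => ?_
    · have h1 := norm_sq_toLp (hmem n)
      rw [h0] at h1
      have h2 : ∀ x, (s n).indicator (fun _ => (1 : ℝ)) x ^ 2 = (s n).indicator (fun _ => (1 : ℝ)) x :=
        fun x => by by_cases hx : x ∈ s n <;> simp [hx]
      simp only [h2] at h1
      rw [integral_indicator_const _ (hm n)] at h1
      simp only [norm_zero, smul_eq_mul, mul_one, measureReal_def] at h1
      rw [zero_pow two_ne_zero] at h1
      exact (ENNReal.toReal_pos (hpos n) (hfin n)).ne h1
    · change ⟪(hmem m).toLp _, (hmem n).toLp _⟫_ℝ = 0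
      rw [inner_toLp]
      have : ∀ x, (s m).indicator (fun _ => (1 : ℝ)) x * (s n).indicator (fun _ => (1 : ℝ)) x = 0 := by
        intro x
        by_cases hx : x ∈ s m
        · have : x ∉ s n := Set.disjoint_left.1 (hdisj hmn) hx
          simp [this]
        · simp [hx]
      simp [this]
  have := hli.finite
  exact not_finite ℕ

/-- Parseval's identity. -/
theorem hasSum_sq_integral_mul {ψ : ℕ → α → ℝ} (hψ : ∀ j, MemLp (ψ j) 2 μ)
    (horth : ∀ i j, ∫ x, ψ i x * ψ j x ∂μ = if i = j then 1 else 0)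
    (hcomp : ∀ f : α → ℝ, MemLp f 2 μ → (∀ j, ∫ x, f x * ψ j x ∂μ = 0) → f =ᵐ[μ] 0)
    {f : α → ℝ} (hf : MemLp f 2 μ) :
    HasSum (fun j => (∫ x, f x * ψ j x ∂μ) ^ 2) (∫ x, f x ^ 2 ∂μ) := by
  have hON : Orthonormal ℝ fun j => (hψ j).toLp (ψ j) := by
    rw [orthonormal_iff_ite]
    intro i j
    rw [inner_toLp, horth]
  have hbot : (Submodule.span ℝ (Set.range fun j => (hψ j).toLp (ψ j)))ᗮ = ⊥ := by
    rw [Submodule.eq_bot_iff]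
    intro F hF
    have h1 : ∀ j, ∫ x, F x * ψ j x ∂μ = 0 := by
      intro j
      have h2 := (Submodule.mem_orthogonal' _ _).1 hF _ (Submodule.subset_span ⟨j, rfl⟩)
      have h3 := inner_toLp (Lp.memLp F) (hψ j)
      rw [Lp.toLp_coeFn] at h3
      rw [← h3]; exact h2
    exact (Lp.eq_zero_iff_ae_eq_zero).2 (hcomp F (Lp.memLp F) h1)
  let b := HilbertBasis.mkOfOrthogonalEqBot hON hbot
  have h1 := b.hasSum_inner_mul_inner (hf.toLp f) (hf.toLp f)
  have hb : ∀ j, b j = (hψ j).toLp (ψ j) := fun j => by simp [b]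
  simp only [hb, inner_toLp] at h1
  have h2 : ∀ j, (∫ x, f x * ψ j x ∂μ) * ∫ x, ψ j x * f x ∂μ = (∫ x, f x * ψ j x ∂μ) ^ 2 := by
    intro j
    rw [sq]
    congr 2
    ext x
    ring
  simpa only [h2, ← sq] using h1

/-- In a triple `(φ, φ₁, φ₂)` of `𝒟`, the last two entries stand for the terms whose squares add up
to a quadratic form at `φ`; if the form controls `φ` compactly, then its closure has discrete spectrum
and its eigenfunctions are complete. The eigenvalues are those of the form plus `1`. -/
theorem exists_eigensystem_of_compact (𝒟 : Submodule ℝ (Fin 3 → α → ℝ))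
    (hmem : ∀ d ∈ 𝒟, ∀ i, MemLp (d i) 2 μ)
    (hC : ∀ δ : ℝ, 0 < δ → ∃ (κ : Type) (_ : Fintype κ) (g : κ → α → ℝ), (∀ k, MemLp (g k) 2 μ) ∧
      ∀ d ∈ 𝒟, ∫ x, d 0 x ^ 2 ∂μ ≤
        δ * ∑ i, ∫ x, d i x ^ 2 ∂μ + ∑ k, (∫ x, g k x * d 0 x ∂μ) ^ 2)
    (hd : ∀ f, MemLp f 2 μ → (∀ d ∈ 𝒟, ∫ x, f x * d 0 x ∂μ = 0) → f =ᵐ[μ] 0)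
    (hinf : ¬ FiniteDimensional ℝ (Lp ℝ 2 μ)) :
    ∃ (ν : ℕ → ℝ) (w : ℕ → Fin 3 → α → ℝ), Monotone ν ∧ Tendsto ν atTop atTop ∧
      (∀ j i, MemLp (w j i) 2 μ) ∧
      (∀ j, ∃ d : ℕ → Fin 3 → α → ℝ, (∀ n, d n ∈ 𝒟) ∧
        ∀ i, Tendsto (fun n => ∫ x, (d n i x - w j i x) ^ 2 ∂μ) atTop (𝓝 0)) ∧
      (∀ j, ∀ d ∈ 𝒟, ∑ i, ∫ x, w j i x * d i x ∂μ = ν j * ∫ x, w j 0 x * d 0 x ∂μ) ∧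
      (∀ i j, ∫ x, w i 0 x * w j 0 x ∂μ = if i = j then 1 else 0) ∧
      (∀ f, MemLp f 2 μ → (∀ j, ∫ x, f x * w j 0 x ∂μ = 0) → f =ᵐ[μ] 0) := by
  let E := PiLp 2 fun _ : Fin 3 => Lp ℝ 2 μ
  let Φ : 𝒟 →ₗ[ℝ] E :=
    { toFun := fun d => WithLp.toLp 2 fun i => (hmem d.1 d.2 i).toLp (d.1 i)
      map_add' := fun d d' => by
        ext1 i; exact MemLp.toLp_add (hmem d.1 d.2 i) (hmem d'.1 d'.2 i)
      map_smul' := fun c d => by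
        ext1 i; exact MemLp.toLp_const_smul c (hmem d.1 d.2 i) }
  have hΦ : ∀ d (hd : d ∈ 𝒟) i, Φ ⟨d, hd⟩ i = (hmem d hd i).toLp (d i) := fun d hd i => rfl
  let D : Submodule ℝ E := LinearMap.range Φ
  let V : Submodule ℝ E := D.topologicalClosure
  have hVc : IsClosed (V : Set E) := D.isClosed_topologicalClosure
  have : CompleteSpace V := hVc.completeSpace_coe
  let ι : V →L[ℝ] Lp ℝ 2 μ := (PiLp.proj 2 (fun _ : Fin 3 => Lp ℝ 2 μ) 0 : E →L[ℝ] Lp ℝ 2 μ) ∘L V.subtypeL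
  have hι : ∀ v : V, ι v = v.1 0 := fun v => rfl
  have hDV : ∀ d (hd : d ∈ 𝒟), Φ ⟨d, hd⟩ ∈ V := fun d hd =>
    D.le_topologicalClosure ⟨_, rfl⟩
  have hnorm : ∀ v : E, ‖v‖ ^ 2 = ∑ i, ‖v i‖ ^ 2 := fun v => PiLp.norm_sq_eq_of_L2 _ v
  obtain ⟨ν, e, h1, h2, h3, h4, h5⟩ := exists_eigensequence ι (by
      intro δ hδ
      obtain ⟨κ, hκ, g, hg, hle⟩ := hC δ hδ
      refine ⟨κ, hκ, fun k => (hg k).toLp (g k), fun v => ?_⟩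
      have hcl : IsClosed {v : E | ‖v 0‖ ^ 2 ≤
          δ * ‖v‖ ^ 2 + ∑ k, ⟪(hg k).toLp (g k), v 0⟫_ℝ ^ 2} := by
        have hc : Continuous fun v : E => v 0 :=
          PiLp.continuous_apply 2 (fun _ : Fin 3 => Lp ℝ 2 μ) 0
        refine isClosed_le (hc.norm.pow 2) ?_
        refine ((continuous_norm.pow 2).const_mul δ).add ?_
        exact continuous_finsetSum _ fun k _ => (continuous_const.inner hc).pow 2
      have hsub : (D : Set E) ⊆ {v : E | ‖v 0‖ ^ 2 ≤
          δ * ‖v‖ ^ 2 + ∑ k, ⟪(hg k).toLp (g k), v 0⟫_ℝ ^ 2} := by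
        rintro _ ⟨⟨d, hd⟩, rfl⟩
        have := hle d hd
        simp only [Set.mem_ofPred_eq, hnorm, hΦ, norm_sq_toLp, inner_toLp]
        exact this
      have hv : v.1 ∈ closure (D : Set E) := v.2
      exact closure_minimal hsub hcl hv)
    (by
      intro f hf
      refine (Lp.eq_zero_iff_ae_eq_zero).2 (hd f (Lp.memLp f) fun d hd => ?_)
      have h := hf ⟨Φ ⟨d, hd⟩, hDV d hd⟩
      rw [hι] at h
      change ⟪f, Φ ⟨d, hd⟩ 0⟫_ℝ = 0 at h
      rw [hΦ, ← Lp.toLp_coeFn f (Lp.memLp f), inner_toLp] at h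
      exact h)
    hinf
  refine ⟨ν, fun j i => ((e j).1 i : α → ℝ), h1, h2, fun j i => Lp.memLp _, ?_, ?_, ?_, ?_⟩
  · intro j
    have hv : (e j).1 ∈ closure (D : Set E) := (e j).2
    obtain ⟨u, hu, hlim⟩ := mem_closure_iff_seq_limit.1 hv
    choose d hd using hu
    refine ⟨fun n => (d n).1, fun n => (d n).2, fun i => ?_⟩
    have hc : Tendsto (fun n => u n i) atTop (𝓝 ((e j).1 i)) :=
      ((PiLp.continuous_apply 2 (fun _ : Fin 3 => Lp ℝ 2 μ) i).tendsto _).comp hlim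
    rw [tendsto_iff_norm_sub_tendsto_zero] at hc
    have hc2 := hc.pow 2
    rw [zero_pow two_ne_zero] at hc2
    refine hc2.congr fun n => ?_
    have : u n i = (hmem _ (d n).2 i).toLp ((d n).1 i) := by
      rw [← hd n]; rfl
    rw [this]
    nth_rewrite 1 [← Lp.toLp_coeFn ((e j).1 i) (Lp.memLp _)]
    rw [← MemLp.toLp_sub, norm_sq_toLp]
    rfl
  · intro j d hd
    have h := h3 j ⟨Φ ⟨d, hd⟩, hDV d hd⟩
    rw [hι, hι] at h
    have key : ∀ i, ⟪(e j).1 i, Φ ⟨d, hd⟩ i⟫_ℝ = ∫ x, (e j).1 i x * d i x ∂μ := fun i => by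
      rw [hΦ, inner_lp_toLp]
    rw [key] at h
    rw [← h]
    change _ = ⟪(e j).1, Φ ⟨d, hd⟩⟫_ℝ
    rw [PiLp.inner_apply]
    exact Finset.sum_congr rfl fun i _ => (key i).symm
  · intro i j
    rw [← h4 i j, hι, hι, inner_lp]
  · intro f hf hj
    have h6 := h5 (hf.toLp f) fun j => by
      rw [hι, real_inner_comm, inner_lp_toLp, ← hj j]
      simp only [mul_comm]
    have h7 := hf.coeFn_toLp
    rw [h6] at h7
    exact h7.symm.trans (Lp.coeFn_zero _ _ _)

/-- Bessel's inequality for a quadratic form `∫ (P² + R²)` and its eigenfunctions `(p k, r k)`. -/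
theorem sum_eigenvalue_mul_sq_le {p r : ℕ → α → ℝ} {P R : α → ℝ} (hp : ∀ j, MemLp (p j) 2 μ)
    (hr : ∀ j, MemLp (r j) 2 μ) (hP : MemLp P 2 μ) (hR : MemLp R 2 μ) {l c : ℕ → ℝ}
    (horth : ∀ i j, ∫ x, (p i x * p j x + r i x * r j x) ∂μ = l i * if i = j then 1 else 0)
    (hc : ∀ j, ∫ x, (P x * p j x + R x * r j x) ∂μ = l j * c j) (n : ℕ) :
    ∑ k ∈ Finset.range n, l k * c k ^ 2 ≤ ∫ x, (P x ^ 2 + R x ^ 2) ∂μ := by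
  let E := WithLp 2 (Lp ℝ 2 μ × Lp ℝ 2 μ)
  let e : ℕ → E := fun j => WithLp.toLp 2 ((hp j).toLp _, (hr j).toLp _)
  let T : E := WithLp.toLp 2 (hP.toLp _, hR.toLp _)
  have h1 : ∀ i j, ⟪e i, e j⟫_ℝ = l i * if i = j then 1 else 0 := fun i j => by
    rw [← horth, WithLp.prod_inner_apply, integral_add (integrable_mul (hp i) (hp j))
      (integrable_mul (hr i) (hr j))]
    simp only [e, inner_toLp]
  have h2 : ∀ j, ⟪T, e j⟫_ℝ = l j * c j := fun j => by
    rw [← hc, WithLp.prod_inner_apply, integral_add (integrable_mul hP (hp j))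
      (integrable_mul hR (hr j))]
    simp only [e, T, inner_toLp]
  have h3 : ‖T‖ ^ 2 = ∫ x, (P x ^ 2 + R x ^ 2) ∂μ := by
    rw [WithLp.prod_norm_sq_eq_of_L2, integral_add (integrable_sq hP) (integrable_sq hR)]
    exact congrArg₂ _ (norm_sq_toLp hP) (norm_sq_toLp hR)
  set S := ∑ k ∈ Finset.range n, c k • e k with hS
  have h4 : ⟪T, S⟫_ℝ = ∑ k ∈ Finset.range n, l k * c k ^ 2 := by
    rw [hS, inner_sum]
    refine Finset.sum_congr rfl fun k _ => ?_
    rw [real_inner_smul_right, h2]; ring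
  have h5 : ⟪S, S⟫_ℝ = ∑ k ∈ Finset.range n, l k * c k ^ 2 := by
    conv_lhs => rw [hS]
    rw [sum_inner]
    refine Finset.sum_congr rfl fun k hk => ?_
    rw [inner_sum, Finset.sum_eq_single k]
    · rw [real_inner_smul_left, real_inner_smul_right, h1]; simp; ring
    · intro b _ hb
      rw [real_inner_smul_left, real_inner_smul_right, h1, if_neg hb.symm]; simp
    · intro h; exact absurd hk h
  have h6 : 0 ≤ ‖T - S‖ ^ 2 := sq_nonneg _
  rw [norm_sub_sq_real, h4, ← real_inner_self_eq_norm_sq S, h5, h3] at h6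
  linarith

/-- The variational lower bound for a form with eigenvalues `l 0 ≤ l 1 ≤ ⋯`. -/
theorem eigenvalue_lower_bound {ψ : ℕ → α → ℝ} (hψ : ∀ j, MemLp (ψ j) 2 μ)
    (horth : ∀ i j, ∫ x, ψ i x * ψ j x ∂μ = if i = j then 1 else 0)
    (hcomp : ∀ f : α → ℝ, MemLp f 2 μ → (∀ j, ∫ x, f x * ψ j x ∂μ = 0) → f =ᵐ[μ] 0)
    {l : ℕ → ℝ} (hl : Monotone l)
    {p r : ℕ → α → ℝ} {P R : α → ℝ} (hp : ∀ j, MemLp (p j) 2 μ)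
    (hr : ∀ j, MemLp (r j) 2 μ) (hP : MemLp P 2 μ) (hR : MemLp R 2 μ)
    (hform : ∀ i j, ∫ x, (p i x * p j x + r i x * r j x) ∂μ = l i * ∫ x, ψ i x * ψ j x ∂μ)
    {f : α → ℝ} (hf : MemLp f 2 μ)
    (hc : ∀ j, ∫ x, (P x * p j x + R x * r j x) ∂μ = l j * ∫ x, f x * ψ j x ∂μ) (N : ℕ) :
    ∑ k ∈ Finset.range N, l k * (∫ x, f x * ψ k x ∂μ) ^ 2 +
      l N * (∫ x, f x ^ 2 ∂μ - ∑ k ∈ Finset.range N, (∫ x, f x * ψ k x ∂μ) ^ 2) ≤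
      ∫ x, (P x ^ 2 + R x ^ 2) ∂μ := by
  set c : ℕ → ℝ := fun k => ∫ x, f x * ψ k x ∂μ with hcdef
  have hb := sum_eigenvalue_mul_sq_le hp hr hP hR (fun i j => by rw [hform, horth]) hc
  have hs := (hasSum_sq_integral_mul hψ horth hcomp hf).tendsto_sum_nat
  have hlim : Tendsto (fun n => ∑ k ∈ Finset.range N, l k * c k ^ 2 +
      l N * (∑ k ∈ Finset.range n, c k ^ 2 - ∑ k ∈ Finset.range N, c k ^ 2)) atTop
      (𝓝 (∑ k ∈ Finset.range N, l k * c k ^ 2 +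
        l N * (∫ x, f x ^ 2 ∂μ - ∑ k ∈ Finset.range N, c k ^ 2))) :=
    ((hs.sub_const _).const_mul _).const_add _
  refine le_of_tendsto hlim ?_
  filter_upwards [eventually_ge_atTop N] with n hn
  refine le_trans ?_ (hb n)
  rw [← Finset.sum_range_add_sum_Ico _ hn, ← Finset.sum_range_add_sum_Ico _ hn, add_sub_cancel_left,
    Finset.mul_sum]
  gcongr with k hk
  exact hl (Finset.mem_Ico.1 hk).1

end SquareIntegrable

/-! ### Poincaré inequalities and the spectral gap of an interval -/

section Interval

theorem memLp_restrict_of_isCompact {X F : Type*} [TopologicalSpace X] [T2Space X]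
    [MeasurableSpace X] [OpensMeasurableSpace X] [SecondCountableTopology X]
    {μ : Measure X} [IsFiniteMeasureOnCompacts μ] [NormedAddCommGroup F]
    {f : X → F} {K : Set X} (hK : IsCompact K) (hf : ContinuousOn f K) :
    MemLp f 2 (μ.restrict K) := by
  obtain ⟨C, hC⟩ := hK.exists_bound_of_continuousOn hf
  have : IsFiniteMeasure (μ.restrict K) := ⟨by simpa using hK.measure_lt_top⟩
  refine MemLp.of_bound (hf.aestronglyMeasurable_of_isCompact hK hK.measurableSet) C ?_
  exact (ae_restrict_iff' hK.measurableSet).2 (Eventually.of_forall hC)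

theorem memLp_Ioc_of_continuousOn {F : Type*} [NormedAddCommGroup F] {f : ℝ → F} {c d : ℝ}
    (hf : ContinuousOn f (Set.Icc c d)) : MemLp f 2 (volume.restrict (Set.Ioc c d)) :=
  (memLp_restrict_of_isCompact isCompact_Icc hf).mono_measure
    (Measure.restrict_mono Set.Ioc_subset_Icc_self le_rfl)

theorem sq_intervalIntegral_mul_le {f g : ℝ → ℝ} {c d : ℝ} (hcd : c ≤ d)
    (hf : ContinuousOn f (Set.Icc c d)) (hg : ContinuousOn g (Set.Icc c d)) :
    (∫ x in c..d, f x * g x) ^ 2 ≤ (∫ x in c..d, f x ^ 2) * ∫ x in c..d, g x ^ 2 := by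
  simp only [intervalIntegral.integral_of_le hcd]
  exact sq_integral_mul_le (memLp_Ioc_of_continuousOn hf) (memLp_Ioc_of_continuousOn hg)

theorem sq_intervalIntegral_le {f : ℝ → ℝ} {c d : ℝ} (hcd : c ≤ d)
    (hf : ContinuousOn f (Set.Icc c d)) :
    (∫ x in c..d, f x) ^ 2 ≤ (d - c) * ∫ x in c..d, f x ^ 2 := by
  have := sq_intervalIntegral_mul_le hcd (f := fun _ => 1) continuousOn_const hf
  simpa using this

/-- The Poincaré inequality on an interval. -/
theorem integral_sq_le_of_contDiff {f : ℝ → ℝ} (hf : ContDiff ℝ 1 f) {c d : ℝ} (hcd : c < d) :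
    ∫ x in c..d, f x ^ 2 ≤
      (d - c) ^ 2 * (∫ x in c..d, deriv f x ^ 2) + (d - c)⁻¹ * (∫ x in c..d, f x) ^ 2 := by
  have hfc : Continuous f := hf.continuous
  have hf' : Continuous (deriv f) := hf.continuous_deriv le_rfl
  set K := ∫ x in c..d, deriv f x ^ 2 with hK
  set A := ∫ x in c..d, f x with hA
  set B := ∫ x in c..d, f x ^ 2 with hB
  have hK0 : 0 ≤ K := intervalIntegral.integral_nonneg hcd.le fun _ _ => sq_nonneg _
  have ii : ∀ {g : ℝ → ℝ}, Continuous g → IntervalIntegrable g volume c d :=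
    fun hg => hg.intervalIntegrable _ _
  have h1 : ∀ x ∈ Set.Icc c d, ∀ y ∈ Set.Icc c d, y ≤ x → (f x - f y) ^ 2 ≤ (d - c) * K := by
    intro x hx y hy hyx
    have h2 : ∫ t in y..x, deriv f t = f x - f y :=
      intervalIntegral.integral_deriv_eq_sub (fun t _ => hf.differentiable one_ne_zero t)
        (hf'.intervalIntegrable _ _)
    rw [← h2]
    refine (sq_intervalIntegral_le hyx hf'.continuousOn).trans ?_
    have h3 : ∫ t in y..x, deriv f t ^ 2 ≤ K :=
      intervalIntegral.integral_mono_interval hy.1 hyx hx.2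
        (Eventually.of_forall fun _ => sq_nonneg _) ((hf'.pow 2).intervalIntegrable _ _)
    have h4 : 0 ≤ ∫ t in y..x, deriv f t ^ 2 :=
      intervalIntegral.integral_nonneg hyx fun _ _ => sq_nonneg _
    have h5 := hy.1
    have h6 := hx.2
    gcongr
  have h2 : ∀ x ∈ Set.Icc c d, ∀ y ∈ Set.Icc c d, (f x - f y) ^ 2 ≤ (d - c) * K := by
    intro x hx y hy
    rcases le_total y x with h | h
    · exact h1 x hx y hy h
    · have := h1 y hy x hx h
      nlinarith
  have h3 : ∀ x ∈ Set.Icc c d, (d - c) * f x ^ 2 - 2 * A * f x + B ≤ (d - c) * ((d - c) * K) := by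
    intro x hx
    have h4 : ∫ y in c..d, (f x - f y) ^ 2 ≤ ∫ y in c..d, (d - c) * K :=
      intervalIntegral.integral_mono_on hcd.le (ii (by fun_prop)) (ii (by fun_prop))
        fun y hy => h2 x hx y hy
    have h5 : ∫ y in c..d, (f x - f y) ^ 2 = (d - c) * f x ^ 2 - 2 * A * f x + B := by
      have : ∀ y, (f x - f y) ^ 2 = f x ^ 2 - 2 * f x * f y + f y ^ 2 := fun y => by ring
      simp only [this]
      rw [intervalIntegral.integral_add (ii (by fun_prop)) (ii (by fun_prop)),
        intervalIntegral.integral_sub (ii (by fun_prop)) (ii (by fun_prop)),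
        intervalIntegral.integral_const_mul, intervalIntegral.integral_const]
      simp only [smul_eq_mul, ← hA, ← hB]
      ring
    rw [h5] at h4
    simpa using h4
  have h4 : ∫ x in c..d, ((d - c) * f x ^ 2 - 2 * A * f x + B) ≤
      ∫ x in c..d, (d - c) * ((d - c) * K) :=
    intervalIntegral.integral_mono_on hcd.le (ii (by fun_prop)) (ii (by fun_prop)) h3
  rw [intervalIntegral.integral_add (ii (by fun_prop)) (ii (by fun_prop)),
    intervalIntegral.integral_sub (ii (by fun_prop)) (ii (by fun_prop)),
    intervalIntegral.integral_const_mul, intervalIntegral.integral_const_mul,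
    intervalIntegral.integral_const, intervalIntegral.integral_const] at h4
  simp only [smul_eq_mul, ← hA, ← hB] at h4
  have hl : 0 < d - c := sub_pos.2 hcd
  have h5 : (d - c) * (2 * B) ≤ (d - c) * ((d - c) ^ 2 * K + 2 * ((d - c)⁻¹ * A ^ 2)) := by
    have : (d - c) * (2 * ((d - c)⁻¹ * A ^ 2)) = 2 * A ^ 2 := by field_simp
    rw [mul_add, this]
    nlinarith
  have h6 := le_of_mul_le_mul_left h5 hl
  have h7 : 0 ≤ (d - c) ^ 2 * K := by positivity
  linarith

/-- The first two eigenvalues of the Dirichlet Laplacian on `(0, L)` are `(π / L) ^ 2` and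
`4 (π / L) ^ 2`, the first eigenfunction being a sine. This is Parseval's identity for the Fourier series
of the odd extension. -/
theorem dirichlet_gap {f : ℝ → ℝ} (hf : ContDiff ℝ 1 f) {L : ℝ} (hL : 0 < L)
    (h0 : ∀ y, y ∉ Set.Ioo 0 L → f y = 0) :
    4 * (Real.pi / L) ^ 2 * (∫ y in (0 : ℝ)..L, f y ^ 2) -
      3 * (Real.pi / L) ^ 2 * (2 / L * (∫ y in (0 : ℝ)..L, f y * Real.sin (Real.pi * y / L)) ^ 2) ≤
      ∫ y in (0 : ℝ)..L, deriv f y ^ 2 := by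
  have hfc : Continuous f := hf.continuous
  have hf' : Continuous (deriv f) := hf.continuous_deriv le_rfl
  have hfd : ∀ y, HasDerivAt f (deriv f y) y := fun y =>
    (hf.differentiable one_ne_zero y).hasDerivAt
  have hd0 : ∀ y ≤ 0, deriv f y = 0 := by
    have h1 : ∀ y < 0, deriv f y = 0 := by
      intro y hy
      have : f =ᶠ[𝓝 y] fun _ => 0 := by
        filter_upwards [Iio_mem_nhds hy] with z hz
        exact h0 z fun h => absurd h.1 (not_lt.2 (le_of_lt hz))
      rw [this.deriv_eq]; simp
    have h2 : closure (Set.Iio (0 : ℝ)) ⊆ {y | deriv f y = 0} :=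
      closure_minimal h1 (isClosed_eq hf' continuous_const)
    intro y hy
    exact h2 (by rw [closure_Iio]; exact hy)
  have hf0 : ∀ y ≤ 0, f y = 0 := fun y hy => h0 y fun h => absurd h.1 (not_lt.2 hy)
  have hab : -L < L := by linarith
  let F : ℝ → ℂ := fun y => ((f y - f (-y) : ℝ) : ℂ)
  let F' : ℝ → ℂ := fun y => ((deriv f y + deriv f (-y) : ℝ) : ℂ)
  have hF : Continuous F := by fun_prop
  have hF' : Continuous F' := by fun_prop
  have hFd : ∀ y, HasDerivAt F (F' y) y := by
    intro y
    have h1 : HasDerivAt (fun y => f (-y)) (-deriv f (-y)) y := by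
      have h2 : HasDerivAt (fun y => f (-y)) (deriv f (-y) * -1) y :=
        (hfd (-y)).comp y (hasDerivAt_neg y)
      simpa using h2
    have h2 := ((hfd y).sub h1).ofReal_comp
    simpa [F, F'] using h2
  have memF : ∀ {G : ℝ → ℂ}, Continuous G → MemLp G 2 (volume.restrict (Set.Ioc (-L) L)) := by
    exact fun hG => memLp_Ioc_of_continuousOn hG.continuousOn
  -- integrals over the symmetric interval of functions carried by the positive half
  have half : ∀ g : ℝ → ℝ, Continuous g → (∀ y ≤ 0, g y = 0) →
      ∫ y in -L..L, g y = ∫ y in (0 : ℝ)..L, g y := by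
    intro g hg hg0
    rw [← intervalIntegral.integral_add_adjacent_intervals (hg.intervalIntegrable (-L) 0)
      (hg.intervalIntegrable 0 L), intervalIntegral.integral_congr (g := fun _ => 0)]
    · simp
    · intro y hy
      rw [Set.uIcc_of_le (by linarith)] at hy
      exact hg0 y hy.2
  have refl : ∀ g : ℝ → ℝ, ∫ y in -L..L, g (-y) = ∫ y in -L..L, g y := by
    intro g
    rw [intervalIntegral.integral_comp_neg, neg_neg]
  have sqF : ∫ y in -L..L, ‖F y‖ ^ 2 = 2 * ∫ y in (0 : ℝ)..L, f y ^ 2 := by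
    have h1 : ∀ y, ‖F y‖ ^ 2 = f y ^ 2 + f (-y) ^ 2 := by
      intro y
      have h2 : f y * f (-y) = 0 := by
        rcases le_total y 0 with h | h
        · rw [hf0 y h, zero_mul]
        · rw [hf0 (-y) (by linarith), mul_zero]
      rw [Complex.norm_real, Real.norm_eq_abs, sq_abs]
      linear_combination -2 * h2
    simp only [h1]
    rw [intervalIntegral.integral_add (Continuous.intervalIntegrable (by fun_prop) _ _)
      (Continuous.intervalIntegrable (by fun_prop) _ _), refl (fun y => f y ^ 2),
      half (fun y => f y ^ 2) (by fun_prop) (fun y hy => by simp [hf0 y hy])]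
    ring
  have sqF' : ∫ y in -L..L, ‖F' y‖ ^ 2 = 2 * ∫ y in (0 : ℝ)..L, deriv f y ^ 2 := by
    have h1 : ∀ y, ‖F' y‖ ^ 2 = deriv f y ^ 2 + deriv f (-y) ^ 2 := by
      intro y
      have h2 : deriv f y * deriv f (-y) = 0 := by
        rcases le_total y 0 with h | h
        · rw [hd0 y h, zero_mul]
        · rw [hd0 (-y) (by linarith), mul_zero]
      rw [Complex.norm_real, Real.norm_eq_abs, sq_abs]
      linear_combination 2 * h2
    simp only [h1]
    rw [intervalIntegral.integral_add (Continuous.intervalIntegrable (by fun_prop) _ _)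
      (Continuous.intervalIntegrable (by fun_prop) _ _), refl (fun y => deriv f y ^ 2),
      half (fun y => deriv f y ^ 2) (by fun_prop) (fun y hy => by simp [hd0 y hy])]
    ring
  have hs := hasSum_sq_fourierCoeffOn hab (memF hF)
  have hs' := hasSum_sq_fourierCoeffOn hab (memF hF')
  rw [sqF] at hs
  rw [sqF'] at hs'
  have hLL : L - -L = 2 * L := by ring
  rw [hLL] at hs hs'
  -- the coefficients of the derivative
  have hcoef : ∀ n : ℤ, ‖fourierCoeffOn hab F' n‖ ^ 2 ≥
      (Real.pi / L) ^ 2 * n ^ 2 * ‖fourierCoeffOn hab F n‖ ^ 2 := by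
    intro n
    by_cases hn : n = 0
    · subst hn; simp
    have h1 := fourierCoeffOn_of_hasDerivAt hab hn (fun y _ => hFd y)
      (hF'.intervalIntegrable _ _)
    have h2 : F L - F (-L) = 0 := by
      have e1 : f L = 0 := h0 L fun h => lt_irrefl _ h.2
      have e2 : f (-L) = 0 := hf0 _ (by linarith)
      simp [F, e1, e2]
    rw [h2] at h1
    have hn' : (n : ℝ) ≠ 0 := by exact_mod_cast hn
    have hpi := Real.pi_pos
    have h3 : ‖fourierCoeffOn hab F n‖ = L / (Real.pi * |(n : ℝ)|) * ‖fourierCoeffOn hab F' n‖ := by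
      rw [h1]
      simp only [mul_zero, zero_sub, norm_mul, norm_neg, norm_div, norm_one]
      have e1 : ‖(L : ℂ) - ((-L : ℝ) : ℂ)‖ = 2 * L := by
        rw [← Complex.ofReal_sub, Complex.norm_real, hLL, Real.norm_of_nonneg (by linarith)]
      rw [e1]
      simp only [Complex.norm_I, Complex.norm_real, Complex.norm_intCast, Complex.norm_ofNat,
        Real.norm_of_nonneg hpi.le]
      field_simp
    rw [h3]
    refine le_of_eq ?_
    have h4 : |(n : ℝ)| ≠ 0 := abs_ne_zero.2 hn'
    rw [← sq_abs (n : ℝ)]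
    field_simp
  -- the coefficients of index 0 and ±1
  have hc0 : fourierCoeffOn hab F 0 = 0 := by
    rw [fourierCoeffOn_eq_integral]
    have h1 : ∫ y in -L..L, F y = 0 := by
      have h2 : ∫ y in -L..L, F y = ((∫ y in -L..L, (f y - f (-y)) : ℝ) : ℂ) :=
        intervalIntegral.integral_ofReal
      rw [h2, intervalIntegral.integral_sub (hfc.intervalIntegrable _ _)
        (Continuous.intervalIntegrable (by fun_prop) _ _), refl f, sub_self, Complex.ofReal_zero]
    simp [h1]
  set A := ∫ y in (0 : ℝ)..L, f y * Real.sin (Real.pi * y / L) with hA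
  have hc1 : ∀ n : ℤ, (n = 1 ∨ n = -1) → ‖fourierCoeffOn hab F n‖ ^ 2 = (A / L) ^ 2 := by
    intro n hn
    have hnR : ((n : ℝ)) ^ 2 = 1 := by rcases hn with rfl | rfl <;> norm_num
    have hsin : ∀ t : ℝ, Real.sin (n * t) = n * Real.sin t := by
      intro t; rcases hn with rfl | rfl <;> simp
    have hcos : ∀ t : ℝ, Real.cos (n * t) = Real.cos t := by
      intro t; rcases hn with rfl | rfl <;> simp
    have h1 : ∀ y : ℝ, (fourier (-n) (y : AddCircle (L - -L)) : ℂ) • F y =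
        (((f y - f (-y)) * Real.cos (Real.pi * y / L) : ℝ) : ℂ) -
        ((n * ((f y - f (-y)) * Real.sin (Real.pi * y / L)) : ℝ) : ℂ) * Complex.I := by
      intro y
      rw [fourier_coe_apply]
      have e1 : (2 * Real.pi * Complex.I * (-n : ℤ) * y / (L - -L : ℝ) : ℂ) =
          ((-(n * (Real.pi * y / L)) : ℝ) : ℂ) * Complex.I := by
        rw [hLL]
        push_cast
        have : (L : ℂ) ≠ 0 := by exact_mod_cast hL.ne'
        field_simp
      rw [e1, Complex.exp_mul_I, ← Complex.ofReal_cos, ← Complex.ofReal_sin, Real.cos_neg,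
        Real.sin_neg, hsin, hcos]
      simp only [F, smul_eq_mul]
      push_cast
      ring
    have e2 : ∫ y in -L..L, (f y - f (-y)) * Real.cos (Real.pi * y / L) = 0 := by
      have h2 := refl fun y => (f y - f (-y)) * Real.cos (Real.pi * y / L)
      have h3 : ∀ y, (f (-y) - f (- -y)) * Real.cos (Real.pi * (-y) / L) =
          -((f y - f (-y)) * Real.cos (Real.pi * y / L)) := by
        intro y
        rw [neg_neg, mul_neg, neg_div, Real.cos_neg]; ring
      simp only [h3, intervalIntegral.integral_neg] at h2
      linarith
    have e3 : ∫ y in -L..L, (f y - f (-y)) * Real.sin (Real.pi * y / L) = 2 * A := by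
      have h2 : ∀ y, (f y - f (-y)) * Real.sin (Real.pi * y / L) =
          f y * Real.sin (Real.pi * y / L) + f (-y) * Real.sin (Real.pi * (-y) / L) := by
        intro y
        rw [mul_neg, neg_div, Real.sin_neg]; ring
      simp only [h2]
      rw [intervalIntegral.integral_add (Continuous.intervalIntegrable (by fun_prop) _ _)
        (Continuous.intervalIntegrable (by fun_prop) _ _),
        refl (fun y => f y * Real.sin (Real.pi * y / L)),
        half (fun y => f y * Real.sin (Real.pi * y / L)) (by fun_prop)
          (fun y hy => by simp [hf0 y hy])]
      ring
    rw [fourierCoeffOn_eq_integral]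
    simp only [h1]
    rw [intervalIntegral.integral_sub (Continuous.intervalIntegrable (by fun_prop) _ _)
      (Continuous.intervalIntegrable (by fun_prop) _ _), intervalIntegral.integral_mul_const,
      intervalIntegral.integral_ofReal, intervalIntegral.integral_ofReal, e2,
      intervalIntegral.integral_const_mul, e3, hLL]
    simp only [Complex.ofReal_zero, zero_sub, norm_smul, norm_neg, norm_mul, Complex.norm_I,
      Complex.norm_real, mul_one, mul_pow]
    simp only [Real.norm_eq_abs, sq_abs, ← mul_pow]
    have := hL.ne'
    field_simp
    rw [hnR]; ring
  set c : ℤ → ℝ := fun n => ‖fourierCoeffOn hab F n‖ ^ 2 with hc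
  have hsum1 : HasSum (fun n : ℤ => (Real.pi / L) ^ 2 * (4 * c n -
      ((if n = 1 then 3 * (A / L) ^ 2 else 0) + (if n = -1 then 3 * (A / L) ^ 2 else 0))))
      ((Real.pi / L) ^ 2 * (4 * ((2 * L)⁻¹ • (2 * ∫ y in (0 : ℝ)..L, f y ^ 2)) -
        (3 * (A / L) ^ 2 + 3 * (A / L) ^ 2))) :=
    ((hs.mul_left 4).sub ((hasSum_ite_eq 1 _).add (hasSum_ite_eq (-1) _))).mul_left _
  have hle := hasSum_le (fun n : ℤ => ?_) hsum1 hs'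
  · simp only [smul_eq_mul] at hle
    have h1 : (2 * L) * ((Real.pi / L) ^ 2 * (4 * ((2 * L)⁻¹ * (2 * ∫ y in (0 : ℝ)..L, f y ^ 2)) -
        (3 * (A / L) ^ 2 + 3 * (A / L) ^ 2))) ≤
        (2 * L) * ((2 * L)⁻¹ * (2 * ∫ y in (0 : ℝ)..L, deriv f y ^ 2)) :=
      mul_le_mul_of_nonneg_left hle (by positivity)
    have hL' := hL.ne'
    have h2 : (2 * L) * ((2 * L)⁻¹ * (2 * ∫ y in (0 : ℝ)..L, deriv f y ^ 2)) =
        2 * ∫ y in (0 : ℝ)..L, deriv f y ^ 2 := by field_simp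
    have h3 : (2 * L) * ((Real.pi / L) ^ 2 * (4 * ((2 * L)⁻¹ * (2 * ∫ y in (0 : ℝ)..L, f y ^ 2)) -
        (3 * (A / L) ^ 2 + 3 * (A / L) ^ 2))) =
        2 * (4 * (Real.pi / L) ^ 2 * (∫ y in (0 : ℝ)..L, f y ^ 2) -
        3 * (Real.pi / L) ^ 2 * (2 / L * A ^ 2)) := by
      field_simp
      ring
    rw [h2, h3] at h1
    linarith
  · refine le_trans ?_ (hcoef n)
    rw [mul_assoc]
    refine mul_le_mul_of_nonneg_left ?_ (by positivity)
    change _ ≤ (n : ℝ) ^ 2 * c n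
    have hcn : 0 ≤ c n := by positivity
    by_cases h1 : n = 1
    · have h2 : c n = (A / L) ^ 2 := hc1 n (Or.inl h1)
      subst h1
      norm_num
      rw [h2]; ring_nf; rfl
    by_cases h2 : n = -1
    · have h3 : c n = (A / L) ^ 2 := hc1 n (Or.inr h2)
      subst h2
      norm_num
      rw [h3]; ring_nf; rfl
    rw [if_neg h1, if_neg h2]
    by_cases h3 : n = 0
    · have : c n = 0 := by rw [h3]; simp [hc, hc0]
      rw [this]; simp
    have h4 : (2 : ℤ) ≤ |n| := by
      rcases le_total 0 n with h | h
      · rw [abs_of_nonneg h]; omega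
      · rw [abs_of_nonpos h]; omega
    have h5 : (4 : ℝ) ≤ (n : ℝ) ^ 2 := by
      have : (2 : ℝ) ≤ |(n : ℝ)| := by exact_mod_cast h4
      rw [← sq_abs]; nlinarith
    nlinarith

end Interval

/-! ### Weak derivatives on the line -/

section WeakDerivative

theorem exists_forall_le_abs_eq_zero {f : ℝ → ℝ} (hf : HasCompactSupport f) :
    ∃ R : ℝ, 0 < R ∧ ∀ x, R ≤ |x| → f x = 0 := by
  obtain ⟨R, hR⟩ := hf.isCompact.isBounded.subset_closedBall 0
  refine ⟨max R 0 + 1, by positivity, fun x hx => image_eq_zero_of_notMem_tsupport fun h => ?_⟩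
  have h1 := hR h
  rw [Metric.mem_closedBall, Real.dist_eq, sub_zero] at h1
  have := le_max_left R 0
  linarith

theorem integral_eq_intervalIntegral {f : ℝ → ℝ} {R : ℝ} (hf : ∀ x, R ≤ |x| → f x = 0) :
    ∫ x, f x = ∫ x in -R..R, f x := by
  refine (intervalIntegral.integral_eq_integral_of_support_subset fun x hx => ?_).symm
  have h1 : |x| < R := by
    by_contra h
    exact hx (hf x (not_lt.1 h))
  rw [abs_lt] at h1
  exact ⟨h1.1, h1.2.le⟩

theorem integral_eq_intervalIntegral_of_Ioo {f : ℝ → ℝ} {a b : ℝ} (hf : ∀ x ∉ Set.Ioo a b, f x = 0) :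
    ∫ x, f x = ∫ x in a..b, f x :=
  (intervalIntegral.integral_eq_integral_of_support_subset fun x hx => by
    by_contra hcon
    exact hx (hf x fun h1 => hcon ⟨h1.1, h1.2.le⟩)).symm

theorem hasCompactSupport_of_forall_le_abs {f : ℝ → ℝ} {R : ℝ} (hf : ∀ x, R ≤ |x| → f x = 0) :
    HasCompactSupport f := by
  refine HasCompactSupport.intro (isCompact_Icc (a := -R) (b := R)) fun x hx => hf x ?_
  by_contra h
  have := abs_lt.1 (not_le.1 h)
  exact hx ⟨this.1.le, this.2.le⟩

/-- A compactly supported smooth function of zero mean is the derivative of one. -/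
theorem exists_contDiff_deriv_eq {f : ℝ → ℝ} (hf : ContDiff ℝ ∞ f) (hc : HasCompactSupport f)
    (h0 : ∫ x, f x = 0) :
    ∃ g : ℝ → ℝ, ContDiff ℝ ∞ g ∧ HasCompactSupport g ∧ deriv g = f := by
  obtain ⟨R, hR, hR0⟩ := exists_forall_le_abs_eq_zero hc
  have hfc := hf.continuous
  have hd : ∀ x, HasDerivAt (fun x => ∫ t in -R..x, f t) (f x) x := fun x =>
    intervalIntegral.integral_hasDerivAt_right (hfc.intervalIntegrable _ _)
      hfc.stronglyMeasurable.stronglyMeasurableAtFilter hfc.continuousAt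
  have hd' : deriv (fun x => ∫ t in -R..x, f t) = f := funext fun x => (hd x).deriv
  refine ⟨fun x => ∫ t in -R..x, f t, ?_, ?_, hd'⟩
  · rw [contDiff_infty_iff_deriv, hd']
    exact ⟨fun x => (hd x).differentiableAt, hf⟩
  · refine hasCompactSupport_of_forall_le_abs (R := R) fun x hx => ?_
    rcases le_abs'.1 hx with h | h
    · rw [intervalIntegral.integral_congr (g := fun _ => 0)]
      · simp
      · intro t ht
        rw [Set.uIcc_of_ge h] at ht
        exact hR0 t (by rw [abs_of_nonpos (by linarith [ht.2])]; linarith [ht.2])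
    · rw [← intervalIntegral.integral_add_adjacent_intervals (b := R)
        (hfc.intervalIntegrable _ _) (hfc.intervalIntegrable _ _),
        ← integral_eq_intervalIntegral hR0, h0, zero_add,
        intervalIntegral.integral_congr (g := fun _ => 0)]
      · simp
      · intro t ht
        rw [Set.uIcc_of_le h] at ht
        exact hR0 t (le_abs.2 (Or.inl ht.1))

/-- The du Bois-Reymond lemma: a function with a weak derivative is a primitive of it. -/
theorem ae_eq_integral_of_weak_deriv {F G : ℝ → ℝ} (hF : LocallyIntegrable F)
    (hG : LocallyIntegrable G)
    (h : ∀ φ : ℝ → ℝ, ContDiff ℝ ∞ φ → HasCompactSupport φ →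
      ∫ x, F x * deriv φ x = -∫ x, G x * φ x) :
    ∃ c : ℝ, F =ᵐ[volume] fun x => c + ∫ t in (0 : ℝ)..x, G t := by
  have hGi : ∀ a b, IntervalIntegrable G volume a b := fun a b =>
    (hG.integrableOn_isCompact isCompact_uIcc).intervalIntegrable
  set P : ℝ → ℝ := fun x => ∫ t in (0 : ℝ)..x, G t with hP
  have hPc : Continuous P := intervalIntegral.continuous_primitive hGi 0
  have hPparts : ∀ φ : ℝ → ℝ, ContDiff ℝ ∞ φ → HasCompactSupport φ →
      ∫ x, P x * deriv φ x = -∫ x, G x * φ x := by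
    intro φ hφ hφc
    obtain ⟨R, hR, hR0⟩ := exists_forall_le_abs_eq_zero hφc
    obtain ⟨R', hR', hR0'⟩ := exists_forall_le_abs_eq_zero hφc.deriv
    set S := max R R'
    have hS : 0 < S := lt_max_of_lt_left hR
    have h1 : ∀ x, S ≤ |x| → φ x = 0 := fun x hx => hR0 x ((le_max_left _ _).trans hx)
    have h2 : ∀ x, S ≤ |x| → deriv φ x = 0 := fun x hx => hR0' x ((le_max_right _ _).trans hx)
    rw [integral_eq_intervalIntegral (R := S) fun x hx => by rw [h2 x hx, mul_zero],
      integral_eq_intervalIntegral (R := S) fun x hx => by rw [h1 x hx, mul_zero]]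
    have hPac : AbsolutelyContinuousOnInterval P (-S) S :=
      (hGi _ _).absolutelyContinuousOnInterval_intervalIntegral
        (by rw [Set.uIcc_of_le (by linarith)]; exact ⟨by linarith, hS.le⟩)
    have hφac : AbsolutelyContinuousOnInterval φ (-S) S :=
      ((hφ.of_le (by exact_mod_cast le_top : (1 : WithTop ℕ∞) ≤ ∞)).contDiffOn).absolutelyContinuousOnInterval
    rw [hPac.integral_mul_deriv_eq_deriv_mul hφac, h1 S (le_abs_self S),
      h1 (-S) (by rw [abs_neg]; exact le_abs_self S), mul_zero, mul_zero, sub_zero, zero_sub]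
    congr 1
    refine intervalIntegral.integral_congr_ae ?_
    filter_upwards [LocallyIntegrable.ae_hasDerivAt_integral hG] with x hx _
    rw [(hx 0).deriv]
  have hFP : LocallyIntegrable fun x => F x - P x := hF.sub hPc.locallyIntegrable
  have hint : ∀ {K : ℝ → ℝ}, LocallyIntegrable K → ∀ φ : ℝ → ℝ, Continuous φ →
      HasCompactSupport φ → Integrable fun x => K x * φ x := by
    intro K hK φ hφ hφc
    have := hK.integrable_smul_left_of_hasCompactSupport hφ hφc
    simpa [mul_comm] using this
  have hD : ∀ φ : ℝ → ℝ, ContDiff ℝ ∞ φ → HasCompactSupport φ →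
      ∫ x, (F x - P x) * deriv φ x = 0 := by
    intro φ hφ hφc
    have hφ' : Continuous (deriv φ) := hφ.continuous_deriv (by exact_mod_cast le_top)
    simp only [sub_mul]
    rw [integral_sub (hint hF _ hφ' hφc.deriv) (hint hPc.locallyIntegrable _ hφ' hφc.deriv),
      h φ hφ hφc, hPparts φ hφ hφc, sub_self]
  let b : ContDiffBump (0 : ℝ) := ⟨1, 2, one_pos, one_lt_two⟩
  set ρ : ℝ → ℝ := b.normed volume with hρ
  have hρs : ContDiff ℝ ∞ ρ := b.contDiff_normed
  have hρc : HasCompactSupport ρ := b.hasCompactSupport_normed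
  have hρ1 : ∫ x, ρ x = 1 := b.integral_normed
  refine ⟨∫ x, (F x - P x) * ρ x, ?_⟩
  set c := ∫ x, (F x - P x) * ρ x with hc
  have h0 := ae_eq_of_integral_contDiff_smul_eq (μ := (volume : Measure ℝ)) hFP
    (f' := fun _ => c) continuous_const.locallyIntegrable (by
      intro g hg hgc
      set I := ∫ x, g x with hI
      have hgi : Integrable g := hg.continuous.integrable_of_hasCompactSupport hgc
      have hρi : Integrable ρ := hρs.continuous.integrable_of_hasCompactSupport hρc
      obtain ⟨θ, hθ, hθc, hθd⟩ := exists_contDiff_deriv_eq (f := fun x => g x - I * ρ x)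
        (hg.sub (contDiff_const.mul hρs)) (hgc.sub hρc.mul_left) (by
          rw [integral_sub hgi (hρi.const_mul _), integral_const_mul, hρ1, mul_one, sub_self])
      have h1 := hD θ hθ hθc
      rw [hθd] at h1
      have h2 : ∀ x, (F x - P x) * (g x - I * ρ x) =
          (F x - P x) * g x - I * ((F x - P x) * ρ x) := fun x => by ring
      simp only [h2] at h1
      rw [integral_sub (hint hFP _ hg.continuous hgc)
        ((hint hFP _ hρs.continuous hρc).const_mul _), integral_const_mul, ← hc] at h1
      simp only [smul_eq_mul]
      rw [integral_mul_const, ← hI]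
      have h3 : ∫ x, g x * (F x - P x) = ∫ x, (F x - P x) * g x := by simp only [mul_comm]
      rw [h3]
      linarith)
  filter_upwards [h0] with x hx
  rw [← hx]; ring

/-- The Poincaré inequality on the cells of a uniform partition. -/
theorem integral_sq_le_sum_cells {f : ℝ → ℝ} (hf : ContDiff ℝ 1 f) {c l : ℝ} (hl : 0 < l) (n : ℕ) :
    ∫ x in c..(c + n * l), f x ^ 2 ≤
      l ^ 2 * (∫ x in c..(c + n * l), deriv f x ^ 2) +
        ∑ k : Fin n, l⁻¹ * (∫ x in (c + (k : ℕ) * l)..(c + ((k : ℕ) + 1 : ℕ) * l), f x) ^ 2 := by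
  have hfc := hf.continuous
  have hf' : Continuous (deriv f) := hf.continuous_deriv le_rfl
  have h1 := intervalIntegral.sum_integral_adjacent_intervals (μ := volume) (f := fun x => f x ^ 2)
    (a := fun k : ℕ => c + k * l) (n := n) fun k _ => (hfc.pow 2).intervalIntegrable _ _
  have h2 := intervalIntegral.sum_integral_adjacent_intervals (μ := volume)
    (f := fun x => deriv f x ^ 2)
    (a := fun k : ℕ => c + k * l) (n := n) fun k _ => (hf'.pow 2).intervalIntegrable _ _
  simp only [Nat.cast_zero, zero_mul, add_zero] at h1 h2
  rw [← h1, ← h2, Finset.mul_sum, Fin.sum_univ_eq_sum_range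
    (fun k => l⁻¹ * (∫ x in (c + k * l)..(c + (k + 1 : ℕ) * l), f x) ^ 2), ← Finset.sum_add_distrib]
  refine Finset.sum_le_sum fun k _ => ?_
  have h3 : c + (k + 1 : ℕ) * l - (c + k * l) = l := by push_cast; ring
  have h4 := integral_sq_le_of_contDiff hf (c := c + k * l) (d := c + (k + 1 : ℕ) * l)
    (by linarith)
  rwa [h3] at h4

end WeakDerivative

/-! ### Square integrable solutions of `X'' = (q - ν) X` -/

section Ode

variable {q X Y : ℝ → ℝ} {ν : ℝ}

/-- Uniqueness for the equation `X'' = (q - ν) X`, with `Y = X'`. -/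
theorem solution_eq_zero (hq : Continuous q) (hX : ∀ x, HasDerivAt X (Y x) x)
    (hY : ∀ x, HasDerivAt Y ((q x - ν) * X x) x) {x₀ : ℝ} (h0 : X x₀ = 0) (h1 : Y x₀ = 0) (x : ℝ) :
    X x = 0 := by
  obtain ⟨C, hC⟩ := (isCompact_Icc (a := min x x₀ - 1) (b := max x x₀ + 1)).exists_bound_of_continuousOn
    (hq.sub continuous_const : Continuous fun t => q t - ν).continuousOn
  have hx₀ : x₀ ∈ Set.Ioo (min x x₀ - 1) (max x x₀ + 1) :=
    ⟨by linarith [min_le_right x x₀], by linarith [le_max_right x x₀]⟩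
  have hx : x ∈ Set.Icc (min x x₀ - 1) (max x x₀ + 1) :=
    ⟨by linarith [min_le_left x x₀], by linarith [le_max_left x x₀]⟩
  have hXY : ∀ t, HasDerivAt (fun t => (X t, Y t)) (Y t, (q t - ν) * X t) t :=
    fun t => (hX t).prodMk (hY t)
  have key := ODE_solution_unique_of_mem_Icc (K := Real.toNNReal (max 1 C)) (t₀ := x₀)
    (v := fun t (z : ℝ × ℝ) => (z.2, (q t - ν) * z.1)) (s := fun _ => Set.univ)
    (f := fun t => (X t, Y t)) (g := fun _ => 0) (a := min x x₀ - 1) (b := max x x₀ + 1) (by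
      intro t ht
      refine (LipschitzWith.of_dist_le_mul fun z w => ?_).lipschitzOnWith
      rw [Real.coe_toNNReal _ (le_max_of_le_left zero_le_one), Prod.dist_eq, Prod.dist_eq]
      have h2 := hC t ⟨ht.1.le, ht.2.le⟩
      have h3 : 0 ≤ max (dist z.1 w.1) (dist z.2 w.2) := le_max_of_le_left dist_nonneg
      refine max_le ?_ ?_
      · calc dist z.2 w.2 ≤ 1 * max (dist z.1 w.1) (dist z.2 w.2) := by
              rw [one_mul]; exact le_max_right _ _
          _ ≤ _ := by gcongr; exact le_max_left _ _
      · rw [Real.dist_eq, ← mul_sub, abs_mul]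
        rw [Real.norm_eq_abs] at h2
        have h4 : |z.1 - w.1| ≤ max (dist z.1 w.1) (dist z.2 w.2) := le_max_left _ _
        have h5 : |q t - ν| ≤ max 1 C := h2.trans (le_max_right _ _)
        gcongr)
    hx₀ (fun t _ => (hXY t).continuousAt.continuousWithinAt) (fun t _ => hXY t)
    (fun _ _ => trivial) continuousOn_const
    (fun t _ =>
      (hasDerivAt_const t (0 : ℝ × ℝ)).congr_deriv (by ext <;> simp)) (fun _ _ => trivial)
    (by simp [h0, h1])
  have := key hx
  exact congrArg Prod.fst this

theorem eq_zero_of_monotoneOn_sq {c : ℝ} (hm : MonotoneOn (fun x => X x ^ 2) (Set.Ici c))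
    (hi : Integrable fun x => X x ^ 2) : ∀ x, c ≤ x → X x = 0 := by
  intro x hx
  by_contra h
  have hpos : 0 < X x ^ 2 := by positivity
  have h1 := hi.measure_ge_lt_top hpos
  have h2 : Set.Ici x ⊆ {y | X x ^ 2 ≤ X y ^ 2} := fun y hy => hm hx (hx.trans hy) hy
  have h3 := (measure_mono h2).trans_lt h1
  simp at h3

/-- Far out the equation `X'' = (q - ν) X` has no oscillation: a square integrable solution with a zero
there is trivial. -/
theorem solution_eq_zero_of_zero (hq : Continuous q) (hX : ∀ x, HasDerivAt X (Y x) x)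
    (hY : ∀ x, HasDerivAt Y ((q x - ν) * X x) x) (hi : Integrable fun x => X x ^ 2) {x₀ : ℝ}
    (hle : ∀ x, x₀ ≤ x → ν ≤ q x) (h0 : X x₀ = 0) (x : ℝ) : X x = 0 := by
  have hd : ∀ x, HasDerivAt (fun x => X x * Y x) (Y x * Y x + X x * ((q x - ν) * X x)) x :=
    fun x => (hX x).mul (hY x)
  have hm : MonotoneOn (fun x => X x * Y x) (Set.Ici x₀) := by
    refine monotoneOn_of_hasDerivWithinAt_nonneg (convex_Ici x₀)
      (fun x _ => (hd x).continuousAt.continuousWithinAt) (fun x _ => (hd x).hasDerivWithinAt) ?_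
    intro x hx
    rw [interior_Ici] at hx
    have := hle x (le_of_lt hx)
    have h1 : 0 ≤ (q x - ν) * X x ^ 2 := mul_nonneg (by linarith) (sq_nonneg _)
    nlinarith [sq_nonneg (Y x)]
  have hd2 : ∀ x, HasDerivAt (fun x => X x ^ 2) (2 * (X x * Y x)) x := fun x => by
    have := (hX x).pow 2
    refine this.congr_deriv ?_
    ring
  have hm2 : MonotoneOn (fun x => X x ^ 2) (Set.Ici x₀) := by
    refine monotoneOn_of_hasDerivWithinAt_nonneg (convex_Ici x₀)
      (fun x _ => (hd2 x).continuousAt.continuousWithinAt) (fun x _ => (hd2 x).hasDerivWithinAt) ?_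
    intro x hx
    rw [interior_Ici] at hx
    have h1 := hm (Set.mem_Ici.2 le_rfl) (Set.mem_Ici.2 (le_of_lt hx)) (le_of_lt hx)
    simp only [h0, zero_mul] at h1
    linarith
  have hz := eq_zero_of_monotoneOn_sq hm2 hi
  refine solution_eq_zero hq hX hY (hz (x₀ + 1) (by linarith)) ?_ x
  have h1 : X =ᶠ[𝓝 (x₀ + 1)] fun _ => 0 := by
    filter_upwards [Ioi_mem_nhds (show x₀ < x₀ + 1 by linarith)] with y hy
    exact hz y (le_of_lt hy)
  rw [← (hX (x₀ + 1)).deriv, h1.deriv_eq]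
  simp

/-- A nontrivial square integrable solution has a constant sign near infinity. -/
theorem eventually_pos_or_neg (hq : Continuous q) (hX : ∀ x, HasDerivAt X (Y x) x)
    (hY : ∀ x, HasDerivAt Y ((q x - ν) * X x) x) (hi : Integrable fun x => X x ^ 2)
    (hle : ∀ᶠ x in atTop, ν ≤ q x) (hne : ∃ x, X x ≠ 0) :
    (∀ᶠ x in atTop, 0 < X x) ∨ ∀ᶠ x in atTop, X x < 0 := by
  obtain ⟨R, hR⟩ := eventually_atTop.1 hle
  have hz : ∀ x, R ≤ x → X x ≠ 0 := by
    intro x hx h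
    obtain ⟨y, hy⟩ := hne
    exact hy (solution_eq_zero_of_zero hq hX hY hi (fun z hz => hR z (hx.trans hz)) h y)
  have hc : ContinuousOn X (Set.Ici R) := fun x _ => (hX x).continuousAt.continuousWithinAt
  rcases lt_or_gt_of_ne (hz R le_rfl) with h | h
  · right
    filter_upwards [eventually_ge_atTop R] with x hx
    by_contra h1
    obtain ⟨y, hy, hy0⟩ := intermediate_value_Icc hx (hc.mono Set.Icc_subset_Ici_self)
      (⟨h.le, not_lt.1 h1⟩ : (0 : ℝ) ∈ Set.Icc (X R) (X x))
    exact hz y hy.1 hy0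
  · left
    filter_upwards [eventually_ge_atTop R] with x hx
    by_contra h1
    obtain ⟨y, hy, hy0⟩ := intermediate_value_Icc' hx (hc.mono Set.Icc_subset_Ici_self)
      (⟨not_lt.1 h1, h.le⟩ : (0 : ℝ) ∈ Set.Icc (X x) (X R))
    exact hz y hy.1 hy0

/-- If the energy of a square integrable solution on `(0, b)` were unbounded, then `(X ^ 2)' = 2 X Y`
would be positive far out, and `X ^ 2` could not be integrable. -/
theorem integrableOn_energy (hq : Continuous q) (hq0 : ∀ x, 0 ≤ q x)
    (hX : ∀ x, HasDerivAt X (Y x) x)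
    (hY : ∀ x, HasDerivAt Y ((q x - ν) * X x) x) (hi : Integrable fun x => X x ^ 2) :
    IntegrableOn (fun x => Y x ^ 2 + q x * X x ^ 2) (Set.Ioi 0) := by
  have hXc : Continuous X := continuous_iff_continuousAt.2 fun x => (hX x).continuousAt
  have hYc : Continuous Y := continuous_iff_continuousAt.2 fun x => (hY x).continuousAt
  have hfc : Continuous fun x => Y x ^ 2 + q x * X x ^ 2 := by fun_prop
  have hf0 : ∀ x, 0 ≤ Y x ^ 2 + q x * X x ^ 2 := fun x => by
    have := hq0 x; positivity
  set I : ℝ → ℝ := fun b => ∫ x in (0 : ℝ)..b, (Y x ^ 2 + q x * X x ^ 2) with hI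
  set A := ∫ x, X x ^ 2 with hA
  -- the energy up to `b` differs from `X Y` at `b` by a bounded quantity
  have h1 : ∀ b, 0 ≤ b → I b ≤ X b * Y b - X 0 * Y 0 + |ν| * A := by
    intro b hb
    have hd : ∀ x, HasDerivAt (fun x => X x * Y x) (Y x * Y x + X x * ((q x - ν) * X x)) x :=
      fun x => (hX x).mul (hY x)
    have h2 := intervalIntegral.integral_eq_sub_of_hasDerivAt (a := 0) (b := b) (fun x _ => hd x)
      (Continuous.intervalIntegrable (by fun_prop) _ _)
    have h3 : I b = (∫ x in (0 : ℝ)..b, (Y x * Y x + X x * ((q x - ν) * X x))) +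
        ν * ∫ x in (0 : ℝ)..b, X x ^ 2 := by
      rw [← intervalIntegral.integral_const_mul, ← intervalIntegral.integral_add
        (Continuous.intervalIntegrable (by fun_prop) _ _)
        (Continuous.intervalIntegrable (by fun_prop) _ _)]
      refine intervalIntegral.integral_congr fun x _ => ?_
      ring
    have h4 : ∫ x in (0 : ℝ)..b, X x ^ 2 ≤ A := by
      rw [intervalIntegral.integral_of_le hb]
      exact setIntegral_le_integral hi (Eventually.of_forall fun x => sq_nonneg _)
    have h5 : 0 ≤ ∫ x in (0 : ℝ)..b, X x ^ 2 :=
      intervalIntegral.integral_nonneg hb fun _ _ => sq_nonneg _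
    have h6 : ν * ∫ x in (0 : ℝ)..b, X x ^ 2 ≤ |ν| * A := by
      calc ν * ∫ x in (0 : ℝ)..b, X x ^ 2 ≤ |ν| * ∫ x in (0 : ℝ)..b, X x ^ 2 :=
            mul_le_mul_of_nonneg_right (le_abs_self _) h5
        _ ≤ _ := by gcongr
    rw [h3, h2]
    linarith
  obtain ⟨B, hB⟩ : ∃ B, ∀ b, 0 ≤ b → I b ≤ B := by
    by_contra! hcon
    obtain ⟨b₀, hb₀, hlt⟩ := hcon (-(X 0 * Y 0) + |ν| * A)
    have h2 : ∀ b, b₀ ≤ b → 0 < X b * Y b := by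
      intro b hb
      have h3 : I b₀ ≤ I b := by
        refine intervalIntegral.integral_mono_interval le_rfl hb₀ hb
          (Eventually.of_forall hf0) (hfc.intervalIntegrable _ _)
      have := h1 b (hb₀.trans hb)
      linarith
    have hd2 : ∀ x, HasDerivAt (fun x => X x ^ 2) (2 * (X x * Y x)) x := fun x => by
      have := (hX x).pow 2
      refine this.congr_deriv ?_
      ring
    have hm2 : MonotoneOn (fun x => X x ^ 2) (Set.Ici b₀) := by
      refine monotoneOn_of_hasDerivWithinAt_nonneg (convex_Ici b₀)
        (fun x _ => (hd2 x).continuousAt.continuousWithinAt)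
        (fun x _ => (hd2 x).hasDerivWithinAt) ?_
      intro x hx
      rw [interior_Ici] at hx
      have := h2 x (le_of_lt hx)
      linarith
    have := eq_zero_of_monotoneOn_sq hm2 hi b₀ le_rfl
    have h3 := h2 b₀ le_rfl
    rw [this, zero_mul] at h3
    exact lt_irrefl _ h3
  refine integrableOn_Ioi_of_intervalIntegral_norm_bounded (l := atTop) (b := fun b : ℝ => b) B 0
    (fun b => (hfc.integrableOn_Icc).mono_set Set.Ioc_subset_Icc_self) tendsto_id ?_
  filter_upwards [eventually_ge_atTop 0] with b hb
  refine le_trans (le_of_eq ?_) (hB b hb)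
  refine intervalIntegral.integral_congr fun x _ => ?_
  exact Real.norm_of_nonneg (hf0 x)

/-- A square integrable solution has finite energy. -/
theorem integrable_energy (hq : Continuous q) (hq0 : ∀ x, 0 ≤ q x)
    (hX : ∀ x, HasDerivAt X (Y x) x)
    (hY : ∀ x, HasDerivAt Y ((q x - ν) * X x) x) (hi : Integrable fun x => X x ^ 2) :
    MemLp Y 2 volume ∧ MemLp (fun x => √(q x) * X x) 2 volume := by
  have hXc : Continuous X := continuous_iff_continuousAt.2 fun x => (hX x).continuousAt
  have hYc : Continuous Y := continuous_iff_continuousAt.2 fun x => (hY x).continuousAt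
  have h1 := integrableOn_energy hq hq0 hX hY hi
  have hX' : ∀ x, HasDerivAt (fun x => X (-x)) (-Y (-x)) x := fun x => by
    have : HasDerivAt (fun x => X (-x)) (Y (-x) * -1) x := (hX (-x)).comp x (hasDerivAt_neg x)
    simpa using this
  have hY' : ∀ x, HasDerivAt (fun x => -Y (-x)) ((q (-x) - ν) * X (-x)) x := fun x => by
    have : HasDerivAt (fun x => Y (-x)) ((q (-x) - ν) * X (-x) * -1) x :=
      (hY (-x)).comp x (hasDerivAt_neg x)
    simpa using this.fun_neg
  have h2 := integrableOn_energy (q := fun x => q (-x)) (by fun_prop) (fun x => hq0 _) hX' hY'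
    hi.comp_neg
  have h3 : IntegrableOn (fun x => Y x ^ 2 + q x * X x ^ 2) (Set.Iio 0) := by
    have h4 : (fun x => (-Y (-x)) ^ 2 + q (-x) * X (-x) ^ 2) =
        fun x => (fun x => Y x ^ 2 + q x * X x ^ 2) (-x) := by
      ext x; simp
    rw [h4] at h2
    have h5 := (Measure.measurePreserving_neg (volume : Measure ℝ)).integrableOn_comp_preimage
      (MeasurableEquiv.neg ℝ).measurableEmbedding (s := Set.Iio 0)
      (f := fun x => Y x ^ 2 + q x * X x ^ 2)
    refine h5.1 ?_
    simpa [Function.comp_def] using h2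
  have h5 : Integrable fun x => Y x ^ 2 + q x * X x ^ 2 := by
    rw [← integrableOn_univ, ← Set.Iic_union_Ioi (a := (0 : ℝ))]
    exact (integrableOn_Iic_iff_integrableOn_Iio).2 h3 |>.union h1
  have hs : Continuous fun x => √(q x) * X x := by fun_prop
  constructor
  · rw [memLp_two_iff_integrable_sq hYc.aestronglyMeasurable]
    refine h5.mono' (by fun_prop) (Eventually.of_forall fun x => ?_)
    rw [Real.norm_of_nonneg (sq_nonneg _)]
    have := mul_nonneg (hq0 x) (sq_nonneg (X x))
    linarith
  · rw [memLp_two_iff_integrable_sq hs.aestronglyMeasurable]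
    refine h5.mono' (by fun_prop) (Eventually.of_forall fun x => ?_)
    rw [Real.norm_of_nonneg (sq_nonneg _), mul_pow, Real.sq_sqrt (hq0 x)]
    have := sq_nonneg (Y x)
    linarith

end Ode

/-! ### The spectrum of a Schrödinger operator on the line -/

section Schrodinger

variable {q : ℝ → ℝ}

/-- The triples `(φ, φ', √q φ)` for smooth compactly supported `φ`: the sum of the squares of the last
two norms is the form of `-d²/dx² + q` at `φ`. -/
noncomputable def schrodingerTriples (q : ℝ → ℝ) : Submodule ℝ (Fin 3 → ℝ → ℝ) where
  carrier := {d | ∃ φ : ℝ → ℝ, ContDiff ℝ ∞ φ ∧ HasCompactSupport φ ∧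
    d = ![φ, deriv φ, fun x => √(q x) * φ x]}
  add_mem' := by
    rintro _ _ ⟨φ, h1, h2, rfl⟩ ⟨χ, h3, h4, rfl⟩
    refine ⟨φ + χ, h1.add h3, h2.add h4, ?_⟩
    have h5 : deriv (φ + χ) = deriv φ + deriv χ := funext fun x =>
      deriv_add (h1.differentiable (by simp) x) (h3.differentiable (by simp) x)
    have h6 : (fun x => √(q x) * (φ + χ) x) = (fun x => √(q x) * φ x) + fun x => √(q x) * χ x :=
      funext fun x => by simp [mul_add]
    rw [h5, h6]
    simp
  zero_mem' := ⟨0, contDiff_const, HasCompactSupport.zero, by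
    ext i x
    fin_cases i <;> simp⟩
  smul_mem' := by
    rintro c _ ⟨φ, h1, h2, rfl⟩
    refine ⟨c • φ, h1.const_smul c, h2.smul_left (f := fun _ => c), ?_⟩
    have h5 : deriv (c • φ) = c • deriv φ := funext fun x =>
      deriv_const_smul c (h1.differentiable (by simp) x)
    have h6 : (fun x => √(q x) * (c • φ) x) = c • fun x => √(q x) * φ x :=
      funext fun x => by simp; ring
    rw [h5, h6]
    simp

theorem memLp_of_mem_schrodingerTriples (hq : Continuous q) :
    ∀ d ∈ schrodingerTriples q, ∀ i, MemLp (d i) 2 volume := by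
  rintro _ ⟨φ, h1, h2, rfl⟩ i
  fin_cases i
  · exact h1.continuous.memLp_of_hasCompactSupport h2
  · exact (h1.continuous_deriv (by simp)).memLp_of_hasCompactSupport h2.deriv
  · exact (hq.sqrt.mul h1.continuous).memLp_of_hasCompactSupport h2.mul_left

/-- The form of `-d²/dx² + q` controls the `L²` norm compactly, as `q` is large at infinity. -/
theorem schrodingerTriples_compact (hq : Continuous q) (hq0 : ∀ x, 0 ≤ q x)
    (hqi : Tendsto q (cocompact ℝ) atTop) {δ : ℝ} (hδ : 0 < δ) :
    ∃ (κ : Type) (_ : Fintype κ) (g : κ → ℝ → ℝ), (∀ k, MemLp (g k) 2 volume) ∧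
      ∀ d ∈ schrodingerTriples q, ∫ x, d 0 x ^ 2 ≤
        δ * (∑ i, ∫ x, d i x ^ 2) + ∑ k, (∫ x, g k x * d 0 x) ^ 2 := by
  obtain ⟨R₀, hR₀⟩ : ∃ R : ℝ, ∀ x, R ≤ |x| → δ⁻¹ ≤ q x := by
    have h1 := hqi.eventually (eventually_ge_atTop δ⁻¹)
    obtain ⟨R, -, hR⟩ := (Metric.hasBasis_cobounded_compl_ball (0 : ℝ)).eventually_iff.1
      (Metric.cobounded_eq_cocompact (α := ℝ) ▸ h1)
    exact ⟨R, fun x hx => hR (by simpa using hx)⟩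
  set R := max R₀ 1 with hRdef
  have hR0 : 0 < R := lt_max_of_lt_right one_pos
  have hR : ∀ x, R ≤ |x| → 1 ≤ δ * q x := fun x hx => by
    have := hR₀ x ((le_max_left _ _).trans hx)
    calc (1 : ℝ) = δ * δ⁻¹ := (mul_inv_cancel₀ hδ.ne').symm
      _ ≤ _ := by gcongr
  -- outside `[-R, R]` the potential does it, inside the Poincaré inequality on cells of size `l ≤ √δ`
  obtain ⟨n, hn⟩ := exists_nat_gt (2 * R / √δ)
  have hsδ : 0 < √δ := Real.sqrt_pos.2 hδ
  have hn0 : (0 : ℝ) < n := lt_of_le_of_lt (by positivity) hn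
  set l := 2 * R / n with hl
  have hl0 : 0 < l := by positivity
  have hnl : -R + n * l = R := by rw [hl]; field_simp; ring
  have hlδ : l ^ 2 ≤ δ := by
    have h1 : l ≤ √δ := by
      rw [hl, div_le_iff₀ hn0]
      rw [div_lt_iff₀ hsδ] at hn
      linarith
    calc l ^ 2 ≤ √δ ^ 2 := by gcongr
      _ = δ := Real.sq_sqrt hδ.le
  let J : Fin n → Set ℝ := fun k => Set.Ioc (-R + (k : ℕ) * l) (-R + ((k : ℕ) + 1 : ℕ) * l)
  refine ⟨Fin n, inferInstance, fun k => (J k).indicator fun _ => √(l⁻¹), fun k =>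
    memLp_indicator_const 2 measurableSet_Ioc _ (Or.inr (by simp)), ?_⟩
  rintro _ ⟨φ, h1, h2, rfl⟩
  have hφc := h1.continuous
  have hφ' : Continuous (deriv φ) := h1.continuous_deriv (by simp)
  have e0 : MemLp φ 2 volume := hφc.memLp_of_hasCompactSupport h2
  have e1 : MemLp (deriv φ) 2 volume := hφ'.memLp_of_hasCompactSupport h2.deriv
  have e2 : MemLp (fun x => √(q x) * φ x) 2 volume :=
    (hq.sqrt.mul hφc).memLp_of_hasCompactSupport h2.mul_left
  simp only [Fin.sum_univ_three, Matrix.cons_val_zero, Matrix.cons_val_one, Matrix.cons_val]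
  have hg : ∀ k : Fin n, (∫ x, (J k).indicator (fun _ => √(l⁻¹)) x * φ x) ^ 2 =
      l⁻¹ * (∫ x in (-R + (k : ℕ) * l)..(-R + ((k : ℕ) + 1 : ℕ) * l), φ x) ^ 2 := by
    intro k
    have h3 : ∀ x, (J k).indicator (fun _ => √(l⁻¹)) x * φ x =
        (J k).indicator (fun x => √(l⁻¹) * φ x) x := fun x => by
      by_cases hx : x ∈ J k <;> simp [hx]
    simp only [h3]
    rw [integral_indicator measurableSet_Ioc, intervalIntegral.integral_of_le (by
      push_cast; nlinarith), integral_const_mul, mul_pow, Real.sq_sqrt (by positivity)]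
  simp only [hg]
  have h3 := integral_sq_le_sum_cells (h1.of_le (by simp)) (c := -R) hl0 n
  rw [hnl] at h3
  have h4 : ∫ x, φ x ^ 2 ≤ (∫ x in -R..R, φ x ^ 2) + δ * ∫ x, (√(q x) * φ x) ^ 2 := by
    rw [intervalIntegral.integral_of_le (by linarith), ← integral_add_compl measurableSet_Ioc
      (integrable_sq e0)]
    gcongr
    rw [← integral_const_mul]
    refine (setIntegral_mono_on (integrable_sq e0).integrableOn
      ((integrable_sq e2).const_mul δ).integrableOn measurableSet_Ioc.compl fun x hx => ?_).trans
      (setIntegral_le_integral ((integrable_sq e2).const_mul δ)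
        (Eventually.of_forall fun x => by positivity))
    have h5 : R ≤ |x| := by
      by_contra h
      have := abs_lt.1 (not_le.1 h)
      exact hx ⟨this.1, this.2.le⟩
    rw [mul_pow, Real.sq_sqrt (hq0 x), ← mul_assoc]
    have := mul_le_mul_of_nonneg_right (hR x h5) (sq_nonneg (φ x))
    linarith
  have h5 : ∫ x in -R..R, deriv φ x ^ 2 ≤ ∫ x, deriv φ x ^ 2 := by
    rw [intervalIntegral.integral_of_le (by linarith)]
    exact setIntegral_le_integral (integrable_sq e1) (Eventually.of_forall fun x => sq_nonneg _)
  have h6 : l ^ 2 * (∫ x in -R..R, deriv φ x ^ 2) ≤ δ * ∫ x, deriv φ x ^ 2 := by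
    have : 0 ≤ ∫ x in -R..R, deriv φ x ^ 2 :=
      intervalIntegral.integral_nonneg (by linarith) fun _ _ => sq_nonneg _
    gcongr
  have h7 : 0 ≤ δ * ∫ x, φ x ^ 2 := mul_nonneg hδ.le (integral_nonneg fun _ => sq_nonneg _)
  linarith

theorem locallyIntegrable_of_memLp {f : ℝ → ℝ} (hf : MemLp f 2 volume) : LocallyIntegrable f :=
  hf.locallyIntegrable one_le_two

/-- Regularity of weak eigenfunctions. -/
theorem exists_solution_of_weak {ψ g r : ℝ → ℝ} {ν : ℝ} (hq : Continuous q)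
    (hψ : MemLp ψ 2 volume) (hg : MemLp g 2 volume)
    (hψg : ∀ φ : ℝ → ℝ, ContDiff ℝ ∞ φ → HasCompactSupport φ →
      ∫ x, ψ x * deriv φ x = -∫ x, g x * φ x)
    (hψr : ∀ φ : ℝ → ℝ, ContDiff ℝ ∞ φ → HasCompactSupport φ →
      ∫ x, r x * (√(q x) * φ x) = ∫ x, q x * ψ x * φ x)
    (heq : ∀ φ : ℝ → ℝ, ContDiff ℝ ∞ φ → HasCompactSupport φ →
      (∫ x, ψ x * φ x) + (∫ x, g x * deriv φ x) + ∫ x, r x * (√(q x) * φ x) =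
        ν * ∫ x, ψ x * φ x) :
    ∃ X Y : ℝ → ℝ, X =ᵐ[volume] ψ ∧ (∀ x, HasDerivAt X (Y x) x) ∧
      ∀ x, HasDerivAt Y ((q x - (ν - 1)) * X x) x := by
  have hψl := locallyIntegrable_of_memLp hψ
  have hgl := locallyIntegrable_of_memLp hg
  have hGl : LocallyIntegrable fun x => (q x - (ν - 1)) * ψ x := by
    have := hψl.continuous_smul (g := fun x => q x - (ν - 1)) (by fun_prop)
    simpa using this
  obtain ⟨c₁, hc₁⟩ := ae_eq_integral_of_weak_deriv hψl hgl hψg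
  obtain ⟨c₂, hc₂⟩ := ae_eq_integral_of_weak_deriv hgl hGl (by
    intro φ hφ hφc
    have h1 := heq φ hφ hφc
    rw [hψr φ hφ hφc] at h1
    have hφL : MemLp φ 2 volume := hφ.continuous.memLp_of_hasCompactSupport hφc
    have hqL : MemLp (fun x => q x * φ x) 2 volume :=
      (hq.mul hφ.continuous).memLp_of_hasCompactSupport hφc.mul_left
    have h2 : ∫ x, (q x - (ν - 1)) * ψ x * φ x =
        (∫ x, q x * ψ x * φ x) - (ν - 1) * ∫ x, ψ x * φ x := by
      rw [← integral_const_mul, ← integral_sub]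
      · congr 1; ext x; ring
      · refine (integrable_mul hψ hqL).congr (Eventually.of_forall fun x => ?_)
        simp only; ring
      · exact (integrable_mul hψ hφL).const_mul _
    rw [h2]
    linarith)
  set X : ℝ → ℝ := fun x => c₁ + ∫ t in (0 : ℝ)..x, g t with hXdef
  have hgi : ∀ a b, IntervalIntegrable g volume a b := fun a b =>
    (hgl.integrableOn_isCompact isCompact_uIcc).intervalIntegrable
  have hXc : Continuous X := continuous_const.add (intervalIntegral.continuous_primitive hgi 0)
  set Y : ℝ → ℝ := fun x => c₂ + ∫ t in (0 : ℝ)..x, (q t - (ν - 1)) * X t with hYdef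
  have hgY : g =ᵐ[volume] Y := by
    filter_upwards [hc₂] with x hx
    rw [hx, hYdef]
    simp only [add_right_inj]
    refine intervalIntegral.integral_congr_ae ?_
    filter_upwards [hc₁] with t ht _
    rw [ht]
  have hY : ∀ x, HasDerivAt Y ((q x - (ν - 1)) * X x) x := by
    intro x
    have hc : Continuous fun t => (q t - (ν - 1)) * X t := by fun_prop
    exact ((intervalIntegral.integral_hasDerivAt_right (hc.intervalIntegrable _ _)
      hc.stronglyMeasurable.stronglyMeasurableAtFilter hc.continuousAt)).const_add _
  have hYc : Continuous Y := continuous_iff_continuousAt.2 fun x => (hY x).continuousAt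
  refine ⟨X, Y, hc₁.symm, fun x => ?_, hY⟩
  have h3 : X = fun x => c₁ + ∫ t in (0 : ℝ)..x, Y t := by
    ext x
    simp only [hXdef, add_right_inj]
    refine intervalIntegral.integral_congr_ae ?_
    filter_upwards [hgY] with t ht _
    rw [ht]
  rw [h3]
  exact ((intervalIntegral.integral_hasDerivAt_right (hYc.intervalIntegrable _ _)
      hYc.stronglyMeasurable.stronglyMeasurableAtFilter hYc.continuousAt)).const_add _

/-- The Schrödinger operator with a nonnegative continuous potential growing at infinity has a
complete system of eigenfunctions, and its eigenvalues are simple. -/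
theorem exists_isSchrodingerEigensystem (hq : Continuous q) (hq0 : ∀ x, 0 ≤ q x)
    (hqi : Tendsto q (cocompact ℝ) atTop) :
    ∃ (μ : ℕ → ℝ) (X : ℕ → ℝ → ℝ), IsSchrodingerEigensystem q μ X := by
  obtain ⟨ν, w, hmono, htend, hw, happ, heq, horth, hcomp⟩ :=
    exists_eigensystem_of_compact (μ := volume) (schrodingerTriples q)
      (memLp_of_mem_schrodingerTriples hq)
      (fun δ hδ => schrodingerTriples_compact hq hq0 hqi hδ)
      (by
        intro f hf h0
        refine ae_eq_zero_of_integral_contDiff_smul_eq_zero (locallyIntegrable_of_memLp hf) ?_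
        intro φ hφ hφc
        have := h0 _ ⟨φ, hφ, hφc, rfl⟩
        simpa [mul_comm] using this)
      (not_finiteDimensional_lp (fun n : ℕ => Set.Ioo (n : ℝ) (n + 1)) (fun n => measurableSet_Ioo)
        (fun n => by simp) (fun n => by simp) (by
          intro m n hmn
          rw [Function.onFun, Set.disjoint_left]
          intro x hx hy
          apply hmn
          have h1 : (m : ℝ) < n + 1 := hx.1.trans hy.2
          have h2 : (n : ℝ) < m + 1 := hy.1.trans hx.2
          have h3 : m < n + 1 := by exact_mod_cast h1
          have h4 : n < m + 1 := by exact_mod_cast h2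
          omega))
  have hsol : ∀ j, ∃ X Y : ℝ → ℝ, X =ᵐ[volume] w j 0 ∧ (∀ x, HasDerivAt X (Y x) x) ∧
      ∀ x, HasDerivAt Y ((q x - (ν j - 1)) * X x) x := by
    intro j
    obtain ⟨d, hd, hlim⟩ := happ j
    choose φ hφ hφc hdφ using hd
    have h0 : ∀ n, d n 0 = φ n := fun n => by rw [hdφ]; rfl
    have h1 : ∀ n, d n 1 = deriv (φ n) := fun n => by rw [hdφ]; rfl
    have h2 : ∀ n, d n 2 = fun x => √(q x) * φ n x := fun n => by rw [hdφ]; rfl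
    have l0 := hlim 0
    have l1 := hlim 1
    have l2 := hlim 2
    simp only [h0, h1, h2] at l0 l1 l2
    have m0 : ∀ n, MemLp (φ n) 2 volume := fun n =>
      (hφ n).continuous.memLp_of_hasCompactSupport (hφc n)
    have m1 : ∀ n, MemLp (deriv (φ n)) 2 volume := fun n =>
      ((hφ n).continuous_deriv (by simp)).memLp_of_hasCompactSupport (hφc n).deriv
    have m2 : ∀ n, MemLp (fun x => √(q x) * φ n x) 2 volume := fun n =>
      (hq.sqrt.mul (hφ n).continuous).memLp_of_hasCompactSupport (hφc n).mul_left
    refine exists_solution_of_weak (r := w j 2) hq (hw j 0) (hw j 1) ?_ ?_ ?_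
    · intro χ hχ hχc
      have k0 : MemLp χ 2 volume := hχ.continuous.memLp_of_hasCompactSupport hχc
      have k1 : MemLp (deriv χ) 2 volume :=
        (hχ.continuous_deriv (by simp)).memLp_of_hasCompactSupport hχc.deriv
      have t1 := tendsto_integral_mul_left k1 m0 (hw j 0) l0
      have t2 := (tendsto_integral_mul_left k0 m1 (hw j 1) l1).neg
      have t3 : ∀ n, ∫ x, deriv χ x * φ n x = -∫ x, χ x * deriv (φ n) x := by
        intro n
        have := integral_mul_deriv_eq_deriv_mul_of_integrable (u := φ n) (v := χ)
          (u' := deriv (φ n)) (v' := deriv χ)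
          (fun x _ => ((hφ n).differentiable (by simp) x).hasDerivAt)
          (fun x _ => (hχ.differentiable (by simp) x).hasDerivAt)
          (integrable_mul (m0 n) k1) (integrable_mul (m1 n) k0) (integrable_mul (m0 n) k0)
        simpa only [mul_comm] using this
      have := tendsto_nhds_unique (t1.congr t3) t2
      simpa only [mul_comm] using this
    · intro χ hχ hχc
      have k0 : MemLp (fun x => √(q x) * χ x) 2 volume :=
        (hq.sqrt.mul hχ.continuous).memLp_of_hasCompactSupport hχc.mul_left
      have k1 : MemLp (fun x => q x * χ x) 2 volume :=
        (hq.mul hχ.continuous).memLp_of_hasCompactSupport hχc.mul_left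
      have t1 := tendsto_integral_mul_left k0 m2 (hw j 2) l2
      have t2 := tendsto_integral_mul_left k1 m0 (hw j 0) l0
      have t3 : ∀ n, ∫ x, √(q x) * χ x * (√(q x) * φ n x) = ∫ x, q x * χ x * φ n x := by
        intro n
        congr 1
        ext x
        calc _ = (√(q x) * √(q x)) * (χ x * φ n x) := by ring
          _ = _ := by rw [Real.mul_self_sqrt (hq0 x)]; ring
      have := tendsto_nhds_unique (t1.congr t3) t2
      calc _ = _ := by simp only [mul_comm (w j 2 _)]
        _ = _ := this
        _ = _ := by congr 1; ext x; ring
    · intro χ hχ hχc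
      have := heq j _ ⟨χ, hχ, hχc, rfl⟩
      rw [Fin.sum_univ_three] at this
      exact this
  choose X Y hXw hX hY using hsol
  have hXc : ∀ j, Continuous (X j) := fun j =>
    continuous_iff_continuousAt.2 fun x => (hX j x).continuousAt
  have hL : ∀ j, MemLp (X j) 2 volume := fun j => (memLp_congr_ae (hXw j)).2 (hw j 0)
  have horth' : ∀ i j, ∫ x, X i x * X j x = if i = j then 1 else 0 := fun i j => by
    rw [← horth]
    refine integral_congr_ae ?_
    filter_upwards [hXw i, hXw j] with x h1 h2
    rw [h1, h2]
  have hne : ∀ j, ∃ x, X j x ≠ 0 := by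
    intro j
    by_contra! h
    have := horth' j j
    simp [h] at this
  have hlarge : ∀ c, ∀ᶠ x in atTop, c ≤ q x := fun c =>
    (hqi.mono_left atTop_le_cocompact).eventually (eventually_ge_atTop c)
  have hinj : ∀ i j, i ≠ j → ν i ≠ ν j := by
    intro i j hij hν
    obtain ⟨R, hR⟩ := eventually_atTop.1 (hlarge (ν i - 1))
    -- the combination of the two eigenfunctions that vanishes at `R` is trivial
    have hz : ∀ x, X i R * X j x - X j R * X i x = 0 := by
      have hL' : MemLp (fun x => X i R * X j x - X j R * X i x) 2 volume :=
        ((hL j).const_mul _).sub ((hL i).const_mul _)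
      refine solution_eq_zero_of_zero (ν := ν i - 1) (Y := fun x => X i R * Y j x - X j R * Y i x)
        (x₀ := R) hq
        (fun x => ((hX j x).const_mul _).sub ((hX i x).const_mul _)) (fun x => ?_)
        (integrable_sq hL') hR (by ring)
      have h1 := hY j x
      rw [← hν] at h1
      refine ((h1.const_mul (X i R)).sub ((hY i x).const_mul (X j R))).congr_deriv ?_
      ring
    have h1 : ∫ x, (X i R * X j x - X j R * X i x) * X j x = X i R := by
      simp only [sub_mul, mul_assoc]
      rw [integral_sub ((integrable_mul (hL j) (hL j)).const_mul _)
        ((integrable_mul (hL i) (hL j)).const_mul _), integral_const_mul, integral_const_mul,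
        horth', horth', if_pos rfl, if_neg hij]
      ring
    simp only [hz, zero_mul, integral_zero] at h1
    obtain ⟨x, hx⟩ := hne i
    exact hx (solution_eq_zero_of_zero hq (hX i) (hY i) (integrable_sq (hL i)) hR h1.symm x)
  have hsign : ∀ j, ∃ s : ℝ, (s = 1 ∨ s = -1) ∧ ∀ᶠ x in atTop, 0 < s * X j x := by
    intro j
    rcases eventually_pos_or_neg hq (hX j) (hY j) (integrable_sq (hL j)) (hlarge _) (hne j) with h | h
    · exact ⟨1, Or.inl rfl, by simpa using h⟩
    · exact ⟨-1, Or.inr rfl, by simpa using h⟩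
  choose s hs hspos using hsign
  have hss : ∀ j, s j * s j = 1 := fun j => by rcases hs j with h | h <;> rw [h] <;> norm_num
  have hs0 : ∀ j, s j ≠ 0 := fun j h => by have := hss j; rw [h] at this; norm_num at this
  have hderiv : ∀ j, deriv (fun x => s j * X j x) = fun x => s j * Y j x := fun j =>
    funext fun x => ((hX j x).const_mul _).deriv
  have hderiv2 : ∀ j, deriv (fun x => s j * Y j x) =
      fun x => s j * ((q x - (ν j - 1)) * X j x) := fun j =>
    funext fun x => ((hY j x).const_mul _).deriv
  refine ⟨fun j => ν j - 1, fun j x => s j * X j x, ?_, ?_, ?_, ?_, ?_, ?_, ?_, hspos⟩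
  · have h1 : StrictMono ν := hmono.strictMono_of_injective fun i j h => by
      by_contra hij
      exact hinj i j hij h
    exact fun i j hij => sub_lt_sub_right (h1 hij) 1
  · exact tendsto_atTop_add_const_right _ (-1) htend
  · intro j
    rw [show (2 : WithTop ℕ∞) = 1 + 1 by norm_num, contDiff_succ_iff_deriv]
    refine ⟨fun x => ((hX j x).const_mul _).differentiableAt, by simp, ?_⟩
    rw [hderiv, contDiff_one_iff_deriv]
    refine ⟨fun x => ((hY j x).const_mul _).differentiableAt, ?_⟩
    rw [hderiv2]
    have := hXc j
    fun_prop
  · exact fun j => (hL j).const_mul _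
  · intro j x
    rw [hderiv, hderiv2]
    ring
  · intro i j
    have h1 : ∀ x, s i * X i x * (s j * X j x) = s i * s j * (X i x * X j x) := fun x => by ring
    simp only [h1]
    rw [integral_const_mul, horth']
    split_ifs with h
    · subst h; rw [hss, mul_one]
    · simp
  · intro f hf h0
    refine hcomp f hf fun j => ?_
    have h1 := h0 j
    have h2 : ∀ x, f x * (s j * X j x) = s j * (f x * X j x) := fun x => by ring
    simp only [h2] at h1
    rw [integral_const_mul, mul_eq_zero] at h1
    rw [← h1.resolve_left (hs0 j)]
    refine integral_congr_ae ?_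
    filter_upwards [hXw j] with x hx
    rw [hx]

end Schrodinger

/-! ### The form of the limit operator -/

section Potential

variable {M cp cm m : ℝ}

theorem potential_eq (hm : 0 < m) (x : ℝ) : potential M cp cm m x =
    2 * Real.pi ^ 2 / M ^ 3 * cp * max x 0 ^ m + 2 * Real.pi ^ 2 / M ^ 3 * cm * max (-x) 0 ^ m := by
  unfold potential
  split_ifs with h
  · rw [max_eq_left h.le, max_eq_right (by linarith), Real.zero_rpow hm.ne']; ring
  · rw [max_eq_right (not_lt.1 h), max_eq_left (by linarith), Real.zero_rpow hm.ne',
      abs_of_nonpos (not_lt.1 h)]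
    ring

theorem continuous_potential (hm : 0 < m) : Continuous (potential M cp cm m) := by
  have : potential M cp cm m = _ := funext (potential_eq (M := M) (cp := cp) (cm := cm) hm)
  rw [this]
  have h1 : Continuous fun x : ℝ => max x 0 ^ m :=
    (continuous_id.max continuous_const).rpow_const fun _ => Or.inr hm.le
  have h2 : Continuous fun x : ℝ => max (-x) 0 ^ m :=
    (continuous_neg.max continuous_const).rpow_const fun _ => Or.inr hm.le
  fun_prop

theorem potential_nonneg (hM : 0 < M) (hcp : 0 < cp) (hcm : 0 < cm) (x : ℝ) :
    0 ≤ potential M cp cm m x := by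
  unfold potential
  split_ifs with h <;> positivity

theorem potential_ge (hM : 0 < M) (x : ℝ) :
    2 * Real.pi ^ 2 / M ^ 3 * min cp cm * |x| ^ m ≤ potential M cp cm m x := by
  unfold potential
  split_ifs with h
  · rw [abs_of_pos h]
    have : 0 ≤ x ^ m := by positivity
    gcongr
    exact min_le_left _ _
  · gcongr
    exact min_le_right _ _

/-- The potential is homogeneous of degree `m`. -/
theorem potential_mul {s : ℝ} (hs : 0 < s) (x : ℝ) :
    potential M cp cm m (s * x) = s ^ m * potential M cp cm m x := by
  unfold potential
  by_cases h : 0 < x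
  · rw [if_pos h, if_pos (mul_pos hs h), Real.mul_rpow hs.le h.le]; ring
  · rw [if_neg h, if_neg (fun h' => h (pos_of_mul_pos_right h' hs.le)), abs_mul, abs_of_pos hs,
      Real.mul_rpow hs.le (abs_nonneg x)]
    ring

theorem tendsto_potential (hM : 0 < M) (hcp : 0 < cp) (hcm : 0 < cm) (hm : 0 < m) :
    Tendsto (potential M cp cm m) (cocompact ℝ) atTop := by
  refine tendsto_atTop_mono (potential_ge hM) ?_
  have h1 : Tendsto (fun x : ℝ => |x| ^ m) (cocompact ℝ) atTop :=
    (tendsto_rpow_atTop hm).comp tendsto_norm_cocompact_atTop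
  have : 0 < min cp cm := lt_min hcp hcm
  exact h1.const_mul_atTop (by positivity)

end Potential

section Form

variable {q : ℝ → ℝ} {μ : ℕ → ℝ} {X : ℕ → ℝ → ℝ}

theorem IsSchrodingerEigensystem.hasDerivAt (hS : IsSchrodingerEigensystem q μ X) (j : ℕ) (x : ℝ) :
    HasDerivAt (X j) (deriv (X j) x) x :=
  ((hS.contDiff j).differentiable (by simp) x).hasDerivAt

theorem IsSchrodingerEigensystem.hasDerivAt_deriv (hS : IsSchrodingerEigensystem q μ X) (j : ℕ)
    (x : ℝ) : HasDerivAt (deriv (X j)) ((q x - μ j) * X j x) x := by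
  have h1 : ContDiff ℝ 1 (deriv (X j)) := by
    have := hS.contDiff j
    rw [show (2 : WithTop ℕ∞) = 1 + 1 by norm_num, contDiff_succ_iff_deriv] at this
    exact this.2.2
  have h2 := (h1.differentiable one_ne_zero x).hasDerivAt
  have h3 := hS.eigen j x
  refine h2.congr_deriv ?_
  linarith

theorem IsSchrodingerEigensystem.memLp_energy (hS : IsSchrodingerEigensystem q μ X)
    (hq : Continuous q) (hq0 : ∀ x, 0 ≤ q x) (j : ℕ) :
    MemLp (deriv (X j)) 2 volume ∧ MemLp (fun x => √(q x) * X j x) 2 volume :=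
  integrable_energy hq hq0 (hS.hasDerivAt j) (hS.hasDerivAt_deriv j) (integrable_sq (hS.memLp j))

/-- Green's formula for an eigenfunction. -/
theorem IsSchrodingerEigensystem.form_eq (hS : IsSchrodingerEigensystem q μ X)
    (hq : Continuous q) (hq0 : ∀ x, 0 ≤ q x) (j : ℕ) {v : ℝ → ℝ} (hv : ContDiff ℝ 1 v)
    (hv0 : MemLp v 2 volume) (hv1 : MemLp (deriv v) 2 volume)
    (hv2 : MemLp (fun x => √(q x) * v x) 2 volume) :
    ∫ x, (deriv v x * deriv (X j) x + √(q x) * v x * (√(q x) * X j x)) = μ j * ∫ x, v x * X j x := by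
  obtain ⟨h1, h2⟩ := hS.memLp_energy hq hq0 j
  have h3 : ∀ x, √(q x) * v x * (√(q x) * X j x) = q x * X j x * v x := fun x => by
    calc _ = (√(q x) * √(q x)) * (v x * X j x) := by ring
      _ = _ := by rw [Real.mul_self_sqrt (hq0 x)]; ring
  have h4 : Integrable fun x => q x * X j x * v x :=
    (integrable_mul hv2 h2).congr (Eventually.of_forall h3)
  have h5 : ∀ x, v x * ((q x - μ j) * X j x) = q x * X j x * v x - μ j * (v x * X j x) :=
    fun x => by ring
  have h6 : Integrable fun x => v x * ((q x - μ j) * X j x) :=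
    (h4.sub ((integrable_mul hv0 (hS.memLp j)).const_mul (μ j))).congr
      (Eventually.of_forall fun x => (h5 x).symm)
  have h7 := integral_mul_deriv_eq_deriv_mul_of_integrable (u := v) (v := deriv (X j))
    (u' := deriv v) (v' := fun x => (q x - μ j) * X j x)
    (fun x _ => (hv.differentiable one_ne_zero x).hasDerivAt)
    (fun x _ => hS.hasDerivAt_deriv j x) h6 (integrable_mul hv1 h1) (integrable_mul hv0 h1)
  simp only [h5] at h7
  rw [integral_sub h4 ((integrable_mul hv0 (hS.memLp j)).const_mul (μ j)), integral_const_mul] at h7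
  rw [integral_add (integrable_mul hv1 h1) (integrable_mul hv2 h2)]
  simp only [h3]
  linarith

theorem IsSchrodingerEigensystem.form_self (hS : IsSchrodingerEigensystem q μ X)
    (hq : Continuous q) (hq0 : ∀ x, 0 ≤ q x) (i j : ℕ) :
    ∫ x, (deriv (X i) x * deriv (X j) x + √(q x) * X i x * (√(q x) * X j x)) =
      μ i * ∫ x, X i x * X j x := by
  obtain ⟨h1, h2⟩ := hS.memLp_energy hq hq0 j
  have := hS.form_eq hq hq0 i ((hS.contDiff j).of_le (by norm_num)) (hS.memLp j) h1 h2
  simpa only [mul_comm] using this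

theorem IsSchrodingerEigensystem.nonneg (hS : IsSchrodingerEigensystem q μ X)
    (hq : Continuous q) (hq0 : ∀ x, 0 ≤ q x) (j : ℕ) : 0 ≤ μ j := by
  have h1 := hS.form_self hq hq0 j j
  rw [hS.orthonormal, if_pos rfl, mul_one] at h1
  rw [← h1]
  exact integral_nonneg fun x => add_nonneg (mul_self_nonneg _) (mul_self_nonneg _)

/-- On functions orthogonal to the first `N` eigenfunctions the form of `-d²/dx² + q` is at least
`μ N`. -/
theorem IsSchrodingerEigensystem.form_lower_bound (hS : IsSchrodingerEigensystem q μ X)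
    (hq : Continuous q) (hq0 : ∀ x, 0 ≤ q x) {v : ℝ → ℝ} (hv : ContDiff ℝ 1 v)
    (hvc : HasCompactSupport v) (N : ℕ) :
    μ N * ∫ x, v x ^ 2 ≤ (∫ x, (deriv v x ^ 2 + q x * v x ^ 2)) +
      μ N * ∑ k ∈ Finset.range N, (∫ x, v x * X k x) ^ 2 := by
  have hv0 : MemLp v 2 volume := hv.continuous.memLp_of_hasCompactSupport hvc
  have hv1 : MemLp (deriv v) 2 volume :=
    (hv.continuous_deriv le_rfl).memLp_of_hasCompactSupport hvc.deriv
  have hv2 : MemLp (fun x => √(q x) * v x) 2 volume :=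
    (hq.sqrt.mul hv.continuous).memLp_of_hasCompactSupport hvc.mul_left
  have key := eigenvalue_lower_bound hS.memLp hS.orthonormal hS.complete hS.strictMono.monotone
    (fun j => (hS.memLp_energy hq hq0 j).1) (fun j => (hS.memLp_energy hq hq0 j).2) hv1 hv2
    (hS.form_self hq hq0) hv0 (fun j => hS.form_eq hq hq0 j hv hv0 hv1 hv2) N
  have h1 : 0 ≤ ∑ k ∈ Finset.range N, μ k * (∫ x, v x * X k x) ^ 2 :=
    Finset.sum_nonneg fun k _ => mul_nonneg (hS.nonneg hq hq0 k) (sq_nonneg _)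
  have h2 : ∫ x, (deriv v x ^ 2 + (√(q x) * v x) ^ 2) = ∫ x, (deriv v x ^ 2 + q x * v x ^ 2) := by
    congr 1
    ext x
    rw [mul_pow, Real.sq_sqrt (hq0 x)]
  rw [h2] at key
  linarith

end Form

section Approximation

/-- Density of smooth functions in `C¹`, with control of the supports. -/
theorem exists_smooth_near {w : ℝ → ℝ} (hw : ContDiff ℝ 1 w) {S : ℝ} (hS : 0 < S)
    (hw0 : ∀ x, S ≤ |x| → w x = 0) {η : ℝ} (hη : 0 < η) :
    ∃ v : ℝ → ℝ, ContDiff ℝ ∞ v ∧ (∀ x, S + 1 ≤ |x| → v x = 0) ∧ (∀ x, S + 1 ≤ |x| → deriv v x = 0) ∧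
      (∀ x, |v x - w x| ≤ η) ∧ ∀ x, |deriv v x - deriv w x| ≤ η := by
  have hwc := hw.continuous
  have hw' : Continuous (deriv w) := hw.continuous_deriv le_rfl
  have hwd : ∀ x, HasDerivAt w (deriv w x) x := fun x => (hw.differentiable one_ne_zero x).hasDerivAt
  let b : ContDiffBump (0 : ℝ) := ⟨S, S + 1, hS, by linarith⟩
  have hbs : ContDiff ℝ ∞ b := b.contDiff
  have hb1 : ∀ x, |x| ≤ S → b x = 1 := fun x hx =>
    b.one_of_mem_closedBall (by simpa [b] using hx)
  have hb0 : ∀ x, S + 1 ≤ |x| → b x = 0 := fun x hx =>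
    b.zero_of_le_dist (by simpa [b] using hx)
  have hb01 : ∀ x, |b x| ≤ 1 := fun x => by
    rw [abs_of_nonneg b.nonneg]; exact b.le_one
  have hbd : ∀ x, HasDerivAt b (deriv b x) x := fun x =>
    (hbs.differentiable (by simp) x).hasDerivAt
  have hb'c : Continuous (deriv b) := hbs.continuous_deriv (by simp)
  obtain ⟨C, hC⟩ := (isCompact_Icc (a := -(S + 1)) (b := S + 1)).exists_bound_of_continuousOn
    hb'c.continuousOn
  set C' := max C 0 with hC'
  have hC'0 : 0 ≤ C' := le_max_right _ _
  have hCb : ∀ x, |x| ≤ S + 1 → |deriv b x| ≤ C' := fun x hx =>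
    (hC x (abs_le.1 hx)).trans (le_max_left _ _)
  have hb'0 : ∀ x, S + 1 ≤ |x| → deriv b x = 0 := by
    intro x hx
    -- `b ≥ 0` has a minimum at `x`
    have h1 : IsLocalMin b x := Eventually.of_forall fun y => by
      rw [hb0 x hx]; exact b.nonneg
    exact h1.deriv_eq_zero
  set θ := η / ((C' + 1) * (S + 1)) with hθ
  have hθ0 : 0 < θ := by positivity
  obtain ⟨p, hp⟩ := exists_polynomial_near_of_continuousOn (-(S + 1)) (S + 1) (deriv w)
    hw'.continuousOn θ hθ0
  set P : ℝ → ℝ := fun x => w 0 + ∫ t in (0 : ℝ)..x, p.eval t with hP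
  have hpc : Continuous fun t => p.eval t := p.continuous
  have hPd : ∀ x, HasDerivAt P (p.eval x) x := fun x =>
    (intervalIntegral.integral_hasDerivAt_right (hpc.intervalIntegrable _ _)
      hpc.stronglyMeasurable.stronglyMeasurableAtFilter hpc.continuousAt).const_add _
  have hPs : ContDiff ℝ ∞ P := by
    rw [contDiff_infty_iff_deriv]
    refine ⟨fun x => (hPd x).differentiableAt, ?_⟩
    have : deriv P = fun x => p.eval x := funext fun x => (hPd x).deriv
    rw [this]
    exact p.contDiff_aeval _
  have hPw : ∀ x, |x| ≤ S + 1 → |P x - w x| ≤ (S + 1) * θ := by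
    intro x hx
    have h1 : ∫ t in (0 : ℝ)..x, deriv w t = w x - w 0 :=
      intervalIntegral.integral_deriv_eq_sub (fun t _ => (hwd t).differentiableAt)
        (hw'.intervalIntegrable _ _)
    have h2 : P x - w x = ∫ t in (0 : ℝ)..x, (p.eval t - deriv w t) := by
      rw [intervalIntegral.integral_sub (hpc.intervalIntegrable _ _) (hw'.intervalIntegrable _ _), h1,
        hP]
      ring
    rw [h2, ← Real.norm_eq_abs]
    refine (intervalIntegral.norm_integral_le_of_norm_le_const (C := θ) fun t ht => ?_).trans ?_
    · have h3 : |t| ≤ S + 1 := by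
        refine le_trans ?_ hx
        rcases le_total 0 x with h | h
        · rw [Set.uIoc_of_le h] at ht
          rw [abs_of_pos ht.1, abs_of_nonneg h]; exact ht.2
        · rw [Set.uIoc_of_ge h] at ht
          rw [abs_of_nonpos ht.2, abs_of_nonpos h]; linarith [ht.1]
      exact (hp t (abs_le.1 h3)).le
    · rw [sub_zero, mul_comm]
      gcongr
  have hbw : ∀ x, b x * w x = w x := fun x => by
    rcases le_total |x| S with h | h
    · rw [hb1 x h, one_mul]
    · rw [hw0 x h, mul_zero]
  have hvd : ∀ x, HasDerivAt (fun x => b x * P x) (deriv b x * P x + b x * p.eval x) x :=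
    fun x => (hbd x).mul (hPd x)
  have hwd2 : ∀ x, deriv w x = deriv b x * w x + b x * deriv w x := fun x => by
    have h1 := (hbd x).mul (hwd x)
    have h2 : (b : ℝ → ℝ) * w = w := funext hbw
    rw [h2] at h1
    exact (hwd x).unique h1
  have hη1 : (S + 1) * θ * (C' + 1) = η := by rw [hθ]; field_simp
  refine ⟨fun x => b x * P x, hbs.mul hPs, fun x hx => by simp only [hb0 x hx, zero_mul], fun x hx => ?_,
    fun x => ?_, fun x => ?_⟩
  · rw [(hvd x).deriv, hb0 x hx, hb'0 x hx]; ring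
  · rcases le_total |x| (S + 1) with h | h
    · have h1 : b x * P x - w x = b x * (P x - w x) := by rw [mul_sub, hbw]
      rw [h1, abs_mul]
      calc |b x| * |P x - w x| ≤ 1 * ((S + 1) * θ) :=
            mul_le_mul (hb01 x) (hPw x h) (abs_nonneg _) zero_le_one
        _ ≤ (S + 1) * θ * (C' + 1) := by
            have : 0 ≤ (S + 1) * θ := by positivity
            nlinarith
        _ = η := hη1
    · simp only [hb0 x h, hw0 x (by linarith), zero_mul, sub_zero, abs_zero]; exact hη.le
  · rw [(hvd x).deriv]
    rcases le_total |x| (S + 1) with h | h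
    · have h1 : deriv b x * P x + b x * p.eval x - deriv w x =
          deriv b x * (P x - w x) + b x * (p.eval x - deriv w x) := by
        linear_combination (-1 : ℝ) * hwd2 x
      rw [h1]
      calc _ ≤ |deriv b x * (P x - w x)| + |b x * (p.eval x - deriv w x)| := abs_add_le _ _
        _ ≤ C' * ((S + 1) * θ) + 1 * θ := by
            rw [abs_mul, abs_mul]
            exact add_le_add (mul_le_mul (hCb x h) (hPw x h) (abs_nonneg _) hC'0)
              (mul_le_mul (hb01 x) (hp x (abs_le.1 h)).le (abs_nonneg _) zero_le_one)
        _ ≤ (S + 1) * θ * (C' + 1) := by nlinarith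
        _ = η := hη1
    · have h1 : deriv w x = 0 := by rw [hwd2 x, hb0 x h, hb'0 x h]; ring
      rw [hb0 x h, hb'0 x h, h1]
      simpa using hη.le

variable {q X : ℝ → ℝ}

theorem integral_sq_sub_le {f g k : ℝ → ℝ} (hf : MemLp f 2 volume) (hg : MemLp g 2 volume)
    (hk : MemLp k 2 volume) :
    ∫ x, (f x - k x) ^ 2 ≤ 2 * (∫ x, (f x - g x) ^ 2) + 2 * ∫ x, (g x - k x) ^ 2 := by
  have a : MemLp (fun x => f x - g x) 2 volume := hf.sub hg
  have b : MemLp (fun x => g x - k x) 2 volume := hg.sub hk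
  have c : MemLp (fun x => f x - k x) 2 volume := hf.sub hk
  rw [← integral_const_mul, ← integral_const_mul, ← integral_add
    ((integrable_sq a).const_mul 2) ((integrable_sq b).const_mul 2)]
  refine integral_mono (integrable_sq c)
    (((integrable_sq a).const_mul 2).add ((integrable_sq b).const_mul 2)) fun x => ?_
  simp only
  nlinarith [sq_nonneg (f x - g x - (g x - k x))]

/-- Functions of finite energy are approximated by compactly supported ones. -/
theorem exists_cutoff_approx (hq : Continuous q) (hX : ContDiff ℝ 1 X)
    (h0 : MemLp X 2 volume) (h1 : MemLp (deriv X) 2 volume)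
    (h2 : MemLp (fun x => √(q x) * X x) 2 volume) {τ : ℝ} (hτ : 0 < τ) :
    ∃ w : ℝ → ℝ, ContDiff ℝ 1 w ∧ HasCompactSupport w ∧ ∫ x, (w x - X x) ^ 2 ≤ τ ∧
      ∫ x, (deriv w x - deriv X x) ^ 2 ≤ τ ∧ ∫ x, (√(q x) * w x - √(q x) * X x) ^ 2 ≤ τ := by
  have hXc := hX.continuous
  have hX' : Continuous (deriv X) := hX.continuous_deriv le_rfl
  have hXd : ∀ x, HasDerivAt X (deriv X x) x := fun x => (hX.differentiable one_ne_zero x).hasDerivAt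
  let b : ContDiffBump (0 : ℝ) := ⟨1, 2, one_pos, by norm_num⟩
  have hbs : ContDiff ℝ ∞ b := b.contDiff
  have hb'c : Continuous (deriv b) := hbs.continuous_deriv (by simp)
  have hbd : ∀ x, HasDerivAt b (deriv b x) x := fun x =>
    (hbs.differentiable (by simp) x).hasDerivAt
  have hb01 : ∀ x, 0 ≤ b x ∧ b x ≤ 1 := fun x => ⟨b.nonneg, b.le_one⟩
  obtain ⟨C, hC⟩ := b.hasCompactSupport.deriv.exists_bound_of_continuous hb'c
  simp only [Real.norm_eq_abs] at hC
  -- the cutoffs `b (x / (n + 1))`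
  let t : ℕ → ℝ := fun n => 1 / ((n : ℝ) + 1)
  have ht : Tendsto t atTop (𝓝 0) := tendsto_one_div_add_atTop_nhds_zero_nat
  have ht0 : ∀ n, 0 < t n := fun n => by positivity
  have ht1 : ∀ n, t n ≤ 1 := fun n => by
    rw [div_le_one (by positivity)]
    linarith [(Nat.cast_nonneg n : (0 : ℝ) ≤ n)]
  let w : ℕ → ℝ → ℝ := fun n x => b (t n * x) * X x
  have hlin : ∀ n (x : ℝ), HasDerivAt (fun x : ℝ => t n * x) (t n) x := fun n x => by
    simpa using (hasDerivAt_id x).const_mul (t n)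
  have hwd : ∀ n x, HasDerivAt (w n) (deriv b (t n * x) * t n * X x + b (t n * x) * deriv X x) x :=
    fun n x => ((hbd (t n * x)).comp x (hlin n x)).mul (hXd x)
  have htx : ∀ x, Tendsto (fun n => t n * x) atTop (𝓝 0) := fun x => by
    simpa using ht.mul_const x
  have hbx : ∀ x, Tendsto (fun n => b (t n * x)) atTop (𝓝 1) := fun x => by
    have : Tendsto (fun n => b (t n * x)) atTop (𝓝 (b 0)) :=
      (hbs.continuous.tendsto 0).comp (htx x)
    rwa [b.one_of_mem_closedBall (by simp [b])] at this
  have hb'x : ∀ x, Tendsto (fun n => deriv b (t n * x) * t n) atTop (𝓝 0) := fun x => by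
    have : Tendsto (fun n => deriv b (t n * x)) atTop (𝓝 (deriv b 0)) :=
      (hb'c.tendsto 0).comp (htx x)
    simpa using this.mul ht
  have hsq : ∀ n x, (b (t n * x) - 1) ^ 2 ≤ 1 := fun n x => by
    have := hb01 (t n * x)
    nlinarith
  have lim0 : Tendsto (fun n => ∫ x, (w n x - X x) ^ 2) atTop (𝓝 0) := by
    have := tendsto_integral_of_dominated_convergence (μ := volume)
      (F := fun n x => (w n x - X x) ^ 2) (f := fun _ => (0 : ℝ)) (fun x => X x ^ 2)
      (fun n => by
        have : Continuous fun x => (w n x - X x) ^ 2 := by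
          have := hbs.continuous
          simp only [w]
          fun_prop
        exact this.aestronglyMeasurable) (integrable_sq h0)
      (fun n => Eventually.of_forall fun x => by
        rw [Real.norm_of_nonneg (sq_nonneg _)]
        have : (w n x - X x) ^ 2 = (b (t n * x) - 1) ^ 2 * X x ^ 2 := by simp only [w]; ring
        rw [this]
        nlinarith [hsq n x, sq_nonneg (X x)])
      (Eventually.of_forall fun x => by
        have := (((hbx x).mul_const (X x)).sub_const (X x)).pow 2
        simpa [w] using this)
    simpa using this
  have lim2 : Tendsto (fun n => ∫ x, (√(q x) * w n x - √(q x) * X x) ^ 2) atTop (𝓝 0) := by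
    have := tendsto_integral_of_dominated_convergence (μ := volume)
      (F := fun n x => (√(q x) * w n x - √(q x) * X x) ^ 2) (f := fun _ => (0 : ℝ))
      (fun x => (√(q x) * X x) ^ 2)
      (fun n => by
        have : Continuous fun x => (√(q x) * w n x - √(q x) * X x) ^ 2 := by
          have := hbs.continuous
          simp only [w]
          fun_prop
        exact this.aestronglyMeasurable) (integrable_sq h2)
      (fun n => Eventually.of_forall fun x => by
        rw [Real.norm_of_nonneg (sq_nonneg _)]
        have : (√(q x) * w n x - √(q x) * X x) ^ 2 = (b (t n * x) - 1) ^ 2 * (√(q x) * X x) ^ 2 := by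
          simp only [w]; ring
        rw [this]
        nlinarith [hsq n x, sq_nonneg (√(q x) * X x)])
      (Eventually.of_forall fun x => by
        have := (((hbx x).mul_const (X x)).const_mul (√(q x)) |>.sub_const (√(q x) * X x)).pow 2
        simpa [w] using this)
    simpa using this
  have lim1 : Tendsto (fun n => ∫ x, (deriv (w n) x - deriv X x) ^ 2) atTop (𝓝 0) := by
    have hder : ∀ n, deriv (w n) = fun x => deriv b (t n * x) * t n * X x + b (t n * x) * deriv X x :=
      fun n => funext fun x => (hwd n x).deriv
    have := tendsto_integral_of_dominated_convergence (μ := volume)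
      (F := fun n x => (deriv (w n) x - deriv X x) ^ 2) (f := fun _ => (0 : ℝ))
      (fun x => 2 * C ^ 2 * X x ^ 2 + 2 * deriv X x ^ 2)
      (fun n => by
        have : Continuous fun x => (deriv (w n) x - deriv X x) ^ 2 := by
          have := hbs.continuous
          rw [hder]
          fun_prop
        exact this.aestronglyMeasurable)
      (((integrable_sq h0).const_mul _).add ((integrable_sq h1).const_mul _))
      (fun n => Eventually.of_forall fun x => by
        rw [Real.norm_of_nonneg (sq_nonneg _), hder]
        have e1 : (deriv b (t n * x) * t n) ^ 2 ≤ C ^ 2 := by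
          rw [← sq_abs, abs_mul, abs_of_pos (ht0 n)]
          have := hC (t n * x)
          refine pow_le_pow_left₀ (by have := (ht0 n).le; positivity) ?_ 2
          calc _ ≤ |deriv b (t n * x)| * 1 := by gcongr; exact ht1 n
            _ ≤ C := by linarith
        have e2 := hsq n x
        calc (deriv b (t n * x) * t n * X x + b (t n * x) * deriv X x - deriv X x) ^ 2
            ≤ 2 * ((deriv b (t n * x) * t n) ^ 2 * X x ^ 2) +
              2 * ((b (t n * x) - 1) ^ 2 * deriv X x ^ 2) := by
              nlinarith [sq_nonneg (deriv b (t n * x) * t n * X x - (b (t n * x) - 1) * deriv X x)]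
          _ ≤ 2 * (C ^ 2 * X x ^ 2) + 2 * (1 * deriv X x ^ 2) := by gcongr
          _ = _ := by ring)
      (Eventually.of_forall fun x => by
        have := ((((hb'x x).mul_const (X x)).add ((hbx x).mul_const (deriv X x))).sub_const
          (deriv X x)).pow 2
        simp only [hder]
        simpa using this)
    simpa using this
  obtain ⟨n, ⟨e0, e1⟩, e2⟩ := ((lim0.eventually_le_const hτ).and
    (lim1.eventually_le_const hτ) |>.and
    (lim2.eventually_le_const hτ)).exists
  refine ⟨w n, ?_, ?_, e0, e1, e2⟩
  · have h3 : ContDiff ℝ 1 fun x : ℝ => b (t n * x) :=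
      (hbs.of_le (by simp)).comp (contDiff_const.mul contDiff_id)
    exact h3.mul hX
  · refine hasCompactSupport_of_forall_le_abs (R := 2 / t n) fun x hx => ?_
    have : b (t n * x) = 0 := b.zero_of_le_dist (by
      rw [div_le_iff₀ (ht0 n)] at hx
      simpa [b, abs_mul, abs_of_pos (ht0 n), mul_comm] using hx)
    simp only [w, this, zero_mul]

/-- Functions of finite energy are approximated by smooth compactly supported ones. -/
theorem exists_smooth_approx (hq : Continuous q) (hq0 : ∀ x, 0 ≤ q x) (hX : ContDiff ℝ 1 X)
    (h0 : MemLp X 2 volume) (h1 : MemLp (deriv X) 2 volume)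
    (h2 : MemLp (fun x => √(q x) * X x) 2 volume) {τ : ℝ} (hτ : 0 < τ) :
    ∃ v : ℝ → ℝ, ContDiff ℝ ∞ v ∧ HasCompactSupport v ∧ ∫ x, (v x - X x) ^ 2 ≤ τ ∧
      ∫ x, (deriv v x - deriv X x) ^ 2 ≤ τ ∧ ∫ x, (√(q x) * v x - √(q x) * X x) ^ 2 ≤ τ := by
  obtain ⟨w, hw, hwc, w0, w1, w2⟩ := exists_cutoff_approx hq hX h0 h1 h2 (τ := τ / 4) (by positivity)
  obtain ⟨S, hS, hwS⟩ := exists_forall_le_abs_eq_zero hwc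
  obtain ⟨K, hK⟩ := (isCompact_Icc (a := -(S + 1)) (b := S + 1)).exists_bound_of_continuousOn
    hq.continuousOn
  set K' := max K 1 with hK'
  have hK1 : 1 ≤ K' := le_max_right _ _
  have hKq : ∀ x, |x| ≤ S + 1 → q x ≤ K' := fun x hx =>
    (le_abs_self _).trans ((hK x (abs_le.1 hx)).trans (le_max_left _ _))
  set η := √(τ / (8 * (S + 1) * K')) with hη
  have hη0 : 0 < η := Real.sqrt_pos.2 (by positivity)
  have hη2 : 2 * (S + 1) * (K' * η ^ 2) = τ / 4 := by
    rw [hη, Real.sq_sqrt (by positivity)]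
    field_simp
    norm_num
  obtain ⟨v, hv, hv0, hv0', hvw, hvw'⟩ := exists_smooth_near hw hS hwS hη0
  have hvc : HasCompactSupport v := hasCompactSupport_of_forall_le_abs hv0
  have hvC := hv.continuous
  have hwC := hw.continuous
  have hv'C : Continuous (deriv v) := hv.continuous_deriv (by simp)
  have hw'C : Continuous (deriv w) := hw.continuous_deriv le_rfl
  have hw0' : ∀ x, S + 1 ≤ |x| → deriv w x = 0 := by
    intro x hx
    have : w =ᶠ[𝓝 x] fun _ => 0 := by
      filter_upwards [(continuous_abs.tendsto x).eventually (lt_mem_nhds (show S < |x| by linarith))]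
        with y hy
      exact hwS y (le_of_lt hy)
    rw [this.deriv_eq]
    simp
  have key : ∀ f : ℝ → ℝ, Continuous f → (∀ x, S + 1 ≤ |x| → f x = 0) →
      (∀ x, |x| ≤ S + 1 → f x ^ 2 ≤ K' * η ^ 2) → ∫ x, f x ^ 2 ≤ τ / 4 := by
    intro f hf hf0 hfη
    rw [integral_eq_intervalIntegral (R := S + 1) fun x hx => by rw [hf0 x hx]; ring]
    have h3 : ∫ x in -(S + 1)..(S + 1), f x ^ 2 ≤ ∫ x in -(S + 1)..(S + 1), K' * η ^ 2 :=
      intervalIntegral.integral_mono_on (by linarith) ((hf.pow 2).intervalIntegrable _ _)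
        (by simp) fun x hx => hfη x (abs_le.2 hx)
    rw [intervalIntegral.integral_const, smul_eq_mul] at h3
    linarith
  have hsq : ∀ x : ℝ, |x| ≤ η → x ^ 2 ≤ η ^ 2 := fun x hx => by
    rw [← sq_abs]
    exact pow_le_pow_left₀ (abs_nonneg _) hx 2
  have hηK : η ^ 2 ≤ K' * η ^ 2 := by nlinarith [sq_nonneg η]
  have k0 := key (fun x => v x - w x) (by fun_prop)
    (fun x hx => by rw [hv0 x hx, hwS x (by linarith), sub_zero])
    fun x _ => (hsq _ (hvw x)).trans hηK
  have k1 := key (fun x => deriv v x - deriv w x) (by fun_prop)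
    (fun x hx => by rw [hv0' x hx, hw0' x hx, sub_zero])
    fun x _ => (hsq _ (hvw' x)).trans hηK
  have k2 := key (fun x => √(q x) * v x - √(q x) * w x) (by fun_prop)
    (fun x hx => by rw [hv0 x hx, hwS x (by linarith)]; ring)
    fun x hx => by
      rw [← mul_sub, mul_pow, Real.sq_sqrt (hq0 x)]
      exact mul_le_mul (hKq x hx) (hsq _ (hvw x)) (sq_nonneg _) (by positivity)
  refine ⟨v, hv, hvc, ?_, ?_, ?_⟩
  · have := integral_sq_sub_le (hvC.memLp_of_hasCompactSupport hvc)
      (hwC.memLp_of_hasCompactSupport hwc) h0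
    linarith
  · have := integral_sq_sub_le (hv'C.memLp_of_hasCompactSupport hvc.deriv)
      (hw'C.memLp_of_hasCompactSupport hwc.deriv) h1
    linarith
  · have := integral_sq_sub_le ((hq.sqrt.mul hvC).memLp_of_hasCompactSupport hvc.mul_left)
      ((hq.sqrt.mul hwC).memLp_of_hasCompactSupport hwc.mul_left) h2
    simp only [Pi.mul_apply] at this
    linarith

end Approximation

/-! ### The form of a Laplacian with mixed boundary conditions -/

section Form

variable {Ω Γ : Set (ℝ × ℝ)}

/-- Smooth compactly supported functions on the plane, vanishing near `Γ`. -/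
structure IsTestFunction (Γ : Set (ℝ × ℝ)) (φ : ℝ × ℝ → ℝ) : Prop where
  contDiff : ContDiff ℝ ∞ φ
  hasCompactSupport : HasCompactSupport φ
  disjoint : Disjoint (tsupport φ) Γ

namespace IsTestFunction

variable {φ χ : ℝ × ℝ → ℝ}

theorem zero : IsTestFunction Γ 0 := ⟨contDiff_const, HasCompactSupport.zero, by simp⟩

theorem add (hφ : IsTestFunction Γ φ) (hχ : IsTestFunction Γ χ) : IsTestFunction Γ (φ + χ) :=
  ⟨hφ.contDiff.add hχ.contDiff, hφ.hasCompactSupport.add hχ.hasCompactSupport,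
    (Disjoint.union_left hφ.disjoint hχ.disjoint).mono_left (tsupport_add φ χ)⟩

theorem const_smul (hφ : IsTestFunction Γ φ) (c : ℝ) : IsTestFunction Γ (c • φ) :=
  ⟨hφ.contDiff.const_smul c, hφ.hasCompactSupport.smul_left (f := fun _ => c),
    hφ.disjoint.mono_left (closure_mono (Function.support_const_smul_subset c φ))⟩

theorem memLp (hφ : IsTestFunction Γ φ) : MemLp φ 2 (volume.restrict Ω) :=
  (hφ.contDiff.continuous.memLp_of_hasCompactSupport hφ.hasCompactSupport).restrict Ω

theorem continuous_fderiv (hφ : IsTestFunction Γ φ) (v : ℝ × ℝ) :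
    Continuous fun p => fderiv ℝ φ p v :=
  (hφ.contDiff.continuous_fderiv (by simp)).clm_apply continuous_const

theorem memLp_fderiv (hφ : IsTestFunction Γ φ) (v : ℝ × ℝ) :
    MemLp (fun p => fderiv ℝ φ p v) 2 (volume.restrict Ω) :=
  ((hφ.continuous_fderiv v).memLp_of_hasCompactSupport
    (hφ.hasCompactSupport.fderiv_apply ℝ v)).restrict Ω

theorem fderiv_add (hφ : IsTestFunction Γ φ) (hχ : IsTestFunction Γ χ) (v : ℝ × ℝ) :
    (fun p => fderiv ℝ (φ + χ) p v) = (fun p => fderiv ℝ φ p v) + fun p => fderiv ℝ χ p v :=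
  funext fun p => by
    rw [_root_.fderiv_add (hφ.contDiff.differentiable (by simp) p)
      (hχ.contDiff.differentiable (by simp) p)]
    rfl

theorem fderiv_const_smul (hφ : IsTestFunction Γ φ) (c : ℝ) (v : ℝ × ℝ) :
    (fun p => fderiv ℝ (c • φ) p v) = c • fun p => fderiv ℝ φ p v :=
  funext fun p => by
    rw [_root_.fderiv_const_smul (hφ.contDiff.differentiable (by simp) p)]
    rfl

theorem hasGradVanishingOn (hφ : IsTestFunction Γ φ) :
    HasGradVanishingOn Ω Γ φ (fun p => fderiv ℝ φ p (1, 0)) fun p => fderiv ℝ φ p (0, 1) where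
  memLp := hφ.memLp
  memLp_fst := hφ.memLp_fderiv _
  memLp_snd := hφ.memLp_fderiv _
  approx := ⟨fun _ => φ, fun _ => ⟨hφ.contDiff, hφ.hasCompactSupport, hφ.disjoint⟩,
    by simp, by simp, by simp⟩

end IsTestFunction

namespace HasGradVanishingOn

variable {ψ g₁ g₂ χ k₁ k₂ : ℝ × ℝ → ℝ}

theorem exists_approx (hψ : HasGradVanishingOn Ω Γ ψ g₁ g₂) : ∃ φ : ℕ → ℝ × ℝ → ℝ,
    (∀ n, IsTestFunction Γ (φ n)) ∧
    Tendsto (fun n => ∫ p in Ω, (φ n p - ψ p) ^ 2) atTop (𝓝 0) ∧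
    Tendsto (fun n => ∫ p in Ω, (fderiv ℝ (φ n) p (1, 0) - g₁ p) ^ 2) atTop (𝓝 0) ∧
    Tendsto (fun n => ∫ p in Ω, (fderiv ℝ (φ n) p (0, 1) - g₂ p) ^ 2) atTop (𝓝 0) := by
  obtain ⟨φ, h1, h2⟩ := hψ.approx
  exact ⟨φ, fun n => ⟨(h1 n).1, (h1 n).2.1, (h1 n).2.2⟩, h2⟩

theorem zero : HasGradVanishingOn Ω Γ (fun _ => 0) (fun _ => 0) fun _ => 0 where
  memLp := MemLp.zero'
  memLp_fst := MemLp.zero'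
  memLp_snd := MemLp.zero'
  approx := ⟨fun _ => 0, fun _ => ⟨contDiff_const, HasCompactSupport.zero, by simp⟩,
    by simp, by simp, by simp⟩

theorem tendsto_integral_sq_add {f k : ℕ → ℝ × ℝ → ℝ} {f' k' : ℝ × ℝ → ℝ}
    (hf : ∀ n, MemLp (f n) 2 (volume.restrict Ω)) (hk : ∀ n, MemLp (k n) 2 (volume.restrict Ω))
    (hf' : MemLp f' 2 (volume.restrict Ω)) (hk' : MemLp k' 2 (volume.restrict Ω))
    (h1 : Tendsto (fun n => ∫ p in Ω, (f n p - f' p) ^ 2) atTop (𝓝 0))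
    (h2 : Tendsto (fun n => ∫ p in Ω, (k n p - k' p) ^ 2) atTop (𝓝 0)) :
    Tendsto (fun n => ∫ p in Ω, ((f n + k n) p - (f' p + k' p)) ^ 2) atTop (𝓝 0) := by
  have h3 : Tendsto (fun n => 2 * (∫ p in Ω, (f n p - f' p) ^ 2) +
      2 * ∫ p in Ω, (k n p - k' p) ^ 2) atTop (𝓝 0) := by
    simpa using (h1.const_mul 2).add (h2.const_mul 2)
  refine squeeze_zero (fun n => integral_nonneg fun p => sq_nonneg _) (fun n => ?_) h3
  have a : MemLp (fun p => f n p - f' p) 2 (volume.restrict Ω) := (hf n).sub hf'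
  have b : MemLp (fun p => k n p - k' p) 2 (volume.restrict Ω) := (hk n).sub hk'
  rw [← integral_const_mul, ← integral_const_mul, ← integral_add
    ((integrable_sq a).const_mul 2) ((integrable_sq b).const_mul 2)]
  refine integral_mono_of_nonneg (Eventually.of_forall fun p => sq_nonneg _)
    (((integrable_sq a).const_mul 2).add ((integrable_sq b).const_mul 2))
    (Eventually.of_forall fun p => ?_)
  simp only [Pi.add_apply]
  nlinarith [sq_nonneg (f n p - f' p - (k n p - k' p))]

theorem add (hψ : HasGradVanishingOn Ω Γ ψ g₁ g₂) (hχ : HasGradVanishingOn Ω Γ χ k₁ k₂) :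
    HasGradVanishingOn Ω Γ (fun p => ψ p + χ p) (fun p => g₁ p + k₁ p) fun p => g₂ p + k₂ p := by
  obtain ⟨f, f1, f2, f3, f4⟩ := hψ.exists_approx
  obtain ⟨k, k1, k2, k3, k4⟩ := hχ.exists_approx
  have hfk := fun n => (f1 n).add (k1 n)
  refine ⟨hψ.memLp.add hχ.memLp, hψ.memLp_fst.add hχ.memLp_fst, hψ.memLp_snd.add hχ.memLp_snd,
    fun n => f n + k n, fun n => ⟨(hfk n).contDiff, (hfk n).hasCompactSupport, (hfk n).disjoint⟩,
    tendsto_integral_sq_add (fun n => (f1 n).memLp) (fun n => (k1 n).memLp) hψ.memLp hχ.memLp f2 k2,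
    ?_, ?_⟩
  · have := tendsto_integral_sq_add (fun n => (f1 n).memLp_fderiv (1, 0))
      (fun n => (k1 n).memLp_fderiv (1, 0)) hψ.memLp_fst hχ.memLp_fst f3 k3
    refine this.congr fun n => ?_
    rw [← (f1 n).fderiv_add (k1 n)]
  · have := tendsto_integral_sq_add (fun n => (f1 n).memLp_fderiv (0, 1))
      (fun n => (k1 n).memLp_fderiv (0, 1)) hψ.memLp_snd hχ.memLp_snd f4 k4
    refine this.congr fun n => ?_
    rw [← (f1 n).fderiv_add (k1 n)]

theorem const_mul (hψ : HasGradVanishingOn Ω Γ ψ g₁ g₂) (c : ℝ) :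
    HasGradVanishingOn Ω Γ (fun p => c * ψ p) (fun p => c * g₁ p) fun p => c * g₂ p := by
  obtain ⟨f, f1, f2, f3, f4⟩ := hψ.exists_approx
  have hc := fun n => (f1 n).const_smul c
  have key : ∀ {F : ℕ → ℝ × ℝ → ℝ} {G : ℝ × ℝ → ℝ},
      Tendsto (fun n => ∫ p in Ω, (F n p - G p) ^ 2) atTop (𝓝 0) →
      Tendsto (fun n => ∫ p in Ω, ((c • F n) p - c * G p) ^ 2) atTop (𝓝 0) := by
    intro F G h
    have h1 := h.const_mul (c ^ 2)
    rw [mul_zero] at h1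
    refine h1.congr fun n => ?_
    rw [← integral_const_mul]
    congr 1
    ext p
    simp only [Pi.smul_apply, smul_eq_mul]
    ring
  refine ⟨hψ.memLp.const_mul c, hψ.memLp_fst.const_mul c, hψ.memLp_snd.const_mul c,
    fun n => c • f n, fun n => ⟨(hc n).contDiff, (hc n).hasCompactSupport, (hc n).disjoint⟩,
    key f2, ?_, ?_⟩
  · refine (key f3).congr fun n => ?_
    rw [← (f1 n).fderiv_const_smul]
  · refine (key f4).congr fun n => ?_
    rw [← (f1 n).fderiv_const_smul]

theorem sum {ι : Type*} (s : Finset ι) (a : ι → ℝ) {ψ g₁ g₂ : ι → ℝ × ℝ → ℝ}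
    (h : ∀ i, HasGradVanishingOn Ω Γ (ψ i) (g₁ i) (g₂ i)) :
    HasGradVanishingOn Ω Γ (fun p => ∑ i ∈ s, a i * ψ i p) (fun p => ∑ i ∈ s, a i * g₁ i p)
      fun p => ∑ i ∈ s, a i * g₂ i p := by
  classical
  induction s using Finset.induction_on with
  | empty => simpa using zero
  | insert i s hi ih =>
    simp only [Finset.sum_insert hi]
    exact ((h i).const_mul (a i)).add ih

/-- Quadratic inequalities pass from test functions to their limits. -/
theorem form_bound (hψ : HasGradVanishingOn Ω Γ ψ g₁ g₂) {ι : Type*} [Fintype ι]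
    {w : ι → ℝ × ℝ → ℝ} (hw : ∀ i, MemLp (w i) 2 (volume.restrict Ω)) {c K κ : ℝ}
    (h : ∀ φ, IsTestFunction Γ φ →
      c * ((∫ p in Ω, φ p ^ 2) - ∑ i, (∫ p in Ω, w i p * φ p) ^ 2) ≤
        K * ((∫ p in Ω, (fderiv ℝ φ p (1, 0) ^ 2 + fderiv ℝ φ p (0, 1) ^ 2)) -
          κ * ∫ p in Ω, φ p ^ 2)) :
    c * ((∫ p in Ω, ψ p ^ 2) - ∑ i, (∫ p in Ω, w i p * ψ p) ^ 2) ≤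
      K * ((∫ p in Ω, (g₁ p ^ 2 + g₂ p ^ 2)) - κ * ∫ p in Ω, ψ p ^ 2) := by
  obtain ⟨f, f1, f2, f3, f4⟩ := hψ.exists_approx
  have t0 := tendsto_integral_sq (fun n => (f1 n).memLp) hψ.memLp f2
  have t1 := tendsto_integral_sq (fun n => (f1 n).memLp_fderiv (1, 0)) hψ.memLp_fst f3
  have t2 := tendsto_integral_sq (fun n => (f1 n).memLp_fderiv (0, 1)) hψ.memLp_snd f4
  have t3 := fun i => (tendsto_integral_mul_left (hw i) (fun n => (f1 n).memLp) hψ.memLp f2).pow 2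
  have t4 := (t0.sub (tendsto_finsetSum Finset.univ fun i _ => t3 i)).const_mul c
  have t5 := ((t1.add t2).sub (t0.const_mul κ)).const_mul K
  rw [integral_add (integrable_sq hψ.memLp_fst) (integrable_sq hψ.memLp_snd)]
  refine le_of_tendsto_of_tendsto' t4 t5 fun n => ?_
  have := h _ (f1 n)
  rwa [integral_add (integrable_sq ((f1 n).memLp_fderiv _))
    (integrable_sq ((f1 n).memLp_fderiv _))] at this

end HasGradVanishingOn

namespace IsLaplaceEigensystem

variable {lam : ℕ → ℝ} {Ψ : ℕ → ℝ × ℝ → ℝ}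

/-- The gradients of the eigenfunctions, and their weak equations. -/
theorem exists_grad (hE : IsLaplaceEigensystem Ω Γ lam Ψ) : ∃ g₁ g₂ : ℕ → ℝ × ℝ → ℝ,
    (∀ j, HasGradVanishingOn Ω Γ (Ψ j) (g₁ j) (g₂ j)) ∧
    ∀ j φ k₁ k₂, HasGradVanishingOn Ω Γ φ k₁ k₂ →
      ∫ p in Ω, (k₁ p * g₁ j p + k₂ p * g₂ j p) = lam j * ∫ p in Ω, φ p * Ψ j p := by
  choose g₁ g₂ h1 h2 using hE.eigen
  refine ⟨g₁, g₂, h1, fun j φ k₁ k₂ h => ?_⟩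
  simpa only [mul_comm] using h2 j φ k₁ k₂ h

theorem memLp (hE : IsLaplaceEigensystem Ω Γ lam Ψ) (j : ℕ) :
    MemLp (Ψ j) 2 (volume.restrict Ω) := by
  obtain ⟨g₁, g₂, h, -⟩ := hE.eigen j
  exact h.memLp

/-- The variational bound for the form from the eigenvalue expansion. -/
theorem form_lower_bound (hE : IsLaplaceEigensystem Ω Γ lam Ψ) {T : ℝ × ℝ → ℝ}
    (hT : IsTestFunction Γ T) (N : ℕ) :
    ∑ k ∈ Finset.range N, lam k * (∫ p in Ω, T p * Ψ k p) ^ 2 +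
      lam N * ((∫ p in Ω, T p ^ 2) - ∑ k ∈ Finset.range N, (∫ p in Ω, T p * Ψ k p) ^ 2) ≤
      ∫ p in Ω, (fderiv ℝ T p (1, 0) ^ 2 + fderiv ℝ T p (0, 1) ^ 2) := by
  obtain ⟨g₁, g₂, h1, h2⟩ := hE.exists_grad
  exact eigenvalue_lower_bound hE.memLp hE.orthonormal hE.complete hE.mono
    (fun j => (h1 j).memLp_fst) (fun j => (h1 j).memLp_snd) (hT.memLp_fderiv _) (hT.memLp_fderiv _)
    (fun i j => by simpa only [mul_comm] using h2 i _ _ _ (h1 j)) hT.memLp (fun j => h2 j _ _ _ hT.hasGradVanishingOn) N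

/-- The variational lower bound for an eigenvalue: a form that is positive off `j` linear conditions
is positive on some combination of the first `j + 1` eigenfunctions. -/
theorem le_of_form_bound (hE : IsLaplaceEigensystem Ω Γ lam Ψ) {j : ℕ}
    {w : Fin j → ℝ × ℝ → ℝ} (hw : ∀ i, MemLp (w i) 2 (volume.restrict Ω)) {c K κ : ℝ} (hK : 0 ≤ K)
    (h : ∀ φ, IsTestFunction Γ φ →
      c * ((∫ p in Ω, φ p ^ 2) - ∑ i, (∫ p in Ω, w i p * φ p) ^ 2) ≤
        K * ((∫ p in Ω, (fderiv ℝ φ p (1, 0) ^ 2 + fderiv ℝ φ p (0, 1) ^ 2)) -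
          κ * ∫ p in Ω, φ p ^ 2)) :
    c ≤ K * (lam j - κ) := by
  obtain ⟨g₁, g₂, h1, h2⟩ := hE.exists_grad
  let A : (Fin (j + 1) → ℝ) →ₗ[ℝ] (Fin j → ℝ) :=
    Matrix.toLin' (Matrix.of fun (i : Fin j) (k : Fin (j + 1)) => ∫ p in Ω, w i p * Ψ k p)
  obtain ⟨v, hv, hv0⟩ : ∃ v ∈ LinearMap.ker A, v ≠ 0 :=
    (Submodule.ne_bot_iff _).1 (LinearMap.ker_ne_bot_of_finrank_lt (by simp))
  have hker : ∀ i, ∑ k, v k * ∫ p in Ω, w i p * Ψ k p = 0 := fun i => by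
    have := congrFun (LinearMap.mem_ker.1 hv) i
    simpa [A, Matrix.mulVec, dotProduct, mul_comm] using this
  set S := ∑ k, v k ^ 2 with hS
  have hS0 : 0 < S := by
    obtain ⟨k, hk⟩ : ∃ k, v k ≠ 0 := by
      by_contra! hcon
      exact hv0 (funext hcon)
    exact Finset.sum_pos' (fun k _ => sq_nonneg _) ⟨k, Finset.mem_univ k, by positivity⟩
  set f : ℝ × ℝ → ℝ := fun p => ∑ k : Fin (j + 1), v k * Ψ k p with hf
  have hfg := HasGradVanishingOn.sum Finset.univ v fun k : Fin (j + 1) => h1 k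
  have hfΨ : ∀ k : Fin (j + 1), ∫ p in Ω, f p * Ψ k p = v k := by
    intro k
    simp only [hf, Finset.sum_mul, mul_assoc]
    rw [integral_finsetSum]
    · simp only [integral_const_mul, hE.orthonormal, Fin.val_inj]
      simp
    · exact fun i _ => (integrable_mul (hE.memLp i) (hE.memLp k)).const_mul _
  have hff : ∫ p in Ω, f p ^ 2 = S := by
    have : ∀ p, f p ^ 2 = ∑ k, v k * (f p * Ψ k p) := fun p => by
      calc _ = (∑ k : Fin (j + 1), v k * Ψ k p) * f p := sq (f p)
        _ = _ := by
          rw [Finset.sum_mul]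
          exact Finset.sum_congr rfl fun k _ => by ring
    simp only [this]
    rw [integral_finsetSum]
    · simp only [integral_const_mul, hfΨ, hS, sq]
    · exact fun i _ => (integrable_mul hfg.memLp (hE.memLp i)).const_mul _
  have hfw : ∀ i, ∫ p in Ω, w i p * f p = 0 := by
    intro i
    have : ∀ p, w i p * f p = ∑ k, v k * (w i p * Ψ k p) := fun p => by
      rw [hf, Finset.mul_sum]
      exact Finset.sum_congr rfl fun k _ => by ring
    simp only [this]
    rw [integral_finsetSum]
    · simp only [integral_const_mul]
      exact hker i
    · exact fun k _ => (integrable_mul (hw i) (hE.memLp k)).const_mul _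
  have hgrad : ∫ p in Ω, ((∑ k : Fin (j + 1), v k * g₁ k p) ^ 2 +
      (∑ k : Fin (j + 1), v k * g₂ k p) ^ 2) = ∑ k : Fin (j + 1), lam k * v k ^ 2 := by
    have : ∀ p, (∑ k : Fin (j + 1), v k * g₁ k p) ^ 2 + (∑ k : Fin (j + 1), v k * g₂ k p) ^ 2 =
        ∑ k : Fin (j + 1), v k * ((∑ i : Fin (j + 1), v i * g₁ i p) * g₁ k p +
          (∑ i : Fin (j + 1), v i * g₂ i p) * g₂ k p) := fun p => by
      simp only [mul_add, Finset.sum_add_distrib]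
      rw [sq, sq]
      congr 1
      · conv_lhs => rw [Finset.sum_mul]
        exact Finset.sum_congr rfl fun k _ => by ring
      · conv_lhs => rw [Finset.sum_mul]
        exact Finset.sum_congr rfl fun k _ => by ring
    simp only [this]
    rw [integral_finsetSum]
    · refine Finset.sum_congr rfl fun k _ => ?_
      rw [integral_const_mul, h2 k _ _ _ hfg, hfΨ k]
      ring
    · exact fun k _ => ((integrable_mul hfg.memLp_fst (h1 k).memLp_fst).add
        (integrable_mul hfg.memLp_snd (h1 k).memLp_snd)).const_mul _
  have key := hfg.form_bound hw h
  rw [hff, hgrad] at key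
  have hz : ∑ i, (∫ p in Ω, w i p * ∑ k : Fin (j + 1), v k * Ψ k p) ^ 2 = 0 :=
    Finset.sum_eq_zero fun i _ => by rw [hfw i]; ring
  rw [hz, sub_zero] at key
  have h3 : ∑ k : Fin (j + 1), lam k * v k ^ 2 ≤ lam j * S := by
    rw [hS, Finset.mul_sum]
    refine Finset.sum_le_sum fun k _ => ?_
    have : lam k ≤ lam j := hE.mono (Nat.lt_succ_iff.1 k.2)
    gcongr
  have h4 : c * S ≤ K * (lam j - κ) * S :=
    key.trans (by
      calc _ ≤ K * (lam j * S - κ * S) := by gcongr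
        _ = _ := by ring)
  exact le_of_mul_le_mul_right h4 hS0

end IsLaplaceEigensystem

/-- The triples `(φ, ∂φ/∂x, ∂φ/∂y)` for test functions `φ`. -/
noncomputable def laplaceTriples (Γ : Set (ℝ × ℝ)) : Submodule ℝ (Fin 3 → ℝ × ℝ → ℝ) where
  carrier := {d | ∃ φ, IsTestFunction Γ φ ∧
    d = ![φ, fun p => fderiv ℝ φ p (1, 0), fun p => fderiv ℝ φ p (0, 1)]}
  add_mem' := by
    rintro _ _ ⟨φ, h1, rfl⟩ ⟨χ, h2, rfl⟩
    refine ⟨φ + χ, h1.add h2, ?_⟩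
    rw [h1.fderiv_add h2, h1.fderiv_add h2]
    simp
  zero_mem' := ⟨0, IsTestFunction.zero, by
    ext i x
    fin_cases i <;> simp⟩
  smul_mem' := by
    rintro c _ ⟨φ, h1, rfl⟩
    refine ⟨c • φ, h1.const_smul c, ?_⟩
    rw [h1.fderiv_const_smul, h1.fderiv_const_smul]
    simp

/-- The Laplacian has discrete spectrum as soon as its form domain embeds compactly in `L²`. -/
theorem exists_isLaplaceEigensystem_of_compact
    (hC : ∀ δ : ℝ, 0 < δ → ∃ (κ : Type) (_ : Fintype κ) (g : κ → ℝ × ℝ → ℝ),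
      (∀ k, MemLp (g k) 2 (volume.restrict Ω)) ∧
      ∀ φ, IsTestFunction Γ φ → ∫ p in Ω, φ p ^ 2 ≤
        δ * ((∫ p in Ω, φ p ^ 2) + (∫ p in Ω, fderiv ℝ φ p (1, 0) ^ 2) +
          ∫ p in Ω, fderiv ℝ φ p (0, 1) ^ 2) + ∑ k, (∫ p in Ω, g k p * φ p) ^ 2)
    (hd : ∀ f, MemLp f 2 (volume.restrict Ω) →
      (∀ φ, IsTestFunction Γ φ → ∫ p in Ω, f p * φ p = 0) → f =ᵐ[volume.restrict Ω] 0)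
    (hinf : ¬ FiniteDimensional ℝ (Lp ℝ 2 (volume.restrict Ω))) :
    ∃ (lam : ℕ → ℝ) (Ψ : ℕ → ℝ × ℝ → ℝ), IsLaplaceEigensystem Ω Γ lam Ψ := by
  obtain ⟨ν, w, hmono, htend, hw, happ, heq, horth, hcomp⟩ :=
    exists_eigensystem_of_compact (μ := volume.restrict Ω) (laplaceTriples Γ)
      (by
        rintro _ ⟨φ, h1, rfl⟩ i
        fin_cases i
        · exact h1.memLp
        · exact h1.memLp_fderiv _
        · exact h1.memLp_fderiv _)
      (fun δ hδ => by
        obtain ⟨κ, hκ, g, hg, h⟩ := hC δ hδ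
        refine ⟨κ, hκ, g, hg, ?_⟩
        rintro _ ⟨φ, h1, rfl⟩
        simpa [Fin.sum_univ_three] using h φ h1)
      (fun f hf h0 => hd f hf fun φ hφ => h0 _ ⟨φ, hφ, rfl⟩) hinf
  refine ⟨fun j => ν j - 1, fun j => w j 0, fun i j hij => sub_le_sub_right (hmono hij) 1,
    tendsto_atTop_add_const_right _ (-1) htend, fun j => ⟨w j 1, w j 2, ⟨hw j 0, hw j 1, hw j 2, ?_⟩,
      fun φ k₁ k₂ hφ => ?_⟩, horth, hcomp⟩
  · obtain ⟨d, hd, hlim⟩ := happ j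
    choose φ hφ hdφ using hd
    refine ⟨φ, fun n => ⟨(hφ n).contDiff, (hφ n).hasCompactSupport, (hφ n).disjoint⟩, ?_, ?_, ?_⟩
    · simpa [hdφ] using hlim 0
    · simpa [hdφ] using hlim 1
    · simpa [hdφ] using hlim 2
  · obtain ⟨f, f1, f2, f3, f4⟩ := hφ.exists_approx
    have t0 := tendsto_integral_mul_left (hw j 0) (fun n => (f1 n).memLp) hφ.memLp f2
    have t1 := tendsto_integral_mul_left (hw j 1) (fun n => (f1 n).memLp_fderiv (1, 0))
      hφ.memLp_fst f3
    have t2 := tendsto_integral_mul_left (hw j 2) (fun n => (f1 n).memLp_fderiv (0, 1))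
      hφ.memLp_snd f4
    rw [integral_add (integrable_mul (hw j 1) hφ.memLp_fst) (integrable_mul (hw j 2) hφ.memLp_snd)]
    refine tendsto_nhds_unique (t1.add t2) ((t0.const_mul (ν j - 1)).congr fun n => ?_)
    have := heq j _ ⟨f n, f1 n, rfl⟩
    rw [Fin.sum_univ_three] at this
    simp only [Matrix.cons_val_zero, Matrix.cons_val_one, Matrix.cons_val] at this
    linarith

end Form

/-! ### Slices of the strip -/

section Slice

variable {G : ℝ × ℝ → ℝ}

theorem hasDerivAt_slice_fst (hG : ContDiff ℝ 1 G) (x y : ℝ) :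
    HasDerivAt (fun x => G (x, y)) (fderiv ℝ G (x, y) (1, 0)) x :=
  ((hG.differentiable one_ne_zero (x, y)).hasFDerivAt).comp_hasDerivAt x
    ((hasDerivAt_id x).prodMk (hasDerivAt_const x y))

theorem hasDerivAt_slice_snd (hG : ContDiff ℝ 1 G) (x y : ℝ) :
    HasDerivAt (fun y => G (x, y)) (fderiv ℝ G (x, y) (0, 1)) y :=
  ((hG.differentiable one_ne_zero (x, y)).hasFDerivAt).comp_hasDerivAt y
    ((hasDerivAt_const y x).prodMk (hasDerivAt_id y))

theorem continuous_fderiv_apply (hG : ContDiff ℝ 1 G) (v : ℝ × ℝ) :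
    Continuous fun p => fderiv ℝ G p v :=
  (hG.continuous_fderiv one_ne_zero).clm_apply continuous_const

theorem hasDerivAt_integral_slice (hG : ContDiff ℝ 1 G) {e : ℝ → ℝ} (he : Continuous e) (c d x : ℝ) :
    HasDerivAt (fun x => ∫ y in c..d, G (x, y) * e y)
      (∫ y in c..d, fderiv ℝ G (x, y) (1, 0) * e y) x := by
  have hGc := hG.continuous
  have hG' := continuous_fderiv_apply hG (1, 0)
  obtain ⟨C, hC⟩ := ((isCompact_Icc (a := x - 1) (b := x + 1)).prod
    (isCompact_uIcc (a := c) (b := d))).exists_bound_of_continuousOn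
    (f := fun p : ℝ × ℝ => fderiv ℝ G p (1, 0) * e p.2) (by fun_prop)
  refine (intervalIntegral.hasDerivAt_integral_of_dominated_loc_of_deriv_le
    (F := fun x y => G (x, y) * e y) (F' := fun x y => fderiv ℝ G (x, y) (1, 0) * e y)
    (bound := fun _ => C) (s := Set.Icc (x - 1) (x + 1)) (Icc_mem_nhds (by linarith) (by linarith))
    (Eventually.of_forall fun x => ?_) ?_ ?_ ?_ (by simp) ?_).2
  · exact (Continuous.aestronglyMeasurable (by fun_prop))
  · exact Continuous.intervalIntegrable (by fun_prop) _ _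
  · exact (Continuous.aestronglyMeasurable (by fun_prop))
  · exact Eventually.of_forall fun y hy t ht => hC (t, y) ⟨ht, Set.uIoc_subset_uIcc hy⟩
  · exact Eventually.of_forall fun y _ t _ => (hasDerivAt_slice_fst hG t y).mul_const (e y)

theorem contDiff_integral_slice (hG : ContDiff ℝ 1 G) {e : ℝ → ℝ} (he : Continuous e) (c d : ℝ) :
    ContDiff ℝ 1 fun x => ∫ y in c..d, G (x, y) * e y := by
  rw [contDiff_one_iff_deriv]
  refine ⟨fun x => (hasDerivAt_integral_slice hG he c d x).differentiableAt, ?_⟩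
  have : deriv (fun x => ∫ y in c..d, G (x, y) * e y) =
      fun x => ∫ y in c..d, fderiv ℝ G (x, y) (1, 0) * e y :=
    funext fun x => (hasDerivAt_integral_slice hG he c d x).deriv
  rw [this]
  have hG' := continuous_fderiv_apply hG (1, 0)
  exact intervalIntegral.continuous_parametric_intervalIntegral_of_continuous' (by fun_prop) c d

end Slice

section Strip

variable {a b ε : ℝ} {h : ℝ → ℝ}

/-- The profile continued as a constant beyond the end points of the segment. -/
noncomputable def clampedProfile (a b : ℝ) (hab : -a ≤ b) (h : ℝ → ℝ) (x : ℝ) : ℝ :=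
  h (Set.projIcc (-a) b hab x)

theorem clampedProfile_eq (hab : -a ≤ b) {x : ℝ} (hx : x ∈ Set.Icc (-a) b) :
    clampedProfile a b hab h x = h x := by
  rw [clampedProfile, Set.projIcc_of_mem hab hx]

theorem continuous_clampedProfile (hab : -a ≤ b) (hc : ContinuousOn h (Set.Icc (-a) b)) :
    Continuous (clampedProfile a b hab h) :=
  (continuousOn_iff_continuous_domRestrict.1 hc).comp continuous_projIcc

theorem isOpen_strip (hc : ContinuousOn h (Set.Icc (-a) b)) : IsOpen (strip a b h ε) := by
  rcases le_or_gt (-a) b with hab | hab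
  · have h1 := continuous_clampedProfile hab hc
    have h2 : strip a b h ε =
        {p : ℝ × ℝ | -a < p.1 ∧ p.1 < b ∧ 0 < p.2 ∧ p.2 < ε * clampedProfile a b hab h p.1} := by
      ext p
      simp only [strip, Set.mem_ofPred_eq]
      refine and_congr_right fun h3 => and_congr_right fun h4 => ?_
      rw [clampedProfile_eq hab ⟨h3.le, h4.le⟩]
    rw [h2]
    exact (isOpen_lt continuous_const continuous_fst).inter
      ((isOpen_lt continuous_fst continuous_const).inter
        ((isOpen_lt continuous_const continuous_snd).inter
          (isOpen_lt continuous_snd (by fun_prop))))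
  · have : strip a b h ε = ∅ := by
      ext p
      simp only [strip, Set.mem_ofPred_eq, Set.mem_empty_iff_false, iff_false]
      intro h1
      linarith [h1.1, h1.2.1]
    rw [this]
    exact isOpen_empty

/-- Integration over the strip, slice by slice. -/
theorem setIntegral_strip (hc : ContinuousOn h (Set.Icc (-a) b)) (hab : -a ≤ b)
    (hpos : ∀ x ∈ Set.Icc (-a) b, 0 < ε * h x) {F : ℝ × ℝ → ℝ}
    (hF : IntegrableOn F (strip a b h ε)) :
    ∫ p in strip a b h ε, F p = ∫ x in (-a)..b, ∫ y in (0 : ℝ)..(ε * h x), F (x, y) := by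
  have hm : MeasurableSet (strip a b h ε) := (isOpen_strip hc).measurableSet
  rw [← integral_indicator hm, Measure.volume_eq_prod, integral_prod _ (by
      rw [← Measure.volume_eq_prod]; exact (integrable_indicator_iff hm).2 hF),
    intervalIntegral.integral_of_le hab, integral_Ioc_eq_integral_Ioo,
    ← integral_indicator measurableSet_Ioo]
  congr 1
  ext x
  by_cases hx : x ∈ Set.Ioo (-a) b
  · rw [Set.indicator_of_mem hx, intervalIntegral.integral_of_le
      (hpos x (Set.Ioo_subset_Icc_self hx)).le, integral_Ioc_eq_integral_Ioo,
      ← integral_indicator measurableSet_Ioo]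
    congr 1
    ext y
    by_cases hy : y ∈ Set.Ioo 0 (ε * h x)
    · rw [Set.indicator_of_mem hy, Set.indicator_of_mem]
      exact ⟨hx.1, hx.2, hy.1, hy.2⟩
    · rw [Set.indicator_of_notMem hy, Set.indicator_of_notMem]
      exact fun hxy => hy ⟨hxy.2.2.1, hxy.2.2.2⟩
  · rw [Set.indicator_of_notMem hx]
    refine integral_eq_zero_of_ae (Eventually.of_forall fun y => ?_)
    exact Set.indicator_of_notMem (fun hxy => hx ⟨hxy.1, hxy.2.1⟩) _

theorem disjoint_strip_dirichletPart (hc : ContinuousOn h (Set.Icc (-a) b)) (bc : EndCondition) :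
    Disjoint (strip a b h ε) (dirichletPart a b h ε bc) := by
  cases bc with
  | dirichlet => exact (disjoint_frontier_iff_isOpen.2 (isOpen_strip hc)).symm
  | neumann =>
    rw [Set.disjoint_left]
    rintro p ⟨-, -, h3, h4⟩ ⟨-, h5 | h5⟩
    · exact h3.ne' h5
    · exact h4.ne h5

/-- The two curves `y = 0` and `y = ε h(x)` belong to the Dirichlet part of the boundary. -/
theorem curves_subset_dirichletPart (hc : ContinuousOn h (Set.Icc (-a) b)) (hab : -a < b)
    (hpos : ∀ x ∈ Set.Icc (-a) b, 0 < ε * h x) (bc : EndCondition) :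
    {p : ℝ × ℝ | p.1 ∈ Set.Icc (-a) b ∧ (p.2 = 0 ∨ p.2 = ε * h p.1)} ⊆
      dirichletPart a b h ε bc := by
  cases bc with
  | neumann => exact fun p hp => hp
  | dirichlet =>
    rintro ⟨x, y⟩ ⟨hx, hy⟩
    simp only at hx hy
    show (x, y) ∈ frontier (strip a b h ε)
    rw [frontier, (isOpen_strip hc).interior_eq]
    refine ⟨?_, ?_⟩
    · have h1 := continuous_clampedProfile hab.le hc
      let f : ℝ × ℝ → ℝ × ℝ := fun p => (p.1, p.2 * (ε * clampedProfile a b hab.le h p.1))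
      have hf : Continuous f := by fun_prop
      have h2 : ∀ t ∈ Set.Icc (0 : ℝ) 1, f (x, t) ∈ closure (strip a b h ε) := by
        intro t ht
        have h3 : (x, t) ∈ closure (Set.Ioo (-a) b ×ˢ Set.Ioo (0 : ℝ) 1) := by
          rw [closure_prod_eq, closure_Ioo hab.ne, closure_Ioo zero_ne_one]
          exact ⟨hx, ht⟩
        refine closure_mono ?_ (image_closure_subset_closure_image hf ⟨_, h3, rfl⟩)
        rintro _ ⟨⟨s, r⟩, ⟨hs, hr⟩, rfl⟩
        have h4 := hpos s (Set.Ioo_subset_Icc_self hs)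
        simp only at hs hr
        refine ⟨hs.1, hs.2, ?_, ?_⟩
        · simp only [f, clampedProfile_eq hab.le (Set.Ioo_subset_Icc_self hs)]
          exact mul_pos hr.1 h4
        · simp only [f, clampedProfile_eq hab.le (Set.Ioo_subset_Icc_self hs)]
          nlinarith [hr.2]
      rcases hy with hy | hy
      · have := h2 0 (by simp)
        simpa [f, hy] using this
      · have := h2 1 (by simp)
        simpa [f, hy, clampedProfile_eq hab.le hx] using this
    · rintro ⟨-, -, h3, h4⟩
      rcases hy with hy | hy
      · exact h3.ne' hy
      · exact h4.ne hy

/-- Over the segment `[-a, b]` the support of `G` lies strictly between the two curves. -/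
def IsSupportedInStrip (a b : ℝ) (h : ℝ → ℝ) (ε : ℝ) (G : ℝ × ℝ → ℝ) : Prop :=
  ∀ p ∈ tsupport G, p.1 ∈ Set.Icc (-a) b → 0 < p.2 ∧ p.2 < ε * h p.1

/-- A test function agrees on the strip with a smooth function vanishing above and below the strip. The
test function itself may be nonzero above the strip, where it can also meet the continuations of the two
curves beyond `[-a, b]` if the condition at the ends is Neumann's. -/
theorem exists_zero_extension (hc : ContinuousOn h (Set.Icc (-a) b)) (hab : -a < b)
    (hpos : ∀ x ∈ Set.Icc (-a) b, 0 < ε * h x) {bc : EndCondition} {φ : ℝ × ℝ → ℝ}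
    (hφ : IsTestFunction (dirichletPart a b h ε bc) φ) :
    ∃ G : ℝ × ℝ → ℝ, ContDiff ℝ ∞ G ∧ HasCompactSupport G ∧ IsSupportedInStrip a b h ε G ∧
      (∀ p ∈ strip a b h ε, G p = φ p) ∧ ∀ p ∈ strip a b h ε, fderiv ℝ G p = fderiv ℝ φ p := by
  classical
  have h1 := continuous_clampedProfile hab.le hc
  set k := clampedProfile a b hab.le h with hk
  have hkh : ∀ x ∈ Set.Icc (-a) b, k x = h x := fun x hx => clampedProfile_eq hab.le hx
  have hφΓ : ∀ p ∈ tsupport φ, p.1 ∈ Set.Icc (-a) b → ¬ (p.2 = 0 ∨ p.2 = ε * k p.1) := by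
    intro p hp hpx hp2
    rw [hkh _ hpx] at hp2
    exact Set.disjoint_left.1 hφ.disjoint hp (curves_subset_dirichletPart hc hab hpos bc ⟨hpx, hp2⟩)
  let C : Set (ℝ × ℝ) := {p | p.2 = 0} ∪ {p | p.2 = ε * k p.1}
  have hCc : IsClosed C := (isClosed_eq continuous_snd continuous_const).union
    (isClosed_eq continuous_snd (by fun_prop))
  let P : Set ℝ := Prod.fst '' (tsupport φ ∩ C)
  have hP : IsClosed P :=
    ((hφ.hasCompactSupport.isCompact.inter_right hCc).image continuous_fst).isClosed
  have hPd : Disjoint P (Set.Icc (-a) b) := by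
    rw [Set.disjoint_left]
    rintro _ ⟨p, ⟨hp, hpC⟩, rfl⟩ hx
    exact hφΓ p hp hx hpC
  -- cut off near the abscissas beyond `[-a, b]` where the support of `φ` meets the two curves
  obtain ⟨χ, hχ0, hχ1, -⟩ := exists_contMDiffMap_zero_one_nhds_of_isClosed (n := (⊤ : ℕ∞))
    (modelWithCornersSelf ℝ ℝ) hP isClosed_Icc hPd
  have hχs : ContDiff ℝ ∞ χ := χ.contMDiff.contDiff
  let U : Set (ℝ × ℝ) := {p | 0 < p.2 ∧ p.2 < ε * k p.1}
  have hU : IsOpen U := (isOpen_lt continuous_const continuous_snd).inter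
    (isOpen_lt continuous_snd (by fun_prop))
  let V : Set (ℝ × ℝ) := {p | p.2 < 0} ∪ {p | ε * k p.1 < p.2}
  have hV : IsOpen V := (isOpen_lt continuous_snd continuous_const).union
    (isOpen_lt (by fun_prop) continuous_snd)
  let g : ℝ × ℝ → ℝ := fun p => χ p.1 * φ p
  have hg : ContDiff ℝ ∞ g := (hχs.comp contDiff_fst).mul hφ.contDiff
  let G : ℝ × ℝ → ℝ := U.indicator g
  have hVU : Disjoint V U := by
    rw [Set.disjoint_left]
    rintro p (hp | hp) ⟨h2, h3⟩
    · exact absurd hp (not_lt.2 h2.le)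
    · exact absurd hp (not_lt.2 h3.le)
  have hGU : ∀ p ∈ U, G =ᶠ[𝓝 p] g := fun p hp => by
    filter_upwards [hU.mem_nhds hp] with r hr
    exact Set.indicator_of_mem hr g
  have hGV : ∀ p ∈ V, G =ᶠ[𝓝 p] 0 := fun p hp => by
    filter_upwards [hV.mem_nhds hp] with r hr
    exact Set.indicator_of_notMem (Set.disjoint_left.1 hVU hr) g
  have hGC : ∀ p ∈ C, G =ᶠ[𝓝 p] 0 := fun p hp => by
    by_cases hpφ : p ∈ tsupport φ
    · have h2 : ∀ᶠ x in 𝓝 p.1, χ x = 0 := by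
        rw [eventually_nhdsSet_iff_forall] at hχ0
        exact hχ0 p.1 ⟨p, ⟨hpφ, hp⟩, rfl⟩
      filter_upwards [(continuous_fst.tendsto p).eventually h2] with r hr
      simp [G, g, Set.indicator_apply, hr]
    · filter_upwards [(isClosed_tsupport φ).isOpen_compl.mem_nhds hpφ] with r hr
      simp [G, g, Set.indicator_apply, image_eq_zero_of_notMem_tsupport hr]
  have hUVC : ∀ p, p ∈ U ∨ p ∈ V ∨ p ∈ C := fun p => by
    rcases lt_trichotomy p.2 0 with h2 | h2 | h2
    · exact Or.inr (Or.inl (Or.inl h2))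
    · exact Or.inr (Or.inr (Or.inl h2))
    · rcases lt_trichotomy p.2 (ε * k p.1) with h3 | h3 | h3
      · exact Or.inl ⟨h2, h3⟩
      · exact Or.inr (Or.inr (Or.inr h3))
      · exact Or.inr (Or.inl (Or.inr h3))
  have hstrip : ∀ p ∈ strip a b h ε, G =ᶠ[𝓝 p] φ := by
    rintro p ⟨h2, h3, h4, h5⟩
    have hx : p.1 ∈ Set.Icc (-a) b := ⟨h2.le, h3.le⟩
    have h6 : ∀ᶠ x in 𝓝 p.1, χ x = 1 := by
      rw [eventually_nhdsSet_iff_forall] at hχ1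
      exact hχ1 _ hx
    filter_upwards [hGU p ⟨h4, by rwa [hkh _ hx]⟩, (continuous_fst.tendsto p).eventually h6]
      with r hr1 hr2
    rw [hr1]
    simp only [g, hr2, one_mul]
  refine ⟨G, ?_, ?_, ?_, fun p hp => (hstrip p hp).eq_of_nhds,
    fun p hp => (hstrip p hp).fderiv_eq⟩
  · rw [contDiff_iff_contDiffAt]
    intro p
    rcases hUVC p with hp | hp | hp
    · exact hg.contDiffAt.congr_of_eventuallyEq (hGU p hp)
    · exact contDiffAt_const.congr_of_eventuallyEq (hGV p hp)
    · exact contDiffAt_const.congr_of_eventuallyEq (hGC p hp)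
  · refine hφ.hasCompactSupport.mono fun p hp => ?_
    rw [Function.mem_support] at hp ⊢
    intro h0
    apply hp
    simp [G, g, Set.indicator_apply, h0]
  · intro p hp hx
    have hnz : ¬ G =ᶠ[𝓝 p] 0 := by
      rwa [← notMem_tsupport_iff_eventuallyEq, not_not]
    rcases hUVC p with h2 | h2 | h2
    · have := h2
      rw [← hkh _ hx]
      exact this
    · exact absurd (hGV p h2) hnz
    · exact absurd (hGC p h2) hnz

/-- Integration over the strip of a continuous function vanishing above and below it. -/
theorem setIntegral_strip_eq (hc : ContinuousOn h (Set.Icc (-a) b))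
    (hab : -a ≤ b) (hpos : ∀ x ∈ Set.Icc (-a) b, 0 < ε * h x) {F : ℝ × ℝ → ℝ} (hF : Continuous F)
    (hF0 : ∀ x ∈ Set.Icc (-a) b, ∀ y ∉ Set.Ioo 0 (ε * h x), F (x, y) = 0) {L : ℝ}
    (hL : ∀ x ∈ Set.Icc (-a) b, ε * h x ≤ L) :
    ∫ p in strip a b h ε, F p = ∫ x in (-a)..b, ∫ y in (0 : ℝ)..L, F (x, y) := by
  have hsub : strip a b h ε ⊆ Set.Icc (-a) b ×ˢ Set.Icc 0 L := by
    rintro p ⟨h1, h2, h3, h4⟩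
    exact ⟨⟨h1.le, h2.le⟩, h3.le, h4.le.trans (hL _ ⟨h1.le, h2.le⟩)⟩
  rw [setIntegral_strip hc hab hpos ((hF.continuousOn.integrableOn_compact
    (isCompact_Icc.prod isCompact_Icc)).mono_set hsub)]
  refine intervalIntegral.integral_congr fun x hx => ?_
  rw [Set.uIcc_of_le hab] at hx
  have h5 : Continuous fun y => F (x, y) := by fun_prop
  have h6 := intervalIntegral.integral_add_adjacent_intervals (h5.intervalIntegrable 0 (ε * h x))
    (h5.intervalIntegrable (ε * h x) L) (μ := volume)
  have h7 : ∫ y in (ε * h x)..L, F (x, y) = 0 := by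
    rw [intervalIntegral.integral_congr (g := fun _ => (0 : ℝ)) fun y hy => ?_]
    · simp
    · rw [Set.uIcc_of_le (hL x hx)] at hy
      exact hF0 x hx y fun hy' => absurd hy.1 (not_le.2 hy'.2)
  rw [h7, add_zero] at h6
  exact h6

namespace IsSupportedInStrip

variable {G : ℝ × ℝ → ℝ}

theorem eq_zero (hs : IsSupportedInStrip a b h ε G) {x y : ℝ} (hx : x ∈ Set.Icc (-a) b)
    (hy : y ∉ Set.Ioo 0 (ε * h x)) : G (x, y) = 0 :=
  image_eq_zero_of_notMem_tsupport fun hp => hy (hs _ hp hx)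

theorem fderiv_eq_zero (hs : IsSupportedInStrip a b h ε G) {x y : ℝ} (hx : x ∈ Set.Icc (-a) b)
    (hy : y ∉ Set.Ioo 0 (ε * h x)) : fderiv ℝ G (x, y) = 0 := by
  have h1 : (x, y) ∉ tsupport G := fun hp => hy (hs _ hp hx)
  rw [notMem_tsupport_iff_eventuallyEq] at h1
  rw [h1.fderiv_eq]
  simp

end IsSupportedInStrip

end Strip

/-! ### The spectrum of the strip -/

section Compactness

theorem continuous_intervalIntegral_slice {F : ℝ × ℝ → ℝ} (hF : Continuous F) (c d : ℝ) :
    Continuous fun x => ∫ y in c..d, F (x, y) :=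
  intervalIntegral.continuous_parametric_intervalIntegral_of_continuous' (by fun_prop) c d

theorem sum_intervalIntegral_cells {f : ℝ → ℝ} (hf : Continuous f) (c l : ℝ) (n : ℕ) :
    ∑ k : Fin n, ∫ x in (c + (k : ℕ) * l)..(c + ((k : ℕ) + 1 : ℕ) * l), f x =
      ∫ x in c..(c + n * l), f x := by
  have := intervalIntegral.sum_integral_adjacent_intervals (μ := volume) (f := f)
    (a := fun k : ℕ => c + k * l) (n := n) fun k _ => hf.intervalIntegrable _ _
  rw [← Fin.sum_univ_eq_sum_range (fun k : ℕ => ∫ x in (c + (k : ℕ) * l)..(c + (k + 1 : ℕ) * l), f x)]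
    at this
  simpa using this

/-- The Poincaré inequality on a rectangle divided into small cells. -/
theorem integral_integral_sq_le_sum_cells {G : ℝ × ℝ → ℝ} (hG : ContDiff ℝ 1 G) {c c' l l' : ℝ}
    (hl : 0 < l) (hl' : 0 < l') (n : ℕ) :
    ∫ x in c..(c + n * l), ∫ y in c'..(c' + n * l'), G (x, y) ^ 2 ≤
      l ^ 2 * (∫ x in c..(c + n * l), ∫ y in c'..(c' + n * l'), fderiv ℝ G (x, y) (1, 0) ^ 2) +
      l' ^ 2 * (∫ x in c..(c + n * l), ∫ y in c'..(c' + n * l'), fderiv ℝ G (x, y) (0, 1) ^ 2) +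
      ∑ k : Fin n, ∑ i : Fin n, l⁻¹ * l'⁻¹ *
        (∫ x in (c + (i : ℕ) * l)..(c + ((i : ℕ) + 1 : ℕ) * l),
          ∫ y in (c' + (k : ℕ) * l')..(c' + ((k : ℕ) + 1 : ℕ) * l'), G (x, y)) ^ 2 := by
  have hGc := hG.continuous
  have hGx := continuous_fderiv_apply hG (1, 0)
  have hGy := continuous_fderiv_apply hG (0, 1)
  have hcn : c ≤ c + n * l := by
    have : 0 ≤ (n : ℝ) * l := by positivity
    linarith
  let u : Fin n → ℝ → ℝ := fun k x =>
    ∫ y in (c' + (k : ℕ) * l')..(c' + ((k : ℕ) + 1 : ℕ) * l'), G (x, y)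
  have hcell : ∀ k : Fin n, c' + (k : ℕ) * l' ≤ c' + ((k : ℕ) + 1 : ℕ) * l' := fun k => by
    push_cast; nlinarith
  have hcell' : ∀ k : Fin n, c' + ((k : ℕ) + 1 : ℕ) * l' - (c' + (k : ℕ) * l') = l' := fun k => by
    push_cast; ring
  have hud : ∀ k x, HasDerivAt (u k) (∫ y in (c' + (k : ℕ) * l')..(c' + ((k : ℕ) + 1 : ℕ) * l'),
      fderiv ℝ G (x, y) (1, 0)) x := fun k x => by
    simpa only [mul_one, Pi.one_apply] using hasDerivAt_integral_slice hG continuous_one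
      (c' + (k : ℕ) * l') (c' + ((k : ℕ) + 1 : ℕ) * l') x
  have hu1 : ∀ k, ContDiff ℝ 1 (u k) := fun k => by
    simpa only [mul_one, Pi.one_apply] using contDiff_integral_slice hG continuous_one
      (c' + (k : ℕ) * l') (c' + ((k : ℕ) + 1 : ℕ) * l')
  have h1 : ∀ x, ∫ y in c'..(c' + n * l'), G (x, y) ^ 2 ≤
      l' ^ 2 * (∫ y in c'..(c' + n * l'), fderiv ℝ G (x, y) (0, 1) ^ 2) +
        ∑ k : Fin n, l'⁻¹ * u k x ^ 2 := by
    intro x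
    have h2 : ContDiff ℝ 1 fun y => G (x, y) := hG.comp (contDiff_const.prodMk contDiff_id)
    have h3 := integral_sq_le_sum_cells h2 (c := c') hl' n
    have h4 : deriv (fun y => G (x, y)) = fun y => fderiv ℝ G (x, y) (0, 1) :=
      funext fun y => (hasDerivAt_slice_snd hG x y).deriv
    rw [h4] at h3
    exact h3
  have h2 : ∀ k, ∫ x in c..(c + n * l), u k x ^ 2 ≤
      l ^ 2 * (l' * ∫ x in c..(c + n * l),
        ∫ y in (c' + (k : ℕ) * l')..(c' + ((k : ℕ) + 1 : ℕ) * l'), fderiv ℝ G (x, y) (1, 0) ^ 2) +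
      ∑ i : Fin n, l⁻¹ * (∫ x in (c + (i : ℕ) * l)..(c + ((i : ℕ) + 1 : ℕ) * l), u k x) ^ 2 := by
    intro k
    refine (integral_sq_le_sum_cells (hu1 k) hl n).trans ?_
    gcongr
    rw [← intervalIntegral.integral_const_mul]
    refine intervalIntegral.integral_mono_on hcn
      ((((hu1 k).continuous_deriv le_rfl).pow 2).intervalIntegrable _ _)
      ((continuous_const.mul (continuous_intervalIntegral_slice
        (F := fun p => fderiv ℝ G p (1, 0) ^ 2) (by fun_prop) _ _)).intervalIntegrable _ _)
      fun x _ => ?_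
    rw [(hud k x).deriv]
    have := sq_intervalIntegral_le (f := fun y => fderiv ℝ G (x, y) (1, 0)) (hcell k)
      (by fun_prop)
    rwa [hcell'] at this
  have hcu : ∀ k, Continuous (u k) := fun k => (hu1 k).continuous
  have cy : Continuous fun x => ∫ y in c'..(c' + n * l'), fderiv ℝ G (x, y) (0, 1) ^ 2 :=
    continuous_intervalIntegral_slice (F := fun p => fderiv ℝ G p (0, 1) ^ 2) (by fun_prop) _ _
  calc ∫ x in c..(c + n * l), ∫ y in c'..(c' + n * l'), G (x, y) ^ 2
      ≤ ∫ x in c..(c + n * l), (l' ^ 2 * (∫ y in c'..(c' + n * l'), fderiv ℝ G (x, y) (0, 1) ^ 2) +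
        ∑ k : Fin n, l'⁻¹ * u k x ^ 2) := by
        refine intervalIntegral.integral_mono_on hcn
          ((continuous_intervalIntegral_slice (F := fun p => G p ^ 2)
            (by fun_prop) _ _).intervalIntegrable _ _)
          (Continuous.intervalIntegrable (by fun_prop) _ _) fun x _ => h1 x
    _ = l' ^ 2 * (∫ x in c..(c + n * l), ∫ y in c'..(c' + n * l'), fderiv ℝ G (x, y) (0, 1) ^ 2) +
        ∑ k : Fin n, l'⁻¹ * ∫ x in c..(c + n * l), u k x ^ 2 := by
        rw [intervalIntegral.integral_add (Continuous.intervalIntegrable (by fun_prop) _ _)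
          (Continuous.intervalIntegrable (by fun_prop) _ _), intervalIntegral.integral_const_mul,
          intervalIntegral.integral_finsetSum]
        · simp only [intervalIntegral.integral_const_mul]
        · exact fun k _ => Continuous.intervalIntegrable (by fun_prop) _ _
    _ ≤ l' ^ 2 * (∫ x in c..(c + n * l), ∫ y in c'..(c' + n * l'), fderiv ℝ G (x, y) (0, 1) ^ 2) +
        ∑ k : Fin n, l'⁻¹ * (l ^ 2 * (l' * ∫ x in c..(c + n * l),
        ∫ y in (c' + (k : ℕ) * l')..(c' + ((k : ℕ) + 1 : ℕ) * l'), fderiv ℝ G (x, y) (1, 0) ^ 2) +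
      ∑ i : Fin n, l⁻¹ * (∫ x in (c + (i : ℕ) * l)..(c + ((i : ℕ) + 1 : ℕ) * l), u k x) ^ 2) := by
        gcongr with k _
        exact h2 k
    _ = _ := by
        have h3 : ∑ k : Fin n, (∫ x in c..(c + n * l),
            ∫ y in (c' + (k : ℕ) * l')..(c' + ((k : ℕ) + 1 : ℕ) * l'), fderiv ℝ G (x, y) (1, 0) ^ 2) =
            ∫ x in c..(c + n * l), ∫ y in c'..(c' + n * l'), fderiv ℝ G (x, y) (1, 0) ^ 2 := by
          rw [← intervalIntegral.integral_finsetSum]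
          · refine intervalIntegral.integral_congr fun x _ => ?_
            exact sum_intervalIntegral_cells (f := fun y => fderiv ℝ G (x, y) (1, 0) ^ 2)
              (by fun_prop) c' l' n
          · exact fun k _ => (continuous_intervalIntegral_slice
              (F := fun p => fderiv ℝ G p (1, 0) ^ 2) (by fun_prop) _ _).intervalIntegrable _ _
        rw [← h3]
        simp only [mul_add, Finset.sum_add_distrib, Finset.mul_sum]
        have h4 : ∀ B : ℝ, l'⁻¹ * (l ^ 2 * (l' * B)) = l ^ 2 * B := fun B => by field_simp
        simp only [h4]
        rw [← add_assoc, add_comm (l' ^ 2 * _)]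
        congr 1
        refine Finset.sum_congr rfl fun k _ => Finset.sum_congr rfl fun i _ => ?_
        ring

variable {a b ε : ℝ} {h : ℝ → ℝ}

theorem strip_subset {L : ℝ} (hL : ∀ x ∈ Set.Icc (-a) b, ε * h x ≤ L) :
    strip a b h ε ⊆ Set.Icc (-a) b ×ˢ Set.Icc 0 L := by
  rintro p ⟨h1, h2, h3, h4⟩
  exact ⟨⟨h1.le, h2.le⟩, h3.le, h4.le.trans (hL _ ⟨h1.le, h2.le⟩)⟩

theorem exists_strip_bound (hc : ContinuousOn h (Set.Icc (-a) b)) :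
    ∃ L : ℝ, 0 < L ∧ ∀ x ∈ Set.Icc (-a) b, ε * h x ≤ L := by
  obtain ⟨C, hC⟩ := isCompact_Icc.exists_bound_of_continuousOn (hc.const_mul ε)
  exact ⟨max C 1, by positivity, fun x hx =>
    (le_abs_self _).trans ((hC x hx).trans (le_max_left _ _))⟩

theorem volume_strip_lt_top (hc : ContinuousOn h (Set.Icc (-a) b)) :
    volume (strip a b h ε) < ⊤ := by
  obtain ⟨L, -, hL⟩ := exists_strip_bound (ε := ε) hc
  exact (measure_mono (strip_subset hL)).trans_lt (isCompact_Icc.prod isCompact_Icc).measure_lt_top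

/-- The compactness of the embedding of the form domain of the strip. -/
theorem strip_compact (hc : ContinuousOn h (Set.Icc (-a) b)) (hab : -a < b)
    (hpos : ∀ x ∈ Set.Icc (-a) b, 0 < ε * h x) (bc : EndCondition) {δ : ℝ} (hδ : 0 < δ) :
    ∃ (κ : Type) (_ : Fintype κ) (g : κ → ℝ × ℝ → ℝ),
      (∀ k, MemLp (g k) 2 (volume.restrict (strip a b h ε))) ∧
      ∀ φ, IsTestFunction (dirichletPart a b h ε bc) φ → ∫ p in strip a b h ε, φ p ^ 2 ≤
        δ * ((∫ p in strip a b h ε, φ p ^ 2) + (∫ p in strip a b h ε, fderiv ℝ φ p (1, 0) ^ 2) +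
          ∫ p in strip a b h ε, fderiv ℝ φ p (0, 1) ^ 2) +
          ∑ k, (∫ p in strip a b h ε, g k p * φ p) ^ 2 := by
  obtain ⟨L, hL0, hL⟩ := exists_strip_bound (ε := ε) hc
  have hab' : 0 < a + b := by linarith
  have hsδ : 0 < √δ := Real.sqrt_pos.2 hδ
  obtain ⟨n, hn⟩ := exists_nat_gt (max (a + b) L / √δ)
  have hn0 : (0 : ℝ) < n := lt_of_le_of_lt (by positivity) hn
  rw [div_lt_iff₀ hsδ] at hn
  set l := (a + b) / n with hl
  set l' := L / n with hl'
  have hl0 : 0 < l := by positivity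
  have hl'0 : 0 < l' := by positivity
  have hsq : ∀ t, 0 ≤ t → t ≤ max (a + b) L → (t / n) ^ 2 ≤ δ := fun t ht0 ht => by
    calc (t / n) ^ 2 ≤ √δ ^ 2 := by
          gcongr
          rw [div_le_iff₀ hn0]
          linarith
      _ = δ := Real.sq_sqrt hδ.le
  have hlδ : l ^ 2 ≤ δ := hsq _ hab'.le (le_max_left _ _)
  have hlδ' : l' ^ 2 ≤ δ := hsq _ hL0.le (le_max_right _ _)
  have hnl : -a + n * l = b := by rw [hl]; field_simp; ring
  have hnl' : 0 + n * l' = L := by rw [hl']; field_simp; ring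
  let J : Fin n × Fin n → Set (ℝ × ℝ) := fun k =>
    Set.Ioo (-a + (k.2 : ℕ) * l) (-a + ((k.2 : ℕ) + 1 : ℕ) * l) ×ˢ
      Set.Ioc (0 + (k.1 : ℕ) * l') (0 + ((k.1 : ℕ) + 1 : ℕ) * l')
  have hJm : ∀ k, MeasurableSet (J k) := fun k => measurableSet_Ioo.prod measurableSet_Ioc
  have hJx : ∀ k, ∀ p ∈ J k, p.1 ∈ Set.Ioo (-a) b := by
    rintro k p ⟨⟨h1, h2⟩, -⟩
    have h3 : (((k.2 : ℕ) + 1 : ℕ) : ℝ) ≤ n := by exact_mod_cast k.2.2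
    have h4 : 0 ≤ ((k.2 : ℕ) : ℝ) * l := by positivity
    refine ⟨by linarith, h2.trans_le ?_⟩
    rw [← hnl]
    gcongr
  refine ⟨Fin n × Fin n, inferInstance, fun k => (J k).indicator fun _ => √(l⁻¹ * l'⁻¹), fun k =>
    memLp_indicator_const 2 (hJm k) _ (Or.inr ?_), fun φ hφ => ?_⟩
  · exact ((Measure.restrict_apply_le _ _).trans_lt ((measure_mono (Set.prod_mono Set.Ioo_subset_Icc_self
      Set.Ioc_subset_Icc_self)).trans_lt (isCompact_Icc.prod isCompact_Icc).measure_lt_top)).ne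
  obtain ⟨G, hG, hGc, hGs, hGφ, hGφ'⟩ := exists_zero_extension hc hab hpos hφ
  have hm : MeasurableSet (strip a b h ε) := (isOpen_strip hc).measurableSet
  have hG1 : ContDiff ℝ 1 G := hG.of_le (by simp)
  have hGcont := hG.continuous
  have hGx := continuous_fderiv_apply hG1 (1, 0)
  have hGy := continuous_fderiv_apply hG1 (0, 1)
  have e0 : ∫ p in strip a b h ε, φ p ^ 2 = ∫ x in (-a)..b, ∫ y in (0 : ℝ)..L, G (x, y) ^ 2 := by
    rw [← setIntegral_strip_eq hc hab.le hpos (F := fun p => G p ^ 2) (by fun_prop)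
      (fun x hx y hy => by rw [hGs.eq_zero hx hy]; ring) hL]
    exact setIntegral_congr_fun hm fun p hp => by simp only [hGφ p hp]
  have e1 : ∫ p in strip a b h ε, fderiv ℝ φ p (1, 0) ^ 2 =
      ∫ x in (-a)..b, ∫ y in (0 : ℝ)..L, fderiv ℝ G (x, y) (1, 0) ^ 2 := by
    rw [← setIntegral_strip_eq hc hab.le hpos (F := fun p => fderiv ℝ G p (1, 0) ^ 2) (by fun_prop)
      (fun x hx y hy => by rw [hGs.fderiv_eq_zero hx hy]; simp) hL]
    exact setIntegral_congr_fun hm fun p hp => by simp only [hGφ' p hp]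
  have e2 : ∫ p in strip a b h ε, fderiv ℝ φ p (0, 1) ^ 2 =
      ∫ x in (-a)..b, ∫ y in (0 : ℝ)..L, fderiv ℝ G (x, y) (0, 1) ^ 2 := by
    rw [← setIntegral_strip_eq hc hab.le hpos (F := fun p => fderiv ℝ G p (0, 1) ^ 2) (by fun_prop)
      (fun x hx y hy => by rw [hGs.fderiv_eq_zero hx hy]; simp) hL]
    exact setIntegral_congr_fun hm fun p hp => by simp only [hGφ' p hp]
  have e3 : ∀ k, ∫ p in strip a b h ε, (J k).indicator (fun _ => √(l⁻¹ * l'⁻¹)) p * φ p =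
      √(l⁻¹ * l'⁻¹) * ∫ x in (-a + (k.2 : ℕ) * l)..(-a + ((k.2 : ℕ) + 1 : ℕ) * l),
        ∫ y in (0 + (k.1 : ℕ) * l')..(0 + ((k.1 : ℕ) + 1 : ℕ) * l'), G (x, y) := by
    intro k
    have h1 : ∫ p in strip a b h ε, (J k).indicator (fun _ => √(l⁻¹ * l'⁻¹)) p * φ p =
        ∫ p in strip a b h ε, (J k).indicator (fun p => √(l⁻¹ * l'⁻¹) * G p) p := by
      refine setIntegral_congr_fun hm fun p hp => ?_
      by_cases hpJ : p ∈ J k <;> simp [hpJ, hGφ p hp]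
    rw [h1, setIntegral_indicator (hJm k), integral_const_mul]
    congr 1
    have h2 : ∫ p in strip a b h ε ∩ J k, G p = ∫ p in J k, G p := by
      refine (setIntegral_eq_of_subset_of_forall_sdiff_eq_zero (hJm k) Set.inter_subset_right ?_).symm
      rintro p ⟨hp, hp'⟩
      have hx := hJx k p hp
      refine hGs.eq_zero (x := p.1) (y := p.2) (Set.Ioo_subset_Icc_self hx) fun hy => hp' ⟨?_, hp⟩
      exact ⟨hx.1, hx.2, hy.1, hy.2⟩
    rw [h2, Measure.volume_eq_prod, setIntegral_prod _ (by
      rw [← Measure.volume_eq_prod]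
      exact (hGcont.continuousOn.integrableOn_compact (isCompact_Icc.prod isCompact_Icc)).mono_set
        (Set.prod_mono Set.Ioo_subset_Icc_self Set.Ioc_subset_Icc_self)),
      intervalIntegral.integral_of_le (by push_cast; nlinarith), ← integral_Ioc_eq_integral_Ioo]
    refine setIntegral_congr_fun measurableSet_Ioc fun x _ => ?_
    rw [intervalIntegral.integral_of_le (by push_cast; nlinarith)]
  have key := integral_integral_sq_le_sum_cells hG1 (c := -a) (c' := 0) hl0 hl'0 n
  rw [hnl, hnl'] at key
  simp only [e3]
  rw [e0, e1, e2, Fintype.sum_prod_type]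
  simp only [mul_pow, Real.sq_sqrt (show 0 ≤ l⁻¹ * l'⁻¹ by positivity)]
  have p0 : ∀ {F : ℝ × ℝ → ℝ}, 0 ≤ ∫ x in (-a)..b, ∫ y in (0 : ℝ)..L, F (x, y) ^ 2 := fun {F} =>
    intervalIntegral.integral_nonneg hab.le fun x _ =>
      intervalIntegral.integral_nonneg hL0.le fun y _ => sq_nonneg _
  have q0 := mul_nonneg hδ.le (p0 (F := G))
  have q1 := mul_le_mul_of_nonneg_right hlδ (p0 (F := fun p => fderiv ℝ G p (1, 0)))
  have q2 := mul_le_mul_of_nonneg_right hlδ' (p0 (F := fun p => fderiv ℝ G p (0, 1)))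
  linarith

/-- The Laplacian of the strip has discrete spectrum. -/
theorem exists_isLaplaceEigensystem (hc : ContinuousOn h (Set.Icc (-a) b)) (ha : 0 < a) (hb : 0 < b)
    (hpos : ∀ x ∈ Set.Icc (-a) b, 0 < ε * h x) (bc : EndCondition) :
    ∃ (lam : ℕ → ℝ) (Ψ : ℕ → ℝ × ℝ → ℝ),
      IsLaplaceEigensystem (strip a b h ε) (dirichletPart a b h ε bc) lam Ψ := by
  have hab : -a < b := by linarith
  have hopen : IsOpen (strip a b h ε) := isOpen_strip hc
  have hm := hopen.measurableSet
  refine exists_isLaplaceEigensystem_of_compact (fun δ hδ => strip_compact hc hab hpos bc hδ)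
    (fun f hf h0 => ?_) ?_
  · have : IsFiniteMeasure (volume.restrict (strip a b h ε)) :=
      ⟨by simpa using volume_strip_lt_top hc⟩
    have hfi : IntegrableOn f (strip a b h ε) := hf.integrable one_le_two
    have := hopen.ae_eq_zero_of_integral_contDiff_smul_eq_zero (f := f) (μ := volume)
      hfi.locallyIntegrableOn fun g hg hgc hgs => by
        have h1 := h0 g ⟨hg, hgc, (disjoint_strip_dirichletPart hc bc).mono_left hgs⟩
        rw [setIntegral_eq_integral_of_forall_compl_eq_zero fun p hp => by
          rw [image_eq_zero_of_notMem_tsupport fun h2 => hp (hgs h2), mul_zero]] at h1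
        simpa [mul_comm] using h1
    exact (ae_restrict_iff' hm).2 this
  · let s : ℕ → Set (ℝ × ℝ) := fun n =>
      strip a b h ε ∩ {p | b / (n + 2 : ℕ) < p.1 ∧ p.1 < b / (n + 1 : ℕ)}
    have hso : ∀ n, IsOpen (s n) := fun n => hopen.inter
      ((isOpen_lt continuous_const continuous_fst).inter
        (isOpen_lt continuous_fst continuous_const))
    have hsr : ∀ n, volume.restrict (strip a b h ε) (s n) = volume (s n) := fun n => by
      rw [Measure.restrict_apply (hso n).measurableSet,
        Set.inter_eq_left.2 Set.inter_subset_left]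
    refine not_finiteDimensional_lp s (fun n => (hso n).measurableSet) (fun n => ?_) (fun n => ?_) ?_
    · rw [hsr]
      refine ((hso n).measure_pos volume ?_).ne'
      have h1 : b / (n + 2 : ℕ) < b / (n + 1 : ℕ) := by
        gcongr
        simp
      obtain ⟨x, hx1, hx2⟩ := exists_between h1
      have hx0 : 0 < x := lt_trans (by positivity) hx1
      have hxb : x < b := hx2.trans_le (div_le_self hb.le (by simp))
      have hx := hpos x ⟨by linarith, hxb.le⟩
      exact ⟨(x, ε * h x / 2), ⟨by simp only; linarith, hxb, by simp only; linarith,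
        by simp only; linarith⟩, hx1, hx2⟩
    · rw [hsr]
      exact ((measure_mono Set.inter_subset_left).trans_lt
        (volume_strip_lt_top hc)).ne
    · have key : ∀ i j : ℕ, i < j → Disjoint (s i) (s j) := by
        intro i j hij
        rw [Set.disjoint_left]
        rintro p ⟨-, h1, -⟩ ⟨-, -, h2⟩
        have h4 : ((i + 2 : ℕ) : ℝ) ≤ (j + 1 : ℕ) := by exact_mod_cast Nat.succ_le_succ hij
        have h3 : b / (j + 1 : ℕ) ≤ b / (i + 2 : ℕ) :=
          div_le_div_of_nonneg_left hb.le (by positivity) h4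
        linarith
      intro i j hij
      rcases lt_or_gt_of_ne hij with h1 | h1
      · exact key i j h1
      · exact (key j i h1).symm

end Compactness

/-! ### The profile near and away from its maximum, and the transversal ground state -/

section Profile

variable {a b M cp cm m : ℝ} {h : ℝ → ℝ}

theorem Profile.neg_a_lt_b (hh : Profile a b h M cp cm m) : -a < b := by
  linarith [hh.a_pos, hh.b_pos]

theorem Profile.m_pos (hh : Profile a b h M cp cm m) : 0 < m := one_pos.trans_le hh.one_le_m

theorem Profile.continuousAt_zero (hh : Profile a b h M cp cm m) : ContinuousAt h 0 :=
  hh.continuousOn.continuousAt (Icc_mem_nhds (by linarith [hh.a_pos]) hh.b_pos)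

theorem Profile.apply_zero (hh : Profile a b h M cp cm m) : h 0 = M := by
  have hm := hh.m_pos
  have h1 : Tendsto (fun x : ℝ => x ^ (m + 1)) (𝓝[>] 0) (𝓝 0) := by
    have := (Real.continuousAt_rpow_const 0 (m + 1) (Or.inr (by linarith))).tendsto
    rw [Real.zero_rpow (by linarith)] at this
    exact this.mono_left nhdsWithin_le_nhds
  have h2 : Tendsto (fun x : ℝ => M - cp * x ^ m) (𝓝[>] 0) (𝓝 M) := by
    have := (Real.continuousAt_rpow_const 0 m (Or.inr hm.le)).tendsto
    rw [Real.zero_rpow hm.ne'] at this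
    simpa using ((this.mono_left nhdsWithin_le_nhds).const_mul cp).const_sub M
  have h3 := (hh.expansion_right.trans_tendsto h1).add h2
  simp only [sub_add_cancel, zero_add] at h3
  exact tendsto_nhds_unique (hh.continuousAt_zero.tendsto.mono_left nhdsWithin_le_nhds) h3

theorem Profile.le (hh : Profile a b h M cp cm m) {x : ℝ} (hx : x ∈ Set.Icc (-a) b) : h x ≤ M := by
  rcases eq_or_ne x 0 with rfl | h0
  · exact hh.apply_zero.le
  · rw [← hh.apply_zero]
    exact (hh.isMax x hx h0).le

theorem Profile.abs_sub_le_of_le_rpow_add_one {c K : ℝ} (hc : 0 < c) {δ : ℝ} (hδ : 0 < δ) :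
    ∃ η : ℝ, 0 < η ∧ ∀ t v : ℝ, 0 < t → t ≤ η → |v - (M - c * t ^ m)| ≤ K * |t ^ (m + 1)| →
      |M - v - c * t ^ m| ≤ δ * (c * t ^ m) := by
  refine ⟨δ * c / (|K| + 1), by positivity, fun t v ht htη hv => ?_⟩
  rw [le_div_iff₀ (by positivity)] at htη
  have h1 : M - v - c * t ^ m = -(v - (M - c * t ^ m)) := by ring
  have h2 : 0 < t ^ m := by positivity
  rw [h1, abs_neg]
  refine hv.trans ?_
  rw [abs_of_pos (by positivity), Real.rpow_add_one ht.ne']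
  have h3 : K * t ≤ δ * c := by
    have := le_abs_self K
    nlinarith
  nlinarith

/-- Near the maximum `2 π² M⁻³ (M - h)` is asymptotic to the potential. -/
theorem Profile.expansion (hh : Profile a b h M cp cm m) {δ : ℝ} (hδ : 0 < δ) :
    ∃ η : ℝ, 0 < η ∧ ∀ x, |x| ≤ η →
      |2 * Real.pi ^ 2 / M ^ 3 * (M - h x) - potential M cp cm m x| ≤
        δ * potential M cp cm m x := by
  have hM := hh.M_pos
  have hm := hh.m_pos
  obtain ⟨K₁, hK₁⟩ := hh.expansion_right.bound
  obtain ⟨K₂, hK₂⟩ := hh.expansion_left.bound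
  obtain ⟨r₁, hr₁, h1⟩ := mem_nhdsGT_iff_exists_Ioc_subset.1 hK₁
  obtain ⟨r₂, hr₂, h2⟩ := mem_nhdsLT_iff_exists_Ico_subset.1 hK₂
  obtain ⟨s₁, hs₁, h3⟩ := Profile.abs_sub_le_of_le_rpow_add_one (M := M) (K := K₁) hh.cp_pos hδ
  obtain ⟨s₂, hs₂, h4⟩ := Profile.abs_sub_le_of_le_rpow_add_one (M := M) (K := K₂) hh.cm_pos hδ
  simp only [Set.mem_Ioi, Set.mem_Iio] at hr₁ hr₂
  have hk : 0 < 2 * Real.pi ^ 2 / M ^ 3 := by positivity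
  have hfin : ∀ c t v : ℝ, |M - v - c * t ^ m| ≤ δ * (c * t ^ m) →
      |2 * Real.pi ^ 2 / M ^ 3 * (M - v) - 2 * Real.pi ^ 2 / M ^ 3 * c * t ^ m| ≤
        δ * (2 * Real.pi ^ 2 / M ^ 3 * c * t ^ m) := by
    intro c t v hv
    have e1 : 2 * Real.pi ^ 2 / M ^ 3 * (M - v) - 2 * Real.pi ^ 2 / M ^ 3 * c * t ^ m =
        2 * Real.pi ^ 2 / M ^ 3 * (M - v - c * t ^ m) := by ring
    rw [e1, abs_mul, abs_of_pos hk]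
    calc _ ≤ 2 * Real.pi ^ 2 / M ^ 3 * (δ * (c * t ^ m)) := by gcongr
      _ = _ := by ring
  refine ⟨min (min r₁ (-r₂)) (min s₁ s₂), by
    refine lt_min (lt_min hr₁ (by linarith)) (lt_min hs₁ hs₂), fun x hx => ?_⟩
  simp only [le_min_iff] at hx
  obtain ⟨⟨x1, x2⟩, x3, x4⟩ := hx
  rcases lt_trichotomy x 0 with h0 | h0 | h0
  · have h5 : x ∈ Set.Ico r₂ 0 := ⟨by rw [abs_of_neg h0] at x2; linarith, h0⟩
    have h6 := h2 h5
    simp only [Set.mem_ofPred_eq, Real.norm_eq_abs] at h6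
    rw [potential, if_neg h0.not_gt]
    exact hfin _ _ _ (h4 _ _ (abs_pos.2 h0.ne) x4 h6)
  · rw [h0, hh.apply_zero, potential, if_neg (lt_irrefl 0), abs_zero, Real.zero_rpow hm.ne']
    simp
  · have h5 : x ∈ Set.Ioc 0 r₁ := ⟨h0, by rwa [abs_of_pos h0] at x1⟩
    have h6 := h1 h5
    simp only [Set.mem_ofPred_eq, Real.norm_eq_abs] at h6
    rw [potential, if_pos h0]
    exact hfin _ _ _ (h3 _ _ h0 (by rwa [abs_of_pos h0] at x3) h6)

/-- Away from the maximum `M - h` is bounded below. -/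
theorem Profile.exists_gap (hh : Profile a b h M cp cm m) {η : ℝ} (hη : 0 < η) :
    ∃ θ : ℝ, 0 < θ ∧ ∀ x ∈ Set.Icc (-a) b, η ≤ |x| → θ ≤ M - h x := by
  have hK : IsCompact (Set.Icc (-a) b ∩ {x | η ≤ |x|}) :=
    isCompact_Icc.inter_right (isClosed_le continuous_const continuous_abs)
  rcases (Set.Icc (-a) b ∩ {x | η ≤ |x|}).eq_empty_or_nonempty with he | hne
  · refine ⟨1, one_pos, fun x hx hx' => ?_⟩
    have : x ∈ Set.Icc (-a) b ∩ {x | η ≤ |x|} := ⟨hx, hx'⟩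
    rw [he] at this
    exact this.elim
  · obtain ⟨x₀, ⟨hx₀, hx₀'⟩, hmax⟩ := hK.exists_isMaxOn hne
      (hh.continuousOn.mono Set.inter_subset_left)
    refine ⟨M - h x₀, ?_, fun x hx hx' => ?_⟩
    · have h0 : x₀ ≠ 0 := by
        rintro rfl
        simp only [Set.mem_ofPred_eq, abs_zero] at hx₀'
        linarith
      have := hh.isMax x₀ hx₀ h0
      rw [hh.apply_zero] at this
      linarith
    · have : h x ≤ h x₀ := hmax (a := x) ⟨hx, hx'⟩
      linarith

theorem inv_sq_sub_inv_sq_ge {M t : ℝ} (hM : 0 < M) (ht : 0 < t) :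
    2 / M ^ 3 * (M - t) ≤ 1 / t ^ 2 - 1 / M ^ 2 := by
  have h1 : 1 / t ^ 2 - 1 / M ^ 2 - 2 / M ^ 3 * (M - t) =
      (M - t) ^ 2 * (M + 2 * t) / (t ^ 2 * M ^ 3) := by
    field_simp
    ring
  have : 0 ≤ (M - t) ^ 2 * (M + 2 * t) / (t ^ 2 * M ^ 3) := by positivity
  linarith

end Profile

section Slice

/-- The normalized first Dirichlet eigenfunction of the interval `(0, L)`. -/
noncomputable def groundState (L y : ℝ) : ℝ := √(2 / L) * Real.sin (Real.pi * y / L)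

theorem continuous_groundState (L : ℝ) : Continuous (groundState L) := by
  unfold groundState
  fun_prop

theorem integral_groundState_sq {L : ℝ} (hL : 0 < L) :
    ∫ y in (0 : ℝ)..L, groundState L y ^ 2 = 1 := by
  have h1 : ∀ y, groundState L y ^ 2 = 2 / L * Real.sin ((Real.pi / L) * y) ^ 2 := fun y => by
    rw [groundState, mul_pow, Real.sq_sqrt (by positivity)]
    congr 3
    ring
  have hπ : Real.pi / L ≠ 0 := (div_pos Real.pi_pos hL).ne'
  simp only [h1]
  rw [intervalIntegral.integral_const_mul,
    intervalIntegral.integral_comp_mul_left (fun y => Real.sin y ^ 2) hπ, integral_sin_sq]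
  have h2 : Real.pi / L * L = Real.pi := by field_simp
  rw [h2]
  simp
  field_simp

theorem integral_mul_groundState_sq (g : ℝ → ℝ) {L : ℝ} (hL : 0 < L) :
    (∫ y in (0 : ℝ)..L, g y * groundState L y) ^ 2 =
      2 / L * (∫ y in (0 : ℝ)..L, g y * Real.sin (Real.pi * y / L)) ^ 2 := by
  have h1 : ∀ y, g y * groundState L y = √(2 / L) * (g y * Real.sin (Real.pi * y / L)) := fun y => by
    rw [groundState]; ring
  simp only [h1]
  rw [intervalIntegral.integral_const_mul, mul_pow, Real.sq_sqrt (by positivity)]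

theorem sq_integral_mul_groundState_le {g : ℝ → ℝ} (hg : Continuous g) {L : ℝ} (hL : 0 < L) :
    (∫ y in (0 : ℝ)..L, g y * groundState L y) ^ 2 ≤ ∫ y in (0 : ℝ)..L, g y ^ 2 := by
  have := sq_intervalIntegral_mul_le hL.le hg.continuousOn (continuous_groundState L).continuousOn
  rwa [integral_groundState_sq hL, mul_one] at this

/-- The transversal energy of a function vanishing outside `(0, t)`, compared with the ground state of
the longer interval `(0, L)`. -/
theorem slice_bounds {g : ℝ → ℝ} (hg : ContDiff ℝ 1 g) {t L : ℝ} (ht : 0 < t) (htL : t ≤ L)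
    (h0 : ∀ y ∉ Set.Ioo 0 t, g y = 0) :
    (Real.pi / t) ^ 2 * (∫ y in (0 : ℝ)..L, g y ^ 2) ≤ ∫ y in (0 : ℝ)..L, deriv g y ^ 2 ∧
    3 * (Real.pi / L) ^ 2 * ((∫ y in (0 : ℝ)..L, g y ^ 2) -
      (∫ y in (0 : ℝ)..L, g y * groundState L y) ^ 2) ≤
      (∫ y in (0 : ℝ)..L, deriv g y ^ 2) - (Real.pi / L) ^ 2 * ∫ y in (0 : ℝ)..L, g y ^ 2 := by
  have hL := ht.trans_le htL
  have hg' : Continuous (deriv g) := hg.continuous_deriv le_rfl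
  have hgc := hg.continuous
  constructor
  · have h1 := dirichlet_gap hg ht h0
    rw [← integral_mul_groundState_sq g ht] at h1
    have h2 := sq_integral_mul_groundState_le hgc ht
    have h3 : ∫ y in (0 : ℝ)..L, g y ^ 2 = ∫ y in (0 : ℝ)..t, g y ^ 2 := by
      have hg2 : Continuous fun y => g y ^ 2 := hgc.pow 2
      rw [← intervalIntegral.integral_add_adjacent_intervals
        (hg2.intervalIntegrable 0 t) (hg2.intervalIntegrable t L)]
      have : ∫ y in t..L, g y ^ 2 = 0 := by
        rw [intervalIntegral.integral_congr (g := fun _ => (0 : ℝ)) fun y hy => ?_]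
        · simp
        · rw [Set.uIcc_of_le htL] at hy
          simp only
          rw [h0 y fun hy' => absurd hy.1 (not_le.2 hy'.2)]
          ring
      rw [this, add_zero]
    have h4 : ∫ y in (0 : ℝ)..t, deriv g y ^ 2 ≤ ∫ y in (0 : ℝ)..L, deriv g y ^ 2 :=
      intervalIntegral.integral_mono_interval le_rfl ht.le htL
        (Eventually.of_forall fun y => sq_nonneg _) ((hg'.pow 2).intervalIntegrable _ _)
    rw [h3]
    have h5 := mul_le_mul_of_nonneg_left h2 (sq_nonneg (Real.pi / t))
    linarith
  · have h1 := dirichlet_gap hg hL fun y hy => h0 y fun hy' => hy ⟨hy'.1, hy'.2.trans_le htL⟩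
    rw [← integral_mul_groundState_sq g hL] at h1
    linarith

end Slice

/-! ### The lower bound for the form of the strip -/

section LowerBound

theorem tendsto_const_mul_rpow {m : ℝ} (hm : 0 < m) (c : ℝ) :
    Tendsto (fun s : ℝ => c * s ^ m) (𝓝[>] 0) (𝓝 0) := by
  have := (Real.continuousAt_rpow_const 0 m (Or.inr hm.le)).tendsto
  rw [Real.zero_rpow hm.ne'] at this
  simpa using (this.mono_left nhdsWithin_le_nhds).const_mul c

theorem rpow_sq_eq {ε : ℝ} (hε : 0 ≤ ε) (α : ℝ) : (ε ^ α) ^ 2 = ε ^ (2 * α) := by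
  rw [mul_comm, Real.rpow_mul hε, Real.rpow_two]

/-- The scaling exponent balances the two terms of the limit operator. -/
theorem rpow_rpow_mul_sq {ε m α : ℝ} (hε : 0 < ε) (hm : 0 < m) (hα : α = 2 / (m + 2)) :
    (ε ^ α) ^ m * (ε ^ α) ^ 2 = ε ^ 2 := by
  rw [rpow_sq_eq hε.le, ← Real.rpow_mul hε.le, ← Real.rpow_add hε, ← Real.rpow_natCast]
  congr 1
  rw [hα]
  push_cast
  field_simp

/-- The variational bound for `-d²/dx² + q` with a homogeneous potential, in the scale `s`. -/
theorem IsSchrodingerEigensystem.scaled_form_lower_bound {q : ℝ → ℝ} {μ : ℕ → ℝ} {X : ℕ → ℝ → ℝ}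
    (hS : IsSchrodingerEigensystem q μ X) (hq : Continuous q) (hq0 : ∀ x, 0 ≤ q x) {s r : ℝ}
    (hs : 0 < s) (hqs : ∀ x, q (s * x) = r * q x) (hr : 0 < r) {v : ℝ → ℝ} (hv : ContDiff ℝ 1 v)
    (hvc : HasCompactSupport v) (N : ℕ) :
    μ N * (∫ x, v x ^ 2) ≤ (∫ x, (s ^ 2 * deriv v x ^ 2 + r⁻¹ * (q x * v x ^ 2))) +
      μ N * ∑ k ∈ Finset.range N, (∫ x, v x * ((√s)⁻¹ * X k (s⁻¹ * x))) ^ 2 := by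
  have hw : ContDiff ℝ 1 fun x => v (s * x) := hv.comp (contDiff_const.mul contDiff_id)
  have hwc : HasCompactSupport fun x => v (s * x) :=
    hvc.comp_homeomorph (Homeomorph.mulLeft₀ s hs.ne')
  have hwd : ∀ x, deriv (fun x => v (s * x)) x = s * deriv v (s * x) := fun x => by
    rw [deriv_comp_mul_left, smul_eq_mul]
  have hsc : ∀ f : ℝ → ℝ, ∫ x, f (s * x) = s⁻¹ * ∫ x, f x := fun f => by
    rw [Measure.integral_comp_mul_left, abs_of_pos (inv_pos.2 hs), smul_eq_mul]
  have key := hS.form_lower_bound hq hq0 hw hwc N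
  have e1 : ∫ x, v (s * x) ^ 2 = s⁻¹ * ∫ x, v x ^ 2 := hsc fun x => v x ^ 2
  have e2 : ∫ x, (deriv (fun x => v (s * x)) x ^ 2 + q x * v (s * x) ^ 2) =
      s⁻¹ * ∫ x, (s ^ 2 * deriv v x ^ 2 + r⁻¹ * (q x * v x ^ 2)) := by
    rw [← hsc fun x => s ^ 2 * deriv v x ^ 2 + r⁻¹ * (q x * v x ^ 2)]
    congr 1
    ext x
    rw [hwd, hqs]
    field_simp
  have e3 : ∀ k, (∫ x, v (s * x) * X k x) ^ 2 =
      s⁻¹ * (∫ x, v x * ((√s)⁻¹ * X k (s⁻¹ * x))) ^ 2 := fun k => by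
    have h1 : ∫ x, v (s * x) * X k x = s⁻¹ * ∫ x, v x * X k (s⁻¹ * x) := by
      rw [← hsc fun x => v x * X k (s⁻¹ * x)]
      congr 1
      ext x
      rw [inv_mul_cancel_left₀ hs.ne']
    have h2 : ∫ x, v x * ((√s)⁻¹ * X k (s⁻¹ * x)) = (√s)⁻¹ * ∫ x, v x * X k (s⁻¹ * x) := by
      rw [← integral_const_mul]
      congr 1
      ext x
      ring
    rw [h1, h2, mul_pow, mul_pow, inv_pow √s, Real.sq_sqrt hs.le]
    ring
  rw [e1, e2] at key
  simp only [e3] at key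
  rw [← Finset.mul_sum] at key
  have h3 := mul_le_mul_of_nonneg_left key hs.le
  have h4 : ∀ t : ℝ, s * (s⁻¹ * t) = t := fun t => mul_inv_cancel_left₀ hs.ne' t
  calc μ N * (∫ x, v x ^ 2) = s * (μ N * (s⁻¹ * ∫ x, v x ^ 2)) := by
        rw [mul_left_comm, h4]
    _ ≤ _ := h3
    _ = _ := by rw [mul_add, h4, mul_left_comm, h4]

/-- A smooth cutoff equal to `1` near `0`. -/
theorem exists_cutoff {η : ℝ} (hη : 0 < η) : ∃ χ : ℝ → ℝ, ∃ C : ℝ, ContDiff ℝ ∞ χ ∧ 0 ≤ C ∧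
    (∀ x, 0 ≤ χ x ∧ χ x ≤ 1) ∧ (∀ x, |x| ≤ η / 2 → χ x = 1) ∧ (∀ x, η ≤ |x| → χ x = 0) ∧
    (∀ x, |x| < η / 2 → deriv χ x = 0) ∧ ∀ x, |deriv χ x| ≤ C := by
  let b : ContDiffBump (0 : ℝ) := ⟨η / 2, η, half_pos hη, half_lt_self hη⟩
  have hbs : ContDiff ℝ ∞ b := b.contDiff
  have hb'c : Continuous (deriv b) := hbs.continuous_deriv (by simp)
  obtain ⟨C, hC⟩ := b.hasCompactSupport.deriv.exists_bound_of_continuous hb'c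
  have hb1 : ∀ x, |x| ≤ η / 2 → b x = 1 := fun x hx =>
    b.one_of_mem_closedBall (by simpa [b] using hx)
  refine ⟨b, C, hbs, (norm_nonneg _).trans (hC 0), fun x => ⟨b.nonneg, b.le_one⟩, hb1,
    fun x hx => b.zero_of_le_dist (by simpa [b] using hx), fun x hx => ?_, hC⟩
  have : b =ᶠ[𝓝 x] fun _ => (1 : ℝ) := by
    filter_upwards [(continuous_abs.tendsto x).eventually (gt_mem_nhds hx)] with y hy
    exact hb1 y (le_of_lt hy)
  rw [this.deriv_eq]
  simp

/-- The pointwise form of the comparison with a one-dimensional operator: on one slice `B` is the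
longitudinal energy, `F` the transversal energy above the threshold, `N` the squared norm, `u` the
component along the ground state. -/
theorem slice_comparison {B F N u u' χ χ' δ ε θ κ q C c : ℝ} (hδ : 0 < δ) (hε : 0 < ε)
    (hθ : 0 < θ) (hκ : 0 < κ) (hF0 : 0 ≤ F) (hu : u ^ 2 ≤ N) (hu' : u' ^ 2 ≤ B)
    (hgap : 3 * κ * (N - u ^ 2) ≤ F) (hχ0 : 0 ≤ χ) (hχ1 : χ ≤ 1) (hχ' : |χ'| ≤ C)
    (hq : χ ≠ 0 → c * q * N ≤ ε ^ 2 * F) (hq0 : 0 ≤ q) (hc : 0 ≤ c)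
    (hfar : χ ≠ 1 ∨ χ' ≠ 0 → θ * N ≤ ε ^ 2 * F) (hεδ : (1 + δ⁻¹) * C ^ 2 * ε ^ 2 ≤ δ * θ) :
    (χ' * u + χ * u') ^ 2 + c * (ε ^ 2)⁻¹ * (q * (χ * u) ^ 2) ≤ (1 + δ) * (B + F) ∧
      N - (χ * u) ^ 2 ≤ ((3 * κ)⁻¹ + ε ^ 2 / θ) * F := by
  have hN : 0 ≤ N := (sq_nonneg u).trans hu
  have hB : 0 ≤ B := (sq_nonneg u').trans hu'
  have hχs : χ ^ 2 ≤ 1 := by nlinarith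
  constructor
  · have h1 : (χ' * u + χ * u') ^ 2 ≤ (1 + δ) * (χ * u') ^ 2 + (1 + δ⁻¹) * (χ' * u) ^ 2 := by
      have h2 : (1 + δ) * (χ * u') ^ 2 + (1 + δ⁻¹) * (χ' * u) ^ 2 - (χ' * u + χ * u') ^ 2 =
          δ⁻¹ * (δ * (χ * u') - χ' * u) ^ 2 := by
        field_simp
        ring
      have : 0 ≤ δ⁻¹ * (δ * (χ * u') - χ' * u) ^ 2 := by positivity
      linarith
    have h3 : (χ * u') ^ 2 ≤ B := by
      rw [mul_pow]
      nlinarith [sq_nonneg u']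
    have h4 : (1 + δ⁻¹) * (χ' * u) ^ 2 ≤ δ * F := by
      by_cases h0 : χ' = 0
      · rw [h0, zero_mul]
        simp only [ne_eq, OfNat.ofNat_ne_zero, not_false_eq_true, zero_pow, mul_zero]
        positivity
      · have h5 := hfar (Or.inr h0)
        have h6 : χ' ^ 2 ≤ C ^ 2 := by
          rw [← sq_abs]
          exact pow_le_pow_left₀ (abs_nonneg _) hχ' 2
        have h7 : (1 + δ⁻¹) * (χ' * u) ^ 2 ≤ (1 + δ⁻¹) * C ^ 2 * N := by
          rw [mul_pow, mul_assoc]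
          have : 0 ≤ δ⁻¹ := by positivity
          gcongr
        have h8 : 0 ≤ (1 + δ⁻¹) * C ^ 2 := by positivity
        have h9 : θ * ((1 + δ⁻¹) * C ^ 2 * N) ≤ θ * (δ * F) := by
          calc θ * ((1 + δ⁻¹) * C ^ 2 * N) = (1 + δ⁻¹) * C ^ 2 * (θ * N) := by ring
            _ ≤ (1 + δ⁻¹) * C ^ 2 * (ε ^ 2 * F) := by gcongr
            _ = ((1 + δ⁻¹) * C ^ 2 * ε ^ 2) * F := by ring
            _ ≤ (δ * θ) * F := by gcongr
            _ = _ := by ring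
        exact h7.trans (le_of_mul_le_mul_left h9 hθ)
    have h5 : c * (ε ^ 2)⁻¹ * (q * (χ * u) ^ 2) ≤ F := by
      by_cases h0 : χ = 0
      · rw [h0]
        simpa using hF0
      · have h6 := hq h0
        have h7 : (χ * u) ^ 2 ≤ N := by
          rw [mul_pow]
          nlinarith [sq_nonneg u]
        calc c * (ε ^ 2)⁻¹ * (q * (χ * u) ^ 2) = (ε ^ 2)⁻¹ * (c * q * (χ * u) ^ 2) := by ring
          _ ≤ (ε ^ 2)⁻¹ * (c * q * N) := by gcongr
          _ ≤ (ε ^ 2)⁻¹ * (ε ^ 2 * F) := by gcongr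
          _ = F := inv_mul_cancel_left₀ (by positivity) F
    have h6 : (1 + δ) * (χ * u') ^ 2 ≤ (1 + δ) * B := by gcongr
    linarith
  · have h1 : N - u ^ 2 ≤ (3 * κ)⁻¹ * F := by
      rw [← div_eq_inv_mul, le_div_iff₀ (by positivity)]
      linarith
    have h2 : u ^ 2 - (χ * u) ^ 2 ≤ ε ^ 2 / θ * F := by
      by_cases h0 : χ = 1
      · rw [h0, one_mul, sub_self]
        positivity
      · have h3 := hfar (Or.inl h0)
        have h4 : N ≤ ε ^ 2 / θ * F := by
          rw [div_mul_eq_mul_div, le_div_iff₀ hθ]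
          linarith
        linarith [sq_nonneg (χ * u)]
    rw [add_mul]
    linarith

variable {a b M cp cm m : ℝ} {h : ℝ → ℝ} {μ : ℕ → ℝ} {X : ℕ → ℝ → ℝ}

/-- The main lower bound, for given sizes of the cutoff and of `ε`. Off the span of `N` functions the
form of the strip is bounded below, up to small relative errors, by `μ N` in the scale `s`. In each slice
the energy above the threshold `π² / (M² ε²)` dominates the potential of the limit operator, and the part
of the norm that is orthogonal to the ground state or far from the maximum costs much more. -/
theorem strip_form_lower_bound (hh : Profile a b h M cp cm m)
    (hS : IsSchrodingerEigensystem (potential M cp cm m) μ X) (N : ℕ) (bc : EndCondition)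
    {δ ε s θ η C : ℝ} {χ : ℝ → ℝ} (hδ : 0 < δ) (hδ1 : δ < 1) (hε : 0 < ε) (hs : 0 < s) (hθ : 0 < θ)
    (hsε : s ^ m * s ^ 2 = ε ^ 2) (hχ : ContDiff ℝ ∞ χ) (hηa : η < a) (hηb : η < b)
    (hχ01 : ∀ x, 0 ≤ χ x ∧ χ x ≤ 1)
    (hχ1 : ∀ x, |x| ≤ η / 2 → χ x = 1) (hχ0 : ∀ x, η ≤ |x| → χ x = 0)
    (hχ'0 : ∀ x, |x| < η / 2 → deriv χ x = 0) (hχ'C : ∀ x, |deriv χ x| ≤ C)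
    (hnear : ∀ x, |x| ≤ η →
      (1 - δ) * potential M cp cm m x ≤ 2 * Real.pi ^ 2 / M ^ 3 * (M - h x))
    (hfar : ∀ x ∈ Set.Icc (-a) b, η / 2 ≤ |x| → θ ≤ 2 * Real.pi ^ 2 / M ^ 3 * (M - h x))
    (hεδ : (1 + δ⁻¹) * C ^ 2 * ε ^ 2 ≤ δ * θ) :
    ∃ w : Fin N → ℝ × ℝ → ℝ, (∀ i, MemLp (w i) 2 (volume.restrict (strip a b h ε))) ∧
      ∀ φ, IsTestFunction (dirichletPart a b h ε bc) φ →
        μ N * ((∫ p in strip a b h ε, φ p ^ 2) - ∑ i, (∫ p in strip a b h ε, w i p * φ p) ^ 2) ≤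
          (s ^ 2 * ((1 + δ) / (1 - δ)) + μ N * (ε ^ 2 * (M ^ 2 / (3 * Real.pi ^ 2) + 1 / θ))) *
            ((∫ p in strip a b h ε, (fderiv ℝ φ p (1, 0) ^ 2 + fderiv ℝ φ p (0, 1) ^ 2)) -
              Real.pi ^ 2 / (M ^ 2 * ε ^ 2) * ∫ p in strip a b h ε, φ p ^ 2) := by
  have hM := hh.M_pos
  have hm := hh.m_pos
  have hc := hh.continuousOn
  have hab := hh.neg_a_lt_b
  have hpos : ∀ x ∈ Set.Icc (-a) b, 0 < ε * h x := fun x hx => mul_pos hε (hh.pos x hx)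
  have hq : Continuous (potential M cp cm m) := continuous_potential hm
  have hq0 := potential_nonneg (m := m) hM hh.cp_pos hh.cm_pos
  have hXc : ∀ k, Continuous (X k) := fun k => (hS.contDiff k).continuous
  have hχc := hχ.continuous
  set L := ε * M with hLdef
  have hL0 : 0 < L := mul_pos hε hM
  have hL : ∀ x ∈ Set.Icc (-a) b, ε * h x ≤ L := fun x hx =>
    mul_le_mul_of_nonneg_left (hh.le hx) hε.le
  have hec := continuous_groundState L
  have hmeas : MeasurableSet (strip a b h ε) := (isOpen_strip hc).measurableSet
  have hwc : ∀ i : Fin N, Continuous fun p : ℝ × ℝ =>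
      χ p.1 * ((√s)⁻¹ * X i (s⁻¹ * p.1)) * groundState L p.2 := fun i => by
    have := hXc i
    fun_prop
  refine ⟨fun i p => χ p.1 * ((√s)⁻¹ * X i (s⁻¹ * p.1)) * groundState L p.2, fun i => ?_,
    fun φ hφ => ?_⟩
  · exact (memLp_restrict_of_isCompact (isCompact_Icc.prod isCompact_Icc)
      (hwc i).continuousOn).mono_measure (Measure.restrict_mono (strip_subset hL) le_rfl)
  obtain ⟨G, hG, hGc, hGs, hGφ, hGφ'⟩ := exists_zero_extension hc hab hpos hφ
  have hG1 : ContDiff ℝ 1 G := hG.of_le (by simp)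
  have hGcont := hG.continuous
  have hGx := continuous_fderiv_apply hG1 (1, 0)
  have hGy := continuous_fderiv_apply hG1 (0, 1)
  set κ := Real.pi ^ 2 / (M ^ 2 * ε ^ 2) with hκdef
  have hκ : κ = (Real.pi / L) ^ 2 := by rw [hκdef, hLdef, div_pow, mul_pow]; ring
  have hκ0 : 0 < κ := by positivity
  -- on the slice at `x`: the squared norm `n`, the longitudinal and transversal energies `B` and `D`,
  -- and the component `u` along the ground state of the widest slice `(0, L)`
  let n : ℝ → ℝ := fun x => ∫ y in (0 : ℝ)..L, G (x, y) ^ 2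
  let B : ℝ → ℝ := fun x => ∫ y in (0 : ℝ)..L, fderiv ℝ G (x, y) (1, 0) ^ 2
  let D : ℝ → ℝ := fun x => ∫ y in (0 : ℝ)..L, fderiv ℝ G (x, y) (0, 1) ^ 2
  let u : ℝ → ℝ := fun x => ∫ y in (0 : ℝ)..L, G (x, y) * groundState L y
  have cn : Continuous n := continuous_intervalIntegral_slice (F := fun p => G p ^ 2) (by fun_prop) _ _
  have cB : Continuous B := continuous_intervalIntegral_slice
    (F := fun p => fderiv ℝ G p (1, 0) ^ 2) (by fun_prop) _ _
  have cD : Continuous D := continuous_intervalIntegral_slice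
    (F := fun p => fderiv ℝ G p (0, 1) ^ 2) (by fun_prop) _ _
  have hu1 : ContDiff ℝ 1 u := contDiff_integral_slice hG1 hec 0 L
  have hud : ∀ x, HasDerivAt u (deriv u x) x := fun x =>
    (hu1.differentiable one_ne_zero x).hasDerivAt
  -- the one-dimensional function to which the bound for the limit operator is applied
  let v : ℝ → ℝ := fun x => χ x * u x
  have hv1 : ContDiff ℝ 1 v := (hχ.of_le (by simp)).mul hu1
  have hvd : ∀ x, deriv v x = deriv χ x * u x + χ x * deriv u x := fun x =>
    ((hχ.differentiable (by simp) x).hasDerivAt.mul (hud x)).deriv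
  have hv0 : ∀ x, η ≤ |x| → v x = 0 := fun x hx => by simp only [v, hχ0 x hx, zero_mul]
  have hvc : HasCompactSupport v := hasCompactSupport_of_forall_le_abs hv0
  have hvs : ∀ x, x ∉ Set.Ioo (-a) b → v x = 0 ∧ deriv v x = 0 := by
    intro x hx
    have h1 : η < |x| := by
      by_contra hcon
      have := abs_le.1 (not_lt.1 hcon)
      exact hx ⟨by linarith, by linarith⟩
    refine ⟨hv0 x h1.le, ?_⟩
    have : v =ᶠ[𝓝 x] fun _ => 0 := by
      filter_upwards [(continuous_abs.tendsto x).eventually (lt_mem_nhds h1)] with y hy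
      exact hv0 y (le_of_lt hy)
    rw [this.deriv_eq]
    simp
  have hline : ∀ f : ℝ → ℝ, (∀ x, x ∉ Set.Ioo (-a) b → f x = 0) → ∫ x, f x = ∫ x in (-a)..b, f x :=
    fun f hf => integral_eq_intervalIntegral_of_Ioo hf
  -- the integrals over the strip
  have e0 : ∫ p in strip a b h ε, φ p ^ 2 = ∫ x in (-a)..b, n x := by
    rw [← setIntegral_strip_eq hc hab.le hpos (F := fun p => G p ^ 2) (by fun_prop)
      (fun x hx y hy => by rw [hGs.eq_zero hx hy]; ring) hL]
    exact setIntegral_congr_fun hmeas fun p hp => by simp only [hGφ p hp]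
  have e1 : ∫ p in strip a b h ε, (fderiv ℝ φ p (1, 0) ^ 2 + fderiv ℝ φ p (0, 1) ^ 2) =
      ∫ x in (-a)..b, (B x + D x) := by
    have h1 : ∀ x, B x + D x =
        ∫ y in (0 : ℝ)..L, (fderiv ℝ G (x, y) (1, 0) ^ 2 + fderiv ℝ G (x, y) (0, 1) ^ 2) := fun x =>
      (intervalIntegral.integral_add (Continuous.intervalIntegrable (by fun_prop) _ _)
        (Continuous.intervalIntegrable (by fun_prop) _ _)).symm
    simp only [h1]
    rw [← setIntegral_strip_eq hc hab.le hpos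
      (F := fun p => fderiv ℝ G p (1, 0) ^ 2 + fderiv ℝ G p (0, 1) ^ 2) (by fun_prop)
      (fun x hx y hy => by rw [hGs.fderiv_eq_zero hx hy]; simp) hL]
    exact setIntegral_congr_fun hmeas fun p hp => by simp only [hGφ' p hp]
  have e2 : ∀ i : Fin N, ∫ p in strip a b h ε,
      χ p.1 * ((√s)⁻¹ * X i (s⁻¹ * p.1)) * groundState L p.2 * φ p =
      ∫ x, v x * ((√s)⁻¹ * X i (s⁻¹ * x)) := by
    intro i
    rw [hline _ fun x hx => by rw [(hvs x hx).1, zero_mul]]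
    have h1 : ∀ x, v x * ((√s)⁻¹ * X i (s⁻¹ * x)) = ∫ y in (0 : ℝ)..L,
        χ x * ((√s)⁻¹ * X i (s⁻¹ * x)) * groundState L y * G (x, y) := fun x => by
      simp only [v, u]
      rw [← intervalIntegral.integral_const_mul, ← intervalIntegral.integral_mul_const]
      congr 1
      ext y
      ring
    simp only [h1]
    rw [← setIntegral_strip_eq hc hab.le hpos
      (F := fun p => χ p.1 * ((√s)⁻¹ * X i (s⁻¹ * p.1)) * groundState L p.2 * G p)
      ((hwc i).mul hGcont) (fun x hx y hy => by simp only; rw [hGs.eq_zero hx hy, mul_zero]) hL]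
    exact setIntegral_congr_fun hmeas fun p hp => by simp only [hGφ p hp]
  -- the slice estimates
  have hslice : ∀ x ∈ Set.Icc (-a) b, 2 * Real.pi ^ 2 / M ^ 3 * (M - h x) * n x ≤
      ε ^ 2 * (D x - κ * n x) ∧ 3 * κ * (n x - u x ^ 2) ≤ D x - κ * n x ∧ u x ^ 2 ≤ n x ∧
      deriv u x ^ 2 ≤ B x ∧ 0 ≤ n x := by
    intro x hx
    have h1 : ContDiff ℝ 1 fun y => G (x, y) := hG1.comp (contDiff_const.prodMk contDiff_id)
    have h2 : deriv (fun y => G (x, y)) = fun y => fderiv ℝ G (x, y) (0, 1) :=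
      funext fun y => (hasDerivAt_slice_snd hG1 x y).deriv
    have h3 := slice_bounds h1 (hpos x hx) (hL x hx) fun y hy => hGs.eq_zero hx hy
    rw [h2, ← hκ] at h3
    have hn0 : 0 ≤ n x := intervalIntegral.integral_nonneg hL0.le fun _ _ => sq_nonneg _
    refine ⟨?_, h3.2, sq_integral_mul_groundState_le h1.continuous hL0, ?_, hn0⟩
    · have h4 := inv_sq_sub_inv_sq_ge hM (hh.pos x hx)
      have h5 : ε ^ 2 * ((Real.pi / (ε * h x)) ^ 2 * n x - κ * n x) =
          Real.pi ^ 2 * (1 / h x ^ 2 - 1 / M ^ 2) * n x := by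
        have := hh.pos x hx
        rw [hκdef]
        field_simp
      calc 2 * Real.pi ^ 2 / M ^ 3 * (M - h x) * n x = Real.pi ^ 2 * (2 / M ^ 3 * (M - h x)) * n x := by
            ring
        _ ≤ Real.pi ^ 2 * (1 / h x ^ 2 - 1 / M ^ 2) * n x := by gcongr
        _ = _ := h5.symm
        _ ≤ ε ^ 2 * (D x - κ * n x) := by
            have := h3.1
            gcongr
    · have h4 : deriv u x = ∫ y in (0 : ℝ)..L, fderiv ℝ G (x, y) (1, 0) * groundState L y :=
        (hasDerivAt_integral_slice hG1 hec 0 L x).deriv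
      rw [h4]
      exact sq_integral_mul_groundState_le (g := fun y => fderiv ℝ G (x, y) (1, 0)) (by fun_prop) hL0
  have hWnn : ∀ x ∈ Set.Icc (-a) b, 0 ≤ 2 * Real.pi ^ 2 / M ^ 3 * (M - h x) := fun x hx => by
    have := sub_nonneg.2 (hh.le hx)
    positivity
  have hpt : ∀ x ∈ Set.Icc (-a) b,
      deriv v x ^ 2 + (1 - δ) * (ε ^ 2)⁻¹ * (potential M cp cm m x * v x ^ 2) ≤
        (1 + δ) * (B x + (D x - κ * n x)) ∧
      n x - v x ^ 2 ≤ ((3 * κ)⁻¹ + ε ^ 2 / θ) * (D x - κ * n x) := by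
    intro x hx
    obtain ⟨s1, s2, s3, s4, s5⟩ := hslice x hx
    rw [hvd]
    refine slice_comparison hδ hε hθ hκ0 ?_ s3 s4 s2 (hχ01 x).1 (hχ01 x).2 (hχ'C x) (fun h0 => ?_)
      (hq0 x) (by linarith) (fun h0 => ?_) hεδ
    · exact (mul_nonneg (by positivity) (sub_nonneg.2 s3)).trans s2
    · have h1 : |x| ≤ η := by
        by_contra hcon
        exact h0 (hχ0 x (not_le.1 hcon).le)
      exact (mul_le_mul_of_nonneg_right (hnear x h1) s5).trans s1
    · have h1 : η / 2 ≤ |x| := by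
        by_contra hcon
        rcases h0 with h0 | h0
        · exact h0 (hχ1 x (not_le.1 hcon).le)
        · exact h0 (hχ'0 x (not_le.1 hcon))
      exact (mul_le_mul_of_nonneg_right (hfar x hx h1) s5).trans s1
  set E := (∫ x in (-a)..b, (B x + D x)) - κ * ∫ x in (-a)..b, n x with hEdef
  have hE : E = ∫ x in (-a)..b, (B x + (D x - κ * n x)) := by
    rw [hEdef, ← intervalIntegral.integral_const_mul, ← intervalIntegral.integral_sub
      (Continuous.intervalIntegrable (by fun_prop) _ _)
      (Continuous.intervalIntegrable (by fun_prop) _ _)]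
    congr 1
    ext x
    ring
  have hvC := hv1.continuous
  have hv'C : Continuous (deriv v) := hv1.continuous_deriv le_rfl
  have i1 : (1 - δ) * ∫ x, (s ^ 2 * deriv v x ^ 2 + (s ^ m)⁻¹ * (potential M cp cm m x * v x ^ 2)) ≤
      s ^ 2 * ((1 + δ) * E) := by
    rw [hline _ fun x hx => by rw [(hvs x hx).1, (hvs x hx).2]; ring, hE,
      ← intervalIntegral.integral_const_mul, ← intervalIntegral.integral_const_mul,
      ← intervalIntegral.integral_const_mul]
    refine intervalIntegral.integral_mono_on hab.le (Continuous.intervalIntegrable (by fun_prop) _ _)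
      (Continuous.intervalIntegrable (by fun_prop) _ _) fun x hx => ?_
    have h1 := (hpt x hx).1
    have h2 : (s ^ m)⁻¹ = s ^ 2 * (ε ^ 2)⁻¹ := by
      rw [← hsε]
      have : 0 < s ^ m := by positivity
      field_simp
    rw [h2]
    calc _ ≤ s ^ 2 * (deriv v x ^ 2 +
          (1 - δ) * (ε ^ 2)⁻¹ * (potential M cp cm m x * v x ^ 2)) := by
          have : 0 ≤ s ^ 2 * deriv v x ^ 2 := by positivity
          nlinarith
      _ ≤ _ := by gcongr
  have i2 : (∫ x in (-a)..b, n x) ≤ (∫ x, v x ^ 2) +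
      ε ^ 2 * (M ^ 2 / (3 * Real.pi ^ 2) + 1 / θ) * E := by
    rw [hline _ fun x hx => by rw [(hvs x hx).1]; ring, hE, ← intervalIntegral.integral_const_mul,
      ← intervalIntegral.integral_add (Continuous.intervalIntegrable (by fun_prop) _ _)
      (Continuous.intervalIntegrable (by fun_prop) _ _)]
    refine intervalIntegral.integral_mono_on hab.le (Continuous.intervalIntegrable (by fun_prop) _ _)
      (Continuous.intervalIntegrable (by fun_prop) _ _) fun x hx => ?_
    have h1 := (hpt x hx).2
    have h2 : (3 * κ)⁻¹ + ε ^ 2 / θ = ε ^ 2 * (M ^ 2 / (3 * Real.pi ^ 2) + 1 / θ) := by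
      rw [hκdef]
      field_simp
    rw [h2] at h1
    have h3 : 0 ≤ B x := (sq_nonneg _).trans (hslice x hx).2.2.2.1
    have h4 : 0 ≤ ε ^ 2 * (M ^ 2 / (3 * Real.pi ^ 2) + 1 / θ) * B x := by positivity
    rw [mul_add]
    linarith
  have hμ := hS.nonneg hq hq0 N
  have key := hS.scaled_form_lower_bound hq hq0 hs (potential_mul hs) (by positivity) hv1 hvc N
  rw [← Fin.sum_univ_eq_sum_range
    (fun k => (∫ x, v x * ((√s)⁻¹ * X k (s⁻¹ * x))) ^ 2)] at key
  rw [e0, e1]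
  simp only [e2]
  have i3 : ∫ x, (s ^ 2 * deriv v x ^ 2 + (s ^ m)⁻¹ * (potential M cp cm m x * v x ^ 2)) ≤
      s ^ 2 * ((1 + δ) / (1 - δ)) * E := by
    have h1 : 0 < 1 - δ := by linarith
    refine le_of_mul_le_mul_left (i1.trans_eq ?_) h1
    field_simp
  have i4 := mul_le_mul_of_nonneg_left i2 hμ
  rw [← hEdef]
  linarith

/-- The asymptotic lower bound for the form of the strip. -/
theorem eventually_strip_form_lower_bound (hh : Profile a b h M cp cm m)
    (hS : IsSchrodingerEigensystem (potential M cp cm m) μ X) (N : ℕ) (bc : EndCondition) {α : ℝ}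
    (hα : α = 2 / (m + 2)) {ρ : ℝ} (hρ : 0 < ρ) :
    ∀ᶠ ε in 𝓝[>] (0 : ℝ), ∃ w : Fin N → ℝ × ℝ → ℝ,
      (∀ i, MemLp (w i) 2 (volume.restrict (strip a b h ε))) ∧
      ∃ K : ℝ, 0 ≤ K ∧ K ≤ (1 + ρ) * ε ^ (2 * α) ∧
      ∀ φ, IsTestFunction (dirichletPart a b h ε bc) φ →
        μ N * ((∫ p in strip a b h ε, φ p ^ 2) - ∑ i, (∫ p in strip a b h ε, w i p * φ p) ^ 2) ≤
          K * ((∫ p in strip a b h ε, (fderiv ℝ φ p (1, 0) ^ 2 + fderiv ℝ φ p (0, 1) ^ 2)) -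
              Real.pi ^ 2 / (M ^ 2 * ε ^ 2) * ∫ p in strip a b h ε, φ p ^ 2) := by
  have hM := hh.M_pos
  have hm := hh.m_pos
  have hμ := hS.nonneg (continuous_potential hm) (potential_nonneg hM hh.cp_pos hh.cm_pos) N
  have hα0 : 0 < α := by rw [hα]; positivity
  have hα1 : 0 < 2 - 2 * α := by
    rw [hα]
    have : 2 / (m + 2) < 1 := by rw [div_lt_one (by linarith)]; linarith
    linarith
  obtain ⟨δ, hδ, hδ1, hδρ⟩ : ∃ δ : ℝ, 0 < δ ∧ δ < 1 ∧ (1 + δ) / (1 - δ) ≤ 1 + ρ / 2 := by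
    refine ⟨ρ / (ρ + 4), by positivity, by rw [div_lt_one (by positivity)]; linarith, ?_⟩
    have h1 : 1 - ρ / (ρ + 4) = 4 / (ρ + 4) := by field_simp; ring
    rw [h1, div_le_iff₀ (by positivity)]
    field_simp
    ring_nf
    nlinarith
  obtain ⟨η₀, hη₀, hexp⟩ := hh.expansion hδ
  obtain ⟨η, hη, hηle⟩ := exists_between (show (0 : ℝ) < min η₀ (min a b) from
    lt_min hη₀ (lt_min hh.a_pos hh.b_pos))
  simp only [lt_min_iff] at hηle
  obtain ⟨θ₀, hθ₀, hgap⟩ := hh.exists_gap (half_pos hη)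
  set θ := 2 * Real.pi ^ 2 / M ^ 3 * θ₀ with hθdef
  have hθ : 0 < θ := by positivity
  obtain ⟨χ, C, hχ, hC0, hχ01, hχ1, hχ0, hχ'0, hχ'C⟩ := exists_cutoff hη
  have t1 : Tendsto (fun ε : ℝ => (1 + δ⁻¹) * C ^ 2 * ε ^ 2) (𝓝[>] 0) (𝓝 0) := by
    have : Tendsto (fun ε : ℝ => (1 + δ⁻¹) * C ^ 2 * ε ^ 2) (𝓝 0) (𝓝 ((1 + δ⁻¹) * C ^ 2 * 0 ^ 2)) :=
      (Continuous.tendsto (by fun_prop) 0)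
    simp only [ne_eq, OfNat.ofNat_ne_zero, not_false_eq_true, zero_pow, mul_zero] at this
    exact this.mono_left nhdsWithin_le_nhds
  have t2 : Tendsto (fun ε : ℝ => μ N * (M ^ 2 / (3 * Real.pi ^ 2) + 1 / θ) * ε ^ (2 - 2 * α))
      (𝓝[>] 0) (𝓝 0) :=
    tendsto_const_mul_rpow hα1 _
  filter_upwards [self_mem_nhdsWithin, t1.eventually_le_const (show 0 < δ * θ by positivity),
    t2.eventually_le_const (half_pos hρ)] with ε hε h1 h2
  have hε0 : 0 < ε := hε
  have hs2 := rpow_sq_eq hε0.le α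
  have hsε := rpow_rpow_mul_sq hε0 hm hα
  obtain ⟨w, hw, hform⟩ := strip_form_lower_bound hh hS N bc hδ hδ1 hε0
    (show 0 < ε ^ α by positivity) hθ hsε hχ hηle.2.1 hηle.2.2 hχ01 hχ1 hχ0 hχ'0 hχ'C
    (fun x hx => by
      have := (abs_le.1 (hexp x (hx.trans hηle.1.le))).1
      linarith)
    (fun x hx hx' => by
      rw [hθdef]
      have := hgap x hx hx'
      gcongr) h1
  refine ⟨w, hw, _, ?_, ?_, hform⟩
  · have : 0 < 1 - δ := by linarith
    positivity
  · rw [hs2]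
    have h3 : ε ^ 2 = ε ^ (2 * α) * ε ^ (2 - 2 * α) := by
      rw [← Real.rpow_add hε0, ← Real.rpow_natCast]
      congr 1
      push_cast
      ring
    have h4 : 0 < ε ^ (2 * α) := by positivity
    calc ε ^ (2 * α) * ((1 + δ) / (1 - δ)) + μ N * (ε ^ 2 * (M ^ 2 / (3 * Real.pi ^ 2) + 1 / θ)) =
        ε ^ (2 * α) * ((1 + δ) / (1 - δ) +
          μ N * (M ^ 2 / (3 * Real.pi ^ 2) + 1 / θ) * ε ^ (2 - 2 * α)) := by rw [h3]; ring
      _ ≤ ε ^ (2 * α) * (1 + ρ / 2 + ρ / 2) := by gcongr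
      _ = _ := by ring

end LowerBound

/-! ### Smooth test functions with separated variables -/

section Transversal

/-- A smooth function below the identity, of slope at most `1`, vanishing near `0`. -/
theorem exists_smooth_truncation {θ : ℝ} (hθ : 0 < θ) : ∃ φ : ℝ → ℝ, ContDiff ℝ ∞ φ ∧
    (∀ t ≤ θ, φ t = 0) ∧ (∀ t, 0 ≤ φ t) ∧ (∀ t, t - 2 * θ ≤ φ t) ∧
    ∀ t, 0 ≤ deriv φ t ∧ deriv φ t ≤ 1 := by
  let χ : ℝ → ℝ := fun r => Real.smoothTransition (r / θ - 1)
  have hχ : ContDiff ℝ ∞ χ :=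
    Real.smoothTransition.contDiff.comp ((contDiff_id.div_const θ).sub contDiff_const)
  have hχc := hχ.continuous
  have hd : ∀ t, HasDerivAt (fun t => ∫ r in θ..t, χ r) (χ t) t := fun t =>
    intervalIntegral.integral_hasDerivAt_right (hχc.intervalIntegrable _ _)
      hχc.stronglyMeasurable.stronglyMeasurableAtFilter hχc.continuousAt
  have hd' : deriv (fun t => ∫ r in θ..t, χ r) = χ := funext fun t => (hd t).deriv
  have hχ0 : ∀ r ≤ θ, χ r = 0 := fun r hr => by
    refine Real.smoothTransition.zero_of_nonpos ?_
    rw [sub_nonpos, div_le_one hθ]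
    exact hr
  have hz : ∀ t ≤ θ, ∫ r in θ..t, χ r = 0 := fun t ht => by
    rw [intervalIntegral.integral_congr (g := fun _ => (0 : ℝ)) fun r hr => ?_]
    · simp
    · rw [Set.uIcc_of_ge ht] at hr
      exact hχ0 r hr.2
  have hnn : ∀ t, 0 ≤ ∫ r in θ..t, χ r := fun t => by
    rcases le_total t θ with h | h
    · exact (hz t h).ge
    · exact intervalIntegral.integral_nonneg h fun r _ => Real.smoothTransition.nonneg _
  refine ⟨fun t => ∫ r in θ..t, χ r, ?_, hz, hnn, fun t => ?_, fun t => ?_⟩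
  · rw [contDiff_infty_iff_deriv]
    refine ⟨fun t => (hd t).differentiableAt, ?_⟩
    rw [hd']
    exact hχ
  · rcases le_total t (2 * θ) with h | h
    · linarith [hnn t]
    · show t - 2 * θ ≤ ∫ r in θ..t, χ r
      have h1 := intervalIntegral.integral_add_adjacent_intervals (hχc.intervalIntegrable θ (2 * θ))
        (hχc.intervalIntegrable (2 * θ) t) (μ := volume)
      have h2 := hnn (2 * θ)
      have h3 : ∫ r in (2 * θ)..t, χ r = t - 2 * θ := by
        rw [intervalIntegral.integral_congr (g := fun _ => (1 : ℝ)) fun r hr => ?_]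
        · simp
        · rw [Set.uIcc_of_le h] at hr
          refine Real.smoothTransition.one_of_one_le ?_
          rw [le_sub_iff_add_le, le_div_iff₀ hθ]
          linarith [hr.1]
      linarith
  · rw [hd']
    exact ⟨Real.smoothTransition.nonneg _, Real.smoothTransition.le_one _⟩

/-- Smooth normalized functions supported inside `(0, 1)`, of energy close to that of the ground
state: truncations of `sin (π y)`. -/
theorem exists_transversal_profile {τ : ℝ} (hτ : 0 < τ) : ∃ f : ℝ → ℝ, ContDiff ℝ ∞ f ∧
    (∀ y, 0 ≤ f y) ∧ tsupport f ⊆ Set.Ioo 0 1 ∧ ∫ y in (0 : ℝ)..1, f y ^ 2 = 1 ∧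
    ∫ y in (0 : ℝ)..1, deriv f y ^ 2 ≤ Real.pi ^ 2 + τ := by
  have hπ := Real.pi_pos
  set θ := τ / (8 * (Real.pi ^ 2 + τ)) with hθdef
  have hθ : 0 < θ := by positivity
  have hθ1 : (Real.pi ^ 2 + τ) * (1 - 8 * θ) = Real.pi ^ 2 := by
    rw [hθdef]
    field_simp
    ring
  have hθ8 : 0 < 1 - 8 * θ := by
    have : 0 < Real.pi ^ 2 + τ := by positivity
    by_contra hcon
    nlinarith [sq_pos_of_pos hπ]
  obtain ⟨φ, hφ, hφ0, hφnn, hφge, hφ'⟩ := exists_smooth_truncation hθ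
  -- the bump only removes the other periods of the sine
  let b : ContDiffBump (1 / 2 : ℝ) := ⟨5 / 8, 3 / 4, by norm_num, by norm_num⟩
  have hbs : ContDiff ℝ ∞ b := b.contDiff
  have hsin : ContDiff ℝ ∞ fun y : ℝ => Real.sin (Real.pi * y) :=
    Real.contDiff_sin.comp (contDiff_const.mul contDiff_id)
  have hφs : ContDiff ℝ ∞ fun y => φ (Real.sin (Real.pi * y)) := hφ.comp hsin
  let f : ℝ → ℝ := fun y => b y * φ (Real.sin (Real.pi * y))
  have hf : ContDiff ℝ ∞ f := hbs.mul hφs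
  have hfc := hf.continuous
  have hf'c : Continuous (deriv f) := hf.continuous_deriv (by simp)
  have hfnn : ∀ y, 0 ≤ f y := fun y => mul_nonneg b.nonneg (hφnn _)
  have hfe : ∀ y ∈ Set.Icc (0 : ℝ) 1, f =ᶠ[𝓝 y] fun y => φ (Real.sin (Real.pi * y)) := by
    intro y hy
    have h1 : y ∈ Metric.ball (1 / 2 : ℝ) (5 / 8) := by
      rw [Metric.mem_ball, Real.dist_eq, abs_lt]
      constructor <;> linarith [hy.1, hy.2]
    filter_upwards [Metric.isOpen_ball.mem_nhds h1] with t ht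
    have : b t = 1 := b.one_of_mem_closedBall (Metric.ball_subset_closedBall ht)
    simp only [f, this, one_mul]
  have hfv : ∀ y ∈ Set.Icc (0 : ℝ) 1, f y = φ (Real.sin (Real.pi * y)) := fun y hy =>
    (hfe y hy).eq_of_nhds
  have hf' : ∀ y ∈ Set.Icc (0 : ℝ) 1, deriv f y ^ 2 ≤ Real.pi ^ 2 * Real.cos (Real.pi * y) ^ 2 := by
    intro y hy
    have h1 : HasDerivAt (fun y : ℝ => Real.sin (Real.pi * y)) (Real.cos (Real.pi * y) * Real.pi) y := by
      simpa using ((hasDerivAt_id y).const_mul Real.pi).sin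
    have h2 := ((hφ.differentiable (by simp) (Real.sin (Real.pi * y))).hasDerivAt).comp y h1
    have h3 : deriv f y = deriv φ (Real.sin (Real.pi * y)) * (Real.cos (Real.pi * y) * Real.pi) := by
      rw [(hfe y hy).deriv_eq]
      exact h2.deriv
    rw [h3, mul_pow, mul_pow]
    have h4 := hφ' (Real.sin (Real.pi * y))
    have h5 : deriv φ (Real.sin (Real.pi * y)) ^ 2 ≤ 1 := by nlinarith [h4.1, h4.2]
    have h6 : 0 ≤ Real.cos (Real.pi * y) ^ 2 * Real.pi ^ 2 := by positivity
    nlinarith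
  have hsin0 : ∀ y ∈ Set.Icc (0 : ℝ) 1, 0 ≤ Real.sin (Real.pi * y) := fun y hy =>
    Real.sin_nonneg_of_nonneg_of_le_pi (by have := hy.1; positivity) (by nlinarith [hy.2])
  have hsup : tsupport f ⊆ Set.Ioo 0 1 := by
    have h1 : tsupport f ⊆ {y | |y - 1 / 2| ≤ 3 / 4 ∧ θ ≤ Real.sin (Real.pi * y)} := by
      refine closure_minimal (fun y hy => ?_)
        ((isClosed_le (f := fun y : ℝ => |y - 1 / 2|) (by fun_prop) continuous_const).inter
          (isClosed_le (g := fun y : ℝ => Real.sin (Real.pi * y)) continuous_const (by fun_prop)))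
      rw [Function.mem_support] at hy
      constructor
      · by_contra hcon
        have : b y = 0 := b.zero_of_le_dist (by
          rw [Real.dist_eq]; exact (not_le.1 hcon).le)
        exact hy (by simp only [f, this, zero_mul])
      · by_contra hcon
        exact hy (by simp only [f, hφ0 _ (not_le.1 hcon).le, mul_zero])
    refine h1.trans ?_
    rintro y ⟨hy1, hy2⟩
    rw [abs_le] at hy1
    constructor
    · by_contra hcon
      have h2 : Real.sin (Real.pi * y) ≤ 0 :=
        Real.sin_nonpos_of_nonpos_of_neg_pi_le (by nlinarith) (by nlinarith)
      linarith
    · by_contra hcon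
      have h2 : Real.sin (Real.pi * y) ≤ 0 := by
        have h3 : Real.sin (Real.pi * y) = -Real.sin (Real.pi * y - Real.pi) := by
          rw [Real.sin_sub_pi, neg_neg]
        rw [h3, neg_nonpos]
        exact Real.sin_nonneg_of_nonneg_of_le_pi (by nlinarith) (by nlinarith)
      linarith
  have hs2 : ∫ y in (0 : ℝ)..1, Real.sin (Real.pi * y) ^ 2 = 1 / 2 := by
    have h1 := integral_groundState_sq one_pos
    have h2 : ∀ y, groundState 1 y ^ 2 = 2 * Real.sin (Real.pi * y) ^ 2 := fun y => by
      rw [groundState, mul_pow, Real.sq_sqrt (by positivity)]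
      simp
    simp only [h2] at h1
    rw [intervalIntegral.integral_const_mul] at h1
    linarith
  have hc2 : ∫ y in (0 : ℝ)..1, Real.cos (Real.pi * y) ^ 2 = 1 / 2 := by
    have h1 : ∀ y, Real.cos (Real.pi * y) ^ 2 = 1 - Real.sin (Real.pi * y) ^ 2 := fun y => by
      rw [Real.cos_sq']
    simp only [h1]
    rw [intervalIntegral.integral_sub (by simp) (Continuous.intervalIntegrable (by fun_prop) _ _), hs2]
    norm_num
  set I := ∫ y in (0 : ℝ)..1, f y ^ 2 with hI
  have hIge : (1 - 8 * θ) / 2 ≤ I := by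
    have h1 : ∫ y in (0 : ℝ)..1, (Real.sin (Real.pi * y) ^ 2 - 4 * θ) ≤ I := by
      refine intervalIntegral.integral_mono_on zero_le_one
        (Continuous.intervalIntegrable (by fun_prop) _ _)
        (Continuous.intervalIntegrable (by fun_prop) _ _) fun y hy => ?_
      rw [hfv y hy]
      have h2 := hsin0 y hy
      have h3 := hφge (Real.sin (Real.pi * y))
      have h4 := hφnn (Real.sin (Real.pi * y))
      have h5 := Real.sin_le_one (Real.pi * y)
      rcases le_total (2 * θ) (Real.sin (Real.pi * y)) with h6 | h6
      · nlinarith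
      · nlinarith [sq_nonneg (φ (Real.sin (Real.pi * y)))]
    rw [intervalIntegral.integral_sub (Continuous.intervalIntegrable (by fun_prop) _ _) (by simp),
      hs2] at h1
    simp only [intervalIntegral.integral_const, sub_zero, smul_eq_mul, one_mul] at h1
    linarith
  have hI0 : 0 < I := by linarith
  have hE : ∫ y in (0 : ℝ)..1, deriv f y ^ 2 ≤ Real.pi ^ 2 / 2 := by
    have h1 : ∫ y in (0 : ℝ)..1, deriv f y ^ 2 ≤
        ∫ y in (0 : ℝ)..1, Real.pi ^ 2 * Real.cos (Real.pi * y) ^ 2 :=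
      intervalIntegral.integral_mono_on zero_le_one
        (Continuous.intervalIntegrable (by fun_prop) _ _)
        (Continuous.intervalIntegrable (by fun_prop) _ _) hf'
    rw [intervalIntegral.integral_const_mul, hc2] at h1
    linarith
  have hI2 : (√I)⁻¹ ^ 2 = I⁻¹ := by rw [inv_pow, Real.sq_sqrt hI0.le]
  refine ⟨fun y => (√I)⁻¹ * f y, contDiff_const.mul hf,
    fun y => mul_nonneg (by positivity) (hfnn y), ?_, ?_, ?_⟩
  · refine (closure_mono ?_).trans hsup
    intro y hy
    rw [Function.mem_support] at hy ⊢
    exact right_ne_zero_of_mul hy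
  · simp only [mul_pow, hI2]
    rw [intervalIntegral.integral_const_mul, ← hI, inv_mul_cancel₀ hI0.ne']
  · have h1 : deriv (fun y => (√I)⁻¹ * f y) = fun y => (√I)⁻¹ * deriv f y :=
      funext fun y => deriv_const_mul _ (hf.differentiable (by simp) y)
    simp only [h1, mul_pow, hI2]
    rw [intervalIntegral.integral_const_mul, inv_mul_le_iff₀ hI0]
    have h2 : 0 < Real.pi ^ 2 + τ := by positivity
    nlinarith

end Transversal

section Separated

variable {a b ε : ℝ} {h : ℝ → ℝ} {A k f : ℝ → ℝ}

/-- The function `A(x) √k(x) f(k(x) y)`: the profile `f` of the interval `(0, 1)`, rescaled to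
`(0, 1 / k(x))` with its norm preserved, and modulated by `A`. -/
noncomputable def separated (A k f : ℝ → ℝ) (p : ℝ × ℝ) : ℝ := A p.1 * √(k p.1) * f (k p.1 * p.2)

theorem contDiff_separated (hA : ContDiff ℝ ∞ A) (hk : ContDiff ℝ ∞ k) (hk0 : ∀ x, 0 < k x)
    (hf : ContDiff ℝ ∞ f) : ContDiff ℝ ∞ (separated A k f) := by
  have h1 : ContDiff ℝ ∞ fun x => √(k x) := hk.sqrt fun x => (hk0 x).ne'
  exact ((hA.comp contDiff_fst).mul (h1.comp contDiff_fst)).mul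
    (hf.comp ((hk.comp contDiff_fst).mul contDiff_snd))

theorem tsupport_separated_subset (hk : Continuous k) : tsupport (separated A k f) ⊆
    {p | p.1 ∈ tsupport A ∧ k p.1 * p.2 ∈ tsupport f} := by
  refine closure_minimal (fun p hp => ?_)
    (((isClosed_tsupport A).preimage continuous_fst).inter
      ((isClosed_tsupport f).preimage (by fun_prop : Continuous fun p : ℝ × ℝ => k p.1 * p.2)))
  rw [Function.mem_support, separated] at hp
  exact ⟨subset_tsupport _ (left_ne_zero_of_mul (left_ne_zero_of_mul hp)),
    subset_tsupport _ (right_ne_zero_of_mul hp)⟩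

/-- The condition `1 ≤ k x * (ε * h x)` says that the rescaled interval `(0, 1 / k x)` fits into the slice
of the strip at `x`. -/
theorem tsupport_separated_subset_strip (hk : Continuous k) (hk0 : ∀ x, 0 < k x)
    (hf : tsupport f ⊆ Set.Ioo 0 1)
    (hA : ∀ x ∈ tsupport A, x ∈ Set.Ioo (-a) b ∧ 1 ≤ k x * (ε * h x)) :
    tsupport (separated A k f) ⊆ strip a b h ε := by
  refine (tsupport_separated_subset hk).trans ?_
  rintro p ⟨h1, h2⟩
  obtain ⟨h3, h4⟩ := hA _ h1
  have h5 := hf h2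
  have h6 := hk0 p.1
  refine ⟨h3.1, h3.2, pos_of_mul_pos_right h5.1 h6.le, ?_⟩
  exact lt_of_mul_lt_mul_left (h5.2.trans_le h4) h6.le

theorem isTestFunction_separated (hc : ContinuousOn h (Set.Icc (-a) b)) (hAs : ContDiff ℝ ∞ A)
    (hk : ContDiff ℝ ∞ k) (hk0 : ∀ x, 0 < k x) (hfs : ContDiff ℝ ∞ f) (hf : tsupport f ⊆ Set.Ioo 0 1)
    (hA : ∀ x ∈ tsupport A, x ∈ Set.Ioo (-a) b ∧ 1 ≤ k x * (ε * h x)) (bc : EndCondition) :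
    IsTestFunction (dirichletPart a b h ε bc) (separated A k f) := by
  have h1 := tsupport_separated_subset_strip hk.continuous hk0 hf hA
  obtain ⟨L, -, hL⟩ := exists_strip_bound (ε := ε) hc
  exact ⟨contDiff_separated hAs hk hk0 hfs,
    (isCompact_Icc.prod isCompact_Icc).of_isClosed_subset (isClosed_tsupport _)
      (h1.trans (strip_subset hL)), (disjoint_strip_dirichletPart hc bc).mono_left h1⟩

theorem integral_comp_mul_of_support {F : ℝ → ℝ} (hF : Continuous F)
    (hF0 : ∀ z ∉ Set.Ioo (0 : ℝ) 1, F z = 0) {c l : ℝ} (hc : 0 < c) (hcl : 1 ≤ c * l) :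
    ∫ y in (0 : ℝ)..l, F (c * y) = c⁻¹ * ∫ z in (0 : ℝ)..1, F z := by
  rw [intervalIntegral.integral_comp_mul_left _ hc.ne', mul_zero, smul_eq_mul,
    ← intervalIntegral.integral_add_adjacent_intervals (hF.intervalIntegrable 0 1)
      (hF.intervalIntegrable 1 (c * l))]
  have : ∫ z in (1 : ℝ)..(c * l), F z = 0 := by
    rw [intervalIntegral.integral_congr (g := fun _ => (0 : ℝ)) fun y hy => ?_]
    · simp
    · rw [Set.uIcc_of_le hcl] at hy
      exact hF0 y fun hy' => absurd hy.1 (not_le.2 hy'.2)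
  rw [this, add_zero]

theorem fderiv_separated_fst (hA : ContDiff ℝ ∞ A) (hk : ContDiff ℝ ∞ k) (hk0 : ∀ x, 0 < k x)
    (hf : ContDiff ℝ ∞ f) (x y : ℝ) : fderiv ℝ (separated A k f) (x, y) (1, 0) =
      √(k x) * (deriv A x * f (k x * y) + A x * (deriv k x / k x) *
        (1 / 2 * f (k x * y) + k x * y * deriv f (k x * y))) := by
  have h1 := hasDerivAt_slice_fst ((contDiff_separated hA hk hk0 hf).of_le (by simp)) x y
  have dA := (hA.differentiable (by simp) x).hasDerivAt
  have dk := (hk.differentiable (by simp) x).hasDerivAt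
  have df := (hf.differentiable (by simp) (k x * y)).hasDerivAt
  have h2 := (dA.mul (dk.sqrt (hk0 x).ne')).mul (df.comp x (dk.mul_const y))
  rw [h1.unique h2]
  have h3 := hk0 x
  have h4 : 0 < √(k x) := Real.sqrt_pos.2 h3
  have h5 : √(k x) ^ 2 = k x := Real.sq_sqrt h3.le
  simp only [Function.comp, Pi.mul_apply]
  nth_rw 5 [← h5]
  field_simp
  rw [h5]
  field_simp
  ring

theorem fderiv_separated_snd (hA : ContDiff ℝ ∞ A) (hk : ContDiff ℝ ∞ k) (hk0 : ∀ x, 0 < k x)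
    (hf : ContDiff ℝ ∞ f) (x y : ℝ) : fderiv ℝ (separated A k f) (x, y) (0, 1) =
      A x * √(k x) * (k x * deriv f (k x * y)) := by
  have h1 := hasDerivAt_slice_snd ((contDiff_separated hA hk hk0 hf).of_le (by simp)) x y
  have df := (hf.differentiable (by simp) (k x * y)).hasDerivAt
  have h2 := (df.comp y ((hasDerivAt_id y).const_mul (k x))).const_mul (A x * √(k x))
  have h3 := h1.unique h2
  rw [h3]
  ring

end Separated

/-! ### Quasimodes -/

section Quasimode

variable {a b ε : ℝ} {h : ℝ → ℝ} {A k f : ℝ → ℝ}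

theorem deriv_eq_zero_of_notMem_tsupport {f : ℝ → ℝ} {x : ℝ} (hx : x ∉ tsupport f) :
    deriv f x = 0 := by
  rw [notMem_tsupport_iff_eventuallyEq] at hx
  rw [hx.deriv_eq]
  simp

theorem integral_separated_sq (hc : ContinuousOn h (Set.Icc (-a) b)) (hab : -a ≤ b)
    (hpos : ∀ x ∈ Set.Icc (-a) b, 0 < ε * h x) (hAs : ContDiff ℝ ∞ A)
    (hk : ContDiff ℝ ∞ k) (hk0 : ∀ x, 0 < k x) (hfs : ContDiff ℝ ∞ f) (hf : tsupport f ⊆ Set.Ioo 0 1)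
    (hA : ∀ x ∈ tsupport A, x ∈ Set.Ioo (-a) b ∧ 1 ≤ k x * (ε * h x))
    (hf1 : ∫ y in (0 : ℝ)..1, f y ^ 2 = 1) :
    ∫ p in strip a b h ε, separated A k f p ^ 2 = ∫ x, A x ^ 2 := by
  have hT := isTestFunction_separated hc hAs hk hk0 hfs hf hA EndCondition.neumann
  have hfc := hfs.continuous
  rw [setIntegral_strip hc hab hpos (integrable_sq hT.memLp),
    integral_eq_intervalIntegral_of_Ioo (a := -a) (b := b) fun x hx => by
      rw [image_eq_zero_of_notMem_tsupport fun h1 => hx (hA x h1).1]; ring]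
  refine intervalIntegral.integral_congr fun x _ => ?_
  by_cases hx : x ∈ tsupport A
  · have h1 : ∀ y, separated A k f (x, y) ^ 2 = A x ^ 2 * k x * f (k x * y) ^ 2 := fun y => by
      rw [separated, mul_pow, mul_pow, Real.sq_sqrt (hk0 x).le]
    simp only [h1]
    rw [intervalIntegral.integral_const_mul, integral_comp_mul_of_support (F := fun z => f z ^ 2)
      (by fun_prop) (fun z hz => by
        rw [image_eq_zero_of_notMem_tsupport fun h1 => hz (hf h1)]; ring) (hk0 x) (hA x hx).2, hf1]
    have := hk0 x
    field_simp
  · have h1 : ∀ y, separated A k f (x, y) = 0 := fun y => by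
      rw [separated, image_eq_zero_of_notMem_tsupport hx]; ring
    simp [h1, image_eq_zero_of_notMem_tsupport hx]

/-- The energy of a separated function, the coupling of `A'` with the deformation `k'` being
estimated with a small parameter `δ`. -/
theorem integral_energy_separated_le (hc : ContinuousOn h (Set.Icc (-a) b)) (hab : -a ≤ b)
    (hpos : ∀ x ∈ Set.Icc (-a) b, 0 < ε * h x) (hAs : ContDiff ℝ ∞ A)
    (hk : ContDiff ℝ ∞ k) (hk0 : ∀ x, 0 < k x) (hfs : ContDiff ℝ ∞ f) (hf : tsupport f ⊆ Set.Ioo 0 1)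
    (hA : ∀ x ∈ tsupport A, x ∈ Set.Ioo (-a) b ∧ 1 ≤ k x * (ε * h x))
    (hf1 : ∫ y in (0 : ℝ)..1, f y ^ 2 = 1) {d : ℝ} (hd : ∫ y in (0 : ℝ)..1, deriv f y ^ 2 = d)
    {δ : ℝ} (hδ : 0 < δ) :
    ∫ p in strip a b h ε, (fderiv ℝ (separated A k f) p (1, 0) ^ 2 +
        fderiv ℝ (separated A k f) p (0, 1) ^ 2) ≤
      ∫ x, ((1 + δ) * deriv A x ^ 2 +
        A x ^ 2 * ((1 + δ⁻¹) * (1 / 2 + 2 * d) * (deriv k x / k x) ^ 2 + k x ^ 2 * d)) := by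
  have hT := isTestFunction_separated hc hAs hk hk0 hfs hf hA EndCondition.neumann
  have hfc := hfs.continuous
  have hf'c : Continuous (deriv f) := hfs.continuous_deriv (by simp)
  have hAc := hAs.continuous
  have hA'c : Continuous (deriv A) := hAs.continuous_deriv (by simp)
  have hkc := hk.continuous
  have hk'c : Continuous (deriv k) := hk.continuous_deriv (by simp)
  have hkne : ∀ x, k x ≠ 0 := fun x => (hk0 x).ne'
  have hfz : ∀ z ∉ Set.Ioo (0 : ℝ) 1, f z = 0 := fun z hz =>
    image_eq_zero_of_notMem_tsupport fun h1 => hz (hf h1)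
  have hf'z : ∀ z ∉ Set.Ioo (0 : ℝ) 1, deriv f z = 0 := fun z hz =>
    deriv_eq_zero_of_notMem_tsupport fun h1 => hz (hf h1)
  have hTi : IntegrableOn (fun p => fderiv ℝ (separated A k f) p (1, 0) ^ 2 +
      fderiv ℝ (separated A k f) p (0, 1) ^ 2) (strip a b h ε) :=
    (integrable_sq (hT.memLp_fderiv (1, 0))).add (integrable_sq (hT.memLp_fderiv (0, 1)))
  rw [setIntegral_strip hc hab hpos hTi,
    integral_eq_intervalIntegral_of_Ioo (a := -a) (b := b) fun x hx => by
      have h1 : x ∉ tsupport A := fun h1 => hx (hA x h1).1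
      rw [image_eq_zero_of_notMem_tsupport h1, deriv_eq_zero_of_notMem_tsupport h1]; ring,
    intervalIntegral.integral_of_le hab, intervalIntegral.integral_of_le hab]
  refine integral_mono_of_nonneg ?_ ?_ ?_
  · refine (ae_restrict_iff' measurableSet_Ioc).2 (Eventually.of_forall fun x hx => ?_)
    exact intervalIntegral.integral_nonneg (hpos x (Set.Ioc_subset_Icc_self hx)).le
      fun y _ => by positivity
  · refine Continuous.integrableOn_Ioc (Continuous.add (by fun_prop) (Continuous.mul (by fun_prop)
      (Continuous.add (Continuous.mul (by fun_prop) ((hk'c.div hkc hkne).pow 2)) (by fun_prop))))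
  · refine (ae_restrict_iff' measurableSet_Ioc).2 (Eventually.of_forall fun x hx => ?_)
    have hl := hpos x (Set.Ioc_subset_Icc_self hx)
    simp only [fderiv_separated_fst hAs hk hk0 hfs, fderiv_separated_snd hAs hk hk0 hfs]
    have hkx := hk0 x
    have hsq : √(k x) ^ 2 = k x := Real.sq_sqrt hkx.le
    by_cases hxA : x ∈ tsupport A
    · set r := deriv k x / k x with hr
      let F : ℝ → ℝ := fun z => ((1 + δ) * deriv A x ^ 2 + (1 + δ⁻¹) * A x ^ 2 * r ^ 2 * (1 / 2)) *
        f z ^ 2 + ((1 + δ⁻¹) * A x ^ 2 * r ^ 2 * 2 + A x ^ 2 * k x ^ 2) * deriv f z ^ 2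
      have hF : Continuous F := by fun_prop
      have hF0 : ∀ z ∉ Set.Ioo (0 : ℝ) 1, F z = 0 := fun z hz => by
        simp only [F, hfz z hz, hf'z z hz]; ring
      have hpt : ∀ y, (√(k x) * (deriv A x * f (k x * y) + A x * r *
          (1 / 2 * f (k x * y) + k x * y * deriv f (k x * y)))) ^ 2 +
          (A x * √(k x) * (k x * deriv f (k x * y))) ^ 2 ≤ k x * F (k x * y) := by
        intro y
        set z := k x * y
        have h1 : (1 / 2 * f z + z * deriv f z) ^ 2 ≤ 1 / 2 * f z ^ 2 + 2 * deriv f z ^ 2 := by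
          by_cases hz : z ∈ Set.Ioo (0 : ℝ) 1
          · have h2 : z ^ 2 ≤ 1 := by nlinarith [hz.1, hz.2]
            have h3 : z ^ 2 * deriv f z ^ 2 ≤ 1 * deriv f z ^ 2 := by gcongr
            nlinarith [sq_nonneg (1 / 2 * f z - z * deriv f z)]
          · rw [hfz z hz, hf'z z hz]; norm_num
        have h2 : (deriv A x * f z + A x * r * (1 / 2 * f z + z * deriv f z)) ^ 2 ≤
            (1 + δ) * (deriv A x * f z) ^ 2 +
              (1 + δ⁻¹) * (A x * r * (1 / 2 * f z + z * deriv f z)) ^ 2 := by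
          generalize deriv A x * f z = P
          generalize A x * r * (1 / 2 * f z + z * deriv f z) = R
          have h3 : (1 + δ) * P ^ 2 + (1 + δ⁻¹) * R ^ 2 - (P + R) ^ 2 = δ⁻¹ * (δ * P - R) ^ 2 := by
            field_simp
            ring
          have : 0 ≤ δ⁻¹ * (δ * P - R) ^ 2 := by positivity
          linarith
        have h3 : (1 + δ⁻¹) * (A x * r * (1 / 2 * f z + z * deriv f z)) ^ 2 ≤
            (1 + δ⁻¹) * (A x ^ 2 * r ^ 2) * (1 / 2 * f z ^ 2 + 2 * deriv f z ^ 2) := by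
          calc _ = (1 + δ⁻¹) * (A x ^ 2 * r ^ 2) * (1 / 2 * f z + z * deriv f z) ^ 2 := by ring
            _ ≤ _ := mul_le_mul_of_nonneg_left h1 (by positivity)
        have e1 : (√(k x) * (deriv A x * f z + A x * r * (1 / 2 * f z + z * deriv f z))) ^ 2 =
            k x * (deriv A x * f z + A x * r * (1 / 2 * f z + z * deriv f z)) ^ 2 := by
          rw [mul_pow, hsq]
        have e2 : (A x * √(k x) * (k x * deriv f z)) ^ 2 =
            k x * (A x ^ 2 * k x ^ 2 * deriv f z ^ 2) := by
          calc _ = √(k x) ^ 2 * (A x ^ 2 * k x ^ 2 * deriv f z ^ 2) := by ring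
            _ = _ := by rw [hsq]
        rw [e1, e2, ← mul_add]
        refine mul_le_mul_of_nonneg_left ?_ hkx.le
        simp only [F]
        linarith
      have hFi : ∫ z in (0 : ℝ)..1, F z = (1 + δ) * deriv A x ^ 2 +
          A x ^ 2 * ((1 + δ⁻¹) * (1 / 2 + 2 * d) * r ^ 2 + k x ^ 2 * d) := by
        simp only [F]
        rw [intervalIntegral.integral_add (Continuous.intervalIntegrable (by fun_prop) _ _)
          (Continuous.intervalIntegrable (by fun_prop) _ _), intervalIntegral.integral_const_mul,
          intervalIntegral.integral_const_mul, hf1, hd]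
        ring
      rw [← hFi]
      refine (intervalIntegral.integral_mono_on hl.le
        (Continuous.intervalIntegrable (by fun_prop) _ _)
        (Continuous.intervalIntegrable (by fun_prop) _ _) fun y _ => hpt y).trans_eq ?_
      rw [intervalIntegral.integral_const_mul, integral_comp_mul_of_support hF hF0 hkx (hA x hxA).2,
        mul_inv_cancel_left₀ hkx.ne']
    · rw [image_eq_zero_of_notMem_tsupport hxA, deriv_eq_zero_of_notMem_tsupport hxA]
      simp

/-- The function `A(x)` times the normalized transversal ground state. -/
noncomputable def quasimode (ε : ℝ) (h A : ℝ → ℝ) (p : ℝ × ℝ) : ℝ :=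
  A p.1 * groundState (ε * h p.1) p.2

theorem memLp_quasimode (hc : ContinuousOn h (Set.Icc (-a) b))
    (hpos : ∀ x ∈ Set.Icc (-a) b, 0 < ε * h x) (hA : Continuous A) :
    MemLp (quasimode ε h A) 2 (volume.restrict (strip a b h ε)) := by
  obtain ⟨L, -, hL⟩ := exists_strip_bound (ε := ε) hc
  refine (memLp_restrict_of_isCompact (isCompact_Icc.prod isCompact_Icc) ?_).mono_measure
    (Measure.restrict_mono (strip_subset hL) le_rfl)
  have h1 : ContinuousOn (fun p : ℝ × ℝ => ε * h p.1) (Set.Icc (-a) b ×ˢ Set.Icc 0 L) :=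
    (hc.comp continuousOn_fst fun p hp => hp.1).const_mul ε
  have h2 : ∀ p ∈ Set.Icc (-a) b ×ˢ Set.Icc 0 L, ε * h p.1 ≠ 0 := fun p hp => (hpos _ hp.1).ne'
  unfold quasimode groundState
  exact (hA.comp continuous_fst).continuousOn.mul ((continuousOn_const.div h1 h2).sqrt.mul
    (Real.continuous_sin.comp_continuousOn ((continuousOn_const.mul continuousOn_snd).div h1 h2)))

theorem integral_quasimode_mul (hc : ContinuousOn h (Set.Icc (-a) b)) (hab : -a ≤ b)
    (hpos : ∀ x ∈ Set.Icc (-a) b, 0 < ε * h x) {A' : ℝ → ℝ} (hA : Continuous A) (hA' : Continuous A') :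
    ∫ p in strip a b h ε, quasimode ε h A p * quasimode ε h A' p = ∫ x in (-a)..b, A x * A' x := by
  rw [setIntegral_strip hc hab hpos
    (integrable_mul (memLp_quasimode hc hpos hA) (memLp_quasimode hc hpos hA'))]
  refine intervalIntegral.integral_congr fun x hx => ?_
  rw [Set.uIcc_of_le hab] at hx
  have h1 : ∀ y, quasimode ε h A (x, y) * quasimode ε h A' (x, y) =
      A x * A' x * groundState (ε * h x) y ^ 2 := fun y => by
    simp only [quasimode]; ring
  simp only [h1]
  rw [intervalIntegral.integral_const_mul, integral_groundState_sq (hpos x hx), mul_one]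

/-- A positive normalized function on an interval whose Dirichlet energy is close to the lowest
eigenvalue is close to the ground state, because of the gap to the second eigenvalue. -/
theorem integral_sub_groundState_sq_le {g : ℝ → ℝ} (hg : ContDiff ℝ 1 g) {l : ℝ} (hl : 0 < l)
    (h0 : ∀ y ∉ Set.Ioo 0 l, g y = 0) (hnn : ∀ y, 0 ≤ g y)
    (h1 : ∫ y in (0 : ℝ)..l, g y ^ 2 = 1) {γ : ℝ}
    (hE : ∫ y in (0 : ℝ)..l, deriv g y ^ 2 ≤ (Real.pi / l) ^ 2 * (1 + 3 / 2 * γ)) :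
    ∫ y in (0 : ℝ)..l, (g y - groundState l y) ^ 2 ≤ γ := by
  have hgc := hg.continuous
  have hec := continuous_groundState l
  have h2 := (slice_bounds hg hl le_rfl h0).2
  have h3 := sq_integral_mul_groundState_le hgc hl
  set c := ∫ y in (0 : ℝ)..l, g y * groundState l y with hc
  have hc0 : 0 ≤ c := intervalIntegral.integral_nonneg hl.le fun y hy =>
    mul_nonneg (hnn y) (mul_nonneg (Real.sqrt_nonneg _)
      (Real.sin_nonneg_of_nonneg_of_le_pi (by have := hy.1; have := Real.pi_pos; positivity) (by
        rw [div_le_iff₀ hl]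
        have := Real.pi_pos
        nlinarith [hy.2])))
  rw [h1] at h2 h3
  have hK : 0 < (Real.pi / l) ^ 2 := by have := Real.pi_pos; positivity
  have h4 : 2 * (1 - c ^ 2) ≤ γ := by
    have : (Real.pi / l) ^ 2 * (2 * (1 - c ^ 2)) ≤ (Real.pi / l) ^ 2 * γ := by linarith
    exact le_of_mul_le_mul_left this hK
  have h5 : ∀ y, (g y - groundState l y) ^ 2 =
      g y ^ 2 - 2 * (g y * groundState l y) + groundState l y ^ 2 := fun y => by ring
  simp only [h5]
  rw [intervalIntegral.integral_add (Continuous.intervalIntegrable (by fun_prop) _ _)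
    (Continuous.intervalIntegrable (by fun_prop) _ _), intervalIntegral.integral_sub
    (Continuous.intervalIntegrable (by fun_prop) _ _)
    (Continuous.intervalIntegrable (by fun_prop) _ _), intervalIntegral.integral_const_mul, h1,
    integral_groundState_sq hl, ← hc]
  nlinarith

/-- A separated function is close to the corresponding quasimode. -/
theorem integral_separated_sub_quasimode_le (hc : ContinuousOn h (Set.Icc (-a) b)) (hab : -a ≤ b)
    (hpos : ∀ x ∈ Set.Icc (-a) b, 0 < ε * h x) (hAs : ContDiff ℝ ∞ A)
    (hk : ContDiff ℝ ∞ k) (hk0 : ∀ x, 0 < k x) (hfs : ContDiff ℝ ∞ f) (hf : tsupport f ⊆ Set.Ioo 0 1)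
    (hA : ∀ x ∈ tsupport A, x ∈ Set.Ioo (-a) b ∧ 1 ≤ k x * (ε * h x)) (hfnn : ∀ y, 0 ≤ f y)
    (hf1 : ∫ y in (0 : ℝ)..1, f y ^ 2 = 1) {d : ℝ} (hd : ∫ y in (0 : ℝ)..1, deriv f y ^ 2 = d)
    {γ : ℝ} (hγ : ∀ x ∈ tsupport A, (k x * (ε * h x)) ^ 2 * d ≤ Real.pi ^ 2 * (1 + 3 / 2 * γ))
    {A' : ℝ → ℝ} (hA' : Continuous A') (hAL : MemLp A 2 volume) (hA'L : MemLp A' 2 volume) :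
    ∫ p in strip a b h ε, (separated A k f p - quasimode ε h A' p) ^ 2 ≤
      2 * γ * (∫ x, A x ^ 2) + 2 * ∫ x, (A x - A' x) ^ 2 := by
  have hT := isTestFunction_separated hc hAs hk hk0 hfs hf hA EndCondition.neumann
  have hfc := hfs.continuous
  have hAc := hAs.continuous
  have hdL : MemLp (fun x => A x - A' x) 2 volume := hAL.sub hA'L
  have hfz : ∀ z ∉ Set.Ioo (0 : ℝ) 1, f z = 0 := fun z hz =>
    image_eq_zero_of_notMem_tsupport fun h1 => hz (hf h1)
  have hf'z : ∀ z ∉ Set.Ioo (0 : ℝ) 1, deriv f z = 0 := fun z hz =>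
    deriv_eq_zero_of_notMem_tsupport fun h1 => hz (hf h1)
  have hTi : IntegrableOn (fun p => (separated A k f p - quasimode ε h A' p) ^ 2) (strip a b h ε) :=
    integrable_sq (hT.memLp.sub (memLp_quasimode hc hpos hA'))
  rw [setIntegral_strip hc hab hpos hTi,
    integral_eq_intervalIntegral_of_Ioo (a := -a) (b := b) (f := fun x => A x ^ 2) fun x hx => by
      rw [image_eq_zero_of_notMem_tsupport fun h1 => hx (hA x h1).1]; ring]
  have h1 : ∫ x in (-a)..b, (A x - A' x) ^ 2 ≤ ∫ x, (A x - A' x) ^ 2 := by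
    rw [intervalIntegral.integral_of_le hab]
    exact setIntegral_le_integral (integrable_sq hdL) (Eventually.of_forall fun x => sq_nonneg _)
  have h2 : ∫ x in (-a)..b, ∫ y in (0 : ℝ)..(ε * h x),
      (separated A k f (x, y) - quasimode ε h A' (x, y)) ^ 2 ≤
      ∫ x in (-a)..b, (2 * γ * A x ^ 2 + 2 * (A x - A' x) ^ 2) := by
    rw [intervalIntegral.integral_of_le hab, intervalIntegral.integral_of_le hab]
    refine integral_mono_of_nonneg ?_ (Continuous.integrableOn_Ioc (by fun_prop)) ?_
    · refine (ae_restrict_iff' measurableSet_Ioc).2 (Eventually.of_forall fun x hx => ?_)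
      exact intervalIntegral.integral_nonneg (hpos x (Set.Ioc_subset_Icc_self hx)).le
        fun y _ => sq_nonneg _
    · refine (ae_restrict_iff' measurableSet_Ioc).2 (Eventually.of_forall fun x hx => ?_)
      have hl := hpos x (Set.Ioc_subset_Icc_self hx)
      have hec := continuous_groundState (ε * h x)
      have hkx := hk0 x
      simp only [quasimode]
      by_cases hxA : x ∈ tsupport A
      · let g : ℝ → ℝ := fun y => √(k x) * f (k x * y)
        have hg : ContDiff ℝ ∞ g := contDiff_const.mul (hfs.comp (contDiff_const.mul contDiff_id))
        have hgc := hg.continuous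
        have hsq : √(k x) ^ 2 = k x := Real.sq_sqrt hkx.le
        have hg0 : ∀ y ∉ Set.Ioo 0 (ε * h x), g y = 0 := fun y hy => by
          simp only [g]
          rw [hfz _ fun hz => hy ⟨pos_of_mul_pos_right hz.1 hkx.le,
            lt_of_mul_lt_mul_left (hz.2.trans_le (hA x hxA).2) hkx.le⟩, mul_zero]
        have hg1 : ∫ y in (0 : ℝ)..(ε * h x), g y ^ 2 = 1 := by
          simp only [g, mul_pow, hsq]
          rw [intervalIntegral.integral_const_mul, integral_comp_mul_of_support
            (F := fun z => f z ^ 2) (by fun_prop) (fun z hz => by rw [hfz z hz]; ring) hkx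
            (hA x hxA).2, hf1]
          field_simp
        have hg' : ∀ y, deriv g y = √(k x) * (k x * deriv f (k x * y)) := fun y => by
          have df := (hfs.differentiable (by simp) (k x * y)).hasDerivAt
          have := ((df.comp y ((hasDerivAt_id y).const_mul (k x))).const_mul (√(k x))).deriv
          refine Eq.trans this ?_
          ring
        have hgE : ∫ y in (0 : ℝ)..(ε * h x), deriv g y ^ 2 = k x ^ 2 * d := by
          simp only [hg', mul_pow, hsq]
          have hf'c : Continuous (deriv f) := hfs.continuous_deriv (by simp)
          rw [intervalIntegral.integral_const_mul, intervalIntegral.integral_const_mul,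
            integral_comp_mul_of_support
            (F := fun z => deriv f z ^ 2) (by fun_prop) (fun z hz => by rw [hf'z z hz]; ring) hkx
            (hA x hxA).2, hd]
          field_simp
        have h3 := integral_sub_groundState_sq_le (hg.of_le (by simp)) hl hg0
          (fun y => mul_nonneg (Real.sqrt_nonneg _) (hfnn _)) hg1 (γ := γ) (by
            rw [hgE, div_pow, div_mul_eq_mul_div, le_div_iff₀ (by positivity)]
            have := hγ x hxA
            linarith)
        calc ∫ y in (0 : ℝ)..(ε * h x), (separated A k f (x, y) - A' x * groundState (ε * h x) y) ^ 2
            ≤ ∫ y in (0 : ℝ)..(ε * h x), (2 * A x ^ 2 * (g y - groundState (ε * h x) y) ^ 2 +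
              2 * (A x - A' x) ^ 2 * groundState (ε * h x) y ^ 2) := by
              refine intervalIntegral.integral_mono_on hl.le
                (Continuous.intervalIntegrable ?_ _ _)
                (Continuous.intervalIntegrable (by fun_prop) _ _) fun y _ => ?_
              · have := (contDiff_separated hAs hk hk0 hfs).continuous
                fun_prop
              · have e1 : separated A k f (x, y) = A x * g y := by
                  simp only [separated, g]; ring
                rw [e1]
                nlinarith [sq_nonneg (A x * (g y - groundState (ε * h x) y) -
                  (A x - A' x) * groundState (ε * h x) y)]
          _ = 2 * A x ^ 2 * (∫ y in (0 : ℝ)..(ε * h x), (g y - groundState (ε * h x) y) ^ 2) +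
              2 * (A x - A' x) ^ 2 := by
              rw [intervalIntegral.integral_add (Continuous.intervalIntegrable (by fun_prop) _ _)
                (Continuous.intervalIntegrable (by fun_prop) _ _),
                intervalIntegral.integral_const_mul, intervalIntegral.integral_const_mul,
                integral_groundState_sq hl, mul_one]
          _ ≤ 2 * A x ^ 2 * γ + 2 * (A x - A' x) ^ 2 := by gcongr
          _ = _ := by ring
      · have h3 : A x = 0 := image_eq_zero_of_notMem_tsupport hxA
        have h4 : ∀ y, (separated A k f (x, y) - A' x * groundState (ε * h x) y) ^ 2 =
            A' x ^ 2 * groundState (ε * h x) y ^ 2 := fun y => by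
          rw [separated, h3]; ring
        simp only [h4, h3]
        rw [intervalIntegral.integral_const_mul, integral_groundState_sq hl]
        nlinarith [sq_nonneg (A' x)]
  refine h2.trans ?_
  rw [intervalIntegral.integral_add (Continuous.intervalIntegrable (by fun_prop) _ _)
    (Continuous.intervalIntegrable (by fun_prop) _ _), intervalIntegral.integral_const_mul,
    intervalIntegral.integral_const_mul]
  linarith

end Quasimode

/-! ### Smooth approximations of the limit eigenfunctions and of the profile -/

section UpperBound

variable {a b M cp cm m : ℝ} {h : ℝ → ℝ} {μ : ℕ → ℝ} {X : ℕ → ℝ → ℝ}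

/-- The eigenfunctions of the limit operator are approximated by smooth compactly supported functions
in the norm of the form. -/
theorem IsSchrodingerEigensystem.exists_smooth_approx {q : ℝ → ℝ}
    (hS : IsSchrodingerEigensystem q μ X) (hq : Continuous q) (hq0 : ∀ x, 0 ≤ q x) (j : ℕ) {δ : ℝ}
    (hδ : 0 < δ) : ∃ Y : ℝ → ℝ, ContDiff ℝ ∞ Y ∧ HasCompactSupport Y ∧
      ∫ x, (Y x - X j x) ^ 2 ≤ δ ∧ ∫ x, Y x ^ 2 ≤ 2 ∧
      (∫ x, deriv Y x ^ 2) + (∫ x, q x * Y x ^ 2) ≤ μ j + δ := by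
  obtain ⟨h1, h2⟩ := hS.memLp_energy hq hq0 j
  have h0 := hS.memLp j
  have hX1 : ContDiff ℝ 1 (X j) := (hS.contDiff j).of_le (by norm_num)
  choose v hv hvc v0 v1 v2 using fun n : ℕ => NarrowStrip.exists_smooth_approx hq hq0 hX1 h0 h1 h2
    (τ := 1 / ((n : ℝ) + 1)) (by positivity)
  have hlim : Tendsto (fun n : ℕ => 1 / ((n : ℝ) + 1)) atTop (𝓝 0) :=
    tendsto_one_div_add_atTop_nhds_zero_nat
  have l0 := squeeze_zero (fun n => integral_nonneg fun x => sq_nonneg _) v0 hlim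
  have l1 := squeeze_zero (fun n => integral_nonneg fun x => sq_nonneg _) v1 hlim
  have l2 := squeeze_zero (fun n => integral_nonneg fun x => sq_nonneg _) v2 hlim
  have m0 : ∀ n, MemLp (v n) 2 volume := fun n =>
    (hv n).continuous.memLp_of_hasCompactSupport (hvc n)
  have m1 : ∀ n, MemLp (deriv (v n)) 2 volume := fun n =>
    ((hv n).continuous_deriv (by simp)).memLp_of_hasCompactSupport (hvc n).deriv
  have m2 : ∀ n, MemLp (fun x => √(q x) * v n x) 2 volume := fun n =>
    (hq.sqrt.mul (hv n).continuous).memLp_of_hasCompactSupport (hvc n).mul_left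
  have t0 := tendsto_integral_sq m0 h0 l0
  have t12 := (tendsto_integral_sq m1 h1 l1).add (tendsto_integral_sq m2 h2 l2)
  have e0 : ∫ x, X j x ^ 2 = 1 := by
    have := hS.orthonormal j j
    simpa [sq] using this
  have e1 : (∫ x, deriv (X j) x ^ 2) + (∫ x, (√(q x) * X j x) ^ 2) = μ j := by
    have := hS.form_self hq hq0 j j
    rw [hS.orthonormal, if_pos rfl, mul_one, integral_add (integrable_mul h1 h1)
      (integrable_mul h2 h2)] at this
    simpa only [sq] using this
  rw [e0] at t0
  rw [e1] at t12
  obtain ⟨n, ⟨n0, n1⟩, n2⟩ := ((l0.eventually_le_const hδ).and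
    (t0.eventually_le_const one_lt_two) |>.and
    (t12.eventually_le_const (lt_add_of_pos_right (μ j) hδ))).exists
  refine ⟨v n, hv n, hvc n, n0, n1, ?_⟩
  have : ∀ x, (√(q x) * v n x) ^ 2 = q x * v n x ^ 2 := fun x => by
    rw [mul_pow, Real.sq_sqrt (hq0 x)]
  simpa only [this] using n2

/-- A smooth majorant of a continuous function on a segment, close to it there and bounded together
with its derivative. -/
theorem exists_smooth_majorant {q : ℝ → ℝ} (hq : Continuous q) {S : ℝ} (hS : 0 < S) {δ : ℝ}
    (hδ : 0 < δ) : ∃ (p : ℝ → ℝ) (P : ℝ), ContDiff ℝ ∞ p ∧ 0 < P ∧ (∀ t, |p t| ≤ P) ∧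
      (∀ t, |deriv p t| ≤ P) ∧ ∀ t, |t| ≤ S → q t + δ ≤ p t ∧ p t ≤ q t + 3 * δ := by
  obtain ⟨g, hg⟩ := exists_polynomial_near_of_continuousOn (-S) S (fun t => q t + 2 * δ)
    (by fun_prop) δ hδ
  let b : ContDiffBump (0 : ℝ) := ⟨S, S + 1, hS, by linarith⟩
  let p : ℝ → ℝ := fun t => b t * g.eval t
  have hp : ContDiff ℝ ∞ p := b.contDiff.mul (g.contDiff_aeval _)
  have hpc : HasCompactSupport p := b.hasCompactSupport.mul_right
  obtain ⟨C₁, hC₁⟩ := hpc.exists_bound_of_continuous hp.continuous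
  obtain ⟨C₂, hC₂⟩ := hpc.deriv.exists_bound_of_continuous (hp.continuous_deriv (by simp))
  refine ⟨p, max (max C₁ C₂) 1, hp, by positivity,
    fun t => (hC₁ t).trans ((le_max_left _ _).trans (le_max_left _ _)),
    fun t => (hC₂ t).trans ((le_max_right _ _).trans (le_max_left _ _)), fun t ht => ?_⟩
  have h1 : b t = 1 := b.one_of_mem_closedBall (by simpa [b] using ht)
  have h2 := abs_lt.1 (hg t (abs_le.1 ht))
  simp only [p, h1, one_mul]
  constructor <;> linarith [h2.1, h2.2]

theorem one_div_sub_sq_le {M w : ℝ} (hM : 0 < M) (hw0 : 0 ≤ w) (hw : w ≤ M / 2) :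
    1 / (M - w) ^ 2 ≤ 1 / M ^ 2 + 2 * w / M ^ 3 * (1 + 6 * w / M) := by
  obtain ⟨x, rfl⟩ : ∃ x, w = M * x := ⟨w / M, by field_simp⟩
  have hx0 : 0 ≤ x := nonneg_of_mul_nonneg_right hw0 hM
  have hx1 : x ≤ 1 / 2 := by nlinarith
  have h1 : 1 / M ^ 2 + 2 * (M * x) / M ^ 3 * (1 + 6 * (M * x) / M) =
      (1 + 2 * x * (1 + 6 * x)) / M ^ 2 := by
    field_simp
  have h2 : M - M * x = M * (1 - x) := by ring
  have h3 : 0 < 1 - x := by linarith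
  rw [h1, h2, mul_pow, div_le_div_iff₀ (by positivity) (by positivity), one_mul]
  have h4 : 1 ≤ (1 + 2 * x * (1 + 6 * x)) * (1 - x) ^ 2 := by
    have h5 : (1 + 2 * x * (1 + 6 * x)) * (1 - x) ^ 2 - 1 =
        x ^ 2 * ((1 - 2 * x) * (9 - 6 * x) + 2 * x) := by ring
    have : 0 ≤ x ^ 2 * ((1 - 2 * x) * (9 - 6 * x) + 2 * x) := by
      have e1 : 0 ≤ 1 - 2 * x := by linarith
      have e2 : 0 ≤ 9 - 6 * x := by linarith
      positivity
    linarith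
  have hM2 : 0 < M ^ 2 := by positivity
  nlinarith

theorem one_div_sub_sq_le_four_div {M w : ℝ} (hM : 0 < M) (hw : w ≤ M / 2) :
    1 / (M - w) ^ 2 ≤ 4 / M ^ 2 := by
  have h1 : M / 2 ≤ M - w := by linarith
  have h2 : (M / 2) ^ 2 ≤ (M - w) ^ 2 := by gcongr
  rw [div_le_div_iff₀ (lt_of_lt_of_le (by positivity) h2) (by positivity)]
  nlinarith

/-- The deformed width `ε (M - σ p(x / s))`, in terms of its inverse `k`. As `h` need not be smooth, its
smooth lower bound near the maximum takes the place of `h` in the test functions. -/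
theorem exists_inverse_width {p : ℝ → ℝ} (hp : ContDiff ℝ ∞ p) {P M ε s σ : ℝ} (hM : 0 < M)
    (hε : 0 < ε) (hs : 0 < s) (hσ : 0 < σ) (hP : ∀ t, |p t| ≤ P) (hP' : ∀ t, |deriv p t| ≤ P)
    (hσP : σ * P ≤ M / 2) : ∃ k : ℝ → ℝ, ContDiff ℝ ∞ k ∧ (∀ x, 0 < k x) ∧
      (∀ t, k (s * t) = 1 / (ε * (M - σ * p t))) ∧
      ∀ t, s ^ 2 * (deriv k (s * t) / k (s * t)) ^ 2 ≤ 4 * P ^ 2 / M ^ 2 * σ ^ 2 := by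
  have hw : ∀ t, σ * p t ≤ M / 2 := fun t => by
    have := (abs_le.1 (hP t)).2
    nlinarith
  let D : ℝ → ℝ := fun x => ε * (M - σ * p (s⁻¹ * x))
  have hD : ContDiff ℝ ∞ D := contDiff_const.mul (contDiff_const.sub
    (contDiff_const.mul (hp.comp (contDiff_const.mul contDiff_id))))
  have hD0 : ∀ x, 0 < D x := fun x => mul_pos hε (by linarith [hw (s⁻¹ * x)])
  have hDd : ∀ x, HasDerivAt D (-(ε * σ * s⁻¹ * deriv p (s⁻¹ * x))) x := fun x => by
    have h1 := (hp.differentiable (by simp) (s⁻¹ * x)).hasDerivAt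
    have h2 := h1.comp x ((hasDerivAt_id x).const_mul s⁻¹)
    refine (((h2.const_mul σ).const_sub M).const_mul ε).congr_deriv ?_
    ring
  refine ⟨fun x => 1 / D x, contDiff_const.div hD fun x => (hD0 x).ne',
    fun x => one_div_pos.2 (hD0 x), fun t => ?_, fun t => ?_⟩
  · simp only [D, inv_mul_cancel_left₀ hs.ne']
  · have h1 : deriv (fun x => 1 / D x) (s * t) =
        (ε * σ * s⁻¹ * deriv p t) / D (s * t) ^ 2 := by
      have h2 := ((hDd (s * t)).inv (hD0 _).ne').deriv
      rw [inv_mul_cancel_left₀ hs.ne', neg_neg] at h2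
      rw [← h2]
      congr 1
      ext x
      simp
    have h3 : D (s * t) = ε * (M - σ * p t) := by simp only [D, inv_mul_cancel_left₀ hs.ne']
    have h4 : 0 < M - σ * p t := by linarith [hw t]
    have h5 : s ^ 2 * (deriv (fun x => 1 / D x) (s * t) / (1 / D (s * t))) ^ 2 =
        σ ^ 2 * deriv p t ^ 2 * (1 / (M - σ * p t) ^ 2) := by
      rw [h1, h3]
      field_simp
    rw [h5]
    have h6 : deriv p t ^ 2 ≤ P ^ 2 := by
      rw [← sq_abs]
      exact pow_le_pow_left₀ (abs_nonneg _) (hP' t) 2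
    calc σ ^ 2 * deriv p t ^ 2 * (1 / (M - σ * p t) ^ 2) ≤ σ ^ 2 * P ^ 2 * (4 / M ^ 2) := by
          have := one_div_sub_sq_le_four_div hM (hw t)
          gcongr
      _ = _ := by ring

/-- The transversal energy of the deformed profile above the threshold, in the scale `s`. -/
theorem width_energy_le {M ε s σ p d P : ℝ} (hM : 0 < M) (hε : 0 < ε) (hσ : 0 < σ)
    (hsε : σ * s ^ 2 = ε ^ 2) (hp0 : 0 ≤ p) (hpP : p ≤ P) (hσP : σ * P ≤ M / 2)
    (hd : d ≤ Real.pi ^ 2 + σ ^ 2) :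
    s ^ 2 * ((1 / (ε * (M - σ * p))) ^ 2 * d - Real.pi ^ 2 / (M ^ 2 * ε ^ 2)) ≤
      2 * Real.pi ^ 2 / M ^ 3 * p + (12 * Real.pi ^ 2 * P ^ 2 / M ^ 4 + 4 / M ^ 2) * σ := by
  have hw0 : 0 ≤ σ * p := by positivity
  have hw : σ * p ≤ M / 2 := le_trans (by gcongr) hσP
  have h1 := one_div_sub_sq_le hM hw0 hw
  have h2 := one_div_sub_sq_le_four_div hM hw
  have h3 : 0 < M - σ * p := by linarith
  have hs2 : s ^ 2 = ε ^ 2 / σ := by rw [← hsε]; field_simp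
  have h4 : s ^ 2 * ((1 / (ε * (M - σ * p))) ^ 2 * d - Real.pi ^ 2 / (M ^ 2 * ε ^ 2)) =
      σ⁻¹ * (1 / (M - σ * p) ^ 2 * d - Real.pi ^ 2 / M ^ 2) := by
    rw [hs2]
    field_simp
  rw [h4, inv_mul_le_iff₀ hσ]
  have h5 : 0 ≤ 1 / (M - σ * p) ^ 2 := by positivity
  calc 1 / (M - σ * p) ^ 2 * d - Real.pi ^ 2 / M ^ 2
      ≤ 1 / (M - σ * p) ^ 2 * (Real.pi ^ 2 + σ ^ 2) - Real.pi ^ 2 / M ^ 2 := by gcongr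
    _ = Real.pi ^ 2 * (1 / (M - σ * p) ^ 2) + σ ^ 2 * (1 / (M - σ * p) ^ 2) -
        Real.pi ^ 2 / M ^ 2 := by ring
    _ ≤ Real.pi ^ 2 * (1 / M ^ 2 + 2 * (σ * p) / M ^ 3 * (1 + 6 * (σ * p) / M)) +
        σ ^ 2 * (4 / M ^ 2) - Real.pi ^ 2 / M ^ 2 := by gcongr
    _ = σ * (2 * Real.pi ^ 2 / M ^ 3 * p + (12 * Real.pi ^ 2 * p ^ 2 / M ^ 4 + 4 / M ^ 2) * σ) := by
        field_simp
        ring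
    _ ≤ _ := by gcongr

/-- The deformed width is so close to `t`, which stands for `h x`, that the rescaled profile has almost
the lowest energy on the slice. -/
theorem width_ratio_le {M σ p t ε d P : ℝ} (hM : 0 < M) (hε : 0 < ε) (hσ : 0 < σ) (hσ1 : σ ≤ 1)
    (hp0 : 0 ≤ p) (hpP : p ≤ P) (hσP : σ * P ≤ M / 2) (ht0 : 0 < t) (htM : t ≤ M)
    (hd : d ≤ Real.pi ^ 2 + σ ^ 2) (hd0 : 0 ≤ d) :
    (1 / (ε * (M - σ * p)) * (ε * t)) ^ 2 * d ≤
      Real.pi ^ 2 * (1 + 3 / 2 * ((1 + 16 * P / M) * σ)) := by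
  have hP0 : 0 ≤ P := hp0.trans hpP
  have hw0 : 0 ≤ σ * p := by positivity
  have hwP : σ * p ≤ σ * P := by gcongr
  have hw : σ * p ≤ M / 2 := hwP.trans hσP
  have h1 := one_div_sub_sq_le hM hw0 hw
  have h3 : 0 < M - σ * p := by linarith
  have h4 : (1 / (ε * (M - σ * p)) * (ε * t)) ^ 2 ≤ 1 + 8 * P / M * σ := by
    have h5 : (1 / (ε * (M - σ * p)) * (ε * t)) ^ 2 = t ^ 2 * (1 / (M - σ * p) ^ 2) := by
      field_simp
    rw [h5]
    have h6 : 1 + 6 * (σ * p) / M ≤ 4 := by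
      have : 6 * (σ * p) / M ≤ 3 := by rw [div_le_iff₀ hM]; linarith
      linarith
    calc t ^ 2 * (1 / (M - σ * p) ^ 2) ≤
        M ^ 2 * (1 / M ^ 2 + 2 * (σ * p) / M ^ 3 * (1 + 6 * (σ * p) / M)) := by gcongr
      _ ≤ M ^ 2 * (1 / M ^ 2 + 2 * (σ * P) / M ^ 3 * 4) := by gcongr
      _ = _ := by field_simp; ring
  have hπ : 1 ≤ Real.pi ^ 2 := by nlinarith [Real.pi_gt_three]
  have h7 : d ≤ Real.pi ^ 2 * (1 + σ) := by nlinarith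
  have h8 : (1 + 8 * P / M * σ) * (1 + σ) ≤ 1 + 3 / 2 * ((1 + 16 * P / M) * σ) := by
    have h9 : 0 ≤ P / M := by positivity
    have e1 : 8 * P / M = 8 * (P / M) := by ring
    have e2 : 16 * P / M = 16 * (P / M) := by ring
    rw [e1, e2]
    have h10 : P / M * σ * σ ≤ P / M * σ * 1 := by gcongr
    have h11 : 0 ≤ P / M * σ := by positivity
    nlinarith
  calc (1 / (ε * (M - σ * p)) * (ε * t)) ^ 2 * d
      ≤ (1 + 8 * P / M * σ) * (Real.pi ^ 2 * (1 + σ)) := by gcongr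
    _ = Real.pi ^ 2 * ((1 + 8 * P / M * σ) * (1 + σ)) := by ring
    _ ≤ _ := by gcongr

end UpperBound

/-! ### Test functions for the upper bound -/

section TestFunction

variable {a b M cp cm m : ℝ} {h : ℝ → ℝ} {μ : ℕ → ℝ} {X : ℕ → ℝ → ℝ}

/-- The dilation by `s`, preserving the norm of `L²(ℝ)`. -/
noncomputable def dilate (s : ℝ) (f : ℝ → ℝ) (x : ℝ) : ℝ := (√s)⁻¹ * f (s⁻¹ * x)

theorem integral_eq_mul_integral_comp {s : ℝ} (hs : 0 < s) (f : ℝ → ℝ) :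
    ∫ x, f x = s * ∫ t, f (s * t) := by
  rw [Measure.integral_comp_mul_left, abs_of_pos (inv_pos.2 hs), smul_eq_mul,
    mul_inv_cancel_left₀ hs.ne']

theorem dilate_apply_mul {s : ℝ} (hs : 0 < s) (f : ℝ → ℝ) (t : ℝ) :
    dilate s f (s * t) = (√s)⁻¹ * f t := by
  rw [dilate, inv_mul_cancel_left₀ hs.ne']

theorem inv_sqrt_sq {s : ℝ} (hs : 0 < s) : (√s)⁻¹ ^ 2 = s⁻¹ := by
  rw [inv_pow, Real.sq_sqrt hs.le]

theorem contDiff_dilate {n : WithTop ℕ∞} {f : ℝ → ℝ} (hf : ContDiff ℝ n f) (s : ℝ) :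
    ContDiff ℝ n (dilate s f) :=
  contDiff_const.mul (hf.comp (contDiff_const.mul contDiff_id))

theorem deriv_dilate {f : ℝ → ℝ} (hf : Differentiable ℝ f) {s : ℝ} (hs : 0 < s) (t : ℝ) :
    deriv (dilate s f) (s * t) = (√s)⁻¹ * (s⁻¹ * deriv f t) := by
  have h1 := (((hf (s⁻¹ * (s * t))).hasDerivAt.comp (s * t)
    ((hasDerivAt_id (s * t)).const_mul s⁻¹)).const_mul (√s)⁻¹).deriv
  rw [inv_mul_cancel_left₀ hs.ne'] at h1
  refine Eq.trans h1 ?_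
  ring

theorem memLp_dilate {f : ℝ → ℝ} (hf : MemLp f 2 volume) (hfc : Continuous f) {s : ℝ} (hs : 0 < s) :
    MemLp (dilate s f) 2 volume := by
  have hc : Continuous (dilate s f) := by
    unfold dilate
    fun_prop
  refine (memLp_two_iff_integrable_sq hc.aestronglyMeasurable).2 ?_
  have h1 : Integrable fun x => (√s)⁻¹ ^ 2 * f (s⁻¹ * x) ^ 2 :=
    ((integrable_comp_mul_left_iff (fun x => f x ^ 2) (inv_pos.2 hs).ne').2
      (integrable_sq hf)).const_mul _
  refine h1.congr (Eventually.of_forall fun x => ?_)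
  simp only [dilate, mul_pow]

theorem integral_dilate_sub_sq {s : ℝ} (hs : 0 < s) (f g : ℝ → ℝ) :
    ∫ x, (dilate s f x - dilate s g x) ^ 2 = ∫ x, (f x - g x) ^ 2 := by
  rw [integral_eq_mul_integral_comp hs, ← integral_const_mul]
  congr 1
  ext t
  rw [dilate_apply_mul hs, dilate_apply_mul hs, ← mul_sub, mul_pow, inv_sqrt_sq hs,
    mul_inv_cancel_left₀ hs.ne']

theorem integral_dilate_sq {s : ℝ} (hs : 0 < s) (f : ℝ → ℝ) :
    ∫ x, dilate s f x ^ 2 = ∫ x, f x ^ 2 := by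
  rw [integral_eq_mul_integral_comp hs, ← integral_const_mul]
  congr 1
  ext t
  rw [dilate_apply_mul hs, mul_pow, inv_sqrt_sq hs, mul_inv_cancel_left₀ hs.ne']

theorem rescaled_energy_density {Y : ℝ → ℝ} (hY : Differentiable ℝ Y) {s : ℝ} (hs : 0 < s)
    (t δ v u κ : ℝ) :
    s ^ 2 * (s * ((1 + δ) * deriv (dilate s Y) (s * t) ^ 2 + dilate s Y (s * t) ^ 2 * (v + u))) -
      s ^ 2 * (κ * Y t ^ 2) =
    (1 + δ) * deriv Y t ^ 2 + Y t ^ 2 * (s ^ 2 * v + s ^ 2 * (u - κ)) := by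
  have h1 : (s⁻¹ : ℝ) * s = 1 := inv_mul_cancel₀ hs.ne'
  rw [deriv_dilate hY hs, dilate_apply_mul hs]
  simp only [mul_pow, inv_sqrt_sq hs]
  field_simp
  ring

set_option maxHeartbeats 800000 in
/-- Test functions close to the quasimodes, with almost the energy of the limit operator. The scale
`s` is the only parameter: `ε` is a function of it. -/
theorem eventually_exists_test_function (hh : Profile a b h M cp cm m)
    (hS : IsSchrodingerEigensystem (potential M cp cm m) μ X) (j : ℕ) {δ : ℝ} (hδ : 0 < δ) :
    ∀ᶠ s in 𝓝[>] (0 : ℝ), ∀ ε : ℝ, 0 < ε → s ^ m * s ^ 2 = ε ^ 2 → ∀ bc : EndCondition,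
      ∃ T, IsTestFunction (dirichletPart a b h ε bc) T ∧
        ∫ p in strip a b h ε, (T p - quasimode ε h (dilate s (X j)) p) ^ 2 ≤ δ ∧
        s ^ 2 * ((∫ p in strip a b h ε, (fderiv ℝ T p (1, 0) ^ 2 + fderiv ℝ T p (0, 1) ^ 2)) -
          Real.pi ^ 2 / (M ^ 2 * ε ^ 2) * ∫ p in strip a b h ε, T p ^ 2) ≤ μ j + δ := by
  have hM := hh.M_pos
  have hm := hh.m_pos
  have hc := hh.continuousOn
  have hab := hh.neg_a_lt_b
  set q := potential M cp cm m with hqdef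
  have hq : Continuous q := continuous_potential hm
  have hq0 : ∀ x, 0 ≤ q x := potential_nonneg hM hh.cp_pos hh.cm_pos
  have hμ := hS.nonneg hq hq0 j
  -- the errors add up to less than `(μ j + 10) δ₁`
  set δ₁ := min 1 (δ / (μ j + 10)) with hδ₁def
  have hδ₁ : 0 < δ₁ := lt_min one_pos (by positivity)
  have hδ₁1 : δ₁ ≤ 1 := min_le_left _ _
  have hδ₁δ : δ₁ * (μ j + 10) ≤ δ := by
    rw [← le_div_iff₀ (by positivity)]
    exact min_le_right _ _
  obtain ⟨Y, hY, hYc, hYX, hY2, hYE⟩ := hS.exists_smooth_approx hq hq0 j hδ₁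
  obtain ⟨S, hS0, hYS⟩ := exists_forall_le_abs_eq_zero hYc
  have hYcont := hY.continuous
  have hY'c : Continuous (deriv Y) := hY.continuous_deriv (by simp)
  have hY0 : MemLp Y 2 volume := hYcont.memLp_of_hasCompactSupport hYc
  have hY1 : MemLp (deriv Y) 2 volume := hY'c.memLp_of_hasCompactSupport hYc.deriv
  have hqY : Integrable fun t => q t * Y t ^ 2 := by
    have hcY : HasCompactSupport fun t => q t * Y t ^ 2 := by
      refine hasCompactSupport_of_forall_le_abs (R := S) fun t ht => ?_
      rw [hYS t ht]; ring
    exact (hq.mul (hYcont.pow 2)).integrable_of_hasCompactSupport hcY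
  have hYt : ∀ t ∈ tsupport Y, |t| ≤ S := by
    have : tsupport Y ⊆ {t | |t| ≤ S} := closure_minimal (fun t ht => by
      by_contra hcon
      exact ht (hYS t (not_le.1 hcon).le)) (isClosed_le continuous_abs continuous_const)
    exact this
  set κ' := M ^ 3 / (2 * Real.pi ^ 2) with hκ'
  have hκ'0 : 0 < κ' := by positivity
  have hκ'1 : 2 * Real.pi ^ 2 / M ^ 3 * κ' = 1 := by rw [hκ']; field_simp
  -- `M - σ p` is to lie below `h (s t)`, where `M - h (s t)` is about `σ κ' q t`
  obtain ⟨p, P, hp, hP0, hP, hP', hpq⟩ := exists_smooth_majorant (q := fun t => κ' * q t)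
    (by fun_prop) hS0 (δ := κ' * δ₁) (by positivity)
  obtain ⟨K, hK⟩ := (isCompact_Icc (a := -S) (b := S)).exists_bound_of_continuousOn hq.continuousOn
  obtain ⟨η, hη, hexp⟩ := hh.expansion (δ := δ₁ / (|K| + 1)) (by positivity)
  -- `C σ` collects the errors due to the deformation of the slices and to their transversal profile
  set C := (1 + δ₁⁻¹) * (1 / 2 + 2 * (Real.pi ^ 2 + 1)) * (4 * P ^ 2 / M ^ 2) +
    (12 * Real.pi ^ 2 * P ^ 2 / M ^ 4 + 4 / M ^ 2) with hCdef
  have hs1 : ∀ᶠ s : ℝ in 𝓝[>] 0, s * S < min η (min a b) := by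
    have h1 : Tendsto (fun s : ℝ => s * S) (𝓝 0) (𝓝 (0 * S)) := (continuous_mul_const S).tendsto 0
    rw [zero_mul] at h1
    exact (h1.mono_left nhdsWithin_le_nhds).eventually_lt_const
      (lt_min hη (lt_min hh.a_pos hh.b_pos))
  have hs2 := (tendsto_const_mul_rpow hm 1).eventually_le_const one_pos
  have hs3 := (tendsto_const_mul_rpow hm P).eventually_le_const (half_pos hM)
  have hs4 := (tendsto_const_mul_rpow hm C).eventually_le_const hδ₁
  have hs5 := (tendsto_const_mul_rpow hm (1 + 16 * P / M)).eventually_le_const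
    (show 0 < δ₁ / 4 by positivity)
  filter_upwards [self_mem_nhdsWithin, hs1, hs2, hs3, hs4, hs5] with s hs hsS hσ1 hσP hσC hσγ
  intro ε hε hsε bc
  have hs0 : 0 < s := hs
  set σ := s ^ m with hσdef
  have hσ : 0 < σ := by positivity
  rw [one_mul] at hσ1
  rw [mul_comm] at hσP
  simp only [lt_min_iff] at hsS
  have hpos : ∀ x ∈ Set.Icc (-a) b, 0 < ε * h x := fun x hx => mul_pos hε (hh.pos x hx)
  obtain ⟨k, hk, hk0, hkt, hk't⟩ := exists_inverse_width hp hM hε hs0 hσ hP hP' hσP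
  -- the excess of the transversal energy is divided by `σ` in the scaling, hence the exponent `2`
  obtain ⟨f, hfs, hfnn, hf, hf1, hfE⟩ := exists_transversal_profile (τ := σ ^ 2) (by positivity)
  set d := ∫ y in (0 : ℝ)..1, deriv f y ^ 2 with hd
  have hd0 : 0 ≤ d := intervalIntegral.integral_nonneg zero_le_one fun _ _ => sq_nonneg _
  have hd1 : d ≤ Real.pi ^ 2 + 1 := hfE.trans (by
    have := pow_le_one₀ hσ.le hσ1 (n := 2)
    linarith)
  set A := dilate s Y with hAdef
  have hAs : ContDiff ℝ ∞ A := contDiff_dilate hY s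
  have hAt : ∀ x ∈ tsupport A, ∃ t, |t| ≤ S ∧ x = s * t := by
    intro x hx
    have h1 : tsupport A ⊆ {x | s⁻¹ * x ∈ tsupport Y} := closure_minimal (fun x hx =>
      subset_tsupport _ (right_ne_zero_of_mul hx))
      ((isClosed_tsupport Y).preimage (by fun_prop : Continuous fun x : ℝ => s⁻¹ * x))
    exact ⟨s⁻¹ * x, hYt _ (h1 hx), (mul_inv_cancel_left₀ hs0.ne' x).symm⟩
  have hst : ∀ t, |t| ≤ S → |s * t| ≤ η ∧ s * t ∈ Set.Ioo (-a) b := by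
    intro t ht
    have h1 : |s * t| ≤ s * S := by
      rw [abs_mul, abs_of_pos hs0]
      gcongr
    have h2 := abs_le.1 h1
    exact ⟨h1.trans hsS.1.le, by linarith, by linarith⟩
  have hp0 : ∀ t, |t| ≤ S → 0 ≤ p t := fun t ht => by
    have := (hpq t ht).1
    have h1 := hq0 t
    have : 0 ≤ κ' * q t + κ' * δ₁ := by positivity
    linarith
  have hpP : ∀ t, p t ≤ P := fun t => (le_abs_self _).trans (hP t)
  have hwidth : ∀ t, |t| ≤ S → M - σ * p t ≤ h (s * t) := by
    intro t ht
    have h1 := (abs_le.1 (hexp (s * t) (hst t ht).1)).2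
    rw [potential_mul hs0, ← hqdef, ← hσdef] at h1
    have h2 : δ₁ / (|K| + 1) * q t ≤ δ₁ := by
      have h3 : q t ≤ |K| + 1 := by
        have := (le_abs_self _).trans (hK t (abs_le.1 ht))
        linarith [le_abs_self K]
      calc _ ≤ δ₁ / (|K| + 1) * (|K| + 1) := by gcongr
        _ = δ₁ := by field_simp
    have h3 : 2 * Real.pi ^ 2 / M ^ 3 * (M - h (s * t)) ≤ σ * (q t + δ₁) := by
      have : σ * (δ₁ / (|K| + 1) * q t) ≤ σ * δ₁ := by gcongr
      linarith
    have h4 := mul_le_mul_of_nonneg_left h3 hκ'0.le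
    rw [← mul_assoc, mul_comm κ', hκ'1, one_mul] at h4
    have h5 : σ * (κ' * q t + κ' * δ₁) ≤ σ * p t := by
      have := (hpq t ht).1
      gcongr
    linarith
  have hMσ : ∀ t, 0 < M - σ * p t := fun t => by
    have : σ * p t ≤ σ * P := by
      have := hpP t
      gcongr
    linarith
  have hA : ∀ x ∈ tsupport A, x ∈ Set.Ioo (-a) b ∧ 1 ≤ k x * (ε * h x) := by
    intro x hx
    obtain ⟨t, ht, rfl⟩ := hAt x hx
    refine ⟨(hst t ht).2, ?_⟩
    rw [hkt, one_div_mul_eq_div, one_le_div (mul_pos hε (hMσ t))]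
    have := hwidth t ht
    gcongr
  have hγ : ∀ x ∈ tsupport A, (k x * (ε * h x)) ^ 2 * d ≤
      Real.pi ^ 2 * (1 + 3 / 2 * ((1 + 16 * P / M) * σ)) := by
    intro x hx
    obtain ⟨t, ht, rfl⟩ := hAt x hx
    have hx' := Set.Ioo_subset_Icc_self (hst t ht).2
    rw [hkt]
    exact width_ratio_le hM hε hσ hσ1 (hp0 t ht) (hpP t) hσP (hh.pos _ hx') (hh.le hx') hfE hd0
  have hXc : Continuous (X j) := (hS.contDiff j).continuous
  refine ⟨separated A k f, isTestFunction_separated hc hAs hk hk0 hfs hf hA bc, ?_, ?_⟩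
  · have h1 := integral_separated_sub_quasimode_le hc hab.le hpos hAs hk hk0 hfs hf hA hfnn hf1 hd.symm
      hγ (A' := dilate s (X j)) (by unfold dilate; fun_prop) (memLp_dilate hY0 hYcont hs0)
      (memLp_dilate (hS.memLp j) hXc hs0)
    rw [hAdef, integral_dilate_sq hs0, integral_dilate_sub_sq hs0] at h1
    refine h1.trans ?_
    have h2 : 0 ≤ ∫ x, Y x ^ 2 := integral_nonneg fun x => sq_nonneg _
    have h3 : (1 + 16 * P / M) * σ * (∫ x, Y x ^ 2) ≤ δ₁ / 4 * 2 := by gcongr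
    have h4 := mul_nonneg hδ₁.le hμ
    linarith
  · have hE := integral_energy_separated_le hc hab.le hpos hAs hk hk0 hfs hf hA hf1 hd.symm hδ₁
    have hN := integral_separated_sq hc hab.le hpos hAs hk hk0 hfs hf hA hf1
    rw [integral_eq_mul_integral_comp hs0] at hE
    rw [hN, hAdef, integral_dilate_sq hs0]
    set κ := Real.pi ^ 2 / (M ^ 2 * ε ^ 2) with hκ
    have hkc : Continuous k := hk.continuous
    have hk'c : Continuous (deriv k) := hk.continuous_deriv (by simp)
    let R : ℝ → ℝ := fun t => (1 + δ₁) * deriv A (s * t) ^ 2 + A (s * t) ^ 2 *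
      ((1 + δ₁⁻¹) * (1 / 2 + 2 * d) * (deriv k (s * t) / k (s * t)) ^ 2 + k (s * t) ^ 2 * d)
    have hpt : ∀ t, s ^ 2 * (s * R t) - s ^ 2 * (κ * Y t ^ 2) ≤
        (1 + δ₁) * deriv Y t ^ 2 + q t * Y t ^ 2 + 4 * δ₁ * Y t ^ 2 := by
      intro t
      have e1 : s ^ 2 * (s * R t) - s ^ 2 * (κ * Y t ^ 2) = (1 + δ₁) * deriv Y t ^ 2 +
          Y t ^ 2 * ((1 + δ₁⁻¹) * (1 / 2 + 2 * d) * (s ^ 2 * (deriv k (s * t) / k (s * t)) ^ 2) +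
            s ^ 2 * (k (s * t) ^ 2 * d - κ)) := by
        refine Eq.trans ?_ ((rescaled_energy_density (hY.differentiable (by simp)) hs0 t δ₁
          ((1 + δ₁⁻¹) * (1 / 2 + 2 * d) * (deriv k (s * t) / k (s * t)) ^ 2)
          (k (s * t) ^ 2 * d) κ).trans ?_)
        · rfl
        · ring
      rw [e1]
      by_cases ht : |t| ≤ S
      · have h1 := hk't t
        have h2 := width_energy_le hM hε hσ hsε (hp0 t ht) (hpP t) hσP hfE
        rw [← hkt] at h2
        have h3 : (1 + δ₁⁻¹) * (1 / 2 + 2 * d) * (s ^ 2 * (deriv k (s * t) / k (s * t)) ^ 2) ≤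
            (1 + δ₁⁻¹) * (1 / 2 + 2 * (Real.pi ^ 2 + 1)) * (4 * P ^ 2 / M ^ 2 * σ) := by
          have h4 : 4 * P ^ 2 / M ^ 2 * σ ^ 2 ≤ 4 * P ^ 2 / M ^ 2 * σ :=
            mul_le_mul_of_nonneg_left
              (pow_le_of_le_one hσ.le hσ1 two_ne_zero) (by positivity)
          exact mul_le_mul (mul_le_mul_of_nonneg_left (by linarith) (by positivity)) (h1.trans h4)
            (by positivity) (by positivity)
        have h4 : 2 * Real.pi ^ 2 / M ^ 3 * p t ≤ q t + 3 * δ₁ := by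
          have h5 : 2 * Real.pi ^ 2 / M ^ 3 * p t ≤
              2 * Real.pi ^ 2 / M ^ 3 * (κ' * q t + 3 * (κ' * δ₁)) := by
            have := (hpq t ht).2
            gcongr
          calc _ ≤ _ := h5
            _ = (2 * Real.pi ^ 2 / M ^ 3 * κ') * (q t + 3 * δ₁) := by ring
            _ = _ := by rw [hκ'1, one_mul]
        have h5 : (1 + δ₁⁻¹) * (1 / 2 + 2 * d) * (s ^ 2 * (deriv k (s * t) / k (s * t)) ^ 2) +
            s ^ 2 * (k (s * t) ^ 2 * d - κ) ≤ q t + 4 * δ₁ := by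
          have h6 : C * σ = (1 + δ₁⁻¹) * (1 / 2 + 2 * (Real.pi ^ 2 + 1)) * (4 * P ^ 2 / M ^ 2 * σ) +
            (12 * Real.pi ^ 2 * P ^ 2 / M ^ 4 + 4 / M ^ 2) * σ := by rw [hCdef]; ring
          linarith
        have h6 := mul_le_mul_of_nonneg_left h5 (sq_nonneg (Y t))
        linarith
      · rw [hYS t (not_le.1 ht).le]
        simp
    have i1 : Integrable fun t => Y t ^ 2 := integrable_sq hY0
    have i2 : Integrable fun t => deriv Y t ^ 2 := integrable_sq hY1
    have i3 : Integrable R := by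
      have hR : HasCompactSupport R := by
        refine hasCompactSupport_of_forall_le_abs (R := S + 1) fun t ht => ?_
        have h1 : t ∉ tsupport Y := fun h1 => by linarith [hYt t h1]
        simp only [R, A]
        rw [deriv_dilate (hY.differentiable (by simp)) hs0, dilate_apply_mul hs0,
          image_eq_zero_of_notMem_tsupport h1, deriv_eq_zero_of_notMem_tsupport h1]
        ring
      have hAc := hAs.continuous
      have hA'c : Continuous (deriv A) := hAs.continuous_deriv (by simp)
      have hdiv : Continuous fun t => deriv k (s * t) / k (s * t) :=
        (hk'c.comp (by fun_prop)).div (hkc.comp (by fun_prop)) fun t => (hk0 _).ne'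
      have hRc : Continuous R := by fun_prop
      exact hRc.integrable_of_hasCompactSupport hR
    have hint : s ^ 2 * (s * ∫ t, R t) - s ^ 2 * (κ * ∫ t, Y t ^ 2) ≤
        (1 + δ₁) * (∫ t, deriv Y t ^ 2) + (∫ t, q t * Y t ^ 2) + 4 * δ₁ * ∫ t, Y t ^ 2 := by
      simp only [← integral_const_mul]
      rw [← integral_sub ((i3.const_mul _).const_mul _) ((i1.const_mul _).const_mul _),
        ← integral_add (i2.const_mul _) hqY, ← integral_add _ (i1.const_mul _)]
      · exact integral_mono (((i3.const_mul _).const_mul _).sub ((i1.const_mul _).const_mul _))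
          (((i2.const_mul _).add hqY).add (i1.const_mul _)) hpt
      · exact (i2.const_mul _).add hqY
    have h7 : 0 ≤ ∫ t, q t * Y t ^ 2 := integral_nonneg fun t => mul_nonneg (hq0 t) (sq_nonneg _)
    have h8 : ∫ t, deriv Y t ^ 2 ≤ μ j + 1 := by linarith
    have h9 : δ₁ * (∫ t, deriv Y t ^ 2) ≤ δ₁ * (μ j + 1) := by gcongr
    have h10 : 4 * δ₁ * (∫ t, Y t ^ 2) ≤ 4 * δ₁ * 2 := by gcongr
    have h11 := mul_le_mul_of_nonneg_left hE (sq_nonneg s)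
    rw [mul_sub]
    linarith

/-- The quasimodes become orthonormal as `s → 0`. -/
theorem tendsto_integral_quasimode_mul (hh : Profile a b h M cp cm m)
    (hS : IsSchrodingerEigensystem (potential M cp cm m) μ X) (i j : ℕ) {s : ℝ → ℝ}
    (hs : Tendsto s (𝓝[>] 0) (𝓝[>] 0)) :
    Tendsto (fun ε => ∫ p in strip a b h ε,
      quasimode ε h (dilate (s ε) (X i)) p * quasimode ε h (dilate (s ε) (X j)) p)
      (𝓝[>] 0) (𝓝 (if i = j then 1 else 0)) := by
  have hXc : ∀ j, Continuous (X j) := fun j => (hS.contDiff j).continuous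
  rw [← hS.orthonormal i j]
  have hinv : Tendsto (fun ε => (s ε)⁻¹) (𝓝[>] 0) atTop := tendsto_inv_nhdsGT_zero.comp hs
  have h1 := intervalIntegral_tendsto_integral (μ := volume)
    (integrable_mul (hS.memLp i) (hS.memLp j))
    (a := fun ε => (s ε)⁻¹ * (-a)) (b := fun ε => (s ε)⁻¹ * b)
    (hinv.atTop_mul_const_of_neg (by linarith [hh.a_pos])) (hinv.atTop_mul_const hh.b_pos)
  refine h1.congr' ?_
  filter_upwards [self_mem_nhdsWithin, hs.eventually self_mem_nhdsWithin] with ε hε hsε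
  have hs0 : 0 < s ε := hsε
  rw [integral_quasimode_mul hh.continuousOn hh.neg_a_lt_b.le
    (fun x hx => mul_pos hε (hh.pos x hx))
    ((contDiff_dilate (contDiff_zero.2 (hXc i)) _).continuous)
    ((contDiff_dilate (contDiff_zero.2 (hXc j)) _).continuous)]
  have h2 : ∀ x, dilate (s ε) (X i) x * dilate (s ε) (X j) x =
      (s ε)⁻¹ * (X i ((s ε)⁻¹ * x) * X j ((s ε)⁻¹ * x)) := fun x => by
    simp only [dilate]
    linear_combination (X i ((s ε)⁻¹ * x) * X j ((s ε)⁻¹ * x)) * inv_sqrt_sq hs0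
  simp only [h2]
  rw [intervalIntegral.integral_const_mul, intervalIntegral.integral_comp_mul_left
    (fun x => X i x * X j x) (inv_pos.2 hs0).ne', smul_eq_mul, inv_inv,
    inv_mul_cancel_left₀ hs0.ne']

end TestFunction

/-! ### From quasimodes to eigenfunctions -/

/-- Objects `t` that exist with any positive error, for small `ε`, can be chosen for each `ε` with an error
tending to zero. -/
theorem exists_family_of_forall_eventually {β : Type*} [Nonempty β] {P : ℝ → β → ℝ → Prop}
    (hP : ∀ δ : ℝ, 0 < δ → ∀ᶠ ε in 𝓝[>] (0 : ℝ), ∃ t, P ε t δ) :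
    ∃ (t : ℝ → β) (d : ℝ → ℝ), Tendsto d (𝓝[>] 0) (𝓝 0) ∧ ∀ᶠ ε in 𝓝[>] (0 : ℝ), P ε (t ε) (d ε) := by
  classical
  let S : ℝ → Set ℝ := fun ε => {δ | 0 < δ ∧ ∃ t, P ε t δ}
  have hbdd : ∀ ε, BddBelow (S ε) := fun ε => ⟨0, fun δ hδ => hδ.1.le⟩
  have key : ∀ ε : ℝ, ∃ (t : β) (δ : ℝ), 0 < ε → (S ε).Nonempty →
      0 < δ ∧ P ε t δ ∧ δ < sInf (S ε) + ε := by
    intro ε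
    by_cases h : 0 < ε ∧ (S ε).Nonempty
    · obtain ⟨δ, ⟨hδ, t, ht⟩, hlt⟩ := Real.lt_sInf_add_pos h.2 h.1
      exact ⟨t, δ, fun _ _ => ⟨hδ, ht, hlt⟩⟩
    · exact ⟨Classical.arbitrary β, 0, fun h1 h2 => absurd ⟨h1, h2⟩ h⟩
  choose t d htd using key
  have hev : ∀ᶠ ε in 𝓝[>] (0 : ℝ), 0 < d ε ∧ P ε (t ε) (d ε) ∧ d ε < sInf (S ε) + ε := by
    filter_upwards [self_mem_nhdsWithin, hP 1 one_pos] with ε hε h1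
    exact htd ε hε ⟨1, one_pos, h1⟩
  refine ⟨t, d, ?_, hev.mono fun ε h => h.2.1⟩
  rw [tendsto_order]
  refine ⟨fun c hc => hev.mono fun ε h => hc.trans h.1, fun c hc => ?_⟩
  have h2 : ∀ᶠ ε : ℝ in 𝓝[>] 0, ε < c / 2 :=
    (tendsto_id.mono_left nhdsWithin_le_nhds).eventually_lt_const (half_pos hc)
  filter_upwards [hev, hP (c / 2) (half_pos hc), h2] with ε h h1 h2
  have := csInf_le (hbdd ε) (show c / 2 ∈ S ε from ⟨half_pos hc, h1⟩)
  linarith [h.2.2]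

section Abstract

variable {γ : Type*} [MeasurableSpace γ]

theorem tendsto_zero_of_sq_le {F : Filter ℝ} {f g : ℝ → ℝ} (hfg : ∀ᶠ ε in F, f ε ^ 2 ≤ g ε)
    (hg : Tendsto g F (𝓝 0)) : Tendsto f F (𝓝 0) := by
  have h1 : Tendsto (fun ε => f ε ^ 2) F (𝓝 0) :=
    squeeze_zero' (Eventually.of_forall fun _ => sq_nonneg _) hfg hg
  have h2 := h1.sqrt
  simp only [Real.sqrt_sq_eq_abs, Real.sqrt_zero] at h2
  exact (tendsto_zero_iff_abs_tendsto_zero _).2 h2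

/-- Pairing a family which is small in `L²` with a bounded one. -/
theorem tendsto_integral_sub_mul {F : Filter ℝ} {ν : ℝ → Measure γ} {u v w : ℝ → γ → ℝ} {c : ℝ}
    (hu : ∀ᶠ ε in F, MemLp (u ε) 2 (ν ε)) (hv : ∀ᶠ ε in F, MemLp (v ε) 2 (ν ε))
    (hw : ∀ᶠ ε in F, MemLp (w ε) 2 (ν ε))
    (huv : Tendsto (fun ε => ∫ x, (u ε x - v ε x) ^ 2 ∂ν ε) F (𝓝 0))
    (hwc : Tendsto (fun ε => ∫ x, w ε x ^ 2 ∂ν ε) F (𝓝 c)) :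
    Tendsto (fun ε => (∫ x, u ε x * w ε x ∂ν ε) - ∫ x, v ε x * w ε x ∂ν ε) F (𝓝 0) := by
  refine tendsto_zero_of_sq_le (g := fun ε => (∫ x, (u ε x - v ε x) ^ 2 ∂ν ε) *
    ∫ x, w ε x ^ 2 ∂ν ε) ?_ (by simpa using huv.mul hwc)
  filter_upwards [hu, hv, hw] with ε h1 h2 h3
  rw [← integral_sub (integrable_mul h1 h3) (integrable_mul h2 h3)]
  simp only [← sub_mul]
  exact sq_integral_mul_le (h1.sub h2) h3

/-- Convergence of eigenvalues and eigenfunctions out of lower bounds for the eigenvalues and of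
quasimodes. In the expansion of a quasimode in eigenfunctions the lower modes are negligible by
induction, and the gap `μ (j + 1) - μ j` leaves nothing for the higher ones. -/
theorem tendsto_eigenvalue_and_eigenfunction {ν : ℝ → Measure γ} {Ψ q : ℝ → ℕ → γ → ℝ}
    {Λ : ℝ → ℕ → ℝ} {μ : ℕ → ℝ} (hμ : StrictMono μ)
    (hΨ : ∀ᶠ ε in 𝓝[>] (0 : ℝ), ∀ j, MemLp (Ψ ε j) 2 (ν ε))
    (horth : ∀ᶠ ε in 𝓝[>] (0 : ℝ), ∀ i j, ∫ x, Ψ ε i x * Ψ ε j x ∂ν ε = if i = j then 1 else 0)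
    (hbessel : ∀ᶠ ε in 𝓝[>] (0 : ℝ), ∀ f : γ → ℝ, MemLp f 2 (ν ε) → ∀ N,
      ∑ k ∈ Finset.range N, (∫ x, f x * Ψ ε k x ∂ν ε) ^ 2 ≤ ∫ x, f x ^ 2 ∂ν ε)
    (hq : ∀ᶠ ε in 𝓝[>] (0 : ℝ), ∀ j, MemLp (q ε j) 2 (ν ε))
    (hqq : ∀ i j, Tendsto (fun ε => ∫ x, q ε i x * q ε j x ∂ν ε) (𝓝[>] 0)
      (𝓝 (if i = j then 1 else 0)))
    (hlow : ∀ j, ∀ η : ℝ, 0 < η → ∀ᶠ ε in 𝓝[>] (0 : ℝ), μ j - η ≤ Λ ε j)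
    (hT : ∀ j, ∀ δ : ℝ, 0 < δ → ∀ᶠ ε in 𝓝[>] (0 : ℝ), ∃ T : γ → ℝ, MemLp T 2 (ν ε) ∧
      ∫ x, (T x - q ε j x) ^ 2 ∂ν ε ≤ δ ∧ ∀ N,
        ∑ k ∈ Finset.range N, Λ ε k * (∫ x, T x * Ψ ε k x ∂ν ε) ^ 2 +
          Λ ε N * ((∫ x, T x ^ 2 ∂ν ε) -
            ∑ k ∈ Finset.range N, (∫ x, T x * Ψ ε k x ∂ν ε) ^ 2) ≤ μ j + δ) (j : ℕ) :
    Tendsto (fun ε => Λ ε j) (𝓝[>] 0) (𝓝 (μ j)) ∧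
      ∃ s : ℝ → ℝ, (∀ ε, s ε = 1 ∨ s ε = -1) ∧
        Tendsto (fun ε => ∫ x, (s ε * Ψ ε j x - q ε j x) ^ 2 ∂ν ε) (𝓝[>] 0) (𝓝 0) := by
  induction j using Nat.strong_induction_on with
  | _ j ih =>
  have hΨ1 : ∀ k, ∀ᶠ ε in 𝓝[>] (0 : ℝ), ∫ x, Ψ ε k x ^ 2 ∂ν ε = 1 := fun k =>
    horth.mono fun ε h => by simpa only [sq, if_true] using h k k
  have hΨt : ∀ k, Tendsto (fun ε => ∫ x, Ψ ε k x ^ 2 ∂ν ε) (𝓝[>] 0) (𝓝 1) := fun k =>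
    tendsto_const_nhds.congr' ((hΨ1 k).mono fun _ h => h.symm)
  have hqj : Tendsto (fun ε => ∫ x, q ε j x ^ 2 ∂ν ε) (𝓝[>] 0) (𝓝 1) := by
    simpa only [sq, if_true] using hqq j j
  obtain ⟨T, d, hd, hTd⟩ := exists_family_of_forall_eventually (hT j)
  have hTm := hTd.mono fun ε h => h.1
  have hTq : Tendsto (fun ε => ∫ x, (T ε x - q ε j x) ^ 2 ∂ν ε) (𝓝[>] 0) (𝓝 0) :=
    squeeze_zero' (Eventually.of_forall fun _ => integral_nonneg fun _ => sq_nonneg _)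
      (hTd.mono fun _ h => h.2.1) hd
  set n : ℝ → ℝ := fun ε => ∫ x, T ε x ^ 2 ∂ν ε with hn
  set c : ℕ → ℝ → ℝ := fun k ε => ∫ x, T ε x * Ψ ε k x ∂ν ε with hc
  set z : ℕ → ℝ → ℝ := fun k ε => ∫ x, q ε j x * Ψ ε k x ∂ν ε with hz
  have hcz : ∀ k, Tendsto (fun ε => c k ε - z k ε) (𝓝[>] 0) (𝓝 0) := fun k =>
    tendsto_integral_sub_mul hTm (hq.mono fun _ h => h j) (hΨ.mono fun _ h => h k) hTq (hΨt k)
  have hn1 : Tendsto n (𝓝[>] 0) (𝓝 1) := by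
    have h1 := tendsto_integral_sub_mul hTm (hq.mono fun _ h => h j) (hq.mono fun _ h => h j) hTq hqj
    have h2 := (hTq.add (h1.const_mul 2)).add hqj
    simp only [mul_zero, add_zero, zero_add] at h2
    refine h2.congr' ?_
    filter_upwards [hTm, hq] with ε hT hq
    have e1 : ∀ x, (T ε x - q ε j x) ^ 2 = T ε x ^ 2 - 2 * (T ε x * q ε j x) + q ε j x ^ 2 :=
      fun x => by ring
    have i1 := integrable_sq hT
    have i2 := (integrable_mul hT (hq j)).const_mul 2
    have i3 := integrable_sq (hq j)
    have i4 : Integrable (fun x => T ε x ^ 2 - 2 * (T ε x * q ε j x)) (ν ε) := i1.sub i2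
    simp only [e1]
    rw [integral_add i4 i3, integral_sub i1 i2, integral_const_mul]
    simp only [hn, ← sq]
    ring
  -- the components along the lower modes are negligible
  have hc0 : ∀ k < j, Tendsto (c k) (𝓝[>] 0) (𝓝 0) := by
    intro k hk
    obtain ⟨-, s, hs, hsk⟩ := ih k hk
    have h1 := tendsto_integral_sub_mul (w := fun ε => q ε j) (v := fun ε => q ε k)
      (u := fun ε x => s ε * Ψ ε k x) (hΨ.mono fun _ h => (h k).const_mul _)
      (hq.mono fun _ h => h k) (hq.mono fun _ h => h j) hsk hqj
    have h2 := h1.add (hqq k j)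
    rw [if_neg hk.ne, add_zero] at h2
    have h3 : Tendsto (z k) (𝓝[>] 0) (𝓝 0) := by
      refine tendsto_zero_of_sq_le (Eventually.of_forall fun ε => le_of_eq ?_)
        (by simpa using h2.pow 2)
      have e1 : ∀ x, s ε * Ψ ε k x * q ε j x = s ε * (q ε j x * Ψ ε k x) := fun x => by ring
      simp only [e1, integral_const_mul, hz]
      rcases hs ε with h | h <;> rw [h] <;> ring
    simpa using (hcz k).add h3
  set S₁ : ℝ → ℝ := fun ε => ∑ k ∈ Finset.range j, Λ ε k * c k ε ^ 2 with hS1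
  set S₀ : ℝ → ℝ := fun ε => ∑ k ∈ Finset.range j, c k ε ^ 2 with hS0
  have l1 : Tendsto S₁ (𝓝[>] 0) (𝓝 0) := by
    have := tendsto_finsetSum (Finset.range j) fun k hk =>
      ((ih k (Finset.mem_range.1 hk)).1.mul ((hc0 k (Finset.mem_range.1 hk)).pow 2))
    simpa using this
  have l0 : Tendsto S₀ (𝓝[>] 0) (𝓝 0) := by
    have := tendsto_finsetSum (Finset.range j) fun k hk =>
      ((hc0 k (Finset.mem_range.1 hk)).pow 2)
    simpa using this
  have lN : Tendsto (fun ε => n ε - S₀ ε) (𝓝[>] 0) (𝓝 1) := by simpa using hn1.sub l0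
  have lD : Tendsto (fun ε => μ j + d ε - S₁ ε) (𝓝[>] 0) (𝓝 (μ j)) := by
    simpa using (hd.const_add (μ j)).sub l1
  have hΛ : Tendsto (fun ε => Λ ε j) (𝓝[>] 0) (𝓝 (μ j)) := by
    have lU : Tendsto (fun ε => (μ j + d ε - S₁ ε) / (n ε - S₀ ε)) (𝓝[>] 0) (𝓝 (μ j)) := by
      have := lD.div lN one_ne_zero
      rwa [div_one] at this
    rw [tendsto_order]
    constructor
    · intro x hx
      filter_upwards [hlow j ((μ j - x) / 2) (by linarith)] with ε h
      linarith
    · intro x hx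
      filter_upwards [lU.eventually_lt_const hx, hTd, lN.eventually_const_lt zero_lt_one]
        with ε h1 h2 h3
      refine lt_of_le_of_lt ?_ h1
      rw [le_div_iff₀ h3]
      have := h2.2.2 j
      linarith
  refine ⟨hΛ, ?_⟩
  -- the part of the norm beyond the modes `0, …, j`
  set r : ℝ → ℝ := fun ε => n ε - S₀ ε - c j ε ^ 2 with hr
  have hr0 : Tendsto r (𝓝[>] 0) (𝓝 0) := by
    have hg : 0 < μ (j + 1) - μ j := sub_pos.2 (hμ (Nat.lt_succ_self j))
    set g := μ (j + 1) - μ j with hgdef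
    have l2 : Tendsto (fun ε => 2 / g * ((μ j + d ε - S₁ ε) - Λ ε j * (n ε - S₀ ε))) (𝓝[>] 0)
        (𝓝 0) := by
      simpa using (lD.sub (hΛ.mul lN)).const_mul (2 / g)
    have hrnn : ∀ᶠ ε in 𝓝[>] (0 : ℝ), 0 ≤ r ε := by
      filter_upwards [hTm, hbessel] with ε h1 h2
      have := h2 _ h1 (j + 1)
      rw [Finset.sum_range_succ] at this
      simp only [hr, hn, hS0, hc]
      linarith
    refine squeeze_zero' hrnn ?_ l2
    filter_upwards [hTd, hrnn, hlow (j + 1) (g / 4) (by linarith),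
      hΛ.eventually_lt_const (show μ j < μ j + g / 4 by linarith)] with ε h1 h2 h3 h4
    have h5 := h1.2.2 (j + 1)
    rw [Finset.sum_range_succ, Finset.sum_range_succ] at h5
    have h6 : S₁ ε + Λ ε j * c j ε ^ 2 + Λ ε (j + 1) * r ε ≤ μ j + d ε := by
      have e : r ε = n ε - (S₀ ε + c j ε ^ 2) := by simp only [hr]; ring
      rw [e]
      exact h5
    have h7 : g / 2 * r ε ≤ (Λ ε (j + 1) - Λ ε j) * r ε :=
      mul_le_mul_of_nonneg_right (by linarith) h2
    have h8 : c j ε ^ 2 = n ε - S₀ ε - r ε := by simp only [hr]; ring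
    rw [h8] at h6
    rw [div_mul_eq_mul_div, le_div_iff₀ hg]
    linarith
  have hcj : Tendsto (fun ε => |c j ε|) (𝓝[>] 0) (𝓝 1) := by
    have h1 := (lN.sub hr0).sqrt
    simp only [sub_zero, Real.sqrt_one] at h1
    refine h1.congr fun ε => ?_
    rw [← Real.sqrt_sq_eq_abs]
    congr 1
    simp only [hr]
    ring
  have hzj : Tendsto (fun ε => |z j ε|) (𝓝[>] 0) (𝓝 1) := by
    have h1 : Tendsto (fun ε => |c j ε| - |z j ε|) (𝓝[>] 0) (𝓝 0) :=
      squeeze_zero_norm (fun ε => abs_abs_sub_abs_le_abs_sub _ _)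
        (by simpa using (hcz j).abs)
    simpa using hcj.sub h1
  refine ⟨fun ε => if 0 ≤ z j ε then 1 else -1, fun ε => ite_eq_or_eq _ _ _, ?_⟩
  have h1 := ((hΨt j).sub (hzj.const_mul 2)).add hqj
  norm_num at h1
  refine h1.congr' ?_
  filter_upwards [hΨ, hq] with ε hΨ hq
  set s : ℝ := if 0 ≤ z j ε then 1 else -1 with hs
  have hs1 : s ^ 2 = 1 := by rw [hs]; split_ifs <;> norm_num
  have hsz : s * z j ε = |z j ε| := by
    rw [hs]
    split_ifs with h
    · rw [abs_of_nonneg h, one_mul]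
    · rw [abs_of_neg (not_le.1 h)]; ring
  have e1 : ∀ x, (s * Ψ ε j x - q ε j x) ^ 2 =
      Ψ ε j x ^ 2 - 2 * s * (q ε j x * Ψ ε j x) + q ε j x ^ 2 := fun x => by
    linear_combination (Ψ ε j x) ^ 2 * hs1
  have i1 := integrable_sq (hΨ j)
  have i2 := (integrable_mul (hq j) (hΨ j)).const_mul (2 * s)
  have i3 := integrable_sq (hq j)
  have i4 : Integrable (fun x => Ψ ε j x ^ 2 - 2 * s * (q ε j x * Ψ ε j x)) (ν ε) := i1.sub i2
  simp only [e1]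
  rw [integral_add i4 i3, integral_sub i1 i2, integral_const_mul, mul_assoc, ← hsz]

end Abstract

/-! ### The eigenvalues and eigenfunctions of the strip -/

theorem IsSchrodingerEigensystem.eigenvalue_pos {q : ℝ → ℝ} {μ : ℕ → ℝ} {X : ℕ → ℝ → ℝ}
    (hS : IsSchrodingerEigensystem q μ X) (hq : Continuous q) (hq0 : ∀ x, 0 ≤ q x)
    (hqp : ∀ x, 0 < x → 0 < q x) (j : ℕ) : 0 < μ j := by
  obtain ⟨h1, h2⟩ := hS.memLp_energy hq hq0 j
  have h3 := hS.form_self hq hq0 j j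
  rw [hS.orthonormal, if_pos rfl, mul_one] at h3
  rw [← h3]
  obtain ⟨x, hx, hx0⟩ := ((hS.pos j).and (eventually_gt_atTop 0)).exists
  have hXc : Continuous (X j) := (hS.contDiff j).continuous
  have hX'c : Continuous (deriv (X j)) := (hS.contDiff j).continuous_deriv (by norm_num)
  refine integral_pos_of_integrable_nonneg_nonzero (x := x) (by fun_prop)
    ((integrable_mul h1 h1).add (integrable_mul h2 h2))
    (fun x => add_nonneg (mul_self_nonneg _) (mul_self_nonneg _)) ?_
  have h4 : 0 < √(q x) * X j x := mul_pos (Real.sqrt_pos.2 (hqp x hx0)) hx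
  have h5 := mul_self_nonneg (deriv (X j) x)
  exact (by positivity : 0 < deriv (X j) x * deriv (X j) x + √(q x) * X j x * (√(q x) * X j x)).ne'

section Main

variable {a b M cp cm m : ℝ} {h : ℝ → ℝ} {μ : ℕ → ℝ} {X : ℕ → ℝ → ℝ}

theorem quasimode_dilate_eq {ε α : ℝ} (hε : 0 < ε) {p : ℝ × ℝ} (hp : 0 < h p.1) (f : ℝ → ℝ) :
    quasimode ε h (dilate (ε ^ α) f) p =
      √2 / √(ε ^ (1 + α) * h p.1) * f (p.1 * ε ^ (-α)) * Real.sin (Real.pi * p.2 / (ε * h p.1)) := by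
  have hα : 0 < ε ^ α := Real.rpow_pos_of_pos hε α
  rw [quasimode, dilate, groundState, Real.rpow_add hε, Real.rpow_one, Real.rpow_neg hε.le,
    mul_comm p.1, show ε * ε ^ α * h p.1 = ε ^ α * (ε * h p.1) by ring, Real.sqrt_mul hα.le,
    Real.sqrt_div zero_le_two]
  have h1 : 0 < √(ε ^ α) := Real.sqrt_pos.2 hα
  have h2 : 0 < √(ε * h p.1) := Real.sqrt_pos.2 (mul_pos hε hp)
  field_simp

theorem eventually_le_rescaled_eigenvalue (hh : Profile a b h M cp cm m)
    (hS : IsSchrodingerEigensystem (potential M cp cm m) μ X) {bc : EndCondition} {α : ℝ}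
    (hα : α = 2 / (m + 2)) {lam : ℝ → ℕ → ℝ} {Ψ : ℝ → ℕ → ℝ × ℝ → ℝ}
    (hE : ∀ ε : ℝ, 0 < ε →
      IsLaplaceEigensystem (strip a b h ε) (dirichletPart a b h ε bc) (lam ε) (Ψ ε))
    (j : ℕ) {η : ℝ} (hη : 0 < η) :
    ∀ᶠ ε in 𝓝[>] (0 : ℝ),
      μ j - η ≤ ε ^ (2 * α) * (lam ε j - Real.pi ^ 2 / (M ^ 2 * ε ^ 2)) := by
  have hμ := hS.eigenvalue_pos (continuous_potential hh.m_pos)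
    (potential_nonneg hh.M_pos hh.cp_pos hh.cm_pos) (fun x hx => by
      rw [potential, if_pos hx]
      have := hh.M_pos
      have := hh.cp_pos
      positivity) j
  have hρ : 0 < η / μ j := div_pos hη hμ
  filter_upwards [eventually_strip_form_lower_bound hh hS j bc hα hρ, self_mem_nhdsWithin]
    with ε ⟨w, hw, K, hK0, hK, hform⟩ hε
  have h1 := (hE ε hε).le_of_form_bound hw hK0 hform
  set y := lam ε j - Real.pi ^ 2 / (M ^ 2 * ε ^ 2)
  have hy : 0 ≤ y := le_of_not_gt fun hy =>
    (hμ.trans_le h1).not_ge (mul_nonpos_of_nonneg_of_nonpos hK0 hy.le)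
  have h2 : μ j ≤ (1 + η / μ j) * (ε ^ (2 * α) * y) := by
    rw [← mul_assoc]
    exact h1.trans (mul_le_mul_of_nonneg_right hK hy)
  rcases le_or_gt (μ j) (ε ^ (2 * α) * y) with h3 | h3
  · linarith
  · have h4 : η / μ j * (ε ^ (2 * α) * y) ≤ η / μ j * μ j := by gcongr
    rw [div_mul_cancel₀ _ hμ.ne'] at h4
    linarith

theorem tendsto_strip_eigensystem (hh : Profile a b h M cp cm m)
    (hS : IsSchrodingerEigensystem (potential M cp cm m) μ X) {bc : EndCondition} {α : ℝ}
    (hα : α = 2 / (m + 2)) {lam : ℝ → ℕ → ℝ} {Ψ : ℝ → ℕ → ℝ × ℝ → ℝ}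
    (hE : ∀ ε : ℝ, 0 < ε →
      IsLaplaceEigensystem (strip a b h ε) (dirichletPart a b h ε bc) (lam ε) (Ψ ε)) (j : ℕ) :
    Tendsto (fun ε : ℝ => ε ^ (2 * α) * (lam ε j - Real.pi ^ 2 / (M ^ 2 * ε ^ 2)))
      (𝓝[>] 0) (𝓝 (μ j)) ∧
    ∃ s : ℝ → ℝ, (∀ ε, s ε = 1 ∨ s ε = -1) ∧
      Tendsto (fun ε : ℝ => ∫ p in strip a b h ε,
        (s ε * Ψ ε j p - quasimode ε h (dilate (ε ^ α) (X j)) p) ^ 2) (𝓝[>] 0) (𝓝 0) := by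
  have hm := hh.m_pos
  have hα0 : 0 < α := by rw [hα]; positivity
  have hscale : Tendsto (fun ε : ℝ => ε ^ α) (𝓝[>] 0) (𝓝[>] 0) := by
    refine tendsto_nhdsWithin_iff.2 ⟨by simpa using tendsto_const_mul_rpow hα0 1, ?_⟩
    filter_upwards [self_mem_nhdsWithin] with ε hε
    exact Real.rpow_pos_of_pos hε α
  have hpos : ∀ ε : ℝ, 0 < ε → ∀ x ∈ Set.Icc (-a) b, 0 < ε * h x :=
    fun ε hε x hx => mul_pos hε (hh.pos x hx)
  refine tendsto_eigenvalue_and_eigenfunction (ν := fun ε => volume.restrict (strip a b h ε))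
    (Ψ := Ψ) (q := fun ε j => quasimode ε h (dilate (ε ^ α) (X j)))
    (Λ := fun ε j => ε ^ (2 * α) * (lam ε j - Real.pi ^ 2 / (M ^ 2 * ε ^ 2)))
    hS.strictMono ?_ ?_ ?_ ?_ (fun i j => tendsto_integral_quasimode_mul hh hS i j hscale)
    (fun j η hη => eventually_le_rescaled_eigenvalue hh hS hα hE j hη) ?_ j
  · filter_upwards [self_mem_nhdsWithin] with ε hε
    exact (hE ε hε).memLp
  · filter_upwards [self_mem_nhdsWithin] with ε hε
    exact (hE ε hε).orthonormal
  · filter_upwards [self_mem_nhdsWithin] with ε hε f hf N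
    exact sum_le_hasSum _ (fun _ _ => sq_nonneg _)
      (hasSum_sq_integral_mul (hE ε hε).memLp (hE ε hε).orthonormal (hE ε hε).complete hf)
  · filter_upwards [self_mem_nhdsWithin] with ε hε j
    exact memLp_quasimode hh.continuousOn (hpos ε hε)
      (contDiff_dilate (contDiff_zero.2 (hS.contDiff j).continuous) _).continuous
  · intro j δ hδ
    filter_upwards [self_mem_nhdsWithin,
      hscale.eventually (eventually_exists_test_function hh hS j hδ)] with ε hε hev
    have hε0 : 0 < ε := hε
    obtain ⟨T, hT, h1, h2⟩ := hev ε hε (rpow_rpow_mul_sq hε hm hα) bc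
    refine ⟨T, hT.memLp, h1, fun N => le_trans ?_ h2⟩
    have h3 := mul_le_mul_of_nonneg_left ((hE ε hε).form_lower_bound hT N) (sq_nonneg (ε ^ α))
    rw [← rpow_sq_eq hε0.le]
    simp only [mul_assoc, sub_mul, mul_sub, ← Finset.mul_sum, Finset.sum_sub_distrib] at h3 ⊢
    linarith

end Main

end NarrowStrip

open NarrowStrip in
theorem theorem1 (a b : ℝ) (h : ℝ → ℝ) (M cp cm m : ℝ) (hh : Profile a b h M cp cm m)
    (α : ℝ) (hα : α = 2 / (m + 2)) :
    -- the limit operator has discrete simple spectrum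
    (∃ (μ : ℕ → ℝ) (X : ℕ → ℝ → ℝ), IsSchrodingerEigensystem (potential M cp cm m) μ X) ∧
    -- the Laplacian has discrete spectrum, for either condition at the ends and every ε > 0
    (∀ (bc : EndCondition) (ε : ℝ), 0 < ε → ∃ (lam : ℕ → ℝ) (Ψ : ℕ → ℝ × ℝ → ℝ),
      IsLaplaceEigensystem (strip a b h ε) (dirichletPart a b h ε bc) lam Ψ) ∧
    -- asymptotics of all the eigenvalues and eigenfunctions
    ∀ (μ : ℕ → ℝ) (X : ℕ → ℝ → ℝ), IsSchrodingerEigensystem (potential M cp cm m) μ X →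
      ∀ (bc : EndCondition) (lam : ℝ → ℕ → ℝ) (Ψ : ℝ → ℕ → ℝ × ℝ → ℝ),
        (∀ ε : ℝ, 0 < ε →
          IsLaplaceEigensystem (strip a b h ε) (dirichletPart a b h ε bc) (lam ε) (Ψ ε)) →
        ∀ j : ℕ,
          Tendsto (fun ε : ℝ => ε ^ (2 * α) * (lam ε j - Real.pi ^ 2 / (M ^ 2 * ε ^ 2)))
            (𝓝[>] 0) (𝓝 (μ j)) ∧
          ∃ s : ℝ → ℝ, (∀ ε, s ε = 1 ∨ s ε = -1) ∧
            Tendsto (fun ε : ℝ => ∫ p in strip a b h ε,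
                (s ε * Ψ ε j p -
                  √2 / √(ε ^ (1 + α) * h p.1) * X j (p.1 * ε ^ (-α)) *
                    Real.sin (Real.pi * p.2 / (ε * h p.1))) ^ 2)
              (𝓝[>] 0) (𝓝 0) := by
  have hm := hh.m_pos
  have hq : Continuous (potential M cp cm m) := continuous_potential hm
  have hq0 := potential_nonneg (m := m) hh.M_pos hh.cp_pos hh.cm_pos
  refine ⟨exists_isSchrodingerEigensystem hq hq0 (tendsto_potential hh.M_pos hh.cp_pos hh.cm_pos hm),
    fun bc ε hε => exists_isLaplaceEigensystem hh.continuousOn hh.a_pos hh.b_pos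
      (fun x hx => mul_pos hε (hh.pos x hx)) bc, fun μ X hS bc lam Ψ hE j => ?_⟩
  obtain ⟨h1, s, hs, h2⟩ := tendsto_strip_eigensystem hh hS hα hE j
  refine ⟨h1, s, hs, h2.congr' ?_⟩
  filter_upwards [self_mem_nhdsWithin] with ε hε
  refine setIntegral_congr_fun (isOpen_strip hh.continuousOn).measurableSet fun p hp => ?_
  rw [quasimode_dilate_eq hε (hh.pos p.1 ⟨hp.1.le, hp.2.1.le⟩)]
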